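/- **Conventions.** Let $k$ be a field and $A$ an associative $k$-algebra, possibly without unit, which is idempotent ($A=\langle ab\rangle$) and non-degenerate ($ab=0\ \forall b$ implies $a=0$, and $ba=0\ \forall b$ implies $a=0$). Its multiplier algebra $\mathbb M(A)$ consists of the pairs $w=(b\mapsto wb,\ a\mapsto aw)$ of linear maps $A\to A$ with $a(wb)=(aw)b$. A *weak multiplier bialgebra* structure on $A$ consists of an idempotent $E\in\mathbb M(A\otimes A)$, a multiplicative linear map $\Delta:A\to\mathbb M(A\otimes A)$ and a linear map $\epsilon:A\to k$ such that: $T_1(a\otimes b):=\Delta(a)(1\otimes b)$ and $T_2(a\otimes b):=(a\otimes 1)\Delta(b)$ lie in $A\otimes A$; $(T_2\otimes A)(A\otimes T_1)=(A\otimes T_1)(T_2\otimes A)$; $(\epsilon\otimes A)T_1=\mu=(A\otimes\epsilon)T_2$, where $\mu$ is the multiplication; $\langle\Delta(a)x\rangle=E(A\otimes A)$ and $\langle x\Delta(a)\rangle=(A\otimes A)E$; $(E\otimes1)(1\otimes E)=(1\otimes E)(E\otimes 1)$, and this is the value at $E$ of the extensions of both $\Delta\otimes A$ and $A\otimes\Delta$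 to multipliers; $(\epsilon\otimes A)((1\otimes a)E(b\otimes c))=(\epsilon\otimes A)(\Delta(a)(b\otimes c))$ and $(\epsilon\otimes A)((a\otimes b)E(1\otimes c))=(\epsilon\otimes A)((a\otimes b)\Delta(c))$. It is *regular* if $A^{\mathsf{op}}$ is a weak multiplier bialgebra too, with the same $E,\Delta,\epsilon$; in particular $T_3(a\otimes b)=(1\otimes b)\Delta(a)$ and $T_4(a\otimes b)=\Delta(b)(a\otimes1)$ lie in $A\otimes A$. Its comultiplication is *right full* if $\langle(A\otimes\omega)T_1(a\otimes b)\mid a,b\in A,\ \omega\in\mathrm{Lin}(A,k)\rangle=A$. Put $$\sqcap^R(a)=(\mathbb M(A)\otimes\epsilon)[(1\otimes a)E],\quad \overline\sqcap^R(a)=(\mathbb M(A)\otimes\epsilon)[E(1\otimes a)],\quad \overline\sqcap^L(a)=(\epsilon\otimes\mathbb M(A))[(a\otimes1)E].$$ Let $\mathsf M_{(A)}$ be the category of idempotent non-degenerate right $A$-modules ($V=\langle v\cdot a\rangle$, and $v\cdot a=0\ \forall a$ implies $v=0$) and $A$-module maps. Let $\mathsf M^{(A)}$ be the category of full right $A$-comodules: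 vector spaces $M$ with linear maps $\lambda,\varrho:M\otimes A\to M\otimes A$ such that $(1\otimes a)\lambda(m\otimes b)=\varrho(m\otimes a)(1\otimes b)$, $(\lambda\otimes A)\lambda^{13}(M\otimes T_1)=(M\otimes T_1)(\lambda\otimes A)$, $(\lambda\otimes A)\lambda^{13}(M\otimes E)=(\lambda\otimes A)\lambda^{13}$ (with $E$ standing for left multiplication by $E$) and $\langle(M\otimes\omega)\lambda(m\otimes a)\rangle=M$; the morphisms are the linear maps $f$ with $(f\otimes A)\lambda=\lambda'(f\otimes A)$. For $V,W\in\mathsf M_{(A)}$ put $E_2^{V,W}(v\cdot a\otimes w\cdot b)=(v\cdot(-)\otimes w\cdot(-))[(a\otimes b)E]$ and define the diagonal action on $V\otimes W$ by $(v\cdot a\otimes w\cdot b)\Delta(c)=(v\cdot(-)\otimes w\cdot(-))[(a\otimes b)\Delta(c)]$. A *right-right Yetter–Drinfeld module* is a vector space $X$ with the structures of an object of $\mathsf M_{(A)}$ and of an object of $\mathsf M^{(A)}$ such that, for all $x\in X$ and $a,b\in A$, $$\varrho[(x\otimes a)\Delta^{\mathsf{op}}(b)]=\varrho(x\otimes a)\Delta(b),\qquad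 E_2^{X,A}\varrho=\varrho=\varrho\,(E_2^{A,X})^{21},$$ where $(x\otimes a)\Delta^{\mathsf{op}}(b)=\mathsf{tw}[(a\otimes x)\Delta(b)]$ and $\mathsf{tw}$ is the flip. With the linear maps that are both $A$-module and $A$-comodule maps as morphisms, these form the category $\mathsf{YD}(A)$. **Theorem.** Let $A$ be a regular weak multiplier bialgebra over a field with right full comultiplication. 1. The ranges of $\sqcap^R$ and $\overline\sqcap^R$ coincide. This common range $R$ (the base algebra) is a non-unital subalgebra of $\mathbb M(A)$ and a firm algebra, so firm $R$-bimodules form a monoidal category ${}_R\mathsf M_R$ with product $\otimes_R$ and unit $R$. 2. Every $V\in\mathsf M_{(A)}$ is a firm $R$-bimodule via $(v\cdot a)\triangleleft r=v\cdot(ar)$ and $\sqcap^R(b)\triangleright(v\cdot a)=v\cdot(a\overline\sqcap^L(b))$, and every $M\in\mathsf M^{(A)}$ is a firm $R$-bimodule via $m\triangleleft\overline\sqcap^R(a)=(M\otimes\epsilon)\lambda(m\otimes a)$ and $\sqcap^R(a)\triangleright m=(M\otimes\epsilon)\varrho(m\otimes a)$. This gives functors $\mathsf M_{(A)}\to{}_R\mathsf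 M_R$ and $\mathsf M^{(A)}\to{}_R\mathsf M_R$ acting on morphisms as the identity. 3. The categories $\mathsf M_{(A)}$, $\mathsf M^{(A)}$ and $\mathsf{YD}(A)$ carry monoidal structures such that all functors in the diagram of forgetful functors $$\begin{array}{ccc}\mathsf{YD}(A)&\to&\mathsf M_{(A)}\\ \downarrow&&\downarrow\\ \mathsf M^{(A)}&\to&{}_R\mathsf M_R\end{array}$$ are strict monoidal, and the diagram commutes. In particular the monoidal product in each of these categories is $\otimes_R$ and the monoidal unit is $R$. Explicitly, $V\otimes_RW$ is an $A$-module via the action induced by the diagonal action; $R$ is an $A$-module via $\sqcap^R(b)\cdot c=\sqcap^R(bc)$; $M\otimes_RN$ is an $A$-comodule via the maps induced by $\lambda_M^{13}(M\otimes\lambda_N)$ and $(M\otimes\varrho_N)\varrho_M^{13}$; and $R$ is an $A$-comodule via $\lambda(r\otimes a)=E(1\otimes ra)$ and $\varrho(r\otimes a)=(1\otimes ar)E$, regarded as elements of $R\otimes A$. -/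

import Mathlib

open CategoryTheory TensorProduct MonoidalCategory

universe u v

noncomputable section

/-! # Firm bimodules over a non-unital algebra and their tensor product -/

section Bimodules

/-- An `R`-bimodule structure on the `k`-vector space `V`, where `R` is an associative `k`-algebra
possibly without unit: `l a v` is `a ▹ v` and `r a v` is `v ◃ a`. -/
structure BimodStr (k : Type u) (R V : Type v) [Field k] [NonUnitalRing R] [Module k R]
    [AddCommGroup V] [Module k V] where
  l : R →ₗ[k] V →ₗ[k] V
  r : R →ₗ[k] V →ₗ[k] V
  l_mul : ∀ a b v, l (a * b) v = l a (l b v)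
  r_mul : ∀ a b v, r (a * b) v = r b (r a v)
  l_r : ∀ a b v, r b (l a v) = l a (r b v)

variable {k : Type u} {R V W U V' W' U' P : Type v} [Field k] [NonUnitalRing R] [Module k R]
  [AddCommGroup V] [Module k V] [AddCommGroup W] [Module k W] [AddCommGroup U] [Module k U]
  [AddCommGroup V'] [Module k V'] [AddCommGroup W'] [Module k W'] [AddCommGroup U'] [Module k U']
  [AddCommGroup P] [Module k P]

/-- The `R`-module tensor product `V ⊗_R W` of two `R`-bimodules: the quotient of `V ⊗ W` by the
span of the elements `(v ◃ a) ⊗ w - v ⊗ (a ▹ w)`. -/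
def BalTensor (s : BimodStr k R V) (t : BimodStr k R W) : Type v :=
  (V ⊗[k] W) ⧸ Submodule.span k
    {z : V ⊗[k] W | ∃ (v : V) (a : R) (w : W), z = s.r a v ⊗ₜ w - v ⊗ₜ t.l a w}

namespace BalTensor

instance (s : BimodStr k R V) (t : BimodStr k R W) : AddCommGroup (BalTensor s t) :=
  inferInstanceAs (AddCommGroup ((V ⊗[k] W) ⧸ Submodule.span k
    {z : V ⊗[k] W | ∃ (v : V) (a : R) (w : W), z = s.r a v ⊗ₜ w - v ⊗ₜ t.l a w}))

instance (s : BimodStr k R V) (t : BimodStr k R W) : Module k (BalTensor s t) :=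
  inferInstanceAs (Module k ((V ⊗[k] W) ⧸ Submodule.span k
    {z : V ⊗[k] W | ∃ (v : V) (a : R) (w : W), z = s.r a v ⊗ₜ w - v ⊗ₜ t.l a w}))

/-- The canonical epimorphism `V ⊗ W → V ⊗_R W`. -/
def proj (s : BimodStr k R V) (t : BimodStr k R W) : V ⊗[k] W →ₗ[k] BalTensor s t :=
  Submodule.mkQ _

/-- The class of `v ⊗ w` in `V ⊗_R W`. -/
def tmul (s : BimodStr k R V) (t : BimodStr k R W) : V →ₗ[k] W →ₗ[k] BalTensor s t :=
  (TensorProduct.mk k V W).compr₂ (proj s t)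

/-- The map out of `V ⊗_R W` induced by an `R`-balanced bilinear map. -/
def lift (s : BimodStr k R V) (t : BimodStr k R W) (f : V →ₗ[k] W →ₗ[k] P)
    (hf : ∀ v a w, f (s.r a v) w = f v (t.l a w)) : BalTensor s t →ₗ[k] P :=
  Submodule.liftQ _ (TensorProduct.lift f) (by
    rw [Submodule.span_le]
    rintro _ ⟨v, a, w, rfl⟩
    simp [hf])

@[simp] theorem lift_tmul (s : BimodStr k R V) (t : BimodStr k R W) (f : V →ₗ[k] W →ₗ[k] P)
    (hf : ∀ v a w, f (s.r a v) w = f v (t.l a w)) (v : V) (w : W) :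
    lift s t f hf (tmul s t v w) = f v w := by
  change Submodule.liftQ _ (TensorProduct.lift f) _ (Submodule.mkQ _ (v ⊗ₜ w)) = _
  simp

theorem balanced (s : BimodStr k R V) (t : BimodStr k R W) (v : V) (a : R) (w : W) :
    tmul s t (s.r a v) w = tmul s t v (t.l a w) := by
  change Submodule.Quotient.mk _ = Submodule.Quotient.mk _
  rw [Submodule.Quotient.eq]
  exact Submodule.subset_span ⟨v, a, w, rfl⟩

theorem hom_ext {s : BimodStr k R V} {t : BimodStr k R W} {f g : BalTensor s t →ₗ[k] P}
    (h : ∀ v w, f (tmul s t v w) = g (tmul s t v w)) : f = g :=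
  Submodule.linearMap_qext _ (TensorProduct.ext' h)

theorem hom_ext_apply {s : BimodStr k R V} {t : BimodStr k R W} {f g : BalTensor s t →ₗ[k] P}
    (h : ∀ v w, f (tmul s t v w) = g (tmul s t v w)) (z : BalTensor s t) : f z = g z :=
  LinearMap.congr_fun (hom_ext h) z

@[elab_as_elim] theorem induction_on {s : BimodStr k R V} {t : BimodStr k R W}
    {p : BalTensor s t → Prop} (z : BalTensor s t) (zero : p 0) (tmul : ∀ v w, p (tmul s t v w))
    (add : ∀ z z', p z → p z' → p (z + z')) : p z := by
  obtain ⟨x, rfl⟩ := Submodule.mkQ_surjective _ z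
  induction x using TensorProduct.induction_on with
  | zero => rw [map_zero]; exact zero
  | tmul v w => exact tmul v w
  | add x y hx hy => rw [map_add]; exact add _ _ hx hy

theorem hom_ext₃ {s : BimodStr k R V} {t : BimodStr k R W} {q : BimodStr k R (BalTensor s t)}
    {u : BimodStr k R U} {f g : BalTensor q u →ₗ[k] P}
    (h : ∀ v w x, f (tmul q u (tmul s t v w) x) = g (tmul q u (tmul s t v w) x)) : f = g := by
  refine hom_ext fun z x => ?_
  exact LinearMap.congr_fun (f := f ∘ₗ (tmul q u).flip x) (g := g ∘ₗ (tmul q u).flip x)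
    (hom_ext fun v w => h v w x) z

/-- `f ⊗_R g` for maps `f`, `g` compatible with the inner actions. -/
def map {s : BimodStr k R V} {t : BimodStr k R W} {s' : BimodStr k R V'} {t' : BimodStr k R W'}
    (f : V →ₗ[k] V') (g : W →ₗ[k] W') (hf : ∀ a v, f (s.r a v) = s'.r a (f v))
    (hg : ∀ a w, g (t.l a w) = t'.l a (g w)) : BalTensor s t →ₗ[k] BalTensor s' t' :=
  lift s t ((tmul s' t').compl₁₂ f g) (by intro v a w; simp [hf, hg, balanced])

@[simp] theorem map_tmul {s : BimodStr k R V} {t : BimodStr k R W} {s' : BimodStr k R V'}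
    {t' : BimodStr k R W'} (f : V →ₗ[k] V') (g : W →ₗ[k] W')
    (hf : ∀ a v, f (s.r a v) = s'.r a (f v)) (hg : ∀ a w, g (t.l a w) = t'.l a (g w)) (v : V)
    (w : W) : map f g hf hg (tmul s t v w) = tmul s' t' (f v) (g w) := by
  simp [map]

end BalTensor

open BalTensor

namespace BimodStr

/-- The map `a ▹ (-)` on `V ⊗_R W`. -/
def tensorL (s : BimodStr k R V) (t : BimodStr k R W) (a : R) :
    BalTensor s t →ₗ[k] BalTensor s t :=
  BalTensor.map (s.l a) LinearMap.id (fun b v => (s.l_r a b v).symm) (fun _ _ => rfl)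

/-- The map `(-) ◃ a` on `V ⊗_R W`. -/
def tensorR (s : BimodStr k R V) (t : BimodStr k R W) (a : R) :
    BalTensor s t →ₗ[k] BalTensor s t :=
  BalTensor.map LinearMap.id (t.r a) (fun _ _ => rfl) (fun b v => t.l_r b a v)

/-- The bimodule structure of `V ⊗_R W` given by the outer actions. -/
def tensor (s : BimodStr k R V) (t : BimodStr k R W) : BimodStr k R (BalTensor s t) where
  l :=
    { toFun := tensorL s t
      map_add' := fun a b => hom_ext (by simp [tensorL])
      map_smul' := fun c a => hom_ext (by simp [tensorL]) }
  r :=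
    { toFun := tensorR s t
      map_add' := fun a b => hom_ext (by simp [tensorR])
      map_smul' := fun c a => hom_ext (by simp [tensorR]) }
  l_mul := fun a b => hom_ext_apply (f := tensorL s t (a * b)) (g := tensorL s t a ∘ₗ tensorL s t b)
    (by simp [tensorL, l_mul])
  r_mul := fun a b => hom_ext_apply (f := tensorR s t (a * b)) (g := tensorR s t b ∘ₗ tensorR s t a)
    (by simp [tensorR, r_mul])
  l_r := fun a b => hom_ext_apply (f := tensorR s t b ∘ₗ tensorL s t a)
    (g := tensorL s t a ∘ₗ tensorR s t b) (by simp [tensorR, tensorL])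

@[simp] theorem tensor_l_tmul (s : BimodStr k R V) (t : BimodStr k R W) (a : R) (v : V) (w : W) :
    (s.tensor t).l a (tmul s t v w) = tmul s t (s.l a v) w := by
  change tensorL s t a _ = _
  simp [tensorL]

@[simp] theorem tensor_r_tmul (s : BimodStr k R V) (t : BimodStr k R W) (a : R) (v : V) (w : W) :
    (s.tensor t).r a (tmul s t v w) = tmul s t v (t.r a w) := by
  change tensorR s t a _ = _
  simp [tensorR]

/-- The regular bimodule. -/
def regular (k : Type u) (R : Type v) [Field k] [NonUnitalRing R] [Module k R]
    [IsScalarTower k R R] [SMulCommClass k R R] : BimodStr k R R where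
  l := LinearMap.mul k R
  r := (LinearMap.mul k R).flip
  l_mul := by simp [mul_assoc]
  r_mul := by simp [mul_assoc]
  l_r := by simp [mul_assoc]

variable [IsScalarTower k R R] [SMulCommClass k R R]

@[simp] theorem regular_l (a b : R) : (regular k R).l a b = a * b := rfl
@[simp] theorem regular_r (a b : R) : (regular k R).r a b = b * a := rfl

/-- The map `R ⊗_R V → V` induced by the left action. -/
def actL (s : BimodStr k R V) : BalTensor (regular k R) s →ₗ[k] V :=
  BalTensor.lift (regular k R) s s.l (fun a b v => by simp [l_mul])

/-- The map `V ⊗_R R → V` induced by the right action. -/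
def actR (s : BimodStr k R V) : BalTensor s (regular k R) →ₗ[k] V :=
  BalTensor.lift s (regular k R) s.r.flip (fun v a b => by simp [r_mul])

@[simp] theorem actL_tmul (s : BimodStr k R V) (a : R) (v : V) :
    s.actL (tmul (regular k R) s a v) = s.l a v := BalTensor.lift_tmul _ _ _ _ a v

@[simp] theorem actR_tmul (s : BimodStr k R V) (v : V) (a : R) :
    s.actR (tmul s (regular k R) v a) = s.r a v := BalTensor.lift_tmul _ _ _ _ v a

/-- A bimodule is firm if both actions induce isomorphisms `R ⊗_R V ≅ V` and `V ⊗_R R ≅ V`. -/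
structure IsFirm (s : BimodStr k R V) : Prop where
  left : Function.Bijective s.actL
  right : Function.Bijective s.actR

end BimodStr

open BimodStr

namespace BalTensor

/-- The map `(U ⊗_R V) ⊗_R W → U ⊗_R (V ⊗_R W)`. -/
def assocHom (s : BimodStr k R U) (t : BimodStr k R V) (u : BimodStr k R W) :
    BalTensor (s.tensor t) u →ₗ[k] BalTensor s (t.tensor u) :=
  lift (s.tensor t) u
    (lift s t ((LinearMap.llcomp k W _ _).compl₁₂ (tmul s (t.tensor u)) (tmul t u))
      (fun x a y => by
        ext w
        have := balanced s (t.tensor u) x a (tmul t u y w)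
        simpa using this))
    (fun z a w => by
      induction z using induction_on with
      | zero => simp
      | tmul x y => simp [balanced]
      | add z z' hz hz' => simp only [map_add, LinearMap.add_apply, hz, hz'])

/-- The map `U ⊗_R (V ⊗_R W) → (U ⊗_R V) ⊗_R W`. -/
def assocInv (s : BimodStr k R U) (t : BimodStr k R V) (u : BimodStr k R W) :
    BalTensor s (t.tensor u) →ₗ[k] BalTensor (s.tensor t) u :=
  lift s (t.tensor u)
    (LinearMap.flip (lift t u
      (LinearMap.flip
        ((LinearMap.llcomp k U (BalTensor s t) (BalTensor (s.tensor t) u)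
          ∘ₗ (tmul (s.tensor t) u).flip).compl₂ (tmul s t).flip))
      (fun y a w => by
        ext x
        have := balanced (s.tensor t) u (tmul s t x y) a w
        simpa using this)))
    (fun x a z => by
      induction z using induction_on with
      | zero => simp
      | tmul y w => simp [balanced]
      | add z z' hz hz' => simp only [map_add, hz, hz'])

@[simp] theorem assocHom_tmul (s : BimodStr k R U) (t : BimodStr k R V) (u : BimodStr k R W)
    (x : U) (y : V) (z : W) :
    assocHom s t u (tmul (s.tensor t) u (tmul s t x y) z) =
      tmul s (t.tensor u) x (tmul t u y z) := by
  simp [assocHom]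

@[simp] theorem assocInv_tmul (s : BimodStr k R U) (t : BimodStr k R V) (u : BimodStr k R W)
    (x : U) (y : V) (z : W) :
    assocInv s t u (tmul s (t.tensor u) x (tmul t u y z)) =
      tmul (s.tensor t) u (tmul s t x y) z := by
  simp [assocInv]

/-- The associativity isomorphism `(U ⊗_R V) ⊗_R W ≅ U ⊗_R (V ⊗_R W)`. -/
def assoc (s : BimodStr k R U) (t : BimodStr k R V) (u : BimodStr k R W) :
    BalTensor (s.tensor t) u ≃ₗ[k] BalTensor s (t.tensor u) :=
  LinearEquiv.ofLinearMap (assocHom s t u) (assocInv s t u)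
    (by
      refine hom_ext fun x z => ?_
      refine hom_ext_apply (f := (assocHom s t u ∘ₗ assocInv s t u) ∘ₗ tmul s (t.tensor u) x)
        (g := tmul s (t.tensor u) x) (fun y w => ?_) z
      simp)
    (hom_ext₃ fun x y z => by simp)

@[simp] theorem assoc_tmul (s : BimodStr k R U) (t : BimodStr k R V) (u : BimodStr k R W)
    (x : U) (y : V) (z : W) :
    assoc s t u (tmul (s.tensor t) u (tmul s t x y) z) = tmul s (t.tensor u) x (tmul t u y z) :=
  assocHom_tmul s t u x y z

theorem hom_ext₄ {r : BimodStr k R U} {s : BimodStr k R V} {q : BimodStr k R (BalTensor r s)}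
    {t : BimodStr k R W} {p : BimodStr k R (BalTensor q t)}
    {u : BimodStr k R U'} {f g : BalTensor p u →ₗ[k] P}
    (h : ∀ v w x y, f (tmul p u (tmul q t (tmul r s v w) x) y) =
      g (tmul p u (tmul q t (tmul r s v w) x) y)) : f = g :=
  hom_ext fun z y => LinearMap.congr_fun (f := f ∘ₗ (tmul p u).flip y)
    (g := g ∘ₗ (tmul p u).flip y) (hom_ext₃ fun v w x => h v w x y) z

theorem assoc_nat {s : BimodStr k R U} {t : BimodStr k R V} {u : BimodStr k R W}
    {s' : BimodStr k R U'} {t' : BimodStr k R V'} {u' : BimodStr k R W'}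
    {f : U →ₗ[k] U'} {g : V →ₗ[k] V'} {h : W →ₗ[k] W'}
    {fr : ∀ a x, f (s.r a x) = s'.r a (f x)} {gl : ∀ a x, g (t.l a x) = t'.l a (g x)}
    {gr : ∀ a x, g (t.r a x) = t'.r a (g x)} {hl : ∀ a x, h (u.l a x) = u'.l a (h x)}
    {fgr : ∀ a x, map f g fr gl ((s.tensor t).r a x) = (s'.tensor t').r a (map f g fr gl x)}
    {ghl : ∀ a x, map g h gr hl ((t.tensor u).l a x) = (t'.tensor u').l a (map g h gr hl x)} :
    (assoc s' t' u').toLinearMap ∘ₗ map (map f g fr gl) h fgr hl =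
      map f (map g h gr hl) fr ghl ∘ₗ (assoc s t u).toLinearMap :=
  hom_ext₃ fun x y z => by simp

theorem assoc_pentagon {p : BimodStr k R P} {s : BimodStr k R U} {t : BimodStr k R V}
    {u : BimodStr k R W}
    {h₁ : ∀ a x, (assoc p s t).toLinearMap (((p.tensor s).tensor t).r a x) =
      (p.tensor (s.tensor t)).r a ((assoc p s t).toLinearMap x)}
    {h₂ : ∀ a x, (assoc s t u).toLinearMap (((s.tensor t).tensor u).l a x) =
      (s.tensor (t.tensor u)).l a ((assoc s t u).toLinearMap x)} :
    (map (s := p) (s' := p) LinearMap.id (assoc s t u).toLinearMap (fun _ _ => rfl) h₂ ∘ₗ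
      (assoc p (s.tensor t) u).toLinearMap) ∘ₗ
      map (t := u) (t' := u) (assoc p s t).toLinearMap LinearMap.id h₁ (fun _ _ => rfl) =
    (assoc p s (t.tensor u)).toLinearMap ∘ₗ (assoc (p.tensor s) t u).toLinearMap :=
  hom_ext₄ fun x y z w => by simp

theorem assoc_triangle [IsScalarTower k R R] [SMulCommClass k R R] {s : BimodStr k R V}
    {t : BimodStr k R W}
    {h₁ : ∀ a x, t.actL (((regular k R).tensor t).l a x) = t.l a (t.actL x)}
    {h₂ : ∀ a x, s.actR ((s.tensor (regular k R)).r a x) = s.r a (s.actR x)} :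
    map (s := s) (s' := s) LinearMap.id t.actL (fun _ _ => rfl) h₁ ∘ₗ
      (assoc s (regular k R) t).toLinearMap =
    map (t := t) (t' := t) s.actR LinearMap.id h₂ (fun _ _ => rfl) :=
  hom_ext₃ fun x a y => by simp [balanced]

theorem actL_nat [IsScalarTower k R R] [SMulCommClass k R R] {s : BimodStr k R V}
    {t : BimodStr k R W} {f : V →ₗ[k] W} {hf : ∀ a x, f (s.l a x) = t.l a (f x)} :
    t.actL ∘ₗ map (s := regular k R) (s' := regular k R) LinearMap.id f (fun _ _ => rfl) hf =
      f ∘ₗ s.actL :=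
  hom_ext fun a x => by simp [hf]

theorem actR_nat [IsScalarTower k R R] [SMulCommClass k R R] {s : BimodStr k R V}
    {t : BimodStr k R W} {f : V →ₗ[k] W} {hf : ∀ a x, f (s.r a x) = t.r a (f x)} :
    t.actR ∘ₗ map (t := regular k R) (t' := regular k R) f LinearMap.id hf (fun _ _ => rfl) =
      f ∘ₗ s.actR :=
  hom_ext fun a x => by simp [hf]

end BalTensor
namespace BimodStr

theorem tensor_firm [IsScalarTower k R R] [SMulCommClass k R R] {s : BimodStr k R V}
    {t : BimodStr k R W} (hs : s.IsFirm) (ht : t.IsFirm) : (s.tensor t).IsFirm where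
  left := by
    let e := LinearEquiv.ofBijective s.actL hs.left
    have he (x) : e x = s.actL x := rfl
    have hr (a : R) (x) : s.actL (((regular k R).tensor s).r a x) = s.r a (s.actL x) :=
      hom_ext_apply (f := s.actL ∘ₗ ((regular k R).tensor s).r a) (g := s.r a ∘ₗ s.actL)
        (fun b v => by simp [s.l_r]) x
    have hr' (a : R) (v) : e.symm (s.r a v) = ((regular k R).tensor s).r a (e.symm v) := by
      rw [LinearEquiv.symm_apply_eq, he, hr, ← he, LinearEquiv.apply_symm_apply]
    let F : BalTensor ((regular k R).tensor s) t →ₗ[k] BalTensor s t :=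
      BalTensor.map s.actL LinearMap.id hr (fun _ _ => rfl)
    let G : BalTensor s t →ₗ[k] BalTensor ((regular k R).tensor s) t :=
      BalTensor.map e.symm.toLinearMap LinearMap.id hr' (fun _ _ => rfl)
    have hF : Function.Bijective F := by
      refine Function.bijective_iff_has_inverse.2 ⟨G, ?_, ?_⟩
      · refine hom_ext_apply (f := G ∘ₗ F) (g := LinearMap.id) fun x w => ?_
        simp [F, G, ← he]
      · refine hom_ext_apply (f := F ∘ₗ G) (g := LinearMap.id) fun x w => ?_
        simp [F, G, ← he]
    have h : (s.tensor t).actL = F ∘ₗ (assoc (regular k R) s t).symm.toLinearMap := by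
      rw [LinearEquiv.eq_comp_toLinearMap_symm]
      exact hom_ext₃ fun a v w => by simp [F]
    rw [h]
    exact hF.comp (assoc (regular k R) s t).symm.bijective
  right := by
    let e := LinearEquiv.ofBijective t.actR ht.right
    have he (x) : e x = t.actR x := rfl
    have hr (a : R) (x) : t.actR ((t.tensor (regular k R)).l a x) = t.l a (t.actR x) :=
      hom_ext_apply (f := t.actR ∘ₗ (t.tensor (regular k R)).l a) (g := t.l a ∘ₗ t.actR)
        (fun b v => by simp [t.l_r]) x
    have hr' (a : R) (v) : e.symm (t.l a v) = (t.tensor (regular k R)).l a (e.symm v) := by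
      rw [LinearEquiv.symm_apply_eq, he, hr, ← he, LinearEquiv.apply_symm_apply]
    let F : BalTensor s (t.tensor (regular k R)) →ₗ[k] BalTensor s t :=
      BalTensor.map LinearMap.id t.actR (fun _ _ => rfl) hr
    let G : BalTensor s t →ₗ[k] BalTensor s (t.tensor (regular k R)) :=
      BalTensor.map LinearMap.id e.symm.toLinearMap (fun _ _ => rfl) hr'
    have hF : Function.Bijective F := by
      refine Function.bijective_iff_has_inverse.2 ⟨G, ?_, ?_⟩
      · refine hom_ext_apply (f := G ∘ₗ F) (g := LinearMap.id) fun x w => ?_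
        simp [F, G, ← he]
      · refine hom_ext_apply (f := F ∘ₗ G) (g := LinearMap.id) fun x w => ?_
        simp [F, G, ← he]
    have h : (s.tensor t).actR = F ∘ₗ (assoc s t (regular k R)).toLinearMap :=
      hom_ext₃ fun a v w => by simp [F]
    rw [h]
    exact hF.comp (assoc s t (regular k R)).bijective

end BimodStr

/-- A firm `R`-bimodule. -/
structure FirmBimod (k : Type u) (R : Type v) [Field k] [NonUnitalRing R] [Module k R]
    [IsScalarTower k R R] [SMulCommClass k R R] where
  carrier : Type v
  [grp : AddCommGroup carrier]
  [mod : Module k carrier]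
  str : BimodStr k R carrier
  firm : str.IsFirm

namespace FirmBimod

variable [IsScalarTower k R R] [SMulCommClass k R R]

attribute [instance] FirmBimod.grp FirmBimod.mod

/-- A morphism of bimodules. -/
@[ext] structure Hom (X Y : FirmBimod k R) where
  lin : X.carrier →ₗ[k] Y.carrier
  map_l : ∀ a x, lin (X.str.l a x) = Y.str.l a (lin x)
  map_r : ∀ a x, lin (X.str.r a x) = Y.str.r a (lin x)

instance : Category (FirmBimod k R) where
  Hom := Hom
  id X := ⟨LinearMap.id, fun _ _ => rfl, fun _ _ => rfl⟩
  comp f g := ⟨g.lin ∘ₗ f.lin, fun a x => by simp [f.map_l, g.map_l],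
    fun a x => by simp [f.map_r, g.map_r]⟩

@[simp] theorem id_lin (X : FirmBimod k R) : Hom.lin (𝟙 X) = LinearMap.id := rfl
@[simp] theorem comp_lin {X Y Z : FirmBimod k R} (f : X ⟶ Y) (g : Y ⟶ Z) :
    Hom.lin (f ≫ g) = g.lin ∘ₗ f.lin := rfl

theorem hom_ext' {X Y : FirmBimod k R} {f g : X ⟶ Y} (h : Hom.lin f = Hom.lin g) : f = g :=
  Hom.ext h

/-- A bijective morphism is an isomorphism. -/
def isoOfEquiv {X Y : FirmBimod k R} (e : X.carrier ≃ₗ[k] Y.carrier)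
    (hl : ∀ a x, e (X.str.l a x) = Y.str.l a (e x))
    (hr : ∀ a x, e (X.str.r a x) = Y.str.r a (e x)) : X ≅ Y where
  hom := ⟨e.toLinearMap, hl, hr⟩
  inv := ⟨e.symm.toLinearMap, fun a y => by
      rw [LinearEquiv.coe_coe, LinearEquiv.symm_apply_eq, hl, LinearEquiv.apply_symm_apply],
    fun a y => by
      rw [LinearEquiv.coe_coe, LinearEquiv.symm_apply_eq, hr, LinearEquiv.apply_symm_apply]⟩
  hom_inv_id := hom_ext' (by ext; simp)
  inv_hom_id := hom_ext' (by ext; simp)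

@[simp] theorem isoOfEquiv_hom_lin {X Y : FirmBimod k R} (e : X.carrier ≃ₗ[k] Y.carrier)
    (hl : ∀ a x, e (X.str.l a x) = Y.str.l a (e x))
    (hr : ∀ a x, e (X.str.r a x) = Y.str.r a (e x)) :
    Hom.lin (isoOfEquiv e hl hr).hom = e.toLinearMap := rfl

/-- The tensor product `X ⊗_R Y`. -/
abbrev tensorObj (X Y : FirmBimod k R) : FirmBimod k R :=
  ⟨BalTensor X.str Y.str, X.str.tensor Y.str, tensor_firm X.firm Y.firm⟩

/-- The tensor product `f ⊗_R g`. -/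
def tensorHom {X Y X' Y' : FirmBimod k R} (f : X ⟶ X') (g : Y ⟶ Y') :
    tensorObj X Y ⟶ tensorObj X' Y' where
  lin := BalTensor.map (Hom.lin f) (Hom.lin g) f.map_r g.map_l
  map_l a := hom_ext_apply
    (f := BalTensor.map (Hom.lin f) (Hom.lin g) f.map_r g.map_l ∘ₗ (X.str.tensor Y.str).l a)
    (g := (X'.str.tensor Y'.str).l a ∘ₗ BalTensor.map (Hom.lin f) (Hom.lin g) f.map_r g.map_l)
    (by simp [f.map_l])
  map_r a := hom_ext_apply
    (f := BalTensor.map (Hom.lin f) (Hom.lin g) f.map_r g.map_l ∘ₗ (X.str.tensor Y.str).r a)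
    (g := (X'.str.tensor Y'.str).r a ∘ₗ BalTensor.map (Hom.lin f) (Hom.lin g) f.map_r g.map_l)
    (by simp [g.map_r])

/-- The associativity constraint `(X ⊗_R Y) ⊗_R Z ≅ X ⊗_R (Y ⊗_R Z)`. -/
def associator (X Y Z : FirmBimod k R) :
    tensorObj (tensorObj X Y) Z ≅ tensorObj X (tensorObj Y Z) :=
  isoOfEquiv (BalTensor.assoc X.str Y.str Z.str)
    (fun a => hom_ext_apply
      (f := (assoc X.str Y.str Z.str).toLinearMap ∘ₗ ((X.str.tensor Y.str).tensor Z.str).l a)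
      (g := (X.str.tensor (Y.str.tensor Z.str)).l a ∘ₗ (assoc X.str Y.str Z.str).toLinearMap)
      (fun z w => LinearMap.congr_fun (hom_ext₃ fun x y w => by simp) _))
    (fun a => hom_ext_apply
      (f := (assoc X.str Y.str Z.str).toLinearMap ∘ₗ ((X.str.tensor Y.str).tensor Z.str).r a)
      (g := (X.str.tensor (Y.str.tensor Z.str)).r a ∘ₗ (assoc X.str Y.str Z.str).toLinearMap)
      (fun z w => LinearMap.congr_fun (hom_ext₃ fun x y w => by simp) _))

/-- The regular bimodule of a firm algebra. -/
abbrev unit (h : (regular k R).IsFirm) : FirmBimod k R := ⟨R, regular k R, h⟩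

/-- The left unit constraint `R ⊗_R X ≅ X`. -/
def leftUnitor (h : (regular k R).IsFirm) (X : FirmBimod k R) : tensorObj (unit h) X ≅ X :=
  isoOfEquiv (LinearEquiv.ofBijective X.str.actL X.firm.left)
    (fun a => hom_ext_apply
      (f := X.str.actL ∘ₗ ((regular k R).tensor X.str).l a) (g := X.str.l a ∘ₗ X.str.actL)
      (by simp [X.str.l_mul]))
    (fun a => hom_ext_apply
      (f := X.str.actL ∘ₗ ((regular k R).tensor X.str).r a) (g := X.str.r a ∘ₗ X.str.actL)
      (by simp [X.str.l_r]))

/-- The right unit constraint `X ⊗_R R ≅ X`. -/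
def rightUnitor (h : (regular k R).IsFirm) (X : FirmBimod k R) : tensorObj X (unit h) ≅ X :=
  isoOfEquiv (LinearEquiv.ofBijective X.str.actR X.firm.right)
    (fun a => hom_ext_apply
      (f := X.str.actR ∘ₗ (X.str.tensor (regular k R)).l a) (g := X.str.l a ∘ₗ X.str.actR)
      (by simp [X.str.l_r]))
    (fun a => hom_ext_apply
      (f := X.str.actR ∘ₗ (X.str.tensor (regular k R)).r a) (g := X.str.r a ∘ₗ X.str.actR)
      (by simp [X.str.r_mul]))

theorem tensorHom_id (X Y : FirmBimod k R) : tensorHom (𝟙 X) (𝟙 Y) = 𝟙 (tensorObj X Y) :=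
  hom_ext' (BalTensor.hom_ext fun x y => by simp [tensorHom])

theorem tensorHom_comp {X₁ Y₁ Z₁ X₂ Y₂ Z₂ : FirmBimod k R} (f₁ : X₁ ⟶ Y₁) (f₂ : X₂ ⟶ Y₂)
    (g₁ : Y₁ ⟶ Z₁) (g₂ : Y₂ ⟶ Z₂) :
    tensorHom f₁ f₂ ≫ tensorHom g₁ g₂ = tensorHom (f₁ ≫ g₁) (f₂ ≫ g₂) :=
  hom_ext' (BalTensor.hom_ext fun x y => by simp [tensorHom])

theorem associator_naturality {X₁ X₂ X₃ Y₁ Y₂ Y₃ : FirmBimod k R} (f₁ : X₁ ⟶ Y₁) (f₂ : X₂ ⟶ Y₂)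
    (f₃ : X₃ ⟶ Y₃) : tensorHom (tensorHom f₁ f₂) f₃ ≫ (associator Y₁ Y₂ Y₃).hom =
      (associator X₁ X₂ X₃).hom ≫ tensorHom f₁ (tensorHom f₂ f₃) :=
  hom_ext' (BalTensor.assoc_nat (fr := f₁.map_r) (gl := f₂.map_l) (gr := f₂.map_r) (hl := f₃.map_l)
    (fgr := (tensorHom f₁ f₂).map_r) (ghl := (tensorHom f₂ f₃).map_l))

theorem leftUnitor_naturality (h : (regular k R).IsFirm) {X Y : FirmBimod k R} (f : X ⟶ Y) :
    tensorHom (𝟙 (unit h)) f ≫ (leftUnitor h Y).hom = (leftUnitor h X).hom ≫ f :=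
  hom_ext' (BalTensor.actL_nat (hf := f.map_l))

theorem rightUnitor_naturality (h : (regular k R).IsFirm) {X Y : FirmBimod k R} (f : X ⟶ Y) :
    tensorHom f (𝟙 (unit h)) ≫ (rightUnitor h Y).hom = (rightUnitor h X).hom ≫ f :=
  hom_ext' (BalTensor.actR_nat (hf := f.map_r))

theorem pentagon (W X Y Z : FirmBimod k R) :
    tensorHom (associator W X Y).hom (𝟙 Z) ≫ (associator W (tensorObj X Y) Z).hom ≫
      tensorHom (𝟙 W) (associator X Y Z).hom =
    (associator (tensorObj W X) Y Z).hom ≫ (associator W X (tensorObj Y Z)).hom :=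
  hom_ext' (BalTensor.assoc_pentagon (h₁ := (associator W X Y).hom.map_r)
    (h₂ := (associator X Y Z).hom.map_l))

theorem triangle (h : (regular k R).IsFirm) (X Y : FirmBimod k R) :
    (associator X (unit h) Y).hom ≫ tensorHom (𝟙 X) (leftUnitor h Y).hom =
      tensorHom (rightUnitor h X).hom (𝟙 Y) :=
  hom_ext' (BalTensor.assoc_triangle (h₁ := (leftUnitor h Y).hom.map_l)
    (h₂ := (rightUnitor h X).hom.map_r))

/-- For a firm algebra `R`, the firm `R`-bimodules are a monoidal category via `⊗_R`, with the
regular bimodule as the monoidal unit. -/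
@[reducible] def monoidal (h : (regular k R).IsFirm) : MonoidalCategory (FirmBimod k R) :=
  letI : MonoidalCategoryStruct (FirmBimod k R) :=
    { tensorObj := tensorObj
      whiskerLeft := fun X _ _ f => tensorHom (𝟙 X) f
      whiskerRight := fun f Y => tensorHom f (𝟙 Y)
      tensorHom := tensorHom
      tensorUnit := unit h
      associator := associator
      leftUnitor := leftUnitor h
      rightUnitor := rightUnitor h }
  MonoidalCategory.ofTensorHom
    (id_tensorHom_id := tensorHom_id)
    (id_tensorHom := fun _ _ _ _ => rfl)
    (tensorHom_id := fun _ _ => rfl)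
    (tensorHom_comp_tensorHom := tensorHom_comp)
    (associator_naturality := associator_naturality)
    (leftUnitor_naturality := leftUnitor_naturality h)
    (rightUnitor_naturality := rightUnitor_naturality h)
    (pentagon := pentagon)
    (triangle := triangle h)

end FirmBimod

end Bimodules

/-! # Multipliers -/

/-- The multipliers of `A` as a subalgebra of `End(A) × End(A)ᵒᵖ`. -/
def multiplierSubalgebra (k : Type u) (A : Type v) [Field k] [NonUnitalRing A] [Module k A]
    [IsScalarTower k A A] [SMulCommClass k A A] :
    Subalgebra k (Module.End k A × (Module.End k A)ᵐᵒᵖ) where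
  carrier := {w | ∀ a b : A, a * w.1 b = w.2.unop a * b}
  mul_mem' := fun {w w'} (hw : ∀ a b : A, _) (hw' : ∀ a b : A, _) a b => by
    simp [hw, hw']
  add_mem' := fun {w w'} (hw : ∀ a b : A, _) (hw' : ∀ a b : A, _) a b => by
    simp [mul_add, add_mul, hw, hw']
  algebraMap_mem' := fun c a b => by
    simp [Module.algebraMap_end_apply, mul_smul_comm, smul_mul_assoc]

/-- The multiplier algebra `M(A)`: pairs of linear maps `b ↦ w b`, `a ↦ a w` on `A` such that
`a (w b) = (a w) b`, multiplied by composition and opposite composition. -/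
def Multiplier (k : Type u) (A : Type v) [Field k] [NonUnitalRing A] [Module k A]
    [IsScalarTower k A A] [SMulCommClass k A A] : Type v := multiplierSubalgebra k A

namespace Multiplier

variable {k : Type u} {A : Type v} [Field k] [NonUnitalRing A] [Module k A]
  [IsScalarTower k A A] [SMulCommClass k A A]

instance : Ring (Multiplier k A) := inferInstanceAs (Ring (multiplierSubalgebra k A))

instance : Algebra k (Multiplier k A) := inferInstanceAs (Algebra k (multiplierSubalgebra k A))

/-- `b ↦ w b`, depending linearly on the multiplier `w`. -/
def left : Multiplier k A →ₗ[k] A →ₗ[k] A :=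
  LinearMap.fst k (Module.End k A) (Module.End k A)ᵐᵒᵖ ∘ₗ (multiplierSubalgebra k A).val.toLinearMap

/-- `a ↦ a w`, depending linearly on the multiplier `w`. -/
def right : Multiplier k A →ₗ[k] A →ₗ[k] A :=
  (MulOpposite.opLinearEquiv k).symm.toLinearMap ∘ₗ
    LinearMap.snd k (Module.End k A) (Module.End k A)ᵐᵒᵖ ∘ₗ
      (multiplierSubalgebra k A).val.toLinearMap

theorem mul_left (w : Multiplier k A) (a b : A) : a * left w b = right w a * b := w.2 a b

theorem left_mul (w w' : Multiplier k A) (a : A) : left (w * w') a = left w (left w' a) := rfl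

theorem right_mul (w w' : Multiplier k A) (a : A) : right (w * w') a = right w' (right w a) := rfl

end Multiplier

/-! # Weak multiplier bialgebras -/

section Axioms

variable {k : Type u} {A M V W X Y : Type v} [Field k] [AddCommGroup A] [Module k A]
  [AddCommGroup M] [Module k M] [AddCommGroup V] [Module k V] [AddCommGroup W] [Module k W]
  [AddCommGroup X] [Module k X] [AddCommGroup Y] [Module k Y]

/-- `f` acting on the second and third factors of `M ⊗ V ⊗ W`. -/
def leg23 (M : Type v) [AddCommGroup M] [Module k M] (f : V ⊗[k] W →ₗ[k] X ⊗[k] Y) :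
    (M ⊗[k] V) ⊗[k] W →ₗ[k] (M ⊗[k] X) ⊗[k] Y :=
  (TensorProduct.assoc k M X Y).symm.toLinearMap ∘ₗ f.lTensor M ∘ₗ
    (TensorProduct.assoc k M V W).toLinearMap

/-- `f` acting on the first and third factors of `V ⊗ M ⊗ W`. -/
def leg13 (M : Type v) [AddCommGroup M] [Module k M] (f : V ⊗[k] W →ₗ[k] X ⊗[k] Y) :
    (V ⊗[k] M) ⊗[k] W →ₗ[k] (X ⊗[k] M) ⊗[k] Y :=
  (TensorProduct.rightComm k X Y M).toLinearMap ∘ₗ f.rTensor M ∘ₗ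
    (TensorProduct.rightComm k V M W).toLinearMap

/-- The map `V ⊗ A → V` applying the functional `f` to the second factor. -/
def sliceR (V : Type v) [AddCommGroup V] [Module k V] (f : A →ₗ[k] k) : V ⊗[k] A →ₗ[k] V :=
  (TensorProduct.rid k V).toLinearMap ∘ₗ f.lTensor V

/-- The map `A ⊗ V → V` applying the functional `f` to the first factor. -/
def sliceL (V : Type v) [AddCommGroup V] [Module k V] (f : A →ₗ[k] k) : A ⊗[k] V →ₗ[k] V :=
  (TensorProduct.lid k V).toLinearMap ∘ₗ f.rTensor V

/-- For a product `m` and `T₁ (a ⊗ c) = Δ(a) (1 ⊗ c)`, the map `b ⊗ c ↦ Δ(a) (b ⊗ c)`. -/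
def deltaL (m : A →ₗ[k] A →ₗ[k] A) (T₁ : A ⊗[k] A →ₗ[k] A ⊗[k] A) :
    A →ₗ[k] A ⊗[k] A →ₗ[k] A ⊗[k] A :=
  TensorProduct.uncurry (RingHom.id k) A A (A ⊗[k] A) ∘ₗ
    ((LinearMap.llcomp k A _ _).compl₁₂ (LinearMap.rTensorHom A ∘ₗ m.flip)
      (TensorProduct.curry T₁)).flip

theorem deltaL_tmul (m : A →ₗ[k] A →ₗ[k] A) (T₁ : A ⊗[k] A →ₗ[k] A ⊗[k] A) (a b c : A) :
    deltaL m T₁ a (b ⊗ₜ c) = (m.flip b).rTensor A (T₁ (a ⊗ₜ c)) := rfl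

/-- For a product `m` and `T₂ (b ⊗ a) = (b ⊗ 1) Δ(a)`, the map `b ⊗ c ↦ (b ⊗ c) Δ(a)`. -/
def deltaR (m : A →ₗ[k] A →ₗ[k] A) (T₂ : A ⊗[k] A →ₗ[k] A ⊗[k] A) :
    A →ₗ[k] A ⊗[k] A →ₗ[k] A ⊗[k] A :=
  TensorProduct.uncurry (RingHom.id k) A A (A ⊗[k] A) ∘ₗ LinearMap.lflip.toLinearMap ∘ₗ
    ((LinearMap.llcomp k A _ _).compl₁₂ (LinearMap.lTensorHom A ∘ₗ m)
      (TensorProduct.curry T₂).flip).flip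

theorem deltaR_tmul (m : A →ₗ[k] A →ₗ[k] A) (T₂ : A ⊗[k] A →ₗ[k] A ⊗[k] A) (a b c : A) :
    deltaR m T₂ a (b ⊗ₜ c) = (m c).lTensor A (T₂ (b ⊗ₜ a)) := rfl

/-- The axioms of a weak multiplier bialgebra for the product `m` on `A`, an idempotent multiplier
`E` of `A ⊗ A` and a comultiplication `Δ` from `A` to the multipliers of `A ⊗ A`, given by
`E₁ x = E x`, `E₂ x = x E`, `T₁ (a ⊗ b) = Δ(a) (1 ⊗ b)`, `T₂ (a ⊗ b) = (a ⊗ 1) Δ(b)`, and a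
counit `ε`. -/
structure IsWMB (m : A →ₗ[k] A →ₗ[k] A) (E₁ E₂ T₁ T₂ : A ⊗[k] A →ₗ[k] A ⊗[k] A)
    (ε : A →ₗ[k] k) : Prop where
  assoc : ∀ a b c, m (m a b) c = m a (m b c)
  idempotent : Submodule.span k {c | ∃ a b, c = m a b} = ⊤
  nondeg_left : ∀ a, (∀ b, m a b = 0) → a = 0
  nondeg_right : ∀ a, (∀ b, m b a = 0) → a = 0
  /-- `x (E y) = (x E) y` -/
  E_mult : ∀ x y, TensorProduct.map₂ m m x (E₁ y) = TensorProduct.map₂ m m (E₂ x) y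
  E₁_idem : E₁ ∘ₗ E₁ = E₁
  E₂_idem : E₂ ∘ₗ E₂ = E₂
  /-- `((a ⊗ 1) Δ(b)) (1 ⊗ c) = (a ⊗ 1) (Δ(b) (1 ⊗ c))` -/
  Δ_mult : ∀ a b c, (m.flip c).lTensor A (T₂ (a ⊗ₜ b)) = (m a).rTensor A (T₁ (b ⊗ₜ c))
  /-- `Δ(a b) = Δ(a) Δ(b)` -/
  Δ_mul : ∀ a b, deltaL m T₁ (m a b) = deltaL m T₁ a ∘ₗ deltaL m T₁ b
  coassoc : T₂.rTensor A ∘ₗ leg23 A T₁ = leg23 A T₁ ∘ₗ T₂.rTensor A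
  counit_left : ∀ a b, sliceL A ε (T₁ (a ⊗ₜ b)) = m a b
  counit_right : ∀ a b, sliceR A ε (T₂ (a ⊗ₜ b)) = m a b
  span_left : Submodule.span k {y | ∃ a x, y = deltaL m T₁ a x} = LinearMap.range E₁
  span_right : Submodule.span k {y | ∃ a x, y = deltaR m T₂ a x} = LinearMap.range E₂
  /-- `(E ⊗ 1) (1 ⊗ E) = (1 ⊗ E) (E ⊗ 1)` -/
  E_comm : E₁.rTensor A ∘ₗ leg23 A E₁ = leg23 A E₁ ∘ₗ E₁.rTensor A
  /-- `(1 ⊗ E) (E ⊗ 1)` is the value at `E` of the extension of `Δ ⊗ A` to multipliers -/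
  ΔE_left : ∀ x : A ⊗[k] A, (E₁.rTensor A ∘ₗ leg23 A E₁) ∘ₗ
    TensorProduct.map₂ (deltaL m T₁) m x = TensorProduct.map₂ (deltaL m T₁) m (E₁ x)
  /-- `(1 ⊗ E) (E ⊗ 1)` is the value at `E` of the extension of `A ⊗ Δ` to multipliers -/
  ΔE_right : ∀ x : A ⊗[k] A, (E₁.rTensor A ∘ₗ leg23 A E₁) ∘ₗ
    (TensorProduct.assoc k A A A).symm.toLinearMap ∘ₗ TensorProduct.map₂ m (deltaL m T₁) x =
    (TensorProduct.assoc k A A A).symm.toLinearMap ∘ₗ TensorProduct.map₂ m (deltaL m T₁) (E₁ x)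
  /-- `(ε ⊗ A) ((1 ⊗ a) E (b ⊗ c)) = (ε ⊗ A) (Δ(a) (b ⊗ c))` -/
  counit_E₁ : ∀ a (x : A ⊗[k] A),
    sliceL A ε ((m a).lTensor A (E₁ x)) = sliceL A ε (deltaL m T₁ a x)
  /-- `(ε ⊗ A) ((a ⊗ b) E (1 ⊗ c)) = (ε ⊗ A) ((a ⊗ b) Δ(c))` -/
  counit_E₂ : ∀ c (x : A ⊗[k] A),
    sliceL A ε ((m.flip c).lTensor A (E₂ x)) = sliceL A ε (deltaR m T₂ c x)

end Axioms

/-- A regular weak multiplier bialgebra: a weak multiplier bialgebra `A` such that the opposite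
algebra is a weak multiplier bialgebra, via the same `E`, `ε` and comultiplication. -/
structure RegWMB (k : Type u) (A : Type v) [Field k] [NonUnitalRing A] [Module k A]
    [IsScalarTower k A A] [SMulCommClass k A A] where
  (E₁ E₂ T₁ T₂ T₃ T₄ : A ⊗[k] A →ₗ[k] A ⊗[k] A)
  ε : A →ₗ[k] k
  wmb : IsWMB (LinearMap.mul k A) E₁ E₂ T₁ T₂ ε
  op : IsWMB (LinearMap.mul k A).flip E₂ E₁ T₃ T₄ ε
  /-- `T₃ (a ⊗ b) = (1 ⊗ b) Δ(a)` -/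
  T₃_spec : deltaL (LinearMap.mul k A).flip T₃ = deltaR (LinearMap.mul k A) T₂
  /-- `T₄ (a ⊗ b) = Δ(b) (a ⊗ 1)` -/
  T₄_spec : deltaR (LinearMap.mul k A).flip T₄ = deltaL (LinearMap.mul k A) T₁

section WMB

variable {k : Type u} {A : Type v} [Field k] [NonUnitalRing A] [Module k A]
  [IsScalarTower k A A] [SMulCommClass k A A]

namespace RegWMB

/-- `H.ΔL a x = Δ(a) x` -/
abbrev ΔL (H : RegWMB k A) : A →ₗ[k] A ⊗[k] A →ₗ[k] A ⊗[k] A := deltaL (LinearMap.mul k A) H.T₁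

/-- `H.ΔR a x = x Δ(a)` -/
abbrev ΔR (H : RegWMB k A) : A →ₗ[k] A ⊗[k] A →ₗ[k] A ⊗[k] A := deltaR (LinearMap.mul k A) H.T₂

/-- The comultiplication is right full. -/
def RightFull (H : RegWMB k A) : Prop :=
  Submodule.span k {c | ∃ (a b : A) (ω : A →ₗ[k] k), c = sliceR A ω (H.T₁ (a ⊗ₜ b))} = ⊤

/-- The multiplier `w` is `⊓ᴿ(a) = (M(A) ⊗ ε) ((1 ⊗ a) E)`. -/
def IsPiR (H : RegWMB k A) (a : A) (w : Multiplier k A) : Prop :=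
  ∀ b, Multiplier.right w b = sliceR A H.ε (H.E₂ (b ⊗ₜ a))

/-- The multiplier `w` is `⊓̄ᴿ(a) = (M(A) ⊗ ε) (E (1 ⊗ a))`. -/
def IsPiBarR (H : RegWMB k A) (a : A) (w : Multiplier k A) : Prop :=
  ∀ b, Multiplier.left w b = sliceR A H.ε (H.E₁ (b ⊗ₜ a))

/-- `R` is the base algebra: the coinciding range of the maps `⊓ᴿ, ⊓̄ᴿ : A → M(A)`. -/
structure IsBaseAlgebra (H : RegWMB k A)
    (R : NonUnitalSubalgebra k (Multiplier k A)) : Prop where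
  piR_mem : ∀ a, ∃ w ∈ R, H.IsPiR a w
  exists_piR : ∀ w ∈ R, ∃ a, H.IsPiR a w
  piBarR_mem : ∀ a, ∃ w ∈ R, H.IsPiBarR a w
  exists_piBarR : ∀ w ∈ R, ∃ a, H.IsPiBarR a w

end RegWMB

end WMB

/-! # Modules -/

section Modules

variable {k : Type u} {A V W V' : Type v} [Field k] [NonUnitalRing A] [Module k A]
  [AddCommGroup V] [Module k V] [AddCommGroup W] [Module k W] [AddCommGroup V'] [Module k V']

theorem rTensor_jointly_injective {ι : Type v} (f : ι → V →ₗ[k] V')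
    (hf : ∀ v, (∀ i, f i v = 0) → v = 0) (x : V ⊗[k] W) (hx : ∀ i, (f i).rTensor W x = 0) :
    x = 0 := by
  classical
  let b := Module.Basis.ofVectorSpace k W
  have key (i) (j) : f i ((TensorProduct.equivFinsuppOfBasisRight b x) j) =
      (TensorProduct.equivFinsuppOfBasisRight b ((f i).rTensor W x)) j := by
    clear hx
    induction x using TensorProduct.induction_on with
    | zero => simp
    | tmul v w => simp
    | add x y hx hy => simp only [map_add, Finsupp.add_apply, hx, hy]
  apply (TensorProduct.equivFinsuppOfBasisRight b).injective
  rw [map_zero]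
  ext j
  exact hf _ fun i => by rw [key, hx, map_zero, Finsupp.zero_apply]

theorem lTensor_jointly_injective {ι : Type v} (f : ι → V →ₗ[k] V')
    (hf : ∀ v, (∀ i, f i v = 0) → v = 0) (x : W ⊗[k] V) (hx : ∀ i, (f i).lTensor W x = 0) :
    x = 0 := by
  apply (TensorProduct.comm k W V).injective
  rw [map_zero]
  refine rTensor_jointly_injective f hf _ fun i => ?_
  have h : (f i).rTensor W ∘ₗ (TensorProduct.comm k W V).toLinearMap =
      (TensorProduct.comm k W V').toLinearMap ∘ₗ (f i).lTensor W := TensorProduct.ext' (by simp)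
  exact (LinearMap.congr_fun h x).trans (by simp [hx])

/-- An idempotent non-degenerate right `A`-module structure on the vector space `V`, with
`act v a` being `v · a`. -/
structure ModStr (k : Type u) (A V : Type v) [Field k] [NonUnitalRing A] [Module k A]
    [AddCommGroup V] [Module k V] where
  act : V →ₗ[k] A →ₗ[k] V
  act_mul : ∀ v a b, act v (a * b) = act (act v a) b
  idempotent : Submodule.span k {x | ∃ v a, x = act v a} = ⊤
  nondeg : ∀ v, (∀ a, act v a = 0) → v = 0

namespace ModStr

theorem ext_span (s : ModStr k A V) {P : Type v} [AddCommGroup P] [Module k P]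
    {f g : V →ₗ[k] P} (h : ∀ v a, f (s.act v a) = g (s.act v a)) : f = g :=
  LinearMap.ext_on s.idempotent (by rintro _ ⟨v, a, rfl⟩; exact h v a)

theorem act_surjective (s : ModStr k A V) :
    Function.Surjective (TensorProduct.lift s.act) := by
  rw [← LinearMap.range_eq_top, eq_top_iff, ← s.idempotent, Submodule.span_le]
  rintro _ ⟨v, a, rfl⟩
  exact ⟨v ⊗ₜ a, by simp⟩

/-- The action of `A ⊗ A` on `V ⊗ W`: `actTensor s t z (v ⊗ w) = (v · (-) ⊗ w · (-)) z`. -/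
def actTensor (s : ModStr k A V) (t : ModStr k A W) (x : A ⊗[k] A) : V ⊗[k] W →ₗ[k] V ⊗[k] W :=
  (TensorProduct.map₂ s.act t.act).flip x

theorem actTensor_nondeg (s : ModStr k A V) (t : ModStr k A W) (z : V ⊗[k] W)
    (hz : ∀ x, actTensor s t x z = 0) : z = 0 := by
  refine rTensor_jointly_injective (fun a => s.act.flip a) (fun v => s.nondeg v) z fun a => ?_
  refine lTensor_jointly_injective (fun a => t.act.flip a) (fun v => t.nondeg v) _ fun b => ?_
  rw [← hz (a ⊗ₜ b)]
  clear hz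
  induction z using TensorProduct.induction_on with
  | zero => simp
  | tmul v w => simp [actTensor]
  | add x y hx hy => simp only [map_add, hx, hy]

variable [IsScalarTower k A A] [SMulCommClass k A A]

theorem actTensor_map₂ (s : ModStr k A V) (t : ModStr k A W) (x y : A ⊗[k] A) (z : V ⊗[k] W) :
    actTensor s t (TensorProduct.map₂ (LinearMap.mul k A) (LinearMap.mul k A) x y) z =
      actTensor s t y (actTensor s t x z) := by
  induction x using TensorProduct.induction_on with
  | zero => simp [actTensor]
  | add x x' hx hx' => simp only [actTensor, map_add, LinearMap.add_apply] at *; rw [hx, hx']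
  | tmul a b =>
    induction y using TensorProduct.induction_on with
    | zero => simp [actTensor]
    | add x x' hx hx' => simp only [actTensor, map_add, LinearMap.add_apply] at *; rw [hx, hx']
    | tmul c d =>
      induction z using TensorProduct.induction_on with
      | zero => simp
      | tmul v w => simp [actTensor, act_mul]
      | add x x' hx hx' => simp only [map_add, hx, hx']

/-- For a multiplier of `A ⊗ A`, given by `x ↦ L x = w x` and `x ↦ R x = x w`, there is a unique
linear endomorphism `F` of `V ⊗ W` such that
`F (v · a ⊗ w · b) = (v · (-) ⊗ w · (-)) ((a ⊗ b) w)`. -/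
theorem exists_multAct (s : ModStr k A V) (t : ModStr k A W) (L R : A ⊗[k] A →ₗ[k] A ⊗[k] A)
    (h : ∀ x y, TensorProduct.map₂ (LinearMap.mul k A) (LinearMap.mul k A) x (L y) =
      TensorProduct.map₂ (LinearMap.mul k A) (LinearMap.mul k A) (R x) y) :
    ∃ F : V ⊗[k] W →ₗ[k] V ⊗[k] W, ∀ x z, F (actTensor s t x z) = actTensor s t (R x) z := by
  let P : (V ⊗[k] W) ⊗[k] (A ⊗[k] A) →ₗ[k] V ⊗[k] W :=
    TensorProduct.lift (TensorProduct.map₂ s.act t.act)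
  have hP (z x) : P (z ⊗ₜ x) = actTensor s t x z := by simp [P, actTensor]
  have hPs : Function.Surjective P := by
    have e : P = TensorProduct.map (TensorProduct.lift s.act) (TensorProduct.lift t.act) ∘ₗ
        (TensorProduct.tensorTensorTensorComm k V W A A).toLinearMap := by
      ext v w a b; simp [P]
    rw [e]
    exact (TensorProduct.map_surjective s.act_surjective t.act_surjective).comp
      (LinearEquiv.surjective _)
  have hcomm (y q) : actTensor s t y (P (R.lTensor (V ⊗[k] W) q)) = actTensor s t (L y) (P q) := by
    induction q using TensorProduct.induction_on with
    | zero => simp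
    | add x x' hx hx' => simp only [map_add, hx, hx']
    | tmul z x => rw [LinearMap.lTensor_tmul, hP, hP, ← actTensor_map₂, ← actTensor_map₂, h]
  have hker : LinearMap.ker P ≤ LinearMap.ker (P ∘ₗ R.lTensor (V ⊗[k] W)) := by
    intro q hq
    rw [LinearMap.mem_ker] at hq ⊢
    refine actTensor_nondeg s t _ fun y => ?_
    rw [LinearMap.comp_apply, hcomm, hq, map_zero]
  obtain ⟨g, hg⟩ := P.exists_rightInverse_of_surjective (LinearMap.range_eq_top.2 hPs)
  refine ⟨P ∘ₗ R.lTensor (V ⊗[k] W) ∘ₗ g, fun x z => ?_⟩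
  have : g (P (z ⊗ₜ x)) - z ⊗ₜ x ∈ LinearMap.ker P := by
    rw [LinearMap.mem_ker, map_sub, sub_eq_zero]
    exact LinearMap.congr_fun hg _
  have := hker this
  rw [LinearMap.mem_ker, map_sub, sub_eq_zero] at this
  rw [← hP, LinearMap.comp_apply, LinearMap.comp_apply]
  refine Eq.trans this ?_
  simp [hP]

/-- The endomorphism of `V ⊗ W` given by the right action of a multiplier of `A ⊗ A`. -/
def multAct (s : ModStr k A V) (t : ModStr k A W) (L R : A ⊗[k] A →ₗ[k] A ⊗[k] A)
    (h : ∀ x y, TensorProduct.map₂ (LinearMap.mul k A) (LinearMap.mul k A) x (L y) =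
      TensorProduct.map₂ (LinearMap.mul k A) (LinearMap.mul k A) (R x) y) :
    V ⊗[k] W →ₗ[k] V ⊗[k] W := (exists_multAct s t L R h).choose

theorem multAct_tmul (s : ModStr k A V) (t : ModStr k A W) (L R : A ⊗[k] A →ₗ[k] A ⊗[k] A)
    (h : ∀ x y, TensorProduct.map₂ (LinearMap.mul k A) (LinearMap.mul k A) x (L y) =
      TensorProduct.map₂ (LinearMap.mul k A) (LinearMap.mul k A) (R x) y) (v : V) (w : W)
    (a b : A) : multAct s t L R h (s.act v a ⊗ₜ t.act w b) =
      actTensor s t (R (a ⊗ₜ b)) (v ⊗ₜ w) := by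
  rw [← (exists_multAct s t L R h).choose_spec]
  simp [multAct, actTensor]

/-- The regular module of `A`. -/
def regular (H : RegWMB k A) : ModStr k A A where
  act := LinearMap.mul k A
  act_mul v a b := (mul_assoc v a b).symm
  idempotent := H.wmb.idempotent
  nondeg := H.wmb.nondeg_left

/-- The map `E₂^{V,W}`: `v · a ⊗ w · b ↦ (v · (-) ⊗ w · (-)) ((a ⊗ b) E)`. -/
def E₂ (H : RegWMB k A) (s : ModStr k A V) (t : ModStr k A W) : V ⊗[k] W →ₗ[k] V ⊗[k] W :=
  multAct s t H.E₁ H.E₂ H.wmb.E_mult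

end ModStr

theorem RegWMB.Δ_compat [IsScalarTower k A A] [SMulCommClass k A A] (H : RegWMB k A) (c : A)
    (x y : A ⊗[k] A) :
    TensorProduct.map₂ (LinearMap.mul k A) (LinearMap.mul k A) x (H.ΔL c y) =
      TensorProduct.map₂ (LinearMap.mul k A) (LinearMap.mul k A) (H.ΔR c x) y := by
  induction x using TensorProduct.induction_on with
  | zero => simp
  | add x x' hx hx' => simp only [map_add, LinearMap.add_apply, hx, hx']
  | tmul a b =>
    induction y using TensorProduct.induction_on with
    | zero => simp
    | add x x' hx hx' => simp only [map_add, hx, hx']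
    | tmul p q =>
      rw [ΔL, ΔR, deltaL_tmul, deltaR_tmul]
      have h1 (z : A ⊗[k] A) : TensorProduct.map₂ (LinearMap.mul k A) (LinearMap.mul k A)
          (a ⊗ₜ b) (((LinearMap.mul k A).flip p).rTensor A z) =
          ((LinearMap.mul k A).flip p).rTensor A ((LinearMap.mul k A b).lTensor A
            ((LinearMap.mul k A a).rTensor A z)) := by
        induction z using TensorProduct.induction_on with
        | zero => simp
        | tmul v w => simp [mul_assoc]
        | add x y hx hy => simp only [map_add, hx, hy]
      have h2 (z : A ⊗[k] A) : TensorProduct.map₂ (LinearMap.mul k A) (LinearMap.mul k A)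
          ((LinearMap.mul k A b).lTensor A z) (p ⊗ₜ q) =
          ((LinearMap.mul k A).flip p).rTensor A ((LinearMap.mul k A b).lTensor A
            (((LinearMap.mul k A).flip q).lTensor A z)) := by
        induction z using TensorProduct.induction_on with
        | zero => simp
        | tmul v w => simp [mul_assoc]
        | add x y hx hy => simp only [map_add, LinearMap.add_apply, hx, hy]
      rw [h1, h2, H.wmb.Δ_mult]

/-- The diagonal action of `c` on `V ⊗ W`:
`(v · a ⊗ w · b) · c = (v · (-) ⊗ w · (-)) ((a ⊗ b) Δ(c))`. -/
def ModStr.diag [IsScalarTower k A A] [SMulCommClass k A A] (H : RegWMB k A) (s : ModStr k A V)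
    (t : ModStr k A W) (c : A) : V ⊗[k] W →ₗ[k] V ⊗[k] W :=
  multAct s t (H.ΔL c) (H.ΔR c) (H.Δ_compat c)

/-- An idempotent non-degenerate right `A`-module. -/
structure RMod (k : Type u) (A : Type v) [Field k] [NonUnitalRing A] [Module k A] where
  carrier : Type v
  [grp : AddCommGroup carrier]
  [mod : Module k carrier]
  str : ModStr k A carrier

namespace RMod

attribute [instance] RMod.grp RMod.mod

/-- A morphism of `A`-modules. -/
@[ext] structure Hom (X Y : RMod k A) where
  lin : X.carrier →ₗ[k] Y.carrier
  map_act : ∀ x a, lin (X.str.act x a) = Y.str.act (lin x) a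

instance : Category (RMod k A) where
  Hom := Hom
  id X := ⟨LinearMap.id, fun _ _ => rfl⟩
  comp f g := ⟨g.lin ∘ₗ f.lin, fun a x => by simp [f.map_act, g.map_act]⟩

theorem Hom.map_of_act {V W : RMod k A} (f : Hom V W) {x : V.carrier →ₗ[k] V.carrier}
    {y : W.carrier →ₗ[k] W.carrier} {g : A → A}
    (hx : ∀ v a, x (V.str.act v a) = V.str.act v (g a))
    (hy : ∀ w a, y (W.str.act w a) = W.str.act w (g a)) (v : V.carrier) :
    f.lin (x v) = y (f.lin v) :=
  LinearMap.congr_fun (V.str.ext_span (f := f.lin ∘ₗ x) (g := y ∘ₗ f.lin) fun v a => by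
    simp [f.map_act, hx, hy]) v

end RMod

end Modules

/-! # Comodules -/

section Comodules

variable {k : Type u} {A M M' : Type v} [Field k] [NonUnitalRing A] [Module k A]
  [IsScalarTower k A A] [SMulCommClass k A A] [AddCommGroup M] [Module k M]
  [AddCommGroup M'] [Module k M']

/-- The structure of a full right comodule over a regular weak multiplier bialgebra. -/
structure ComodStr (H : RegWMB k A) (M : Type v) [AddCommGroup M] [Module k M] where
  (lam rho : M ⊗[k] A →ₗ[k] M ⊗[k] A)
  /-- `(1 ⊗ a) λ(m ⊗ b) = ρ(m ⊗ a) (1 ⊗ b)` -/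
  compat : ∀ m a b, (LinearMap.mul k A a).lTensor M (lam (m ⊗ₜ b)) =
    ((LinearMap.mul k A).flip b).lTensor M (rho (m ⊗ₜ a))
  coassoc : lam.rTensor A ∘ₗ leg13 A lam ∘ₗ leg23 M H.T₁ = leg23 M H.T₁ ∘ₗ lam.rTensor A
  normal : lam.rTensor A ∘ₗ leg13 A lam ∘ₗ leg23 M H.E₁ = lam.rTensor A ∘ₗ leg13 A lam
  full : Submodule.span k {x | ∃ m a, ∃ ω : A →ₗ[k] k, x = sliceR M ω (lam (m ⊗ₜ a))} = ⊤

namespace ComodStr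

/-- A linear map compatible with the maps `λ` is also compatible with the maps `ρ`. -/
theorem map_rho {H : RegWMB k A} {s : ComodStr H M} {t : ComodStr H M'} {f : M →ₗ[k] M'}
    (hf : f.rTensor A ∘ₗ s.lam = t.lam ∘ₗ f.rTensor A) :
    f.rTensor A ∘ₗ s.rho = t.rho ∘ₗ f.rTensor A := by
  refine TensorProduct.ext' fun m a => ?_
  rw [← sub_eq_zero]
  refine lTensor_jointly_injective (fun b => (LinearMap.mul k A).flip b)
    (fun v => H.wmb.nondeg_left v) _ fun b => ?_
  have h1 (g : A →ₗ[k] A) (z : M ⊗[k] A) :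
      g.lTensor M' (f.rTensor A z) = f.rTensor A (g.lTensor M z) := by
    rw [← LinearMap.comp_apply, ← LinearMap.comp_apply, LinearMap.lTensor_comp_rTensor,
      LinearMap.rTensor_comp_lTensor]
  have h2 := LinearMap.congr_fun hf (m ⊗ₜ b)
  simp only [LinearMap.comp_apply, LinearMap.rTensor_tmul] at h2 ⊢
  rw [map_sub, sub_eq_zero, h1, ← s.compat, ← t.compat, ← h1, h2]

end ComodStr

/-- A full right comodule. -/
structure FullComod (H : RegWMB k A) where
  carrier : Type v
  [grp : AddCommGroup carrier]
  [mod : Module k carrier]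
  str : ComodStr H carrier

namespace FullComod

attribute [instance] FullComod.grp FullComod.mod

/-- A morphism of comodules. -/
@[ext] structure Hom {H : RegWMB k A} (X Y : FullComod H) where
  lin : X.carrier →ₗ[k] Y.carrier
  map_lam : lin.rTensor A ∘ₗ X.str.lam = Y.str.lam ∘ₗ lin.rTensor A

instance (H : RegWMB k A) : Category (FullComod H) where
  Hom := Hom
  id X := ⟨LinearMap.id, by simp⟩
  comp f g := ⟨g.lin ∘ₗ f.lin, by
    rw [LinearMap.rTensor_comp, LinearMap.comp_assoc, f.map_lam, ← LinearMap.comp_assoc,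
      g.map_lam, LinearMap.comp_assoc]⟩

end FullComod

end Comodules

/-! # Yetter-Drinfeld modules -/

section YetterDrinfeld

variable {k : Type u} {A : Type v} [Field k] [NonUnitalRing A] [Module k A]
  [IsScalarTower k A A] [SMulCommClass k A A]

/-- A right-right Yetter-Drinfeld module `X`: an idempotent non-degenerate right module and a full
right comodule subject to compatibility conditions. -/
structure YD (H : RegWMB k A) where
  carrier : Type v
  [grp : AddCommGroup carrier]
  [mod : Module k carrier]
  mstr : ModStr k A carrier
  cstr : ComodStr H carrier
  /-- `ρ((x ⊗ a) Δᵒᵖ(b)) = ρ(x ⊗ a) Δ(b)`, where `(x ⊗ a) Δᵒᵖ(b)` is the flip of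
  `(a ⊗ x) Δ(b)` -/
  rho_Δ : ∀ b x a,
    cstr.rho (TensorProduct.comm k A carrier ((ModStr.regular H).diag H mstr b (a ⊗ₜ x))) =
      mstr.diag H (ModStr.regular H) b (cstr.rho (x ⊗ₜ a))
  /-- `E₂^{X,A} ρ = ρ` -/
  E₂_rho : mstr.E₂ H (ModStr.regular H) ∘ₗ cstr.rho = cstr.rho
  /-- `ρ (E₂^{A,X})²¹ = ρ` -/
  rho_E₂ : cstr.rho ∘ₗ (TensorProduct.comm k A carrier).toLinearMap ∘ₗ
    (ModStr.regular H).E₂ H mstr ∘ₗ (TensorProduct.comm k carrier A).toLinearMap = cstr.rho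

namespace YD

attribute [instance] YD.grp YD.mod

/-- A morphism of Yetter-Drinfeld modules is a morphism of modules and of comodules. -/
@[ext] structure Hom {H : RegWMB k A} (X Y : YD H) where
  lin : X.carrier →ₗ[k] Y.carrier
  map_act : ∀ x a, lin (X.mstr.act x a) = Y.mstr.act (lin x) a
  map_lam : lin.rTensor A ∘ₗ X.cstr.lam = Y.cstr.lam ∘ₗ lin.rTensor A

instance (H : RegWMB k A) : Category (YD H) where
  Hom := Hom
  id X := ⟨LinearMap.id, fun _ _ => rfl, by simp⟩
  comp f g := ⟨g.lin ∘ₗ f.lin, fun a x => by simp [f.map_act, g.map_act], by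
    rw [LinearMap.rTensor_comp, LinearMap.comp_assoc, f.map_lam, ← LinearMap.comp_assoc,
      g.map_lam, LinearMap.comp_assoc]⟩

/-- The forgetful functor to the category of idempotent non-degenerate modules. -/
def toMod (H : RegWMB k A) : YD H ⥤ RMod k A where
  obj X := ⟨X.carrier, X.mstr⟩
  map f := ⟨f.lin, f.map_act⟩

/-- The forgetful functor to the category of full comodules. -/
def toComod (H : RegWMB k A) : YD H ⥤ FullComod H where
  obj X := ⟨X.carrier, X.cstr⟩
  map f := ⟨f.lin, f.map_lam⟩

end YD

/-! # The forgetful functors to bimodules over the base algebra -/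

variable {V W P M N : Type v} [AddCommGroup V] [Module k V] [AddCommGroup W] [Module k W]
  [AddCommGroup P] [Module k P] [AddCommGroup M] [Module k M] [AddCommGroup N] [Module k N]

/-- The firm bimodule structure over the base algebra `R` induced by an `A`-module structure:
`(v · a) ◃ r = v · (a r)` and `⊓ᴿ(b) ▹ (v · a) = v · (a ⊓̄ᴸ(b))`, where
`a ⊓̄ᴸ(b) = (ε ⊗ A) ((b ⊗ a) E)`. -/
structure ModBimod (H : RegWMB k A) (R : NonUnitalSubalgebra k (Multiplier k A))
    (s : ModStr k A V) where
  str : BimodStr k R V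
  firm : str.IsFirm
  r_act : ∀ (r : R) v a, str.r r (s.act v a) = s.act v (Multiplier.right r.1 a)
  l_act : ∀ (r : R) b, H.IsPiR b r.1 → ∀ v a,
    str.l r (s.act v a) = s.act v (sliceL A H.ε (H.E₂ (b ⊗ₜ a)))

/-- The firm bimodule structure over the base algebra `R` induced by an `A`-comodule structure:
`m ◃ ⊓̄ᴿ(a) = (M ⊗ ε) λ(m ⊗ a)` and `⊓ᴿ(a) ▹ m = (M ⊗ ε) ρ(m ⊗ a)`. -/
structure ComodBimod (H : RegWMB k A) (R : NonUnitalSubalgebra k (Multiplier k A))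
    (s : ComodStr H M) where
  str : BimodStr k R M
  firm : str.IsFirm
  r_eq : ∀ (r : R) a, H.IsPiBarR a r.1 → ∀ m, str.r r m = sliceR M H.ε (s.lam (m ⊗ₜ a))
  l_eq : ∀ (r : R) a, H.IsPiR a r.1 → ∀ m, str.l r m = sliceR M H.ε (s.rho (m ⊗ₜ a))

theorem sliceR_rTensor {B : Type v} [AddCommGroup B] [Module k B] (f : M →ₗ[k] N) (ω : B →ₗ[k] k)
    (z : M ⊗[k] B) : f (sliceR M ω z) = sliceR N ω (f.rTensor B z) := by
  induction z using TensorProduct.induction_on with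
  | zero => simp
  | tmul v w => simp [sliceR]
  | add x y hx hy => simp only [map_add, hx, hy]

theorem map_slice {B : Type v} [AddCommGroup B] [Module k B] {f : M →ₗ[k] N}
    {g : M ⊗[k] B →ₗ[k] M ⊗[k] B} {h : N ⊗[k] B →ₗ[k] N ⊗[k] B}
    (hf : f.rTensor B ∘ₗ g = h ∘ₗ f.rTensor B) (ω : B →ₗ[k] k) (m : M) (a : B) :
    f (sliceR M ω (g (m ⊗ₜ a))) = sliceR N ω (h (f m ⊗ₜ a)) := by
  rw [sliceR_rTensor]
  exact congrArg _ (LinearMap.congr_fun hf (m ⊗ₜ a))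

variable {H : RegWMB k A} {R : NonUnitalSubalgebra k (Multiplier k A)}

/-- The functor from `A`-modules to firm `R`-bimodules, acting on the morphisms as the identity
map. -/
def modToBimod (hR : H.IsBaseAlgebra R) (b : ∀ V : RMod k A, ModBimod H R V.str) :
    RMod k A ⥤ FirmBimod k R where
  obj V := ⟨V.carrier, (b V).str, (b V).firm⟩
  map {V W} f :=
    { lin := f.lin
      map_l := fun r => by
        obtain ⟨c, hc⟩ := hR.exists_piR r.1 r.2
        exact f.map_of_act (x := (b V).str.l r) (y := (b W).str.l r)
          ((b V).l_act r c hc) ((b W).l_act r c hc)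
      map_r := fun r => f.map_of_act (x := (b V).str.r r) (y := (b W).str.r r)
        (g := Multiplier.right r.1) ((b V).r_act r) ((b W).r_act r) }

/-- The functor from `A`-comodules to firm `R`-bimodules, acting on the morphisms as the identity
map. -/
def comodToBimod (hR : H.IsBaseAlgebra R) (b : ∀ M : FullComod H, ComodBimod H R M.str) :
    FullComod H ⥤ FirmBimod k R where
  obj M := ⟨M.carrier, (b M).str, (b M).firm⟩
  map {M N} f :=
    { lin := f.lin
      map_l := fun r m => by
        obtain ⟨a, ha⟩ := hR.exists_piR r.1 r.2
        rw [(b M).l_eq r a ha, (b N).l_eq r a ha, map_slice (ComodStr.map_rho f.map_lam)]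
      map_r := fun r m => by
        obtain ⟨a, ha⟩ := hR.exists_piBarR r.1 r.2
        rw [(b M).r_eq r a ha, (b N).r_eq r a ha, map_slice f.map_lam] }

/-- A monoidal functor is strict if its structure morphisms `𝟙 ⟶ F 𝟙` and `F X ⊗ F Y ⟶ F (X ⊗ Y)`
are identity morphisms (in particular, their source and target are equal). -/
def IsStrictMonoidal {C D : Type*} [Category* C] [Category* D] [MonoidalCategory C]
    [MonoidalCategory D] (F : C ⥤ D) [F.Monoidal] : Prop :=
  (∃ h, Functor.LaxMonoidal.ε F = eqToHom h) ∧
    ∀ X Y, ∃ h, Functor.LaxMonoidal.μ F X Y = eqToHom h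

/-- Via the epimorphism `q : V ⊗ W → P`, the action on `P` is induced by the diagonal action. -/
def IsDiagonalMod (H : RegWMB k A) (s : ModStr k A V) (t : ModStr k A W) (p : ModStr k A P)
    (q : V ⊗[k] W →ₗ[k] P) : Prop :=
  ∀ z c, p.act (q z) c = q (s.diag H t c z)

/-- Via the epimorphism `q : M ⊗ N → P`, the comodule structure of `P` is induced by
`λ_M^{13} (M ⊗ λ_N)` and `(M ⊗ ρ_N) ρ_M^{13}`. -/
def IsDiagonalComod (H : RegWMB k A) (s : ComodStr H M) (t : ComodStr H N) (p : ComodStr H P)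
    (q : M ⊗[k] N →ₗ[k] P) : Prop :=
  p.lam ∘ₗ q.rTensor A = q.rTensor A ∘ₗ leg13 N s.lam ∘ₗ leg23 M t.lam ∧
    p.rho ∘ₗ q.rTensor A = q.rTensor A ∘ₗ leg23 M t.rho ∘ₗ leg13 N s.rho

/-- Via the isomorphism `e : R → P`, the action on `P` is `⊓ᴿ(b) · c = ⊓ᴿ(b c)`. -/
def IsUnitMod (H : RegWMB k A) {R : NonUnitalSubalgebra k (Multiplier k A)}
    (p : ModStr k A P) (e : R →ₗ[k] P) : Prop :=
  ∀ (r r' : R) b c, H.IsPiR b r.1 → H.IsPiR (b * c) r'.1 → p.act (e r) c = e r'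

/-- Via the isomorphism `e : R → P`, the comodule structure of `P` is given by
`λ(r ⊗ a) = E (1 ⊗ r a)` and `ρ(r ⊗ a) = (1 ⊗ a r) E`, regarded as elements of `R ⊗ A`: an element
`x` of `R ⊗ A` is `E (1 ⊗ r a)` if `x (b ⊗ 1) = E (b ⊗ r a)` for all `b`, and it is
`(1 ⊗ a r) E` if `(b ⊗ 1) x = (b ⊗ a r) E` for all `b`. -/
def IsUnitComod (H : RegWMB k A) {R : NonUnitalSubalgebra k (Multiplier k A)}
    (p : ComodStr H P) (e : R →ₗ[k] P) : Prop :=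
  ∀ (r : R) a,
    (∃ x : R ⊗[k] A, (∀ b, ((Multiplier.left.flip b).domRestrict R.toSubmodule).rTensor A x = H.E₁ (b ⊗ₜ Multiplier.left r.1 a)) ∧
      p.lam (e r ⊗ₜ a) = e.rTensor A x) ∧
    (∃ x : R ⊗[k] A, (∀ b, ((Multiplier.right.flip b).domRestrict R.toSubmodule).rTensor A x = H.E₂ (b ⊗ₜ Multiplier.right r.1 a)) ∧
      p.rho (e r ⊗ₜ a) = e.rTensor A x)

end YetterDrinfeld

end

/-!
Comments use the notation `Δ(a) = a₁ ⊗ a₂`, so that `T₁(a ⊗ b) = a₁ ⊗ a₂ b`,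
`T₂(a ⊗ b) = a b₁ ⊗ b₂`, `T₃(a ⊗ b) = a₁ ⊗ b a₂` and `T₄(a ⊗ b) = b₁ a ⊗ b₂`, and sums over
tensors are suppressed. Elements of a tensor product are compared after applying functionals to one
factor (`sliceL_injective`, `sliceR_injective`) or after multiplying by elements of `A`, which is
possible because `A` is non-degenerate. The axioms are symmetric under passage to the opposite
algebra: `RegWMB.opp` and `ComodStr.opp` keep the underlying type and replace the product, so each
rule for `T₁`, `λ` and right multiplications gives its mirror image for `T₃`, `ρ` and left ones.

The base algebra `R` is the range of `⊓ᴿ`, that is, the first leg of `E`. Right fullness makes it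
equal to the range of `⊓̄ᴿ` (`piBarR_mem`, `exists_piBarR`). Its elements satisfy
`Δ(r a) = (1 ⊗ r) Δ(a)` and `Δ(a r) = Δ(a) (1 ⊗ r)` (`base_isBase`). The algebra `R` has left and
right local units (`exists_left_unit`, `exists_right_unit`), and over such an algebra every
idempotent bimodule is firm (`isFirm_of_local_units`); this gives firmness of `R`, of all modules
and of all comodules.

The left action of `R` on modules is given by the antimultiplicative map `τ : R → M(A)` sending
`⊓ᴿ(b)` to `⊓̄ᴸ(b)`; it exists because both multipliers are determined by the functional `ε(b -)`.
Since `(a r ⊗ b) E = (a ⊗ b τ(r)) E` and `E₂` induces the identity on `V ⊗_R W`, the idempotent `E₂`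
on `V ⊗ W` factors through a section `balE₂` of the projection onto `V ⊗_R W`. Hence `V ⊗_R W` is
the range of `E₂`, on which the diagonal action is idempotent and non-degenerate.

For comodules, `E (1 ⊗ a)` and `(1 ⊗ a) E` are viewed as elements `Om` and `Om'` of `R ⊗ A`. One has
`λ(m ◃ r ⊗ a) = λ(m ⊗ r a)` and `λ(r ▹ m ⊗ a) = (1 ⊗ r) λ(m ⊗ a)`, so `λ₁₃ λ₂₃` is compatible with
the defining relations of `M ⊗_R N` (`diagLam_balanced`), and similarly for `ρ`.

On a Yetter-Drinfeld module the two `R`-bimodule structures coincide (`YD.bimod_eq`). Conversely,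
if they coincide then the two conditions involving `E₂` hold (`E₂_rho_of_bimod`,
`rho_E₂_of_bimod`), so for products only the compatibility of `ρ` with `Δ` and `Δᵒᵖ` needs a
computation (`IsYD.tensor`).

In each of the three categories the `R`-bimodule underlying the chosen product is the product of
bimodules, and the structure morphisms of firm `R`-bimodules between these objects are morphisms of
the category. The forgetful functors to bimodules are faithful and reflect isomorphisms, so the
monoidal structure of firm bimodules lifts along them, and all coherence equations can be checked
after applying them (`StrictLift.monoidal`, `StrictLift.exists_isStrictMonoidal`).
-/

noncomputable section
open Multiplier

/-! ### Slices of tensors -/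

section Slices

variable {k : Type u} {A B V W V' W' : Type v} [Field k] [AddCommGroup A] [Module k A]
  [AddCommGroup B] [Module k B] [AddCommGroup V] [Module k V] [AddCommGroup W] [Module k W]
  [AddCommGroup V'] [Module k V'] [AddCommGroup W'] [Module k W']

@[simp] theorem sliceL_tmul (f : A →ₗ[k] k) (a : A) (v : V) :
    sliceL V f (a ⊗ₜ v) = f a • v := by simp [sliceL]

@[simp] theorem sliceR_tmul (f : A →ₗ[k] k) (a : A) (v : V) :
    sliceR V f (v ⊗ₜ a) = f a • v := by simp [sliceR]

theorem sliceL_rTensor (f : B →ₗ[k] k) (g : A →ₗ[k] B) (z : A ⊗[k] V) :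
    sliceL V f (g.rTensor V z) = sliceL V (f ∘ₗ g) z :=
  LinearMap.congr_fun (f := sliceL V f ∘ₗ g.rTensor V) (TensorProduct.ext' (by simp)) z

theorem sliceL_lTensor (f : A →ₗ[k] k) (g : V →ₗ[k] W) (z : A ⊗[k] V) :
    sliceL W f (g.lTensor A z) = g (sliceL V f z) :=
  LinearMap.congr_fun (f := sliceL W f ∘ₗ g.lTensor A) (g := g ∘ₗ sliceL V f)
    (TensorProduct.ext' (by simp)) z

theorem sliceR_lTensor (f : B →ₗ[k] k) (g : A →ₗ[k] B) (z : V ⊗[k] A) :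
    sliceR V f (g.lTensor V z) = sliceR V (f ∘ₗ g) z :=
  LinearMap.congr_fun (f := sliceR V f ∘ₗ g.lTensor V) (TensorProduct.ext' (by simp)) z

theorem sliceR_rTensor' (f : A →ₗ[k] k) (g : V →ₗ[k] W) (z : V ⊗[k] A) :
    sliceR W f (g.rTensor A z) = g (sliceR V f z) :=
  LinearMap.congr_fun (f := sliceR W f ∘ₗ g.rTensor A) (g := g ∘ₗ sliceR V f)
    (TensorProduct.ext' (by simp)) z

theorem slice_slice (f : A →ₗ[k] k) (g : B →ₗ[k] k) (z : A ⊗[k] B) :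
    g (sliceL B f z) = f (sliceR A g z) :=
  LinearMap.congr_fun (f := g ∘ₗ sliceL B f) (g := f ∘ₗ sliceR A g)
    (TensorProduct.ext' (by simp [mul_comm])) z

theorem rTensor_lTensor (f : V →ₗ[k] V') (g : W →ₗ[k] W') (z : V ⊗[k] W) :
    f.rTensor W' (g.lTensor V z) = g.lTensor V' (f.rTensor W z) :=
  LinearMap.congr_fun (f := f.rTensor W' ∘ₗ g.lTensor V) (g := g.lTensor V' ∘ₗ f.rTensor W)
    (TensorProduct.ext' (by simp)) z

theorem dual_separates (v : V) (h : ∀ ω : V →ₗ[k] k, ω v = 0) : v = 0 :=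
  (Module.forall_dual_apply_eq_zero_iff k v).1 h

theorem sliceL_injective {z z' : A ⊗[k] V} (h : ∀ ω : A →ₗ[k] k, sliceL V ω z = sliceL V ω z') :
    z = z' := by
  rw [← sub_eq_zero]
  obtain ⟨y, hy⟩ : ∃ y, y = z - z' := ⟨_, rfl⟩
  rw [← hy]
  have h' (ω : A →ₗ[k] k) : sliceL V ω y = 0 := by rw [hy, map_sub, h, sub_self]
  classical
  let b := Module.Basis.ofVectorSpace k A
  apply (TensorProduct.equivFinsuppOfBasisLeft b).injective
  rw [map_zero]
  ext i
  have key (y : A ⊗[k] V) : TensorProduct.equivFinsuppOfBasisLeft b y i = sliceL V (b.coord i) y := by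
    induction y using TensorProduct.induction_on with
    | zero => simp
    | tmul v w => simp
    | add x y hx hy => simp only [map_add, Finsupp.add_apply, hx, hy]
  rw [key, h', Finsupp.zero_apply]

theorem sliceR_injective {z z' : V ⊗[k] A} (h : ∀ ω : A →ₗ[k] k, sliceR V ω z = sliceR V ω z') :
    z = z' := by
  apply (TensorProduct.comm k V A).injective
  refine sliceL_injective fun ω => ?_
  have key (y : V ⊗[k] A) : sliceL V ω (TensorProduct.comm k V A y) = sliceR V ω y :=
    LinearMap.congr_fun (f := sliceL V ω ∘ₗ (TensorProduct.comm k V A).toLinearMap)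
      (TensorProduct.ext' (by simp)) y
  rw [key, key, h]

/-- Linear maps which jointly separate the elements of `V` also separate those of `V ⊗ W`. -/
theorem eq_of_rTensor {ι : Type*} (f : ι → V →ₗ[k] V') (hf : ∀ v, (∀ i, f i v = 0) → v = 0)
    {x y : V ⊗[k] W} (h : ∀ i, (f i).rTensor W x = (f i).rTensor W y) : x = y := by
  refine sliceR_injective fun ω => sub_eq_zero.1 (hf _ fun i => ?_)
  rw [map_sub, ← sliceR_rTensor', ← sliceR_rTensor', h, sub_self]

/-- Linear maps which jointly separate the elements of `V` also separate those of `W ⊗ V`. -/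
theorem eq_of_lTensor {ι : Type*} (f : ι → V →ₗ[k] V') (hf : ∀ v, (∀ i, f i v = 0) → v = 0)
    {x y : W ⊗[k] V} (h : ∀ i, (f i).lTensor W x = (f i).lTensor W y) : x = y := by
  refine sliceL_injective fun ω => sub_eq_zero.1 (hf _ fun i => ?_)
  rw [map_sub, ← sliceL_lTensor, ← sliceL_lTensor, h, sub_self]

end Slices

/-! ### The opposite weak multiplier bialgebra -/

/-- The opposite product, on the same type: a mirrored statement about a weak multiplier bialgebra
is the statement itself for `RegWMB.opp`, up to unfolding. -/
abbrev opRing (A : Type v) [inst : NonUnitalRing A] : NonUnitalRing A :=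
  { inst.toAddCommGroup with
    mul := fun a b => b * a
    left_distrib := fun a b c => add_mul (R := A) b c a
    right_distrib := fun a b c => mul_add (R := A) c a b
    zero_mul := fun a => mul_zero (M₀ := A) a
    mul_zero := fun a => zero_mul (M₀ := A) a
    mul_assoc := fun a b c => (mul_assoc (G := A) c b a).symm }

section Opposite

variable {k : Type u} {A : Type v} [Field k] [NonUnitalRing A] [Module k A]

theorem opTower [SMulCommClass k A A] :
    @IsScalarTower k A A _ (@instSMulOfMul A (opRing A).toMul) _ := by
  have h (c : k) (a b : A) : b * c • a = c • (b * a) := mul_smul_comm c b a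
  let _ := opRing A
  exact ⟨h⟩

theorem opComm [IsScalarTower k A A] :
    @SMulCommClass k A A _ (@instSMulOfMul A (opRing A).toMul) := by
  have h (c : k) (a b : A) : c • (b * a) = (c • b) * a := (smul_mul_assoc c b a).symm
  let _ := opRing A
  exact ⟨h⟩

variable [IsScalarTower k A A] [SMulCommClass k A A]

/-- The same `E`, `Δ`, `ε` on the opposite algebra. -/
abbrev RegWMB.opp (H : RegWMB k A) : @RegWMB k A _ (opRing A) _ opTower opComm :=
  @RegWMB.mk k A _ (opRing A) _ opTower opComm H.E₂ H.E₁ H.T₃ H.T₄ H.T₁ H.T₂ H.ε H.op H.wmb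
    H.T₄_spec.symm H.T₃_spec.symm

end Opposite

/-- Multiplication by `a` on the left. -/
abbrev lm (k : Type u) {A : Type v} [Field k] [NonUnitalRing A] [Module k A]
    [IsScalarTower k A A] [SMulCommClass k A A] (a : A) : A →ₗ[k] A := LinearMap.mul k A a

/-- Multiplication by `a` on the right. -/
abbrev rm (k : Type u) {A : Type v} [Field k] [NonUnitalRing A] [Module k A]
    [IsScalarTower k A A] [SMulCommClass k A A] (a : A) : A →ₗ[k] A := (LinearMap.mul k A).flip a

/-! ### First consequences of the axioms -/

namespace RegWMB

variable {k : Type u} {A V W : Type v} {_ : Field k} {iA : NonUnitalRing A} {_ : Module k A}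
  {i1 : IsScalarTower k A A} {i2 : SMulCommClass k A A} [AddCommGroup V] [Module k V]
  [AddCommGroup W] [Module k W]

theorem eq_zero_of_mul_right (H : RegWMB k A) {a : A} (h : ∀ b, a * b = 0) : a = 0 :=
  H.wmb.nondeg_left a h

theorem eq_zero_of_mul_left (H : RegWMB k A) {a : A} (h : ∀ b, b * a = 0) : a = 0 :=
  H.wmb.nondeg_right a h

theorem eq_of_mul_right (H : RegWMB k A) {a a' : A} (h : ∀ b, a * b = a' * b) : a = a' :=
  sub_eq_zero.1 (H.eq_zero_of_mul_right fun b => by rw [sub_mul, h, sub_self])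

theorem eq_of_mul_left (H : RegWMB k A) {a a' : A} (h : ∀ b, b * a = b * a') : a = a' :=
  sub_eq_zero.1 (H.eq_zero_of_mul_left fun b => by rw [mul_sub, h, sub_self])

/-- To prove a linear statement about the elements of `A` it is enough to consider products. -/
theorem ext_mul {X : Type*} [AddCommGroup X] [Module k X] (H : RegWMB k A)
    {f g : A →ₗ[k] X} (h : ∀ a b, f (a * b) = g (a * b)) : f = g :=
  LinearMap.ext_on H.wmb.idempotent (by rintro _ ⟨a, b, rfl⟩; exact h a b)

theorem eq_of_rTensor_lm (H : RegWMB k A) {x y : A ⊗[k] V}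
    (h : ∀ a, (lm k a).rTensor V x = (lm k a).rTensor V y) : x = y :=
  eq_of_rTensor (fun a => lm k a) (fun _ hv => H.eq_zero_of_mul_left hv) h

theorem eq_of_rTensor_rm (H : RegWMB k A) {x y : A ⊗[k] V}
    (h : ∀ a, (rm k a).rTensor V x = (rm k a).rTensor V y) : x = y :=
  eq_of_rTensor (fun a => rm k a) (fun _ hv => H.eq_zero_of_mul_right hv) h

theorem eq_of_lTensor_lm (H : RegWMB k A) {x y : V ⊗[k] A}
    (h : ∀ a, (lm k a).lTensor V x = (lm k a).lTensor V y) : x = y :=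
  eq_of_lTensor (fun a => lm k a) (fun _ hv => H.eq_zero_of_mul_left hv) h

theorem eq_of_lTensor_rm (H : RegWMB k A) {x y : V ⊗[k] A}
    (h : ∀ a, (rm k a).lTensor V x = (rm k a).lTensor V y) : x = y :=
  eq_of_lTensor (fun a => rm k a) (fun _ hv => H.eq_zero_of_mul_right hv) h

theorem lm_mul (a b : A) : lm k (a * b) = lm k a ∘ₗ lm k b := by ext; simp [mul_assoc]
theorem rm_mul (a b : A) : rm k (a * b) = rm k b ∘ₗ rm k a := by ext; simp [mul_assoc]
theorem lm_rm (a b : A) : lm k a ∘ₗ rm k b = rm k b ∘ₗ lm k a := by ext; simp [mul_assoc]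

theorem map₂_tmul_left (a b : A) (z : A ⊗[k] A) :
    TensorProduct.map₂ (LinearMap.mul k A) (LinearMap.mul k A) (a ⊗ₜ b) z =
      (lm k a).rTensor A ((lm k b).lTensor A z) := by
  refine LinearMap.congr_fun (g := (lm k a).rTensor A ∘ₗ (lm k b).lTensor A)
    (TensorProduct.ext' fun c d => ?_) z
  simp

theorem map₂_tmul_right (c d : A) (z : A ⊗[k] A) :
    TensorProduct.map₂ (LinearMap.mul k A) (LinearMap.mul k A) z (c ⊗ₜ d) =
      (rm k c).rTensor A ((rm k d).lTensor A z) := by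
  refine LinearMap.congr_fun
    (f := (TensorProduct.map₂ (LinearMap.mul k A) (LinearMap.mul k A)).flip (c ⊗ₜ d))
    (g := (rm k c).rTensor A ∘ₗ (rm k d).lTensor A) (TensorProduct.ext' fun c d => ?_) z
  simp

/-- `(a ⊗ b) (E (c ⊗ d)) = ((a ⊗ b) E) (c ⊗ d)` -/
theorem E_mult (H : RegWMB k A) (a b c d : A) :
    (lm k a).rTensor A ((lm k b).lTensor A (H.E₁ (c ⊗ₜ d))) =
      (rm k c).rTensor A ((rm k d).lTensor A (H.E₂ (a ⊗ₜ b))) := by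
  rw [← map₂_tmul_left, ← map₂_tmul_right, H.wmb.E_mult]

theorem eq_of_mul_tensor_left (H : RegWMB k A) {x y : A ⊗[k] A}
    (h : ∀ a b, (lm k a).rTensor A ((lm k b).lTensor A x) =
      (lm k a).rTensor A ((lm k b).lTensor A y)) : x = y :=
  H.eq_of_lTensor_lm fun b => H.eq_of_rTensor_lm fun a => h a b

theorem lm_rm_rTensor (a b : A) (z : A ⊗[k] V) :
    (lm k a).rTensor V ((rm k b).rTensor V z) = (rm k b).rTensor V ((lm k a).rTensor V z) := by
  rw [← LinearMap.rTensor_comp_apply, ← LinearMap.rTensor_comp_apply, lm_rm]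

theorem lm_rm_lTensor (a b : A) (z : V ⊗[k] A) :
    (lm k a).lTensor V ((rm k b).lTensor V z) = (rm k b).lTensor V ((lm k a).lTensor V z) := by
  rw [← LinearMap.lTensor_comp_apply, ← LinearMap.lTensor_comp_apply, lm_rm]

theorem E₁_rm_left (H : RegWMB k A) (e : A) (z : A ⊗[k] A) :
    H.E₁ ((rm k e).rTensor A z) = (rm k e).rTensor A (H.E₁ z) := by
  refine LinearMap.congr_fun (f := H.E₁ ∘ₗ (rm k e).rTensor A)
    (g := (rm k e).rTensor A ∘ₗ H.E₁) (TensorProduct.ext' fun c d => ?_) z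
  refine H.eq_of_mul_tensor_left fun a b => ?_
  simp only [LinearMap.comp_apply, LinearMap.rTensor_tmul]
  rw [← rTensor_lTensor, lm_rm_rTensor, E_mult, E_mult]
  simp only [LinearMap.flip_apply, LinearMap.mul_apply', rm_mul, LinearMap.rTensor_comp_apply]

theorem E₁_rm_right (H : RegWMB k A) (e : A) (z : A ⊗[k] A) :
    H.E₁ ((rm k e).lTensor A z) = (rm k e).lTensor A (H.E₁ z) := by
  refine LinearMap.congr_fun (f := H.E₁ ∘ₗ (rm k e).lTensor A)
    (g := (rm k e).lTensor A ∘ₗ H.E₁) (TensorProduct.ext' fun c d => ?_) z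
  refine H.eq_of_mul_tensor_left fun a b => ?_
  simp only [LinearMap.comp_apply, LinearMap.lTensor_tmul]
  rw [lm_rm_lTensor, rTensor_lTensor (lm k a) (rm k e), E_mult, E_mult]
  simp only [LinearMap.flip_apply, LinearMap.mul_apply', rm_mul, LinearMap.lTensor_comp_apply,
    rTensor_lTensor]

theorem E₂_lm_left (H : RegWMB k A) (e : A) (z : A ⊗[k] A) :
    H.E₂ ((lm k e).rTensor A z) = (lm k e).rTensor A (H.E₂ z) := E₁_rm_left H.opp e z

theorem E₂_lm_right (H : RegWMB k A) (e : A) (z : A ⊗[k] A) :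
    H.E₂ ((lm k e).lTensor A z) = (lm k e).lTensor A (H.E₂ z) := E₁_rm_right H.opp e z

theorem ΔL_tmul (H : RegWMB k A) (a b c : A) :
    H.ΔL a (b ⊗ₜ c) = (rm k b).rTensor A (H.T₁ (a ⊗ₜ c)) := rfl

theorem ΔR_tmul (H : RegWMB k A) (a b c : A) :
    H.ΔR a (b ⊗ₜ c) = (lm k c).lTensor A (H.T₂ (b ⊗ₜ a)) := rfl

theorem ΔL_tmul' (H : RegWMB k A) (a b c : A) :
    H.ΔL a (b ⊗ₜ c) = (rm k c).lTensor A (H.T₄ (b ⊗ₜ a)) := by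
  rw [ΔL, ← H.T₄_spec]; rfl

theorem ΔR_tmul' (H : RegWMB k A) (a b c : A) :
    H.ΔR a (b ⊗ₜ c) = (lm k b).rTensor A (H.T₃ (a ⊗ₜ c)) := by
  rw [ΔR, ← H.T₃_spec]; rfl

theorem lm_T₁ (H : RegWMB k A) (a b c : A) :
    (lm k a).rTensor A (H.T₁ (b ⊗ₜ c)) = (rm k c).lTensor A (H.T₂ (a ⊗ₜ b)) :=
  (H.wmb.Δ_mult a b c).symm

theorem T₁_rm (H : RegWMB k A) (a b c : A) :
    H.T₁ (a ⊗ₜ (b * c)) = (rm k c).lTensor A (H.T₁ (a ⊗ₜ b)) := by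
  refine H.eq_of_rTensor_lm fun x => ?_
  rw [lm_T₁, rTensor_lTensor, lm_T₁, rm_mul, LinearMap.lTensor_comp_apply]

theorem rm_T₁ (H : RegWMB k A) (a b c : A) :
    (rm k c).rTensor A (H.T₁ (a ⊗ₜ b)) = (rm k b).lTensor A (H.T₄ (c ⊗ₜ a)) := by
  rw [← ΔL_tmul, ΔL_tmul']

theorem rm_T₃ (H : RegWMB k A) (a b c : A) :
    (lm k c).rTensor A (H.T₃ (a ⊗ₜ b)) = (lm k b).lTensor A (H.T₂ (c ⊗ₜ a)) := rm_T₁ H.opp a b c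

theorem lm_T₁' (H : RegWMB k A) (a b c : A) :
    (lm k c).lTensor A (H.T₁ (a ⊗ₜ b)) = (rm k b).lTensor A (H.T₃ (a ⊗ₜ c)) := by
  refine H.eq_of_rTensor_lm fun x => ?_
  rw [rTensor_lTensor, lm_T₁, rTensor_lTensor, rm_T₃, lm_rm_lTensor]

theorem lm_T₄ (H : RegWMB k A) (a b c : A) :
    (lm k c).lTensor A (H.T₄ (a ⊗ₜ b)) = (rm k a).rTensor A (H.T₃ (b ⊗ₜ c)) := 
  (H.op.Δ_mult a b c)

theorem T₂_lm (H : RegWMB k A) (a b c : A) :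
    H.T₂ ((a * b) ⊗ₜ c) = (lm k a).rTensor A (H.T₂ (b ⊗ₜ c)) := by
  refine H.eq_of_lTensor_rm fun x => ?_
  rw [← lm_T₁, lm_mul, LinearMap.rTensor_comp_apply, lm_T₁, rTensor_lTensor]

theorem T₃_lm (H : RegWMB k A) (a b c : A) :
    H.T₃ (a ⊗ₜ (b * c)) = (lm k b).lTensor A (H.T₃ (a ⊗ₜ c)) := T₁_rm H.opp a c b

theorem counit_T₁ (H : RegWMB k A) (a b : A) : sliceL A H.ε (H.T₁ (a ⊗ₜ b)) = a * b :=
  H.wmb.counit_left a b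
theorem counit_T₂ (H : RegWMB k A) (a b : A) : sliceR A H.ε (H.T₂ (a ⊗ₜ b)) = a * b :=
  H.wmb.counit_right a b
theorem counit_T₃ (H : RegWMB k A) (a b : A) : sliceL A H.ε (H.T₃ (a ⊗ₜ b)) = b * a :=
  H.op.counit_left a b
theorem counit_T₄ (H : RegWMB k A) (a b : A) : sliceR A H.ε (H.T₄ (a ⊗ₜ b)) = b * a :=
  H.op.counit_right a b

theorem E₁_ΔL (H : RegWMB k A) (a : A) (x : A ⊗[k] A) : H.E₁ (H.ΔL a x) = H.ΔL a x := by
  have : H.ΔL a x ∈ LinearMap.range H.E₁ := by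
    rw [← H.wmb.span_left]; exact Submodule.subset_span ⟨a, x, rfl⟩
  obtain ⟨y, hy⟩ := this
  rw [← hy]
  exact LinearMap.congr_fun H.wmb.E₁_idem y

theorem E₂_ΔR (H : RegWMB k A) (a : A) (x : A ⊗[k] A) : H.E₂ (H.ΔR a x) = H.ΔR a x := by
  rw [ΔR, ← H.T₃_spec]
  exact E₁_ΔL H.opp a x

theorem E₁_T₁ (H : RegWMB k A) (z : A ⊗[k] A) : H.E₁ (H.T₁ z) = H.T₁ z := by
  refine LinearMap.congr_fun (f := H.E₁ ∘ₗ H.T₁) (TensorProduct.ext' fun a b => ?_) z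
  refine H.eq_of_rTensor_rm fun c => ?_
  rw [LinearMap.comp_apply, ← E₁_rm_left, ← ΔL_tmul, E₁_ΔL]

theorem E₁_T₄ (H : RegWMB k A) (z : A ⊗[k] A) : H.E₁ (H.T₄ z) = H.T₄ z := by
  refine LinearMap.congr_fun (f := H.E₁ ∘ₗ H.T₄) (TensorProduct.ext' fun a b => ?_) z
  refine H.eq_of_lTensor_rm fun c => ?_
  rw [LinearMap.comp_apply, ← E₁_rm_right, ← ΔL_tmul', E₁_ΔL]

theorem E₂_T₃ (H : RegWMB k A) (z : A ⊗[k] A) : H.E₂ (H.T₃ z) = H.T₃ z := E₁_T₁ H.opp z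
theorem E₂_T₂ (H : RegWMB k A) (z : A ⊗[k] A) : H.E₂ (H.T₂ z) = H.T₂ z := E₁_T₄ H.opp z

theorem ΔL_E₁ (H : RegWMB k A) (a : A) (x : A ⊗[k] A) : H.ΔL a (H.E₁ x) = H.ΔL a x := by
  refine H.eq_of_mul_tensor_left fun c d => ?_
  rw [← map₂_tmul_left, ← map₂_tmul_left, H.Δ_compat, H.wmb.E_mult, E₂_ΔR, H.Δ_compat]

/-- Every element of the range of `E` is a combination of elements `Δ(a) x`. -/
theorem E₁_induction (H : RegWMB k A) {f g : A ⊗[k] A →ₗ[k] V}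
    (h : ∀ a x, f (H.ΔL a x) = g (H.ΔL a x)) (x : A ⊗[k] A) : f (H.E₁ x) = g (H.E₁ x) := by
  have hx : H.E₁ x ∈ Submodule.span k {y | ∃ a x, y = H.ΔL a x} := by
    rw [H.wmb.span_left]; exact ⟨x, rfl⟩
  generalize H.E₁ x = y at hx
  induction hx using Submodule.span_induction with
  | mem y hy => obtain ⟨a, x, rfl⟩ := hy; exact h a x
  | zero => simp
  | add x y _ _ hx hy => rw [map_add, map_add, hx, hy]
  | smul c x _ hx => rw [map_smul, map_smul, hx]

end RegWMB

/-! ### Slices of maps acting on two of three factors -/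

section Legs

variable {k : Type u} {A B M V W X Y Z : Type v} [Field k] [AddCommGroup A] [Module k A]
  [AddCommGroup M] [Module k M] [AddCommGroup V] [Module k V] [AddCommGroup W] [Module k W]
  [AddCommGroup X] [Module k X] [AddCommGroup Y] [Module k Y] [AddCommGroup Z] [Module k Z]

theorem leg23_tmul (f : V ⊗[k] W →ₗ[k] X ⊗[k] Y) (m : M) (v : V) (w : W) :
    leg23 M f ((m ⊗ₜ v) ⊗ₜ w) = (TensorProduct.mk k M X m).rTensor Y (f (v ⊗ₜ w)) := by
  simp only [leg23, LinearMap.comp_apply, LinearEquiv.coe_coe, TensorProduct.assoc_tmul,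
    LinearMap.lTensor_tmul]
  refine LinearMap.congr_fun (f := (TensorProduct.assoc k M X Y).symm.toLinearMap ∘ₗ
    TensorProduct.mk k M (X ⊗[k] Y) m) (TensorProduct.ext' fun _ _ => ?_) _
  simp

theorem leg13_tmul (f : V ⊗[k] W →ₗ[k] X ⊗[k] Y) (m : M) (v : V) (w : W) :
    leg13 M f ((v ⊗ₜ m) ⊗ₜ w) = ((TensorProduct.mk k X M).flip m).rTensor Y (f (v ⊗ₜ w)) := by
  simp only [leg13, LinearMap.comp_apply, LinearEquiv.coe_coe, TensorProduct.rightComm_tmul,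
    LinearMap.rTensor_tmul]
  refine LinearMap.congr_fun (f := (TensorProduct.rightComm k X Y M).toLinearMap ∘ₗ
    (TensorProduct.mk k (X ⊗[k] Y) M).flip m) (TensorProduct.ext' fun _ _ => ?_) _
  simp

theorem sliceL_leg23 (f : V ⊗[k] W →ₗ[k] X ⊗[k] Y) (ω : M →ₗ[k] k) (z : (M ⊗[k] V) ⊗[k] W) :
    (sliceL X ω).rTensor Y (leg23 M f z) = f ((sliceL V ω).rTensor W z) := by
  refine LinearMap.congr_fun (f := (sliceL X ω).rTensor Y ∘ₗ leg23 M f)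
    (g := f ∘ₗ (sliceL V ω).rTensor W) (TensorProduct.ext_threefold fun m v w => ?_) z
  simp only [LinearMap.comp_apply, leg23_tmul, LinearMap.rTensor_tmul, sliceL_tmul]
  rw [← LinearMap.rTensor_comp_apply, ← TensorProduct.smul_tmul', map_smul]
  refine LinearMap.congr_fun (f := (sliceL X ω ∘ₗ TensorProduct.mk k M X m).rTensor Y)
    (g := ω m • LinearMap.id) (TensorProduct.ext' fun _ _ => ?_) _
  simp [TensorProduct.smul_tmul']

theorem sliceR_leg23 (f : V ⊗[k] W →ₗ[k] X ⊗[k] Y) (ω : Y →ₗ[k] k) (z : M ⊗[k] V) (w : W) :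
    sliceR (M ⊗[k] X) ω (leg23 M f (z ⊗ₜ w)) =
      (sliceR X ω ∘ₗ (TensorProduct.curry f).flip w).lTensor M z := by
  refine LinearMap.congr_fun (f := sliceR (M ⊗[k] X) ω ∘ₗ leg23 M f ∘ₗ
    (TensorProduct.mk k _ W).flip w) (TensorProduct.ext' fun m v => ?_) z
  simp [leg23_tmul, sliceR_rTensor']

theorem sliceM_leg23 (f : V ⊗[k] W →ₗ[k] X ⊗[k] Y) (ω : X →ₗ[k] k) (z : M ⊗[k] V) (w : W) :
    (sliceR M ω).rTensor Y (leg23 M f (z ⊗ₜ w)) =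
      (sliceL Y ω ∘ₗ (TensorProduct.curry f).flip w).lTensor M z := by
  refine LinearMap.congr_fun (f := (sliceR M ω).rTensor Y ∘ₗ leg23 M f ∘ₗ
    (TensorProduct.mk k _ W).flip w) (TensorProduct.ext' fun m v => ?_) z
  simp only [LinearMap.comp_apply, LinearMap.flip_apply, TensorProduct.mk_apply, leg23_tmul,
    LinearMap.lTensor_tmul, TensorProduct.curry_apply]
  refine LinearMap.congr_fun (f := (sliceR M ω).rTensor Y ∘ₗ (TensorProduct.mk k M X m).rTensor Y)
    (g := TensorProduct.mk k M Y m ∘ₗ sliceL Y ω) (TensorProduct.ext' fun _ _ => ?_) _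
  simp [TensorProduct.smul_tmul]

theorem rTensor_curry (f : V ⊗[k] W →ₗ[k] X) (v : V) (z : W ⊗[k] Y) :
    f.rTensor Y ((TensorProduct.mk k V W v).rTensor Y z) = (TensorProduct.curry f v).rTensor Y z := by
  rw [← LinearMap.rTensor_comp_apply]; rfl

end Legs

namespace RegWMB

variable {k : Type u} {A V W : Type v} {_ : Field k} {iA : NonUnitalRing A} {_ : Module k A}
  {i1 : IsScalarTower k A A} {i2 : SMulCommClass k A A} [AddCommGroup V] [Module k V]
  [AddCommGroup W] [Module k W]

/-! ### Coassociativity in terms of slices -/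

/-- For `U(b) = (ω ⊗ A)((a ⊗ 1) Δ(b))`, one has `Δ(U(b)) (1 ⊗ c) = (U ⊗ A)(Δ(b) (1 ⊗ c))`. -/
theorem T₁_sliceT₂ (H : RegWMB k A) (ω : A →ₗ[k] k) (a b c : A) :
    H.T₁ (sliceL A ω (H.T₂ (a ⊗ₜ b)) ⊗ₜ c) =
      (sliceL A ω ∘ₗ TensorProduct.curry H.T₂ a).rTensor A (H.T₁ (b ⊗ₜ c)) := by
  have h := LinearMap.congr_fun H.wmb.coassoc ((a ⊗ₜ b) ⊗ₜ c)
  have h := congrArg ((sliceL A ω).rTensor A) h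
  simp only [LinearMap.comp_apply, sliceL_leg23, LinearMap.rTensor_tmul, leg23_tmul,
    rTensor_curry] at h
  rw [← h, ← LinearMap.rTensor_comp_apply]

/-- For `W(b) = (A ⊗ ω)(Δ(b) (1 ⊗ c))`, one has `(a ⊗ 1) Δ(W(b)) = (A ⊗ W)((a ⊗ 1) Δ(b))`. -/
theorem T₂_sliceT₁ (H : RegWMB k A) (ω : A →ₗ[k] k) (a b c : A) :
    H.T₂ (a ⊗ₜ sliceR A ω (H.T₁ (b ⊗ₜ c))) =
      (sliceR A ω ∘ₗ (TensorProduct.curry H.T₁).flip c).lTensor A (H.T₂ (a ⊗ₜ b)) := by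
  have h := LinearMap.congr_fun H.wmb.coassoc ((a ⊗ₜ b) ⊗ₜ c)
  have h := congrArg (sliceR (A ⊗[k] A) ω) h
  simp only [LinearMap.comp_apply, LinearMap.rTensor_tmul, leg23_tmul, rTensor_curry,
    sliceR_leg23, sliceR_rTensor'] at h
  exact h

theorem T₄_sliceT₃ (H : RegWMB k A) (ω : A →ₗ[k] k) (a b c : A) :
    H.T₄ (a ⊗ₜ sliceR A ω (H.T₃ (b ⊗ₜ c))) =
      (sliceR A ω ∘ₗ (TensorProduct.curry H.T₃).flip c).lTensor A (H.T₄ (a ⊗ₜ b)) :=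
  T₂_sliceT₁ H.opp ω a b c

/-! ### The legs of `E` -/

/-- `p ↦ (A ⊗ ω)(E (p ⊗ q))`, the left multiplication by an element of the first leg of `E`. -/
def legR (H : RegWMB k A) (ω : A →ₗ[k] k) (q : A) : A →ₗ[k] A :=
  sliceR A ω ∘ₗ (TensorProduct.curry H.E₁).flip q

/-- `q ↦ (ω ⊗ A)(E (p ⊗ q))`, the left multiplication by an element of the second leg of `E`. -/
def legL (H : RegWMB k A) (ω : A →ₗ[k] k) (p : A) : A →ₗ[k] A :=
  sliceL A ω ∘ₗ TensorProduct.curry H.E₁ p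

theorem legR_apply (H : RegWMB k A) (ω : A →ₗ[k] k) (q p : A) :
    H.legR ω q p = sliceR A ω (H.E₁ (p ⊗ₜ q)) := rfl

theorem legL_apply (H : RegWMB k A) (ω : A →ₗ[k] k) (q p : A) :
    H.legL ω p q = sliceL A ω (H.E₁ (p ⊗ₜ q)) := rfl

theorem legR_mul (H : RegWMB k A) (ω : A →ₗ[k] k) (q p p' : A) :
    H.legR ω q (p * p') = H.legR ω q p * p' := by
  have : (p * p') ⊗ₜ[k] q = (rm k p').rTensor A (p ⊗ₜ q) := by simp
  rw [legR_apply, this, E₁_rm_left, sliceR_rTensor']; rfl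

theorem legL_mul (H : RegWMB k A) (ω : A →ₗ[k] k) (p q q' : A) :
    H.legL ω p (q * q') = H.legL ω p q * q' := by
  have : p ⊗ₜ[k] (q * q') = (rm k q').lTensor A (p ⊗ₜ q) := by simp
  rw [legL_apply, this, E₁_rm_right, sliceL_lTensor]; rfl

theorem legR_mul_right (H : RegWMB k A) (ω : A →ₗ[k] k) (q q' p : A) :
    H.legR ω (q * q') p = H.legR (ω ∘ₗ rm k q') q p := by
  have : p ⊗ₜ[k] (q * q') = (rm k q').lTensor A (p ⊗ₜ q) := by simp
  rw [legR_apply, this, E₁_rm_right, sliceR_lTensor]; rfl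

theorem legL_mul_left (H : RegWMB k A) (ω : A →ₗ[k] k) (q p p' : A) :
    H.legL ω (p * p') q = H.legL (ω ∘ₗ rm k p') p q := by
  have : (p * p') ⊗ₜ[k] q = (rm k p').rTensor A (p ⊗ₜ q) := by simp
  rw [legL_apply, this, E₁_rm_left, sliceL_rTensor]; rfl

/-- `Δ(r p) = (1 ⊗ r) Δ(p)` for `r` in the first leg of `E`: slice the third factor of the
equality `(Δ ⊗ A)(E) = (1 ⊗ E) (E ⊗ 1)`. -/
theorem ΔL_legR (H : RegWMB k A) (ω : A →ₗ[k] k) (q p : A) (x : A ⊗[k] A) :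
    H.ΔL (H.legR ω q p) x = (H.legR ω q).lTensor A (H.ΔL p x) := by
  have key (q q' : A) : H.ΔL (H.legR ω (q * q') p) x = (H.legR ω (q * q')).lTensor A (H.ΔL p x) := by
    have h := LinearMap.congr_fun (H.wmb.ΔE_left (p ⊗ₜ q)) (x ⊗ₜ q')
    have h := congrArg (sliceR (A ⊗[k] A) ω) h
    rw [H.wmb.E_comm] at h
    simp only [LinearMap.comp_apply, TensorProduct.map₂_apply_tmul, TensorProduct.map_tmul,
      LinearMap.rTensor_tmul, sliceR_leg23] at h
    rw [E₁_ΔL] at h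
    refine Eq.trans ?_ h.symm
    rw [legR_mul_right, legR_apply]
    generalize H.E₁ (p ⊗ₜ q) = t
    refine LinearMap.congr_fun (f := (H.ΔL.flip x) ∘ₗ sliceR A (ω ∘ₗ rm k q'))
      (g := sliceR (A ⊗[k] A) ω ∘ₗ
        (TensorProduct.map₂ H.ΔL (LinearMap.mul k A)).flip (x ⊗ₜ q'))
      (TensorProduct.ext' fun c d => ?_) t
    simp [ΔL]
  have hadd : ∀ q q', H.legR ω (q + q') = H.legR ω q + H.legR ω q' := fun q q' => by
    ext; simp [legR]
  have hsmul : ∀ (c : k) q, H.legR ω (c • q) = c • H.legR ω q := fun c q => by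
    ext; simp [legR]
  let f : A →ₗ[k] A ⊗[k] A :=
    { toFun := fun q => H.ΔL (H.legR ω q p) x
      map_add' := fun a b => by simp [hadd]
      map_smul' := fun c a => by simp [hsmul] }
  let g : A →ₗ[k] A ⊗[k] A :=
    { toFun := fun q => (H.legR ω q).lTensor A (H.ΔL p x)
      map_add' := fun a b => by simp [hadd, LinearMap.lTensor_add]
      map_smul' := fun c a => by simp [hsmul, LinearMap.lTensor_smul] }
  exact LinearMap.congr_fun (H.ext_mul (f := f) (g := g) key) q

/-- `Δ(l q) = (l ⊗ 1) Δ(q)` for `l` in the second leg of `E`: slice the first factor of the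
equality `(A ⊗ Δ)(E) = (E ⊗ 1) (1 ⊗ E)`. -/
theorem ΔL_legL (H : RegWMB k A) (ω : A →ₗ[k] k) (q p : A) (x : A ⊗[k] A) :
    H.ΔL (H.legL ω p q) x = (H.legL ω p).rTensor A (H.ΔL q x) := by
  have key (p p' : A) : H.ΔL (H.legL ω (p * p') q) x = (H.legL ω (p * p')).rTensor A (H.ΔL q x) := by
    have h := LinearMap.congr_fun (H.wmb.ΔE_right (p ⊗ₜ q)) (p' ⊗ₜ x)
    have h := congrArg ((sliceL A ω).rTensor A) h
    simp only [LinearMap.comp_apply, TensorProduct.map₂_apply_tmul, TensorProduct.map_tmul] at h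
    have e (z : A ⊗[k] A) : leg23 A H.E₁ ((TensorProduct.assoc k A A A).symm.toLinearMap
        ((p * p') ⊗ₜ z)) = (TensorProduct.assoc k A A A).symm.toLinearMap ((p * p') ⊗ₜ H.E₁ z) := by
      simp [leg23]
    have e' (z : A ⊗[k] A) : (sliceL A ω).rTensor A (H.E₁.rTensor A
        ((TensorProduct.assoc k A A A).symm.toLinearMap ((p * p') ⊗ₜ z))) =
        (H.legL ω (p * p')).rTensor A z := by
      refine LinearMap.congr_fun (f := (sliceL A ω).rTensor A ∘ₗ H.E₁.rTensor A ∘ₗ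
        (TensorProduct.assoc k A A A).symm.toLinearMap ∘ₗ TensorProduct.mk k A _ (p * p'))
        (TensorProduct.ext' fun c d => ?_) z
      simp [legL]
    rw [LinearMap.mul_apply', e, E₁_ΔL, e'] at h
    refine Eq.trans ?_ h.symm
    rw [legL_mul_left, legL_apply]
    generalize H.E₁ (p ⊗ₜ q) = t
    refine LinearMap.congr_fun (f := (H.ΔL.flip x) ∘ₗ sliceL A (ω ∘ₗ rm k p'))
      (g := (sliceL A ω).rTensor A ∘ₗ (TensorProduct.assoc k A A A).symm.toLinearMap ∘ₗ
        (TensorProduct.map₂ (LinearMap.mul k A) H.ΔL).flip (p' ⊗ₜ x))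
      (TensorProduct.ext' fun c d => ?_) t
    simp only [LinearMap.comp_apply, sliceL_tmul, LinearMap.flip_apply,
      TensorProduct.map₂_apply_tmul, TensorProduct.map_tmul, map_smul]
    generalize (H.ΔL d) x = z
    refine LinearMap.congr_fun (f := ω (c * p') • LinearMap.id) (g := (sliceL A ω).rTensor A ∘ₗ
      (TensorProduct.assoc k A A A).symm.toLinearMap ∘ₗ TensorProduct.mk k A _ (c * p'))
      (TensorProduct.ext' fun c d => ?_) z
    simp [TensorProduct.smul_tmul']
  have hadd : ∀ q q', H.legL ω (q + q') = H.legL ω q + H.legL ω q' := fun q q' => by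
    ext; simp [legL]
  have hsmul : ∀ (c : k) q, H.legL ω (c • q) = c • H.legL ω q := fun c q => by
    ext; simp [legL]
  let f : A →ₗ[k] A ⊗[k] A :=
    { toFun := fun p => H.ΔL (H.legL ω p q) x
      map_add' := fun a b => by simp [hadd]
      map_smul' := fun c a => by simp [hsmul] }
  let g : A →ₗ[k] A ⊗[k] A :=
    { toFun := fun p => (H.legL ω p).rTensor A (H.ΔL q x)
      map_add' := fun a b => by simp [hadd, LinearMap.rTensor_add]
      map_smul' := fun c a => by simp [hsmul, LinearMap.rTensor_smul] }
  exact LinearMap.congr_fun (H.ext_mul (f := f) (g := g) key) p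

theorem lTensor_rm (f : A →ₗ[k] A) (hf : ∀ p p', f (p * p') = f p * p') (c : A) (z : V ⊗[k] A) :
    f.lTensor V ((rm k c).lTensor V z) = (rm k c).lTensor V (f.lTensor V z) := by
  rw [← LinearMap.lTensor_comp_apply, ← LinearMap.lTensor_comp_apply]
  congr 2; ext p; exact hf p c

theorem rTensor_rm (f : A →ₗ[k] A) (hf : ∀ p p', f (p * p') = f p * p') (c : A) (z : A ⊗[k] V) :
    f.rTensor V ((rm k c).rTensor V z) = (rm k c).rTensor V (f.rTensor V z) := by
  rw [← LinearMap.rTensor_comp_apply, ← LinearMap.rTensor_comp_apply]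
  congr 2; ext p; exact hf p c

theorem T₄_of_ΔL (H : RegWMB k A) {f : A →ₗ[k] A} (hf : ∀ p p', f (p * p') = f p * p')
    (h : ∀ a x, H.ΔL (f a) x = f.lTensor A (H.ΔL a x)) (y p : A) :
    H.T₄ (y ⊗ₜ f p) = f.lTensor A (H.T₄ (y ⊗ₜ p)) := by
  refine H.eq_of_lTensor_rm fun c => ?_
  rw [← ΔL_tmul', h, ΔL_tmul', lTensor_rm f hf]

theorem T₁_of_ΔL (H : RegWMB k A) {f : A →ₗ[k] A} (h : ∀ a x, H.ΔL (f a) x = f.lTensor A (H.ΔL a x))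
    (p z : A) : H.T₁ (f p ⊗ₜ z) = f.lTensor A (H.T₁ (p ⊗ₜ z)) := by
  refine H.eq_of_rTensor_rm fun c => ?_
  rw [← ΔL_tmul, h, ΔL_tmul, rTensor_lTensor]

theorem T₄_legR (H : RegWMB k A) (ω : A →ₗ[k] k) (q y p : A) :
    H.T₄ (y ⊗ₜ H.legR ω q p) = (H.legR ω q).lTensor A (H.T₄ (y ⊗ₜ p)) :=
  H.T₄_of_ΔL (H.legR_mul ω q) (H.ΔL_legR ω q) y p

theorem T₁_legL (H : RegWMB k A) (ω : A →ₗ[k] k) (p q z : A) :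
    H.T₁ (H.legL ω p q ⊗ₜ z) = (H.legL ω p).rTensor A (H.T₁ (q ⊗ₜ z)) := by
  refine H.eq_of_rTensor_rm fun c => ?_
  rw [← ΔL_tmul, ΔL_legL, ΔL_tmul, rTensor_rm _ (H.legL_mul ω p)]

/-- `E (p y ⊗ q) = p₁ y ⊗ ⊓ᴸ(p₂) q` -/
theorem E₁_mul_tmul (H : RegWMB k A) (p y q : A) :
    H.E₁ ((p * y) ⊗ₜ q) = (sliceL A H.ε ∘ₗ H.E₁ ∘ₗ (TensorProduct.mk k A A).flip q).lTensor A
      (H.T₄ (y ⊗ₜ p)) := by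
  refine sliceR_injective fun ω => ?_
  rw [← legR_apply, legR_mul, ← H.counit_T₄, T₄_legR, sliceR_lTensor, sliceR_lTensor]
  congr 2
  ext v
  simp [legR_apply, slice_slice]

/-- `E (p ⊗ q z) = ⊓̄ᴿ(q₁) p ⊗ q₂ z` -/
theorem E₁_tmul_mul (H : RegWMB k A) (p q z : A) :
    H.E₁ (p ⊗ₜ (q * z)) = (sliceR A H.ε ∘ₗ H.E₁ ∘ₗ TensorProduct.mk k A A p).rTensor A
      (H.T₁ (q ⊗ₜ z)) := by
  refine sliceL_injective fun ω => ?_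
  rw [← legL_apply, legL_mul, ← H.counit_T₁, T₁_legL, sliceL_rTensor, sliceL_rTensor]
  congr 2
  ext v
  simp [legL_apply, slice_slice]

end RegWMB

/-! ### Multipliers -/

namespace Multiplier

variable {k : Type u} {A : Type v} [Field k] [NonUnitalRing A] [Module k A]
  [IsScalarTower k A A] [SMulCommClass k A A]

/-- The multiplier given by a pair of maps. -/
def ofMaps (l r : A →ₗ[k] A) (h : ∀ a b, a * l b = r a * b) : Multiplier k A :=
  ⟨(l, MulOpposite.op r), h⟩

@[simp] theorem left_ofMaps (l r : A →ₗ[k] A) (h : ∀ a b, a * l b = r a * b) (a : A) :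
    left (ofMaps l r h) a = l a := rfl

@[simp] theorem right_ofMaps (l r : A →ₗ[k] A) (h : ∀ a b, a * l b = r a * b) (a : A) :
    right (ofMaps l r h) a = r a := rfl

theorem ext_maps {w w' : Multiplier k A} (hl : ∀ a, left w a = left w' a)
    (hr : ∀ a, right w a = right w' a) : w = w' :=
  Subtype.ext (Prod.ext (LinearMap.ext hl) (MulOpposite.unop_injective (LinearMap.ext hr)))

end Multiplier


namespace RegWMB

variable {k : Type u} {A V W : Type v} {_ : Field k} {iA : NonUnitalRing A} {_ : Module k A}
  {i1 : IsScalarTower k A A} {i2 : SMulCommClass k A A} [AddCommGroup V] [Module k V]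
  [AddCommGroup W] [Module k W]

theorem multiplier_ext_left (H : RegWMB k A) {w w' : Multiplier k A}
    (h : ∀ a, left w a = left w' a) : w = w' :=
  ext_maps h fun a => H.eq_of_mul_right fun b => by rw [← mul_left, ← mul_left, h]

theorem multiplier_ext_right (H : RegWMB k A) {w w' : Multiplier k A}
    (h : ∀ a, right w a = right w' a) : w = w' :=
  ext_maps (fun a => H.eq_of_mul_left fun b => by rw [mul_left, mul_left, h]) h

theorem left_mul_apply (H : RegWMB k A) (w : Multiplier k A) (a b : A) :
    left w (a * b) = left w a * b :=
  H.eq_of_mul_left fun c => by rw [mul_left, ← mul_assoc, ← mul_left, mul_assoc]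

theorem right_mul_apply (H : RegWMB k A) (w : Multiplier k A) (a b : A) :
    right w (a * b) = a * right w b :=
  H.eq_of_mul_right fun c => by rw [← mul_left, mul_assoc, mul_left, mul_assoc]

theorem lm_right (w : Multiplier k A) (a : A) : lm k (right w a) = lm k a ∘ₗ left w := by
  ext b; simp [mul_left]

theorem rm_left (w : Multiplier k A) (a : A) : rm k (left w a) = rm k a ∘ₗ right w := by
  ext b; simp [mul_left]

/-! ### The maps `⊓ᴿ`, `⊓̄ᴿ` and `⊓̄ᴸ` -/

/-- The left and right multiplications by `⊓ᴿ(a)` form a multiplier. -/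
theorem piR_compat (H : RegWMB k A) (a b c : A) :
    c * sliceR A H.ε (H.T₃ (b ⊗ₜ a)) = sliceR A H.ε (H.E₂ (c ⊗ₜ a)) * b := by
  -- the map `v ↦ (ε ⊗ A)(Δ(a) (v ⊗ 1))`; by the axiom on `ε`, right multiplication of its values by
  -- `q` is `(ε ⊗ A)((1 ⊗ a) E (v ⊗ q))`
  let P : A →ₗ[k] A := sliceL A H.ε ∘ₗ (TensorProduct.curry H.T₄).flip a
  have hP (v q : A) : a * sliceL A H.ε (H.E₁ (v ⊗ₜ q)) = P v * q := by
    have h := H.wmb.counit_E₁ a (v ⊗ₜ q)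
    rw [sliceL_lTensor] at h
    refine h.trans ?_
    change sliceL A H.ε (H.ΔL a (v ⊗ₜ q)) = _
    rw [ΔL_tmul', sliceL_lTensor]; rfl
  have key (y : A) : (rm k (b * y)).rTensor A (H.E₂ (c ⊗ₜ a)) =
      (lm k c).rTensor A (P.lTensor A (H.T₄ (y ⊗ₜ b))) := by
    refine H.eq_of_lTensor_rm fun q => ?_
    rw [← rTensor_lTensor, ← E_mult, E₁_mul_tmul, ← rTensor_lTensor,
      ← LinearMap.lTensor_comp_apply, ← LinearMap.lTensor_comp_apply]
    congr 2
    ext v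
    simp [hP]
  refine H.eq_of_mul_right fun y => ?_
  have h := congrArg (sliceR A H.ε) (key y)
  rw [sliceR_rTensor', sliceR_rTensor', sliceR_lTensor] at h
  have hε : H.ε ∘ₗ P = H.ε ∘ₗ lm k a := by
    ext v
    simp [P, slice_slice, H.counit_T₄]
  rw [hε, ← sliceR_lTensor, lm_T₄, sliceR_rTensor'] at h
  simp only [LinearMap.mul_apply', LinearMap.flip_apply] at h
  rw [mul_assoc, mul_assoc, ← h]

/-- The multiplier `⊓ᴿ(a)`. -/
def piR (H : RegWMB k A) : A →ₗ[k] Multiplier k A where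
  toFun a := ofMaps (sliceR A H.ε ∘ₗ (TensorProduct.curry H.T₃).flip a)
    (sliceR A H.ε ∘ₗ (TensorProduct.curry H.E₂).flip a) fun c b => H.piR_compat a b c
  map_add' a b := by
    refine H.multiplier_ext_left fun c => ?_
    rw [map_add left]; simp; rfl
  map_smul' a b := by
    refine H.multiplier_ext_left fun c => ?_
    rw [map_smul left]; simp; rfl

theorem piR_left (H : RegWMB k A) (a b : A) :
    left (H.piR a) b = sliceR A H.ε (H.T₃ (b ⊗ₜ a)) := rfl

theorem piR_right (H : RegWMB k A) (a b : A) :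
    right (H.piR a) b = sliceR A H.ε (H.E₂ (b ⊗ₜ a)) := rfl

/-- The multiplier `⊓̄ᴿ(a)`. -/
def piBarR (H : RegWMB k A) : A →ₗ[k] Multiplier k A where
  toFun a := ofMaps (sliceR A H.ε ∘ₗ (TensorProduct.curry H.E₁).flip a)
    (sliceR A H.ε ∘ₗ (TensorProduct.curry H.T₁).flip a) fun c b =>
      (piR_compat H.opp a c b).symm
  map_add' a b := by
    refine H.multiplier_ext_left fun c => ?_
    rw [map_add left]; simp; rfl
  map_smul' a b := by
    refine H.multiplier_ext_left fun c => ?_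
    rw [map_smul left]; simp; rfl

theorem piBarR_left (H : RegWMB k A) (a b : A) :
    left (H.piBarR a) b = sliceR A H.ε (H.E₁ (b ⊗ₜ a)) := rfl

theorem piBarR_right (H : RegWMB k A) (a b : A) :
    right (H.piBarR a) b = sliceR A H.ε (H.T₁ (b ⊗ₜ a)) := rfl

/-- The left and right multiplications by `⊓̄ᴸ(a)` form a multiplier; this is one of the axioms on
`ε`. -/
theorem piBarL_compat (H : RegWMB k A) (a b c : A) :
    c * sliceL A H.ε (H.T₂ (a ⊗ₜ b)) = sliceL A H.ε (H.E₂ (a ⊗ₜ c)) * b := by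
  have h := H.wmb.counit_E₂ b (a ⊗ₜ c)
  rw [sliceL_lTensor, deltaR_tmul, sliceL_lTensor] at h
  exact h.symm

/-- The multiplier `⊓̄ᴸ(a)`. -/
def piBarL (H : RegWMB k A) : A →ₗ[k] Multiplier k A where
  toFun a := ofMaps (sliceL A H.ε ∘ₗ TensorProduct.curry H.T₂ a)
    (sliceL A H.ε ∘ₗ TensorProduct.curry H.E₂ a) fun c b => H.piBarL_compat a b c
  map_add' a b := by
    refine H.multiplier_ext_left fun c => ?_
    rw [map_add left]; simp; rfl
  map_smul' a b := by
    refine H.multiplier_ext_left fun c => ?_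
    rw [map_smul left]; simp; rfl

theorem piBarL_left (H : RegWMB k A) (a b : A) :
    left (H.piBarL a) b = sliceL A H.ε (H.T₂ (a ⊗ₜ b)) := rfl

theorem piBarL_right (H : RegWMB k A) (a b : A) :
    right (H.piBarL a) b = sliceL A H.ε (H.E₂ (a ⊗ₜ b)) := rfl

/-- `(y p ⊗ q) E = y p₁ ⊗ q ⊓̄ᴸ(p₂)` -/
theorem E₂_mul_tmul (H : RegWMB k A) (y p q : A) :
    H.E₂ ((y * p) ⊗ₜ q) = ((right ∘ₗ H.piBarL).flip q).lTensor A (H.T₂ (y ⊗ₜ p)) :=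
  E₁_mul_tmul H.opp p y q

/-- `(p ⊗ z q) E = p ⊓ᴿ(q₁) ⊗ z q₂` -/
theorem E₂_tmul_mul (H : RegWMB k A) (p z q : A) :
    H.E₂ (p ⊗ₜ (z * q)) = ((right ∘ₗ H.piR).flip p).rTensor A (H.T₃ (q ⊗ₜ z)) :=
  E₁_tmul_mul H.opp p q z

/-- `E (p ⊗ q z) = ⊓̄ᴿ(q₁) p ⊗ q₂ z` -/
theorem E₁_tmul_mul' (H : RegWMB k A) (p q z : A) :
    H.E₁ (p ⊗ₜ (q * z)) = ((left ∘ₗ H.piBarR).flip p).rTensor A (H.T₁ (q ⊗ₜ z)) :=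
  E₁_tmul_mul H p q z

/-! ### Multipliers commuting with the comultiplication like elements of the base algebra -/

/-- The pair of maps `l : a ↦ r a` and `r : a ↦ a r` is a multiplier with `Δ(r a) = (1 ⊗ r) Δ(a)`
and `Δ(a r) = Δ(a) (1 ⊗ r)`. -/
structure IsBase (H : RegWMB k A) (l r : A →ₗ[k] A) : Prop where
  compat : ∀ a b, a * l b = r a * b
  ΔL : ∀ a x, H.ΔL (l a) x = l.lTensor A (H.ΔL a x)
  ΔR : ∀ a x, H.ΔR (r a) x = r.lTensor A (H.ΔR a x)

namespace IsBase

variable {H : RegWMB k A} {l r : A →ₗ[k] A}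

theorem opp (h : H.IsBase l r) : IsBase H.opp r l where
  compat a b := (h.compat b a).symm
  ΔL a x := by
    have e := h.ΔR a x
    rw [RegWMB.ΔR, ← H.T₃_spec] at e
    exact e
  ΔR a x := by
    have e := h.ΔL a x
    rw [RegWMB.ΔL, ← H.T₄_spec] at e
    exact e

theorem lm_eq (h : H.IsBase l r) (a : A) : lm k (r a) = lm k a ∘ₗ l := by
  ext b; simp [h.compat]

theorem T₁_left (h : H.IsBase l r) (p z : A) : H.T₁ (l p ⊗ₜ z) = l.lTensor A (H.T₁ (p ⊗ₜ z)) :=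
  H.T₁_of_ΔL h.ΔL p z

theorem T₃_left (h : H.IsBase l r) (p c : A) : H.T₃ (l p ⊗ₜ c) = H.T₃ (p ⊗ₜ r c) := by
  refine H.eq_of_lTensor_rm fun q => ?_
  rw [← lm_T₁', ← lm_T₁', h.T₁_left, h.lm_eq, LinearMap.lTensor_comp_apply]

theorem T₃_right (h : H.IsBase l r) (p z : A) : H.T₃ (r p ⊗ₜ z) = r.lTensor A (H.T₃ (p ⊗ₜ z)) :=
  h.opp.T₁_left p z

theorem T₁_right (h : H.IsBase l r) (p c : A) : H.T₁ (r p ⊗ₜ c) = H.T₁ (p ⊗ₜ l c) :=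
  h.opp.T₃_left p c

/-- `E (1 ⊗ r) E = (1 ⊗ r) E` -/
theorem E₁_left_E₁ (h : H.IsBase l r) (x : A ⊗[k] A) :
    H.E₁ (l.lTensor A (H.E₁ x)) = l.lTensor A (H.E₁ x) := by
  refine H.E₁_induction (f := H.E₁ ∘ₗ l.lTensor A) (fun a x => ?_) x
  rw [LinearMap.comp_apply, ← h.ΔL, E₁_ΔL]

/-- `E₁` commutes with `1 ⊗ r`. -/
theorem E₁_left (h : H.IsBase l r) (x : A ⊗[k] A) :
    H.E₁ (l.lTensor A x) = l.lTensor A (H.E₁ x) := by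
  refine LinearMap.congr_fun (f := H.E₁ ∘ₗ l.lTensor A)
    (g := l.lTensor A ∘ₗ H.E₁) (TensorProduct.ext' fun c d => ?_) x
  have h1 : H.E₁ (l.lTensor A (c ⊗ₜ d)) = H.E₁ (l.lTensor A (H.E₁ (c ⊗ₜ d))) := by
    refine H.eq_of_mul_tensor_left fun a b => ?_
    have e (z : A ⊗[k] A) : (lm k a).rTensor A ((lm k b).lTensor A (H.E₁ z)) =
        TensorProduct.map₂ (LinearMap.mul k A) (LinearMap.mul k A) (H.E₂ (a ⊗ₜ b)) z := by
      rw [← map₂_tmul_left, H.wmb.E_mult]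
    have e' (x z : A ⊗[k] A) :
        TensorProduct.map₂ (LinearMap.mul k A) (LinearMap.mul k A) x (l.lTensor A z) =
        TensorProduct.map₂ (LinearMap.mul k A) (LinearMap.mul k A) (r.lTensor A x) z := by
      refine LinearMap.congr_fun (LinearMap.congr_fun
        (f := (TensorProduct.map₂ (LinearMap.mul k A) (LinearMap.mul k A)).compl₂ (l.lTensor A))
        (g := (TensorProduct.map₂ (LinearMap.mul k A) (LinearMap.mul k A)) ∘ₗ r.lTensor A)
        (TensorProduct.ext' fun p q => TensorProduct.ext' fun p' q' => ?_) x) z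
      simp [h.compat]
    rw [e, e, e', e', H.wmb.E_mult]
    congr 2
    exact (h.opp.E₁_left_E₁ _).symm
  rw [LinearMap.comp_apply, h1, h.E₁_left_E₁]; rfl

end IsBase

/-- The values of `⊓ᴿ` are slices of `E` on its second leg, so they inherit the commutation rule
of the first leg of `E` with the comultiplication. -/
theorem piR_isBase (H : RegWMB k A) (c : A) : H.IsBase (left (H.piR c)) (right (H.piR c)) where
  compat := mul_left _
  ΔL a x := by
    refine LinearMap.congr_fun (f := H.ΔL _) (g := (left (H.piR c)).lTensor A ∘ₗ H.ΔL a)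
      (TensorProduct.ext' fun p q => ?_) x
    rw [LinearMap.comp_apply, ΔL_tmul', ΔL_tmul', lTensor_rm _ (H.left_mul_apply _), piR_left,
      T₄_sliceT₃]
    rfl
  ΔR a x := by
    rw [RegWMB.ΔR, ← H.T₃_spec]
    exact ΔL_legR H.opp H.ε c a x

end RegWMB

namespace RegWMB

variable {k : Type u} {A V W : Type v} {_ : Field k} {iA : NonUnitalRing A} {_ : Module k A}
  {i1 : IsScalarTower k A A} {i2 : SMulCommClass k A A} [AddCommGroup V] [Module k V]
  [AddCommGroup W] [Module k W]

/-! ### Relations between `⊓ᴿ`, `⊓̄ᴿ` and `⊓̄ᴸ` -/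

/-- `ε(⊓ᴿ(d) a) = ε(d a)`, so that `⊓ᴿ(d)` determines the functional `ε(d -)`. -/
theorem ε_piR (H : RegWMB k A) (d a : A) : H.ε (left (H.piR d) a) = H.ε (d * a) := by
  rw [piR_left, ← slice_slice, counit_T₃]

theorem ε_piBarR (H : RegWMB k A) (d a : A) : H.ε (right (H.piBarR d) a) = H.ε (a * d) :=
  ε_piR H.opp d a

theorem piR_left_mul (H : RegWMB k A) (b z y : A) :
    left (H.piR b) z * y = sliceR A (H.ε ∘ₗ lm k b) (H.T₄ (y ⊗ₜ z)) := by
  rw [← sliceR_lTensor, lm_T₄, sliceR_rTensor']; rfl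

theorem piBarL_left_mul (H : RegWMB k A) (b c d : A) :
    left (H.piBarL b) c * d = sliceL A (H.ε ∘ₗ lm k b) (H.T₁ (c ⊗ₜ d)) := by
  rw [← sliceL_rTensor, lm_T₁, sliceL_lTensor]; rfl

/-- `⊓ᴿ(b)` depends only on the functional `ε(b -)`. -/
theorem piR_eq_of (H : RegWMB k A) {b b' : A} (h : ∀ y, H.ε (b * y) = H.ε (b' * y)) :
    H.piR b = H.piR b' := by
  refine H.multiplier_ext_left fun z => H.eq_of_mul_right fun y => ?_
  rw [piR_left_mul, piR_left_mul]
  congr 2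
  ext c
  exact h c

/-- `⊓̄ᴸ(b)` depends only on the functional `ε(b -)`. -/
theorem piBarL_eq_of (H : RegWMB k A) {b b' : A} (h : ∀ y, H.ε (b * y) = H.ε (b' * y)) :
    H.piBarL b = H.piBarL b' := by
  refine H.multiplier_ext_left fun z => H.eq_of_mul_right fun y => ?_
  rw [piBarL_left_mul, piBarL_left_mul]
  congr 2
  ext c
  exact h c

theorem ε_mul_eq_of_piR (H : RegWMB k A) {b b' : A} (h : H.piR b = H.piR b') (y : A) :
    H.ε (b * y) = H.ε (b' * y) := by rw [← ε_piR, h, ε_piR]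

/-- `⊓ᴿ(u r) = ⊓ᴿ(u) r` -/
theorem piR_mul (H : RegWMB k A) {w : Multiplier k A} (hw : H.IsBase (left w) (right w)) (u : A) :
    H.piR (right w u) = H.piR u * w := by
  refine H.multiplier_ext_left fun z => ?_
  rw [left_mul, piR_left, piR_left, hw.T₃_left]

/-- `⊓̄ᴿ(r u) = r ⊓̄ᴿ(u)` -/
theorem piBarR_mul (H : RegWMB k A) {w : Multiplier k A} (hw : H.IsBase (left w) (right w))
    (u : A) : H.piBarR (left w u) = w * H.piBarR u := by
  refine H.multiplier_ext_right fun z => ?_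
  rw [right_mul, piBarR_right, piBarR_right, hw.T₁_right]

/-- `(⊓ᴿ(u) ⊗ 1) Δ(z) = (1 ⊗ ⊓̄ᴸ(u)) Δ(z)` -/
theorem piR_T₁ (H : RegWMB k A) (u z q : A) :
    (left (H.piR u)).rTensor A (H.T₁ (z ⊗ₜ q)) = (left (H.piBarL u)).lTensor A (H.T₁ (z ⊗ₜ q)) := by
  refine H.eq_of_rTensor_lm fun b => ?_
  have h := LinearMap.congr_fun H.wmb.coassoc ((b ⊗ₜ z) ⊗ₜ q)
  have h := congrArg ((sliceR A (H.ε ∘ₗ lm k u)).rTensor A) h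
  simp only [LinearMap.comp_apply, LinearMap.rTensor_tmul, leg23_tmul, rTensor_curry,
    sliceM_leg23] at h
  rw [rTensor_lTensor (lm k b), lm_T₁, ← LinearMap.rTensor_comp_apply,
    ← LinearMap.lTensor_comp_apply]
  rw [← LinearMap.rTensor_comp_apply] at h
  refine Eq.trans ?_ (h.trans ?_)
  · congr 2
    ext x
    simp only [LinearMap.comp_apply, LinearMap.mul_apply', TensorProduct.curry_apply]
    rw [← sliceR_lTensor, ← rm_T₃, sliceR_rTensor']; rfl
  · congr 2
    ext x
    simp only [LinearMap.comp_apply, LinearMap.flip_apply, LinearMap.mul_apply',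
      TensorProduct.curry_apply]
    rw [left_mul_apply H, piBarL_left_mul]

theorem piR_T₄ (H : RegWMB k A) (u z q : A) :
    (left (H.piR u)).rTensor A (H.T₄ (z ⊗ₜ q)) = (left (H.piBarL u)).lTensor A (H.T₄ (z ⊗ₜ q)) := by
  refine H.eq_of_lTensor_rm fun b => ?_
  rw [← rTensor_lTensor, ← lTensor_rm _ (H.left_mul_apply _), ← H.rm_T₁,
    rTensor_rm _ (H.left_mul_apply _), piR_T₁, rTensor_lTensor]

/-- `(⊓ᴿ(u) ⊗ 1) E = (1 ⊗ ⊓̄ᴸ(u)) E` -/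
theorem piR_E₁ (H : RegWMB k A) (u : A) (x : A ⊗[k] A) :
    (left (H.piR u)).rTensor A (H.E₁ x) = (left (H.piBarL u)).lTensor A (H.E₁ x) := by
  refine H.E₁_induction (fun a x => ?_) x
  refine LinearMap.congr_fun (f := (left (H.piR u)).rTensor A ∘ₗ H.ΔL a)
    (g := (left (H.piBarL u)).lTensor A ∘ₗ H.ΔL a) (TensorProduct.ext' fun p q => ?_) x
  rw [LinearMap.comp_apply, ΔL_tmul, rTensor_rm _ (H.left_mul_apply _), piR_T₁, rTensor_lTensor]
  rfl

/-- `(a r ⊗ b) E = (a ⊗ b τ(r)) E` for `r = ⊓ᴿ(u)`, `τ(r) = ⊓̄ᴸ(u)` -/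
theorem E₂_piR (H : RegWMB k A) (u a b : A) :
    H.E₂ (right (H.piR u) a ⊗ₜ b) = H.E₂ (a ⊗ₜ right (H.piBarL u) b) := by
  refine H.eq_of_lTensor_rm fun d => H.eq_of_rTensor_rm fun c => ?_
  rw [← E_mult, ← E_mult, lm_right, lm_right, LinearMap.rTensor_comp_apply,
    LinearMap.lTensor_comp_apply, rTensor_lTensor (left _), piR_E₁]

/-- `τ` is antimultiplicative -/
theorem piBarL_piR (H : RegWMB k A) (b c : A) :
    H.piBarL (right (H.piR c) b) = H.piBarL c * H.piBarL b := by
  refine H.multiplier_ext_left fun z => H.eq_of_mul_right fun y => ?_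
  rw [piBarL_left_mul, lm_right, left_mul, ← left_mul_apply H, piBarL_left_mul,
    ← LinearMap.comp_assoc, ← sliceL_rTensor, piR_T₁, sliceL_lTensor]

/-- `⊓ᴿ(c τ(r)) = r ⊓ᴿ(c)` -/
theorem piR_piBarL (H : RegWMB k A) (u c : A) :
    H.piR (right (H.piBarL u) c) = H.piR u * H.piR c := by
  refine H.multiplier_ext_left fun z => H.eq_of_mul_right fun y => ?_
  rw [piR_left_mul, lm_right, left_mul, ← left_mul_apply H, piR_left_mul,
    ← LinearMap.comp_assoc, ← sliceR_lTensor, ← piR_T₄, sliceR_rTensor']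

theorem T₁_piBarL (H : RegWMB k A) (u b c : A) :
    H.T₁ (left (H.piBarL u) b ⊗ₜ c) = (left (H.piBarL u)).rTensor A (H.T₁ (b ⊗ₜ c)) :=
  H.T₁_sliceT₂ H.ε u b c

theorem T₄_piBarL (H : RegWMB k A) (u b c : A) :
    H.T₄ (c ⊗ₜ left (H.piBarL u) b) = (left (H.piBarL u)).rTensor A (H.T₄ (c ⊗ₜ b)) := by
  refine H.eq_of_lTensor_rm fun q => ?_
  rw [← rm_T₁, T₁_piBarL, ← rTensor_lTensor, ← rm_T₁, rTensor_rm _ (H.left_mul_apply _)]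

/-- `Δ(q l) = Δ(q) (l ⊗ 1)` for `l = ⊓̄ᴸ(p)` -/
theorem T₃_piBarL (H : RegWMB k A) (p q z : A) :
    H.T₃ (right (H.piBarL p) q ⊗ₜ z) = (right (H.piBarL p)).rTensor A (H.T₃ (q ⊗ₜ z)) :=
  T₁_legL H.opp H.ε p q z

theorem piR_comm_piBarL (H : RegWMB k A) (u c : A) :
    H.piR u * H.piBarL c = H.piBarL c * H.piR u := by
  refine H.multiplier_ext_left fun z => H.eq_of_mul_right fun y => ?_
  rw [left_mul, left_mul, piR_left_mul, T₄_piBarL, sliceR_rTensor', ← piR_left_mul,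
    left_mul_apply H]

/-! ### The base algebra -/

/-- The base algebra: the range of `⊓ᴿ`. -/
def base (H : RegWMB k A) : NonUnitalSubalgebra k (Multiplier k A) where
  carrier := {w | ∃ a, H.piR a = w}
  add_mem' := by rintro _ _ ⟨a, rfl⟩ ⟨b, rfl⟩; exact ⟨a + b, map_add _ _ _⟩
  zero_mem' := ⟨0, map_zero _⟩
  smul_mem' := by rintro c _ ⟨a, rfl⟩; exact ⟨c • a, map_smul _ _ _⟩
  mul_mem' := by
    rintro _ _ ⟨a, rfl⟩ ⟨b, rfl⟩
    exact ⟨_, H.piR_mul (H.piR_isBase b) a⟩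

theorem base_isBase (H : RegWMB k A) (r : H.base) : H.IsBase (left r.1) (right r.1) := by
  obtain ⟨_, a, rfl⟩ := r
  exact H.piR_isBase a

/-- `⊓ᴿ` with values in the base algebra. -/
def piR' (H : RegWMB k A) : A →ₗ[k] H.base where
  toFun a := ⟨H.piR a, a, rfl⟩
  map_add' a b := Subtype.ext (map_add H.piR a b)
  map_smul' a b := Subtype.ext (map_smul H.piR a b)

@[simp] theorem piR'_coe (H : RegWMB k A) (a : A) : (H.piR' a).1 = H.piR a := rfl

theorem piR'_surjective (H : RegWMB k A) : Function.Surjective H.piR' := by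
  rintro ⟨_, a, rfl⟩; exact ⟨a, rfl⟩

/-- `r ↦ r p` -/
def evL (H : RegWMB k A) (p : A) : H.base →ₗ[k] A :=
  (left.flip p).domRestrict H.base.toSubmodule

/-- `r ↦ p r` -/
def evR (H : RegWMB k A) (p : A) : H.base →ₗ[k] A :=
  (right.flip p).domRestrict H.base.toSubmodule

@[simp] theorem evL_apply (H : RegWMB k A) (p : A) (r : H.base) : H.evL p r = left r.1 p := rfl
@[simp] theorem evR_apply (H : RegWMB k A) (p : A) (r : H.base) : H.evR p r = right r.1 p := rfl

theorem evL_separates (H : RegWMB k A) (r : H.base) (h : ∀ p, H.evL p r = 0) : r = 0 :=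
  Subtype.ext (H.multiplier_ext_left fun a => (h a).trans (by simp))

theorem evR_separates (H : RegWMB k A) (r : H.base) (h : ∀ p, H.evR p r = 0) : r = 0 :=
  Subtype.ext (H.multiplier_ext_right fun a => (h a).trans (by simp))

theorem base_tensor_ext_left (H : RegWMB k A) {x y : H.base ⊗[k] V}
    (h : ∀ p, (H.evL p).rTensor V x = (H.evL p).rTensor V y) : x = y :=
  eq_of_rTensor H.evL H.evL_separates h

theorem base_tensor_ext_right (H : RegWMB k A) {x y : H.base ⊗[k] V}
    (h : ∀ p, (H.evR p).rTensor V x = (H.evR p).rTensor V y) : x = y :=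
  eq_of_rTensor H.evR H.evR_separates h

/-- An element of `V ⊗ W` vanishes in `(V / S) ⊗ W`, that is, lies in `S ⊗ W`, if and only if all its
slices by functionals on `W` lie in `S`. -/
theorem mkQ_rTensor_eq_zero_iff (S : Submodule k V) (z : V ⊗[k] W) :
    S.mkQ.rTensor W z = 0 ↔ ∀ ω : W →ₗ[k] k, sliceR V ω z ∈ S := by
  constructor
  · intro h ω
    rw [← Submodule.ker_mkQ S, LinearMap.mem_ker, ← sliceR_rTensor', h, map_zero]
  · intro h
    refine sliceR_injective fun ω => ?_
    rw [sliceR_rTensor', map_zero, ← LinearMap.mem_ker, Submodule.ker_mkQ]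
    exact h ω

/-- Right fullness, defined by means of `T₁`, holds for `T₃` too, since `(1 ⊗ c) T₁(a ⊗ b)` is
`T₃(a ⊗ c) (1 ⊗ b)`. -/
theorem RightFull.opp {H : RegWMB k A} (h : H.RightFull) :
    @RegWMB.RightFull k A _ (opRing A) _ opTower opComm H.opp := by
  change Submodule.span k {c | ∃ (a b : A) (ω : A →ₗ[k] k), c = sliceR A ω (H.T₃ (a ⊗ₜ b))} = ⊤
  set S := Submodule.span k {c | ∃ (a b : A) (ω : A →ₗ[k] k), c = sliceR A ω (H.T₃ (a ⊗ₜ b))}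
  rw [eq_top_iff, ← h, Submodule.span_le]
  rintro _ ⟨a, b, ω, rfl⟩
  refine (mkQ_rTensor_eq_zero_iff S _).1 (H.eq_of_lTensor_lm fun c => ?_) ω
  rw [← rTensor_lTensor, lm_T₁', rTensor_lTensor, (mkQ_rTensor_eq_zero_iff S _).2, map_zero,
    map_zero]
  exact fun ω => Submodule.subset_span ⟨a, c, ω, rfl⟩

/-- By right fullness the range of `⊓̄ᴿ` is contained in that of `⊓ᴿ`: the elements
`(1 ⊗ c) E (1 ⊗ a b)` lie in `⊓ᴿ(A) ⊗ A` and `E (1 ⊗ a b) = ⊓̄ᴿ(a₁) ⊗ a₂ b`. -/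
theorem piBarR_mem (H : RegWMB k A) (hf : H.RightFull) (a : A) : ∃ b, H.piR b = H.piBarR a := by
  let S := LinearMap.range H.piR
  have key (a b : A) : (S.mkQ ∘ₗ H.piBarR).rTensor A (H.T₁ (a ⊗ₜ b)) = 0 := by
    refine H.eq_of_lTensor_lm fun c'' => H.eq_of_lTensor_lm fun c => ?_
    have e : (lm k (c * c'')).lTensor _ (H.piBarR.rTensor A (H.T₁ (a ⊗ₜ b))) =
        (rm k (a * b)).lTensor _ (H.piR.rTensor A (H.T₃ (c'' ⊗ₜ c))) := by
      refine eq_of_rTensor (ι := A) (fun x => left.flip x)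
        (fun w h => H.multiplier_ext_left fun a => (h a).trans (by simp)) fun x => ?_
      refine H.eq_of_rTensor_lm fun y => ?_
      have h := H.E_mult y (c * c'') x (a * b)
      rw [E₁_tmul_mul', E₂_tmul_mul] at h
      simp only [rTensor_lTensor, ← LinearMap.rTensor_comp_apply] at h ⊢
      refine h.trans ?_
      congr 3
      ext t
      simp [mul_left]
    rw [LinearMap.rTensor_comp_apply, ← LinearMap.lTensor_comp_apply, ← lm_mul, ← rTensor_lTensor,
      e, rTensor_lTensor, ← LinearMap.rTensor_comp_apply, LinearMap.range_mkQ_comp]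
    simp
  have h0 : S.mkQ ∘ₗ H.piBarR = 0 := by
    refine LinearMap.ext_on hf ?_
    rintro _ ⟨a, b, ω, rfl⟩
    rw [← sliceR_rTensor', key]; simp
  have : H.piBarR a ∈ S := by
    rw [← Submodule.ker_mkQ S, LinearMap.mem_ker]; exact LinearMap.congr_fun h0 a
  exact this

/-- The inclusion opposite to `piBarR_mem`, by passing to the opposite algebra. -/
theorem exists_piBarR (H : RegWMB k A) (hf : H.RightFull) (a : A) :
    ∃ b, H.piBarR b = H.piR a := by
  obtain ⟨b, hb⟩ := piBarR_mem H.opp hf.opp a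
  refine ⟨b, H.multiplier_ext_right fun x => ?_⟩
  exact congrArg (fun w => @left k A _ (opRing A) _ opTower opComm w x) hb

theorem isBaseAlgebra (H : RegWMB k A) (hf : H.RightFull) : H.IsBaseAlgebra H.base where
  piR_mem a := ⟨H.piR a, ⟨a, rfl⟩, fun _ => rfl⟩
  exists_piR := by rintro _ ⟨a, rfl⟩; exact ⟨a, fun _ => rfl⟩
  piBarR_mem a := ⟨H.piBarR a, H.piBarR_mem hf a, fun _ => rfl⟩
  exists_piBarR := by
    rintro _ ⟨a, rfl⟩
    obtain ⟨b, hb⟩ := H.exists_piBarR hf a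
    exact ⟨b, fun x => by rw [← hb]; rfl⟩

theorem isPiR_iff (H : RegWMB k A) (a : A) (w : Multiplier k A) : H.IsPiR a w ↔ w = H.piR a :=
  ⟨fun h => H.multiplier_ext_right h, fun h _ => by rw [h]; rfl⟩

theorem isPiBarR_iff (H : RegWMB k A) (a : A) (w : Multiplier k A) :
    H.IsPiBarR a w ↔ w = H.piBarR a :=
  ⟨fun h => H.multiplier_ext_left h, fun h _ => by rw [h]; rfl⟩

/-- `⊓̄ᴿ` with values in the base algebra. -/
def piBarR' (H : RegWMB k A) (hf : H.RightFull) : A →ₗ[k] H.base where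
  toFun a := ⟨H.piBarR a, H.piBarR_mem hf a⟩
  map_add' a b := Subtype.ext (map_add H.piBarR a b)
  map_smul' a b := Subtype.ext (map_smul H.piBarR a b)

@[simp] theorem piBarR'_coe (H : RegWMB k A) (hf : H.RightFull) (a : A) :
    (H.piBarR' hf a).1 = H.piBarR a := rfl

theorem piBarR'_surjective (H : RegWMB k A) (hf : H.RightFull) :
    Function.Surjective (H.piBarR' hf) := by
  rintro ⟨_, a, rfl⟩
  obtain ⟨b, hb⟩ := H.exists_piBarR hf a
  exact ⟨b, Subtype.ext hb⟩

theorem piR'_mul (H : RegWMB k A) (r : H.base) (u : A) : H.piR' (right r.1 u) = H.piR' u * r :=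
  Subtype.ext (H.piR_mul (H.base_isBase r) u)

theorem piBarR'_mul (H : RegWMB k A) (hf : H.RightFull) (r : H.base) (u : A) :
    H.piBarR' hf (left r.1 u) = r * H.piBarR' hf u :=
  Subtype.ext (H.piBarR_mul (H.base_isBase r) u)

/-- A linear map on `A` factors through an injection if its values on products lie in the image,
as `A` is spanned by products. -/
theorem exists_lift_of_injective {X : Type*} [AddCommGroup X] [Module k X] (H : RegWMB k A)
    (j : V →ₗ[k] X) (hj : Function.Injective j) (J : A →ₗ[k] X)
    (h : ∀ a b, ∃ z, j z = J (a * b)) : ∃ f : A →ₗ[k] V, ∀ a, j (f a) = J a := by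
  have hJ (a : A) : J a ∈ LinearMap.range j := by
    have : a ∈ (⊤ : Submodule k A) := trivial
    rw [← H.wmb.idempotent] at this
    have hle : Submodule.span k {c | ∃ a b, c = LinearMap.mul k A a b} ≤
        (LinearMap.range j).comap J := by
      rw [Submodule.span_le]
      rintro _ ⟨a, b, rfl⟩
      exact h a b
    exact hle this
  refine ⟨(LinearEquiv.ofInjective j hj).symm.toLinearMap ∘ₗ J.codRestrict _ hJ, fun a => ?_⟩
  exact congrArg Subtype.val
    ((LinearEquiv.ofInjective j hj).apply_symm_apply (J.codRestrict _ hJ a))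

/-- `(1 ⊗ a) E` lies in `R ⊗ A`: for `a` replaced by a product `a b` it is the image of
`T₃(b ⊗ a) = b₁ ⊗ a b₂` under `⊓ᴿ ⊗ A`. -/
theorem exists_Om' (H : RegWMB k A) :
    ∃ f : A →ₗ[k] H.base ⊗[k] A, ∀ a p, (H.evR p).rTensor A (f a) = H.E₂ (p ⊗ₜ a) := by
  let ev : A →ₗ[k] H.base →ₗ[k] A := (right.domRestrict H.base.toSubmodule).flip
  obtain ⟨f, hf⟩ := H.exists_lift_of_injective ((LinearMap.rTensorHom A ∘ₗ ev).flip)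
    (fun x y h => H.base_tensor_ext_right fun p => LinearMap.congr_fun h p)
    (TensorProduct.curry H.E₂).flip (fun a b => ⟨H.piR'.rTensor A (H.T₃ (b ⊗ₜ a)), by
      ext p
      change (H.evR p).rTensor A (H.piR'.rTensor A (H.T₃ (b ⊗ₜ a))) = H.E₂ (p ⊗ₜ (a * b))
      rw [E₂_tmul_mul, ← LinearMap.rTensor_comp_apply]
      rfl⟩)
  exact ⟨f, fun a p => LinearMap.congr_fun (hf a) p⟩

/-- The element `(1 ⊗ a) E` of `R ⊗ A`. -/
def Om' (H : RegWMB k A) : A →ₗ[k] H.base ⊗[k] A := H.exists_Om'.choose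

theorem evR_Om' (H : RegWMB k A) (p a : A) : (H.evR p).rTensor A (H.Om' a) = H.E₂ (p ⊗ₜ a) :=
  H.exists_Om'.choose_spec a p

theorem Om'_mul (H : RegWMB k A) (z q : A) : H.Om' (z * q) = H.piR'.rTensor A (H.T₃ (q ⊗ₜ z)) := by
  refine H.base_tensor_ext_right fun p => ?_
  rw [evR_Om', E₂_tmul_mul, ← LinearMap.rTensor_comp_apply]
  rfl

/-- `E (1 ⊗ a)` lies in `R ⊗ A`: for `a` replaced by a product `a b` it is the image of
`T₁(a ⊗ b) = a₁ ⊗ a₂ b` under `⊓̄ᴿ ⊗ A`. -/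
theorem exists_Om (H : RegWMB k A) (hf : H.RightFull) :
    ∃ f : A →ₗ[k] H.base ⊗[k] A, ∀ a p, (H.evL p).rTensor A (f a) = H.E₁ (p ⊗ₜ a) := by
  let ev : A →ₗ[k] H.base →ₗ[k] A := (left.domRestrict H.base.toSubmodule).flip
  obtain ⟨f, hf⟩ := H.exists_lift_of_injective ((LinearMap.rTensorHom A ∘ₗ ev).flip)
    (fun x y h => H.base_tensor_ext_left fun p => LinearMap.congr_fun h p)
    (TensorProduct.curry H.E₁).flip (fun a b => ⟨(H.piBarR' hf).rTensor A (H.T₁ (a ⊗ₜ b)), by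
      ext p
      change (H.evL p).rTensor A ((H.piBarR' hf).rTensor A (H.T₁ (a ⊗ₜ b))) = H.E₁ (p ⊗ₜ (a * b))
      rw [E₁_tmul_mul', ← LinearMap.rTensor_comp_apply]
      rfl⟩)
  exact ⟨f, fun a p => LinearMap.congr_fun (hf a) p⟩

/-- The element `E (1 ⊗ a)` of `R ⊗ A`. -/
def Om (H : RegWMB k A) (hf : H.RightFull) : A →ₗ[k] H.base ⊗[k] A := (H.exists_Om hf).choose

theorem evL_Om (H : RegWMB k A) (hf : H.RightFull) (p a : A) :
    (H.evL p).rTensor A (H.Om hf a) = H.E₁ (p ⊗ₜ a) := (H.exists_Om hf).choose_spec a p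

theorem Om_mul (H : RegWMB k A) (hf : H.RightFull) (q z : A) :
    H.Om hf (q * z) = (H.piBarR' hf).rTensor A (H.T₁ (q ⊗ₜ z)) := by
  refine H.base_tensor_ext_left fun p => ?_
  rw [evL_Om, E₁_tmul_mul', ← LinearMap.rTensor_comp_apply]
  rfl

/-- `(1 ⊗ a) (E (1 ⊗ b)) = ((1 ⊗ a) E) (1 ⊗ b)` -/
theorem lm_Om (H : RegWMB k A) (hf : H.RightFull) (a b : A) :
    (lm k a).lTensor _ (H.Om hf b) = (rm k b).lTensor _ (H.Om' a) := by
  refine H.base_tensor_ext_left fun p => H.eq_of_rTensor_lm fun y => ?_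
  rw [rTensor_lTensor, evL_Om, E_mult, ← evR_Om']
  simp only [rTensor_lTensor, ← LinearMap.rTensor_comp_apply]
  congr 3
  ext t
  simp [mul_left]

end RegWMB

/-! ### Firm bimodules over algebras with local units -/

section LocalUnits

variable {k : Type u} {R V : Type v} [Field k] [NonUnitalRing R] [Module k R]
  [AddCommGroup V] [Module k V]

theorem exists_left_unit_finset (h : ∀ r : R, ∃ e, e * r = r) (F : Finset R) :
    ∃ e, ∀ r ∈ F, e * r = r := by
  classical
  induction F using Finset.induction_on with
  | empty => exact ⟨0, by simp⟩
  | insert r F _ ih =>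
    obtain ⟨e, he⟩ := ih
    obtain ⟨f, hf⟩ := h (r - e * r)
    have key (s : R) (hs : f * (s - e * s) = s - e * s) : (e + f - f * e) * s = s := by
      rw [sub_mul, add_mul, mul_assoc, add_sub_assoc, ← mul_sub, hs, add_sub_cancel]
    refine ⟨e + f - f * e, fun s hs => ?_⟩
    rcases Finset.mem_insert.1 hs with rfl | hs
    · exact key s hf
    · exact key s (by rw [he s hs, sub_self, mul_zero])

theorem exists_right_unit_finset (h : ∀ r : R, ∃ e, r * e = r) (F : Finset R) :
    ∃ e, ∀ r ∈ F, r * e = r :=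
  @exists_left_unit_finset R (opRing R) h F

namespace BimodStr

variable [IsScalarTower k R R] [SMulCommClass k R R]

/-- `∑ rᵢ ⊗ vᵢ = e ⊗ ∑ rᵢ vᵢ` in the balanced tensor product, if `e rᵢ = rᵢ` for all `i`. -/
theorem exists_eq_tmul_actL (s : BimodStr k R V) (z : BalTensor (regular k R) s) :
    ∃ F : Finset R, ∀ e, (∀ r ∈ F, e * r = r) → z = BalTensor.tmul _ s e (s.actL z) := by
  classical
  induction z using BalTensor.induction_on with
  | zero => exact ⟨∅, by simp⟩
  | tmul r v =>
    refine ⟨{r}, fun e he => ?_⟩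
    rw [actL_tmul, ← BalTensor.balanced, regular_r, he r (by simp)]
  | add z z' h h' =>
    obtain ⟨F, hF⟩ := h
    obtain ⟨F', hF'⟩ := h'
    refine ⟨F ∪ F', fun e he => ?_⟩
    conv_lhs => rw [hF e fun r hr => he r (by simp [hr]), hF' e fun r hr => he r (by simp [hr])]
    rw [map_add, map_add]

/-- Over an algebra with left local units, a firm bimodule is non-degenerate. -/
theorem IsFirm.eq_of_l {s : BimodStr k R V} (hs : s.IsFirm) (hl : ∀ r : R, ∃ e, e * r = r)
    {v v' : V} (h : ∀ r, s.l r v = s.l r v') : v = v' := by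
  rw [← sub_eq_zero]
  obtain ⟨z, hz⟩ := hs.left.2 (v - v')
  obtain ⟨F, hF⟩ := s.exists_eq_tmul_actL z
  obtain ⟨e, he⟩ := exists_left_unit_finset hl F
  rw [← hz, hF e he, actL_tmul, hz, map_sub, h, sub_self]

/-- An idempotent bimodule over an algebra with local units is firm: `∑ rᵢ ⊗ vᵢ = e ⊗ ∑ rᵢ vᵢ`
if `e rᵢ = rᵢ` for all `i`. -/
theorem isFirm_of_local_units (s : BimodStr k R V) (hl : ∀ r : R, ∃ e, e * r = r)
    (hr : ∀ r : R, ∃ e, r * e = r) (sl : ∀ f : V →ₗ[k] V ⧸ LinearMap.range s.actL,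
      (∀ r v, f (s.l r v) = 0) → f = 0)
    (sr : ∀ f : V →ₗ[k] V ⧸ LinearMap.range s.actR, (∀ r v, f (s.r r v) = 0) → f = 0) :
    s.IsFirm := by
  classical
  refine ⟨⟨?_, ?_⟩, ⟨?_, ?_⟩⟩
  · rw [← LinearMap.ker_eq_bot, LinearMap.ker_eq_bot']
    intro z hz
    obtain ⟨F, hF⟩ := s.exists_eq_tmul_actL z
    obtain ⟨e, he⟩ := exists_left_unit_finset hl F
    rw [hF e he, hz, map_zero]
  · rw [← LinearMap.range_eq_top, ← Submodule.ker_mkQ (LinearMap.range s.actL),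
      sl (Submodule.mkQ _), LinearMap.ker_zero]
    intro r v
    rw [Submodule.mkQ_apply, Submodule.Quotient.mk_eq_zero]
    exact ⟨BalTensor.tmul _ s r v, by simp⟩
  · rw [← LinearMap.ker_eq_bot, LinearMap.ker_eq_bot']
    intro z hz
    have key (z : BalTensor s (regular k R)) : ∃ F : Finset R, ∀ e, (∀ r ∈ F, r * e = r) →
        z = BalTensor.tmul s _ (s.actR z) e := by
      induction z using BalTensor.induction_on with
      | zero => exact ⟨∅, by simp⟩
      | tmul v r =>
        refine ⟨{r}, fun e he => ?_⟩
        rw [actR_tmul, BalTensor.balanced, regular_l, he r (by simp)]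
      | add z z' h h' =>
        obtain ⟨F, hF⟩ := h
        obtain ⟨F', hF'⟩ := h'
        refine ⟨F ∪ F', fun e he => ?_⟩
        conv_lhs => rw [hF e fun r hr => he r (by simp [hr]), hF' e fun r hr => he r (by simp [hr])]
        rw [map_add, map_add, LinearMap.add_apply]
    obtain ⟨F, hF⟩ := key z
    obtain ⟨e, he⟩ := exists_right_unit_finset hr F
    rw [hF e he, hz, map_zero, LinearMap.zero_apply]
  · rw [← LinearMap.range_eq_top, ← Submodule.ker_mkQ (LinearMap.range s.actR),
      sr (Submodule.mkQ _), LinearMap.ker_zero]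
    intro r v
    rw [Submodule.mkQ_apply, Submodule.Quotient.mk_eq_zero]
    exact ⟨BalTensor.tmul s _ v r, by simp⟩

end BimodStr

end LocalUnits

namespace RegWMB

variable {k : Type u} {A V W : Type v} {_ : Field k} {iA : NonUnitalRing A} {_ : Module k A}
  {i1 : IsScalarTower k A A} {i2 : SMulCommClass k A A} [AddCommGroup V] [Module k V]
  [AddCommGroup W] [Module k W]

/-! ### Local units of the base algebra -/

/-- `(M(A) ⊗ ε) ((1 ⊗ c) E (1 ⊗ u)) = ⊓ᴿ(c) ⊓̄ᴿ(u)` -/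
theorem sliceR_Om' (H : RegWMB k A) (hf : H.RightFull) (c u : A) :
    sliceR H.base (H.ε ∘ₗ rm k u) (H.Om' c) = H.piR' c * H.piBarR' hf u := by
  have e : H.ε ∘ₗ lm k c = H.ε ∘ₗ left (H.piR c) := by ext; simp [ε_piR]
  rw [← sliceR_lTensor, ← H.lm_Om hf, sliceR_lTensor, e, ← sliceR_lTensor]
  refine Subtype.ext (H.multiplier_ext_left fun p => ?_)
  rw [← evL_apply, ← sliceR_rTensor', rTensor_lTensor, evL_Om, ← (H.piR_isBase c).E₁_left,
    ← piR'_coe, ← piBarR'_mul]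
  rfl

/-- Multiplying both factors of `(1 ⊗ c) E ∈ R ⊗ A` after applying `⊓ᴿ` to the second one. -/
theorem mul_piR'_Om' (H : RegWMB k A) (c : A) :
    TensorProduct.lift (LinearMap.mul k H.base) (H.piR'.lTensor _ (H.Om' c)) = H.piR' c := by
  refine Subtype.ext (H.multiplier_ext_right fun b => ?_)
  have h (z : H.base ⊗[k] A) :
      H.evR b (TensorProduct.lift (LinearMap.mul k H.base) (H.piR'.lTensor _ z)) =
        sliceR A H.ε (H.E₂ ((H.evR b).rTensor A z)) :=
    LinearMap.congr_fun (f := H.evR b ∘ₗ TensorProduct.lift (LinearMap.mul k H.base) ∘ₗ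
      H.piR'.lTensor _) (g := sliceR A H.ε ∘ₗ H.E₂ ∘ₗ (H.evR b).rTensor A)
      (TensorProduct.ext' fun r a => by simp [right_mul, piR_right]) z
  refine (h _).trans ?_
  rw [evR_Om']
  have := LinearMap.congr_fun H.wmb.E₂_idem (b ⊗ₜ c)
  rw [LinearMap.comp_apply] at this
  rw [this]; rfl

/-- Write `r = ⊓ᴿ(c)` and let `ζ` in `R ⊗ R` be the image of `(1 ⊗ c) E` under `R ⊗ ⊓ᴿ`. Its
product is `r`, and it lies in `R ⊗ R r` since `⊓ᴿ(c ⊓̄ᴸ(v)) = ⊓ᴿ(v) ⊓ᴿ(c)`. Hence `r` lies in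
`R r`. -/
theorem exists_left_unit (H : RegWMB k A) (r : H.base) : ∃ e, e * r = r := by
  let S := LinearMap.range ((LinearMap.mul k H.base).flip r)
  obtain ⟨c, hc⟩ := H.piR'_surjective r
  -- `ζ` vanishes in `R ⊗ (R / R r)`, tested by evaluating the first factor at `p q`
  have h0 : S.mkQ.lTensor H.base (H.piR'.lTensor _ (H.Om' c)) = 0 := by
    refine eq_of_rTensor (ι := A × A) (fun x => H.evR (x.1 * x.2)) (fun w h => ?_) fun x => ?_
    · refine Subtype.ext (H.multiplier_ext_right fun a => ?_)
      refine LinearMap.congr_fun (g := right (0 : Multiplier k A))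
        (H.ext_mul fun x y => ?_) a
      exact (h (x, y)).trans (by simp)
    · rw [rTensor_lTensor, rTensor_lTensor, evR_Om', E₂_mul_tmul, ← LinearMap.lTensor_comp_apply,
        ← LinearMap.lTensor_comp_apply, map_zero]
      have e : (S.mkQ ∘ₗ H.piR') ∘ₗ (right ∘ₗ H.piBarL).flip c = 0 := by
        ext v
        have : H.piR' (right (H.piBarL v) c) = H.piR' v * H.piR' c :=
          Subtype.ext (H.piR_piBarL v c)
        simp only [LinearMap.comp_apply, LinearMap.flip_apply, LinearMap.zero_apply, this]
        rw [Submodule.mkQ_apply, Submodule.Quotient.mk_eq_zero, hc]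
        exact ⟨_, rfl⟩
      rw [e, LinearMap.lTensor_zero, LinearMap.zero_apply]
  -- the multiplication `R ⊗ R → R` descends to a map `R ⊗ (R / R r) → R / R r`
  let F : H.base ⧸ S →ₗ[k] H.base →ₗ[k] H.base ⧸ S :=
    S.liftQ ((LinearMap.mul k H.base).flip.compr₂ S.mkQ) (by
      rintro _ ⟨s, rfl⟩
      ext a
      refine (Submodule.Quotient.mk_eq_zero S).2 ⟨a * s, ?_⟩
      simp [mul_assoc])
  have h1 (z : H.base ⊗[k] H.base) : S.mkQ (TensorProduct.lift (LinearMap.mul k H.base) z) =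
      TensorProduct.lift F.flip (S.mkQ.lTensor H.base z) :=
    LinearMap.congr_fun (f := S.mkQ ∘ₗ TensorProduct.lift (LinearMap.mul k H.base))
      (g := TensorProduct.lift F.flip ∘ₗ S.mkQ.lTensor H.base)
      (TensorProduct.ext' fun a b => by simp [F]) z
  have h2 := h1 (H.piR'.lTensor _ (H.Om' c))
  rw [h0, map_zero, mul_piR'_Om', hc, Submodule.mkQ_apply, Submodule.Quotient.mk_eq_zero] at h2
  exact h2

/-- As for left units: the element `ζ` of `R ⊗ R` with product `r` also lies in `r R ⊗ R`. -/
theorem exists_right_unit (H : RegWMB k A) (hf : H.RightFull) (r : H.base) : ∃ e, r * e = r := by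
  let S := LinearMap.range (LinearMap.mul k H.base r)
  obtain ⟨c, hc⟩ := H.piR'_surjective r
  have h0 : S.mkQ.rTensor H.base (H.piR'.lTensor _ (H.Om' c)) = 0 := by
    refine eq_of_lTensor (ι := A × A) (fun x => H.evL (x.1 * x.2)) (fun w h => ?_) fun x => ?_
    · refine Subtype.ext (H.multiplier_ext_left fun a => ?_)
      refine LinearMap.congr_fun (g := left (0 : Multiplier k A))
        (H.ext_mul fun x y => ?_) a
      exact (h (x, y)).trans (by simp)
    · obtain ⟨x, y⟩ := x
      rw [map_zero, ← rTensor_lTensor, ← LinearMap.lTensor_comp_apply]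
      refine sliceR_injective fun ω => ?_
      -- the functional `a ↦ ω (⊓ᴿ(a) x y)` is `a ↦ ε (a v)` for some `v`
      have e : ω ∘ₗ H.evL (x * y) ∘ₗ H.piR' = H.ε ∘ₗ rm k (sliceL A ω (H.T₄ (y ⊗ₜ x))) := by
        ext a
        simp only [LinearMap.comp_apply, evL_apply, piR'_coe, left_mul_apply H, piR_left_mul]
        have h := slice_slice ω (H.ε ∘ₗ lm k a) (H.T₄ (y ⊗ₜ x))
        exact h.symm
      rw [sliceR_rTensor', sliceR_lTensor, e, H.sliceR_Om' hf, map_zero, hc, Submodule.mkQ_apply,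
        Submodule.Quotient.mk_eq_zero]
      exact ⟨_, rfl⟩
  let F : H.base ⧸ S →ₗ[k] H.base →ₗ[k] H.base ⧸ S :=
    S.liftQ ((LinearMap.mul k H.base).compr₂ S.mkQ) (by
      rintro _ ⟨s, rfl⟩
      ext a
      refine (Submodule.Quotient.mk_eq_zero S).2 ⟨s * a, ?_⟩
      simp [mul_assoc])
  have h1 (z : H.base ⊗[k] H.base) : S.mkQ (TensorProduct.lift (LinearMap.mul k H.base) z) =
      TensorProduct.lift F (S.mkQ.rTensor H.base z) :=
    LinearMap.congr_fun (f := S.mkQ ∘ₗ TensorProduct.lift (LinearMap.mul k H.base))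
      (g := TensorProduct.lift F ∘ₗ S.mkQ.rTensor H.base)
      (TensorProduct.ext' fun a b => by simp [F]) z
  have h2 := h1 (H.piR'.lTensor _ (H.Om' c))
  rw [h0, map_zero, mul_piR'_Om', hc, Submodule.mkQ_apply, Submodule.Quotient.mk_eq_zero] at h2
  exact h2

theorem base_firm (H : RegWMB k A) (hf : H.RightFull) : (BimodStr.regular k H.base).IsFirm := by
  refine BimodStr.isFirm_of_local_units _ H.exists_left_unit (H.exists_right_unit hf) ?_ ?_
  · intro f hF
    ext r
    obtain ⟨e, he⟩ := H.exists_left_unit r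
    rw [← he]; exact hF e r
  · intro f hF
    ext r
    obtain ⟨e, he⟩ := H.exists_right_unit hf r
    rw [← he]; exact hF e r

/-! ### The actions of the base algebra on `A` -/

/-- `A` is spanned by the elements `r a`, since `μ(a ⊗ b) = (A ⊗ ε)(T₄(b ⊗ a))` and `E T₄ = T₄`. -/
theorem ext_left (H : RegWMB k A) (hf : H.RightFull) {f g : A →ₗ[k] V}
    (h : ∀ (r : H.base) a, f (left r.1 a) = g (left r.1 a)) : f = g := by
  refine H.ext_mul fun a b => ?_
  rw [← counit_T₄, ← E₁_T₄]
  refine LinearMap.congr_fun (f := f ∘ₗ sliceR A H.ε ∘ₗ H.E₁) (g := g ∘ₗ sliceR A H.ε ∘ₗ H.E₁)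
    (TensorProduct.ext' fun c d => ?_) _
  exact h (H.piBarR' hf d) c

/-- `A` is spanned by the elements `a r`, since `μ(a ⊗ b) = (A ⊗ ε)(T₂(a ⊗ b))` and the values of
`T₂` lie in `(A ⊗ A) E`. -/
theorem ext_right (H : RegWMB k A) {f g : A →ₗ[k] V}
    (h : ∀ (r : H.base) a, f (right r.1 a) = g (right r.1 a)) : f = g := by
  refine H.ext_mul fun a b => ?_
  rw [← counit_T₂, ← E₂_T₂]
  refine LinearMap.congr_fun (f := f ∘ₗ sliceR A H.ε ∘ₗ H.E₂) (g := g ∘ₗ sliceR A H.ε ∘ₗ H.E₂)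
    (TensorProduct.ext' fun c d => ?_) _
  exact h (H.piR' d) c

theorem ext_piBarL (H : RegWMB k A) {f g : A →ₗ[k] V}
    (h : ∀ c a, f (right (H.piBarL c) a) = g (right (H.piBarL c) a)) : f = g := by
  refine H.ext_mul fun a b => ?_
  rw [← counit_T₃, ← E₂_T₃]
  refine LinearMap.congr_fun (f := f ∘ₗ sliceL A H.ε ∘ₗ H.E₂) (g := g ∘ₗ sliceL A H.ε ∘ₗ H.E₂)
    (TensorProduct.ext' fun c d => ?_) _
  exact h c d

theorem exists_left_unit_act (H : RegWMB k A) (hf : H.RightFull) (a : A) :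
    ∃ e : H.base, left e.1 a = a := by
  classical
  -- the elements fixed by every `e` that is a left unit for sufficiently many elements of `R`
  let P : Submodule k A :=
    { carrier := {a | ∃ F : Finset H.base, ∀ e, (∀ r ∈ F, e * r = r) → left e.1 a = a}
      zero_mem' := ⟨∅, by simp⟩
      add_mem' := by
        rintro a b ⟨F, hF⟩ ⟨G, hG⟩
        refine ⟨F ∪ G, fun e he => ?_⟩
        rw [map_add, hF e fun r hr => he r (by simp [hr]), hG e fun r hr => he r (by simp [hr])]
      smul_mem' := by
        rintro c a ⟨F, hF⟩
        exact ⟨F, fun e he => by rw [map_smul, hF e he]⟩ }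
  have h : P.mkQ = 0 := by
    refine H.ext_left hf fun r a => ?_
    rw [Submodule.mkQ_apply, LinearMap.zero_apply, Submodule.Quotient.mk_eq_zero]
    refine ⟨{r}, fun e he => ?_⟩
    have := he r (by simp)
    rw [← Multiplier.left_mul]
    exact congrArg (fun s : H.base => left s.1 a) this
  have ha : a ∈ P := by
    rw [← Submodule.ker_mkQ P, h]; rfl
  obtain ⟨F, hF⟩ := ha
  obtain ⟨e, he⟩ := exists_left_unit_finset H.exists_left_unit F
  exact ⟨e, hF e he⟩

/-- Some `⊓ᴿ(d)` fixes `a`, so that `ε(a) = ε(⊓ᴿ(d) a) = ε(d a)`. -/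
theorem ε_eq_zero_of_mul (H : RegWMB k A) (hf : H.RightFull) {a : A} (h : ∀ x, H.ε (x * a) = 0) :
    H.ε a = 0 := by
  obtain ⟨e, he⟩ := H.exists_left_unit_act hf a
  obtain ⟨d, rfl⟩ := H.piR'_surjective e
  rw [← he, piR'_coe, ε_piR, h]

/-! ### The anti-isomorphism `⊓ᴿ(b) ↦ ⊓̄ᴸ(b)` -/

/-- The assignment is well defined, as both multipliers are determined by the functional `ε(b -)`
and the first one determines this functional. -/
theorem exists_tau (H : RegWMB k A) :
    ∃ f : H.base →ₗ[k] Multiplier k A, ∀ b, f (H.piR' b) = H.piBarL b := by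
  obtain ⟨g, hg⟩ := H.piR'.exists_rightInverse_of_surjective
    (LinearMap.range_eq_top.2 H.piR'_surjective)
  refine ⟨H.piBarL ∘ₗ g, fun b => H.piBarL_eq_of fun y => H.ε_mul_eq_of_piR ?_ y⟩
  exact congrArg Subtype.val (LinearMap.congr_fun hg (H.piR' b))

/-- The antimultiplicative map `τ` from the base algebra to `M(A)` sending `⊓ᴿ(b)` to `⊓̄ᴸ(b)`. -/
def tau (H : RegWMB k A) : H.base →ₗ[k] Multiplier k A := H.exists_tau.choose

@[simp] theorem tau_piR' (H : RegWMB k A) (b : A) : H.tau (H.piR' b) = H.piBarL b :=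
  H.exists_tau.choose_spec b

theorem tau_mul (H : RegWMB k A) (r s : H.base) : H.tau (r * s) = H.tau s * H.tau r := by
  obtain ⟨b, rfl⟩ := H.piR'_surjective r
  obtain ⟨c, rfl⟩ := H.piR'_surjective s
  rw [← piR'_mul, tau_piR', tau_piR', tau_piR', piR'_coe, piBarL_piR]

theorem mul_tau (H : RegWMB k A) (r s : H.base) : r.1 * H.tau s = H.tau s * r.1 := by
  obtain ⟨b, rfl⟩ := H.piR'_surjective r
  obtain ⟨c, rfl⟩ := H.piR'_surjective s
  rw [tau_piR', piR'_coe, piR_comm_piBarL]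

theorem ext_tau (H : RegWMB k A) {f g : A →ₗ[k] V}
    (h : ∀ r a, f (right (H.tau r) a) = g (right (H.tau r) a)) : f = g :=
  H.ext_piBarL fun c a => by rw [← tau_piR', h]

theorem E₂_tau (H : RegWMB k A) (r : H.base) (a b : A) :
    H.E₂ (right r.1 a ⊗ₜ b) = H.E₂ (a ⊗ₜ right (H.tau r) b) := by
  obtain ⟨c, rfl⟩ := H.piR'_surjective r
  rw [tau_piR', piR'_coe, E₂_piR]

end RegWMB

namespace RegWMB

variable {k : Type u} {A V W : Type v} {_ : Field k} {iA : NonUnitalRing A} {_ : Module k A}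
  {i1 : IsScalarTower k A A} {i2 : SMulCommClass k A A}

/-- `b' τ(r) = b` if `(1 ⊗ b) E` is `r ⊗ b' ∈ R ⊗ A` -/
theorem lift_tau_Om' (H : RegWMB k A) (b : A) :
    TensorProduct.lift (right ∘ₗ H.tau) (H.Om' b) = b := by
  refine LinearMap.congr_fun (f := TensorProduct.lift (right ∘ₗ H.tau) ∘ₗ H.Om')
    (g := LinearMap.id) (H.ext_mul fun z q => ?_) b
  rw [LinearMap.comp_apply, Om'_mul]
  refine Eq.trans ?_ ((congrArg (sliceL A H.ε) (H.E₂_T₃ (q ⊗ₜ z))).trans (H.counit_T₃ q z))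
  refine LinearMap.congr_fun (f := TensorProduct.lift (right ∘ₗ H.tau) ∘ₗ H.piR'.rTensor A)
    (g := sliceL A H.ε ∘ₗ H.E₂) (TensorProduct.ext' fun c d => ?_) _
  simp [piBarL_right]

end RegWMB

/-! ### The action of multipliers on modules -/

namespace ModStr

variable {k : Type u} {A V W U V' W' : Type v} [Field k] [NonUnitalRing A] [Module k A]
  [AddCommGroup V] [Module k V] [AddCommGroup W] [Module k W] [AddCommGroup U] [Module k U]
  [AddCommGroup V'] [Module k V'] [AddCommGroup W'] [Module k W']

theorem eq_of_act (s : ModStr k A V) {v v' : V} (h : ∀ a, s.act v a = s.act v' a) : v = v' := by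
  refine sub_eq_zero.1 (s.nondeg _ fun a => ?_)
  rw [map_sub, LinearMap.sub_apply, h, sub_self]

theorem tensor_ext_right (t : ModStr k A W) {f g : V ⊗[k] W →ₗ[k] U}
    (h : ∀ v w b, f (v ⊗ₜ t.act w b) = g (v ⊗ₜ t.act w b)) : f = g :=
  TensorProduct.ext (LinearMap.ext fun v => t.ext_span fun w b => h v w b)

theorem tensor_ext_left (s : ModStr k A V) {f g : V ⊗[k] W →ₗ[k] U}
    (h : ∀ v a w, f (s.act v a ⊗ₜ w) = g (s.act v a ⊗ₜ w)) : f = g :=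
  TensorProduct.ext (s.ext_span fun v a => LinearMap.ext fun w => h v a w)

theorem eq_of_actTensor (s : ModStr k A V) (t : ModStr k A W) {z z' : V ⊗[k] W}
    (h : ∀ x, actTensor s t x z = actTensor s t x z') : z = z' :=
  sub_eq_zero.1 (actTensor_nondeg s t _ fun x => by rw [map_sub, h, sub_self])

theorem ext_actTensor (s : ModStr k A V) (t : ModStr k A W) {f g : V ⊗[k] W →ₗ[k] U}
    (h : ∀ x z, f (actTensor s t x z) = g (actTensor s t x z)) : f = g := by
  refine s.tensor_ext_left fun v a w => ?_
  refine LinearMap.congr_fun (f := f ∘ₗ TensorProduct.mk k V W (s.act v a))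
    (g := g ∘ₗ TensorProduct.mk k V W (s.act v a)) (t.ext_span fun w b => ?_) w
  simpa [actTensor] using h (a ⊗ₜ b) (v ⊗ₜ w)

variable [IsScalarTower k A A] [SMulCommClass k A A]

/-- The formula is consistent by non-degeneracy, because `(v · a w) · b = v · (a (w b))`. -/
theorem exists_mact (s : ModStr k A V) : ∃ f : Multiplier k A →ₗ[k] V →ₗ[k] V,
    ∀ w v a, f w (s.act v a) = s.act v (right w a) := by
  obtain ⟨g, hg⟩ := (TensorProduct.lift s.act).exists_rightInverse_of_surjective
    (LinearMap.range_eq_top.2 s.act_surjective)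
  have key (w : Multiplier k A) (z : V ⊗[k] A) (b : A) :
      s.act (TensorProduct.lift s.act ((right w).lTensor V z)) b =
        s.act (TensorProduct.lift s.act z) (left w b) :=
    LinearMap.congr_fun (f := s.act.flip b ∘ₗ TensorProduct.lift s.act ∘ₗ (right w).lTensor V)
      (g := s.act.flip (left w b) ∘ₗ TensorProduct.lift s.act)
      (TensorProduct.ext' fun v a => by simp [← s.act_mul, mul_left]) z
  refine ⟨LinearMap.mk₂ k (fun w v => TensorProduct.lift s.act ((right w).lTensor V (g v)))
    ?_ ?_ ?_ ?_, fun w v a => s.eq_of_act fun b => ?_⟩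
  · intro w w' v; simp [LinearMap.lTensor_add]
  · intro c w v; simp [LinearMap.lTensor_smul]
  · intro w v v'; simp
  · intro c w v; simp
  · have := LinearMap.congr_fun hg (s.act v a)
    simp only [LinearMap.comp_apply, LinearMap.id_apply] at this
    rw [LinearMap.mk₂_apply, key, this, ← s.act_mul, ← s.act_mul, mul_left]

/-- The extension of the action to multipliers, with `(v · a) · w = v · (a w)`. -/
def mact (s : ModStr k A V) : Multiplier k A →ₗ[k] V →ₗ[k] V := s.exists_mact.choose

theorem mact_act (s : ModStr k A V) (w : Multiplier k A) (v : V) (a : A) :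
    s.mact w (s.act v a) = s.act v (right w a) := s.exists_mact.choose_spec w v a

theorem act_mact (s : ModStr k A V) (w : Multiplier k A) (v : V) (a : A) :
    s.act (s.mact w v) a = s.act v (left w a) :=
  LinearMap.congr_fun (s.ext_span (f := s.act.flip a ∘ₗ s.mact w) (g := s.act.flip (left w a))
    fun v b => by simp [mact_act, ← s.act_mul, mul_left]) v

theorem mact_mul (s : ModStr k A V) (w w' : Multiplier k A) (v : V) :
    s.mact (w * w') v = s.mact w' (s.mact w v) :=
  s.eq_of_act fun a => by rw [act_mact, act_mact, act_mact, left_mul]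

/-- The bimodule structure over the base algebra of an `A`-module. -/
def bimod (H : RegWMB k A) (s : ModStr k A V) : BimodStr k H.base V where
  l := s.mact ∘ₗ H.tau
  r := s.mact.domRestrict H.base.toSubmodule
  l_mul a b v := by
    simp only [LinearMap.comp_apply]
    rw [H.tau_mul, mact_mul]
  r_mul a b v := s.mact_mul a.1 b.1 v
  l_r a b v := by
    change s.mact b.1 (s.mact (H.tau a) v) = s.mact (H.tau a) (s.mact b.1 v)
    rw [← mact_mul, ← mact_mul, H.mul_tau]

theorem bimod_l (H : RegWMB k A) (s : ModStr k A V) (r : H.base) :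
    (s.bimod H).l r = s.mact (H.tau r) := rfl

theorem bimod_r (H : RegWMB k A) (s : ModStr k A V) (r : H.base) :
    (s.bimod H).r r = s.mact r.1 := rfl

/-- Since `A = A R = A τ(R)`, the actions of the base algebra on an idempotent `A`-module are
idempotent. -/
theorem bimod_firm (H : RegWMB k A) (hf : H.RightFull) (s : ModStr k A V) :
    (s.bimod H).IsFirm := by
  refine BimodStr.isFirm_of_local_units _ H.exists_left_unit (H.exists_right_unit hf)
    (fun f h => s.ext_span fun v a => ?_) (fun f h => s.ext_span fun v a => ?_)
  · refine LinearMap.congr_fun (f := f ∘ₗ s.act v) (g := 0) (H.ext_tau fun r a => ?_) a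
    simp only [LinearMap.comp_apply, ← mact_act]
    exact h r _
  · refine LinearMap.congr_fun (f := f ∘ₗ s.act v) (g := 0) (H.ext_right fun r a => ?_) a
    simp only [LinearMap.comp_apply, ← mact_act]
    exact h r _

/-- The firm bimodule structure of an `A`-module. -/
def modBimod (H : RegWMB k A) (hf : H.RightFull) (s : ModStr k A V) : ModBimod H H.base s where
  str := s.bimod H
  firm := s.bimod_firm H hf
  r_act r v a := s.mact_act r.1 v a
  l_act r b hr v a := by
    have : r = H.piR' b := Subtype.ext ((H.isPiR_iff _ _).1 hr)
    rw [this, bimod_l, mact_act, H.tau_piR']; rfl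

/-! ### The diagonal action -/

theorem multAct_actTensor (s : ModStr k A V) (t : ModStr k A W)
    (L R : A ⊗[k] A →ₗ[k] A ⊗[k] A)
    (h : ∀ x y, TensorProduct.map₂ (LinearMap.mul k A) (LinearMap.mul k A) x (L y) =
      TensorProduct.map₂ (LinearMap.mul k A) (LinearMap.mul k A) (R x) y) (x : A ⊗[k] A)
    (z : V ⊗[k] W) : multAct s t L R h (actTensor s t x z) = actTensor s t (R x) z :=
  (exists_multAct s t L R h).choose_spec x z

theorem actTensor_multAct (s : ModStr k A V) (t : ModStr k A W)
    (L R : A ⊗[k] A →ₗ[k] A ⊗[k] A)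
    (h : ∀ x y, TensorProduct.map₂ (LinearMap.mul k A) (LinearMap.mul k A) x (L y) =
      TensorProduct.map₂ (LinearMap.mul k A) (LinearMap.mul k A) (R x) y) (y : A ⊗[k] A)
    (z : V ⊗[k] W) : actTensor s t y (multAct s t L R h z) = actTensor s t (L y) z :=
  LinearMap.congr_fun (s.ext_actTensor t (f := actTensor s t y ∘ₗ multAct s t L R h)
    (g := actTensor s t (L y)) fun x z => by
      rw [LinearMap.comp_apply, multAct_actTensor, ← actTensor_map₂, ← actTensor_map₂, h]) z

theorem map_act_lm (s : ModStr k A V) (f : A →ₗ[k] W) (v : V) (a : A) (z : A ⊗[k] A) :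
    TensorProduct.map (s.act v) f ((lm k a).rTensor A z) =
      TensorProduct.map (s.act (s.act v a)) f z :=
  LinearMap.congr_fun (f := TensorProduct.map (s.act v) f ∘ₗ (lm k a).rTensor A)
    (TensorProduct.ext' fun c d => by simp [s.act_mul]) z

theorem map_lm_act (t : ModStr k A W) (f : A →ₗ[k] V) (w : W) (a : A) (z : A ⊗[k] A) :
    TensorProduct.map f (t.act w) ((lm k a).lTensor A z) =
      TensorProduct.map f (t.act (t.act w a)) z :=
  LinearMap.congr_fun (f := TensorProduct.map f (t.act w) ∘ₗ (lm k a).lTensor A)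
    (TensorProduct.ext' fun c d => by simp [t.act_mul]) z

/-- `(v ⊗ w · b) Δ(c) = v · c₁ ⊗ w · (b c₂)` -/
theorem diag_act_right (H : RegWMB k A) (s : ModStr k A V) (t : ModStr k A W) (c : A) (v : V)
    (w : W) (b : A) : s.diag H t c (v ⊗ₜ t.act w b) =
      TensorProduct.map (s.act v) (t.act w) (H.T₃ (c ⊗ₜ b)) := by
  refine LinearMap.congr_fun (s.ext_span
    (f := s.diag H t c ∘ₗ (TensorProduct.mk k V W).flip (t.act w b))
    (g := ((TensorProduct.map₂ s.act t.act).flip (H.T₃ (c ⊗ₜ b))) ∘ₗ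
      (TensorProduct.mk k V W).flip w) fun v a => ?_) v
  have h := multAct_actTensor s t (H.ΔL c) (H.ΔR c) (H.Δ_compat c) (a ⊗ₜ b) (v ⊗ₜ w)
  simp only [actTensor, LinearMap.flip_apply, TensorProduct.map₂_apply_tmul,
    TensorProduct.map_tmul] at h
  simp only [LinearMap.comp_apply, LinearMap.flip_apply, TensorProduct.mk_apply,
    TensorProduct.map₂_apply_tmul]
  refine h.trans ?_
  rw [RegWMB.ΔR_tmul', map_act_lm]

/-- `(v · a ⊗ w) Δ(c) = v · (a c₁) ⊗ w · c₂` -/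
theorem diag_act_left (H : RegWMB k A) (s : ModStr k A V) (t : ModStr k A W) (c : A) (v : V)
    (w : W) (a : A) : s.diag H t c (s.act v a ⊗ₜ w) =
      TensorProduct.map (s.act v) (t.act w) (H.T₂ (a ⊗ₜ c)) := by
  refine LinearMap.congr_fun (t.ext_span
    (f := s.diag H t c ∘ₗ (TensorProduct.mk k V W) (s.act v a))
    (g := ((TensorProduct.map₂ s.act t.act).flip (H.T₂ (a ⊗ₜ c))) ∘ₗ
      (TensorProduct.mk k V W) v) fun w b => ?_) w
  have h := multAct_actTensor s t (H.ΔL c) (H.ΔR c) (H.Δ_compat c) (a ⊗ₜ b) (v ⊗ₜ w)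
  simp only [actTensor, LinearMap.flip_apply, TensorProduct.map₂_apply_tmul,
    TensorProduct.map_tmul] at h
  simp only [LinearMap.comp_apply, LinearMap.flip_apply, TensorProduct.mk_apply,
    TensorProduct.map₂_apply_tmul]
  refine h.trans ?_
  rw [RegWMB.ΔR_tmul, map_lm_act]

theorem diag_mul (H : RegWMB k A) (s : ModStr k A V) (t : ModStr k A W) (c d : A)
    (z : V ⊗[k] W) : s.diag H t (c * d) z = s.diag H t d (s.diag H t c z) := by
  refine s.eq_of_actTensor t fun x => ?_
  have h := LinearMap.congr_fun (H.wmb.Δ_mul c d) x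
  rw [diag, actTensor_multAct, diag, actTensor_multAct, diag, actTensor_multAct]
  exact congrArg (fun y => actTensor s t y z) h

theorem E₂_diag (H : RegWMB k A) (s : ModStr k A V) (t : ModStr k A W) (c : A)
    (z : V ⊗[k] W) : s.E₂ H t (s.diag H t c z) = s.diag H t c z := by
  refine s.eq_of_actTensor t fun x => ?_
  rw [E₂, actTensor_multAct, diag, actTensor_multAct, actTensor_multAct, H.ΔL_E₁]

theorem diag_E₂ (H : RegWMB k A) (s : ModStr k A V) (t : ModStr k A W) (c : A)
    (z : V ⊗[k] W) : s.diag H t c (s.E₂ H t z) = s.diag H t c z := by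
  refine s.eq_of_actTensor t fun x => ?_
  rw [E₂, diag, actTensor_multAct, actTensor_multAct, actTensor_multAct, H.E₁_ΔL]

/-- The values of the diagonal action span the range of `E₂`. -/
theorem E₂_ext_diag (H : RegWMB k A) (s : ModStr k A V) (t : ModStr k A W)
    {f g : V ⊗[k] W →ₗ[k] U} (h : ∀ c z, f (s.diag H t c z) = g (s.diag H t c z)) :
    f ∘ₗ s.E₂ H t = g ∘ₗ s.E₂ H t := by
  refine s.ext_actTensor t fun x z => ?_
  rw [LinearMap.comp_apply, LinearMap.comp_apply, E₂, multAct_actTensor]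
  have hx : H.E₂ x ∈ Submodule.span k {y | ∃ a x, y = deltaR (LinearMap.mul k A) H.T₂ a x} := by
    rw [H.wmb.span_right]; exact ⟨x, rfl⟩
  generalize H.E₂ x = y at hx
  induction hx using Submodule.span_induction with
  | mem y hy =>
    obtain ⟨c, x, rfl⟩ := hy
    rw [← multAct_actTensor s t (H.ΔL c) (H.ΔR c) (H.Δ_compat c)]
    exact h c _
  | zero => simp [actTensor]
  | add y y' _ _ hy hy' =>
    simp only [actTensor, map_add, LinearMap.add_apply] at hy hy' ⊢
    rw [hy, hy']
  | smul c y _ hy =>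
    simp only [actTensor, map_smul, LinearMap.smul_apply] at hy ⊢
    rw [hy]

/-- The diagonal action is non-degenerate on the range of `E₂`. -/
theorem E₂_eq_zero (H : RegWMB k A) (s : ModStr k A V) (t : ModStr k A W) {z : V ⊗[k] W}
    (h : ∀ c, s.diag H t c z = 0) : s.E₂ H t z = 0 := by
  refine actTensor_nondeg s t _ fun x => ?_
  rw [E₂, actTensor_multAct]
  refine H.E₁_induction (f := TensorProduct.map₂ s.act t.act z) (g := 0) (fun a x => ?_) x
  refine (actTensor_multAct s t (H.ΔL a) (H.ΔR a) (H.Δ_compat a) x z).symm.trans ?_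
  have := h a
  rw [diag] at this
  rw [this, map_zero]; rfl

theorem E₂_act (H : RegWMB k A) (s : ModStr k A V) (t : ModStr k A W) (v : V) (w : W) (a b : A) :
    s.E₂ H t (s.act v a ⊗ₜ t.act w b) = TensorProduct.map (s.act v) (t.act w) (H.E₂ (a ⊗ₜ b)) := by
  rw [E₂, multAct_tmul, actTensor, LinearMap.flip_apply, TensorProduct.map₂_apply_tmul]

/-- `(v ⊗ w · b) E = v ◃ r ⊗ w · b'` if `(1 ⊗ b) E` is `r ⊗ b' ∈ R ⊗ A` -/
theorem E₂_act_right (H : RegWMB k A) (s : ModStr k A V) (t : ModStr k A W) (v : V) (w : W)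
    (b : A) : s.E₂ H t (v ⊗ₜ t.act w b) =
      TensorProduct.map ((s.bimod H).r.flip v) (t.act w) (H.Om' b) := by
  refine LinearMap.congr_fun (s.ext_span (f := s.E₂ H t ∘ₗ (TensorProduct.mk k V W).flip (t.act w b))
    (g := (TensorProduct.map₂ (s.bimod H).r.flip t.act).flip (H.Om' b) ∘ₗ
      (TensorProduct.mk k V W).flip w) fun v a => ?_) v
  simp only [LinearMap.comp_apply, LinearMap.flip_apply, TensorProduct.mk_apply,
    TensorProduct.map₂_apply_tmul]
  rw [E₂_act, ← RegWMB.evR_Om']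
  refine LinearMap.congr_fun (f := TensorProduct.map (s.act v) (t.act w) ∘ₗ (H.evR a).rTensor A)
    (TensorProduct.ext' fun r b => ?_) _
  simp [bimod_r, mact_act]

/-- `E₂` induces the identity on `V ⊗_R W`: if `(1 ⊗ b) E` is `r ⊗ b'`, then `v ◃ r ⊗_R w · b'` is
`v ⊗_R w · (b' τ(r))`, and `b' τ(r) = b`. -/
theorem proj_E₂ (H : RegWMB k A) (s : ModStr k A V) (t : ModStr k A W) (z : V ⊗[k] W) :
    BalTensor.proj (s.bimod H) (t.bimod H) (s.E₂ H t z) =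
      BalTensor.proj (s.bimod H) (t.bimod H) z := by
  refine LinearMap.congr_fun (f := BalTensor.proj (s.bimod H) (t.bimod H) ∘ₗ s.E₂ H t)
    (t.tensor_ext_right fun v w b => ?_) z
  have e : BalTensor.proj (s.bimod H) (t.bimod H) ∘ₗ
      TensorProduct.map ((s.bimod H).r.flip v) (t.act w) =
      BalTensor.tmul (s.bimod H) (t.bimod H) v ∘ₗ t.act w ∘ₗ
        TensorProduct.lift (right ∘ₗ H.tau) :=
    TensorProduct.ext' fun r b => by
      have := BalTensor.balanced (s.bimod H) (t.bimod H) v r (t.act w b)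
      rw [bimod_l, mact_act] at this
      exact this
  rw [LinearMap.comp_apply, E₂_act_right, ← LinearMap.comp_apply, e]
  simp only [LinearMap.comp_apply, RegWMB.lift_tau_Om']
  rfl

/-- By `(a r ⊗ b) E = (a ⊗ b τ(r)) E`, the map `E₂` factors through `V ⊗_R W`. -/
theorem E₂_balanced (H : RegWMB k A) (s : ModStr k A V) (t : ModStr k A W) (v : V) (r : H.base)
    (w : W) : s.E₂ H t ((s.bimod H).r r v ⊗ₜ w) = s.E₂ H t (v ⊗ₜ (t.bimod H).l r w) := by
  refine LinearMap.congr_fun (f := s.E₂ H t ∘ₗ ((s.bimod H).r r).rTensor W)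
    (g := s.E₂ H t ∘ₗ ((t.bimod H).l r).lTensor V) (s.tensor_ext_left fun v a w => ?_) (v ⊗ₜ w)
  refine LinearMap.congr_fun (f := (s.E₂ H t ∘ₗ ((s.bimod H).r r).rTensor W) ∘ₗ
      TensorProduct.mk k V W (s.act v a)) (g := (s.E₂ H t ∘ₗ ((t.bimod H).l r).lTensor V) ∘ₗ
      TensorProduct.mk k V W (s.act v a)) (t.ext_span fun w b => ?_) w
  simp only [LinearMap.comp_apply, TensorProduct.mk_apply, LinearMap.rTensor_tmul,
    LinearMap.lTensor_tmul, bimod_l, bimod_r, mact_act, E₂_act, H.E₂_tau]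

theorem diag_add (H : RegWMB k A) (s : ModStr k A V) (t : ModStr k A W) (c d : A)
    (z : V ⊗[k] W) : s.diag H t (c + d) z = s.diag H t c z + s.diag H t d z := by
  refine s.eq_of_actTensor t fun x => ?_
  rw [map_add, diag, actTensor_multAct, diag, actTensor_multAct, diag, actTensor_multAct, map_add]
  simp [actTensor]

theorem diag_smul (H : RegWMB k A) (s : ModStr k A V) (t : ModStr k A W) (c : k) (d : A)
    (z : V ⊗[k] W) : s.diag H t (c • d) z = c • s.diag H t d z := by
  refine s.eq_of_actTensor t fun x => ?_
  rw [map_smul, diag, actTensor_multAct, diag, actTensor_multAct, map_smul]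
  simp [actTensor]

/-- The diagonal action intertwines tensor products of module maps. -/
theorem map_diag (H : RegWMB k A) {s : ModStr k A V} {t : ModStr k A W} {s' : ModStr k A V'}
    {t' : ModStr k A W'} {f : V →ₗ[k] V'} {g : W →ₗ[k] W'}
    (hf : ∀ v a, f (s.act v a) = s'.act (f v) a) (hg : ∀ w a, g (t.act w a) = t'.act (g w) a)
    (c : A) (z : V ⊗[k] W) :
    TensorProduct.map f g (s.diag H t c z) = s'.diag H t' c (TensorProduct.map f g z) := by
  refine LinearMap.congr_fun (f := TensorProduct.map f g ∘ₗ s.diag H t c)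
    (g := s'.diag H t' c ∘ₗ TensorProduct.map f g) (t.tensor_ext_right fun v w b => ?_) z
  simp only [LinearMap.comp_apply, TensorProduct.map_tmul, hg, diag_act_right]
  refine LinearMap.congr_fun (f := TensorProduct.map f g ∘ₗ TensorProduct.map (s.act v) (t.act w))
    (TensorProduct.ext' fun x y => ?_) _
  simp [hf, hg]

/-! ### The tensor product of modules -/

/-- The map `V ⊗_R W → V ⊗ W` induced by `E₂`, a section of the canonical epimorphism. -/
def balE₂ (H : RegWMB k A) (s : ModStr k A V) (t : ModStr k A W) :
    BalTensor (s.bimod H) (t.bimod H) →ₗ[k] V ⊗[k] W :=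
  BalTensor.lift _ _ ((TensorProduct.mk k V W).compr₂ (s.E₂ H t)) (E₂_balanced H s t)

theorem balE₂_proj (H : RegWMB k A) (s : ModStr k A V) (t : ModStr k A W) (z : V ⊗[k] W) :
    balE₂ H s t (BalTensor.proj _ _ z) = s.E₂ H t z :=
  LinearMap.congr_fun (f := balE₂ H s t ∘ₗ BalTensor.proj _ _)
    (g := s.E₂ H t) (TensorProduct.ext' fun v w => BalTensor.lift_tmul _ _
      ((TensorProduct.mk k V W).compr₂ (s.E₂ H t)) (E₂_balanced H s t) v w) z

theorem proj_balE₂ (H : RegWMB k A) (s : ModStr k A V) (t : ModStr k A W)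
    (z : BalTensor (s.bimod H) (t.bimod H)) : BalTensor.proj _ _ (balE₂ H s t z) = z := by
  obtain ⟨z, rfl⟩ := Submodule.mkQ_surjective _ z
  exact (congrArg _ (balE₂_proj H s t z)).trans (proj_E₂ H s t z)

/-- The diagonal action on `V ⊗_R W`. -/
def tensorAct (H : RegWMB k A) (s : ModStr k A V) (t : ModStr k A W) :
    BalTensor (s.bimod H) (t.bimod H) →ₗ[k] A →ₗ[k] BalTensor (s.bimod H) (t.bimod H) :=
  LinearMap.mk₂ k (fun z c => BalTensor.proj _ _ (s.diag H t c (balE₂ H s t z)))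
    (by intros; simp) (by intros; simp) (by intros; simp [diag_add]) (by intros; simp [diag_smul])

theorem tensorAct_proj (H : RegWMB k A) (s : ModStr k A V) (t : ModStr k A W) (z : V ⊗[k] W)
    (c : A) : tensorAct H s t (BalTensor.proj _ _ z) c = BalTensor.proj _ _ (s.diag H t c z) := by
  rw [tensorAct, LinearMap.mk₂_apply, balE₂_proj, diag_E₂]

theorem proj_surjective {R : Type v} [NonUnitalRing R] [Module k R] (s : BimodStr k R V)
    (t : BimodStr k R W) : Function.Surjective (BalTensor.proj s t) := Submodule.mkQ_surjective _

/-- The `A`-module `V ⊗_R W`. -/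
def tensor (H : RegWMB k A) (s : ModStr k A V) (t : ModStr k A W) :
    ModStr k A (BalTensor (s.bimod H) (t.bimod H)) where
  act := tensorAct H s t
  act_mul z a b := by
    obtain ⟨z, rfl⟩ := proj_surjective _ _ z
    rw [tensorAct_proj, tensorAct_proj, tensorAct_proj, diag_mul]
  idempotent := by
    rw [← Submodule.ker_mkQ (Submodule.span k _), LinearMap.ker_eq_top]
    ext z
    obtain ⟨z, rfl⟩ := proj_surjective _ _ z
    rw [← proj_E₂]
    refine LinearMap.congr_fun (f := (Submodule.mkQ _ ∘ₗ BalTensor.proj _ _) ∘ₗ s.E₂ H t)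
      (g := 0 ∘ₗ s.E₂ H t) (E₂_ext_diag H s t fun c z => ?_) z
    refine (Submodule.Quotient.mk_eq_zero _).2 (Submodule.subset_span ⟨BalTensor.proj _ _ z, c, ?_⟩)
    rw [tensorAct_proj]
  nondeg z hz := by
    rw [← proj_balE₂ H s t z]
    obtain ⟨z, rfl⟩ := proj_surjective _ _ z
    have h : s.E₂ H t z = 0 := by
      refine E₂_eq_zero H s t fun c => ?_
      have := congrArg (balE₂ H s t) (hz c)
      rwa [tensorAct_proj, balE₂_proj, E₂_diag, map_zero] at this
    rw [balE₂_proj, h, map_zero]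

theorem tensor_act_proj (H : RegWMB k A) (s : ModStr k A V) (t : ModStr k A W) (z : V ⊗[k] W)
    (c : A) : (s.tensor H t).act (BalTensor.proj _ _ z) c = BalTensor.proj _ _ (s.diag H t c z) :=
  tensorAct_proj H s t z c

end ModStr

namespace RegWMB

variable {k : Type u} {A V W : Type v} {_ : Field k} {iA : NonUnitalRing A} {_ : Module k A}
  {i1 : IsScalarTower k A A} {i2 : SMulCommClass k A A}

/-- The element `a c₁ ⊗ c₂ ⊗ b c₃` does not depend on the way of evaluating it. -/
theorem T₂_T₃ (H : RegWMB k A) (a b c : A) :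
    (TensorProduct.curry H.T₂ a).rTensor A (H.T₃ (c ⊗ₜ b)) =
      (TensorProduct.assoc k A A A).symm ((((TensorProduct.curry H.T₃).flip b)).lTensor A
        (H.T₂ (a ⊗ₜ c))) := by
  refine H.eq_of_lTensor_rm fun q => ?_
  have h := LinearMap.congr_fun H.wmb.coassoc ((a ⊗ₜ c) ⊗ₜ q)
  have h := congrArg ((lm k b).lTensor (A ⊗[k] A)) h
  simp only [LinearMap.comp_apply, LinearMap.rTensor_tmul, leg23_tmul, rTensor_curry] at h
  rw [← rTensor_lTensor, lm_T₁', rTensor_lTensor] at h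
  refine h.trans ?_
  refine LinearMap.congr_fun (f := (lm k b).lTensor (A ⊗[k] A) ∘ₗ leg23 A H.T₁ ∘ₗ
    (TensorProduct.mk k _ A).flip q) (g := (rm k q).lTensor (A ⊗[k] A) ∘ₗ
    (TensorProduct.assoc k A A A).symm.toLinearMap ∘ₗ
    ((TensorProduct.curry H.T₃).flip b).lTensor A) (TensorProduct.ext' fun m v => ?_) _
  have e (z : A ⊗[k] A) : (TensorProduct.assoc k A A A).symm (m ⊗ₜ z) =
      (TensorProduct.mk k A A m).rTensor A z :=
    LinearMap.congr_fun (f := (TensorProduct.assoc k A A A).symm.toLinearMap ∘ₗ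
      TensorProduct.mk k A (A ⊗[k] A) m) (TensorProduct.ext' fun _ _ => by simp) z
  simp only [LinearMap.comp_apply, LinearMap.flip_apply, TensorProduct.mk_apply, leg23_tmul,
    LinearMap.lTensor_tmul, TensorProduct.curry_apply, LinearEquiv.coe_coe, e]
  rw [← rTensor_lTensor, lm_T₁', rTensor_lTensor]

theorem T₃_tau (H : RegWMB k A) (r : H.base) (q z : A) :
    H.T₃ (right (H.tau r) q ⊗ₜ z) = (right (H.tau r)).rTensor A (H.T₃ (q ⊗ₜ z)) := by
  obtain ⟨b, rfl⟩ := H.piR'_surjective r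
  rw [tau_piR', T₃_piBarL]

end RegWMB

theorem BimodStr.ext_maps {k : Type u} {R V : Type v} [Field k] [NonUnitalRing R] [Module k R]
    [AddCommGroup V] [Module k V] {s t : BimodStr k R V} (hl : ∀ r v, s.l r v = t.l r v)
    (hr : ∀ r v, s.r r v = t.r r v) : s = t := by
  obtain ⟨l, r, _, _, _⟩ := s
  obtain ⟨l', r', _, _, _⟩ := t
  obtain rfl : l = l' := LinearMap.ext₂ hl
  obtain rfl : r = r' := LinearMap.ext₂ hr
  rfl

theorem BalTensor.proj_tmul {k : Type u} {R V W : Type v} [Field k] [NonUnitalRing R] [Module k R]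
    [AddCommGroup V] [Module k V] [AddCommGroup W] [Module k W] (s : BimodStr k R V)
    (t : BimodStr k R W) (v : V) (w : W) : proj s t (v ⊗ₜ w) = tmul s t v w := rfl

namespace ModStr

variable {k : Type u} {A V W U V' W' U' : Type v} [Field k] [NonUnitalRing A] [Module k A]
  [IsScalarTower k A A] [SMulCommClass k A A]
  [AddCommGroup V] [Module k V] [AddCommGroup W] [Module k W] [AddCommGroup U] [Module k U]
  [AddCommGroup V'] [Module k V'] [AddCommGroup W'] [Module k W'] [AddCommGroup U'] [Module k U']

/-- `z Δ(c r) = z Δ(c) (1 ⊗ r)` -/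
theorem diag_right (H : RegWMB k A) (s : ModStr k A V) (t : ModStr k A W) (r : H.base) (c : A)
    (z : V ⊗[k] W) :
    s.diag H t (right r.1 c) z = ((t.bimod H).r r).lTensor V (s.diag H t c z) := by
  refine LinearMap.congr_fun (g := ((t.bimod H).r r).lTensor V ∘ₗ s.diag H t c)
    (t.tensor_ext_right fun v w b => ?_) z
  rw [LinearMap.comp_apply, diag_act_right, diag_act_right, (H.base_isBase r).T₃_right]
  refine LinearMap.congr_fun (f := TensorProduct.map (s.act v) (t.act w) ∘ₗ (right r.1).lTensor A)
    (g := ((t.bimod H).r r).lTensor V ∘ₗ TensorProduct.map (s.act v) (t.act w))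
    (TensorProduct.ext' fun x y => ?_) _
  simp [bimod_r, mact_act]

/-- `z Δ(c τ(r)) = z Δ(c) (τ(r) ⊗ 1)` -/
theorem diag_tau (H : RegWMB k A) (s : ModStr k A V) (t : ModStr k A W) (r : H.base) (c : A)
    (z : V ⊗[k] W) :
    s.diag H t (right (H.tau r) c) z = ((s.bimod H).l r).rTensor W (s.diag H t c z) := by
  refine LinearMap.congr_fun (g := ((s.bimod H).l r).rTensor W ∘ₗ s.diag H t c)
    (t.tensor_ext_right fun v w b => ?_) z
  rw [LinearMap.comp_apply, diag_act_right, diag_act_right, H.T₃_tau]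
  refine LinearMap.congr_fun
    (f := TensorProduct.map (s.act v) (t.act w) ∘ₗ (right (H.tau r)).rTensor A)
    (g := ((s.bimod H).l r).rTensor W ∘ₗ TensorProduct.map (s.act v) (t.act w))
    (TensorProduct.ext' fun x y => ?_) _
  simp [bimod_l, mact_act]

/-- The bimodule structure of the module `V ⊗_R W` is given by the outer actions. -/
theorem tensor_bimod (H : RegWMB k A) (s : ModStr k A V) (t : ModStr k A W) :
    (s.tensor H t).bimod H = (s.bimod H).tensor (t.bimod H) := by
  refine BimodStr.ext_maps (fun r => LinearMap.congr_fun ((s.tensor H t).ext_span fun z c => ?_))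
    (fun r => LinearMap.congr_fun ((s.tensor H t).ext_span fun z c => ?_))
  · obtain ⟨z, rfl⟩ := proj_surjective _ _ z
    rw [bimod_l, mact_act, tensor_act_proj, tensor_act_proj, diag_tau]
    refine LinearMap.congr_fun (f := BalTensor.proj (s.bimod H) (t.bimod H) ∘ₗ
      ((s.bimod H).l r).rTensor W) (g := ((s.bimod H).tensor (t.bimod H)).l r ∘ₗ
      BalTensor.proj (s.bimod H) (t.bimod H)) (TensorProduct.ext' fun v w => ?_) _
    simp [BalTensor.proj_tmul]
  · obtain ⟨z, rfl⟩ := proj_surjective _ _ z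
    rw [bimod_r, mact_act, tensor_act_proj, tensor_act_proj, diag_right]
    refine LinearMap.congr_fun (f := BalTensor.proj (s.bimod H) (t.bimod H) ∘ₗ
      ((t.bimod H).r r).lTensor V) (g := ((s.bimod H).tensor (t.bimod H)).r r ∘ₗ
      BalTensor.proj (s.bimod H) (t.bimod H)) (TensorProduct.ext' fun v w => ?_) _
    simp [BalTensor.proj_tmul]

theorem tensor_act_tmul_right (H : RegWMB k A) (s : ModStr k A V) (t : ModStr k A W) (v : V)
    (w : W) (b c : A) : (s.tensor H t).act (BalTensor.tmul _ _ v (t.act w b)) c =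
      BalTensor.proj _ _ (TensorProduct.map (s.act v) (t.act w) (H.T₃ (c ⊗ₜ b))) := by
  rw [← diag_act_right, ← tensor_act_proj, BalTensor.proj_tmul]

theorem tensor_act_tmul_left (H : RegWMB k A) (s : ModStr k A V) (t : ModStr k A W) (v : V)
    (w : W) (a c : A) : (s.tensor H t).act (BalTensor.tmul _ _ (s.act v a) w) c =
      BalTensor.proj _ _ (TensorProduct.map (s.act v) (t.act w) (H.T₂ (a ⊗ₜ c))) := by
  rw [← diag_act_left, ← tensor_act_proj, BalTensor.proj_tmul]

/-- The tensor product over `R` of module maps is a module map. -/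
theorem map_act (H : RegWMB k A) {s : ModStr k A V} {t : ModStr k A W} {s' : ModStr k A V'}
    {t' : ModStr k A W'} {f : V →ₗ[k] V'} {g : W →ₗ[k] W'}
    (hf : ∀ v a, f (s.act v a) = s'.act (f v) a) (hg : ∀ w a, g (t.act w a) = t'.act (g w) a)
    {φ : BalTensor (s.bimod H) (t.bimod H) →ₗ[k] BalTensor (s'.bimod H) (t'.bimod H)}
    (hφ : ∀ v w, φ (BalTensor.tmul _ _ v w) = BalTensor.tmul _ _ (f v) (g w))
    (z : BalTensor (s.bimod H) (t.bimod H)) (c : A) :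
    φ ((s.tensor H t).act z c) = (s'.tensor H t').act (φ z) c := by
  obtain ⟨z, rfl⟩ := proj_surjective _ _ z
  have e (z : V ⊗[k] W) : φ (BalTensor.proj _ _ z) =
      BalTensor.proj _ _ (TensorProduct.map f g z) :=
    LinearMap.congr_fun (f := φ ∘ₗ BalTensor.proj _ _)
      (g := BalTensor.proj _ _ ∘ₗ TensorProduct.map f g) (TensorProduct.ext' hφ) z
  rw [tensor_act_proj, e, e, tensor_act_proj, map_diag H hf hg]

/-- The associativity constraint is a module map. -/
theorem assoc_act (H : RegWMB k A) {s : ModStr k A U} {t : ModStr k A V} {u : ModStr k A W}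
    {φ : BalTensor ((s.tensor H t).bimod H) (u.bimod H) →ₗ[k]
      BalTensor (s.bimod H) ((t.tensor H u).bimod H)}
    (hφ : ∀ x y z, φ (BalTensor.tmul _ _ (BalTensor.tmul _ _ x y) z) =
      BalTensor.tmul _ _ x (BalTensor.tmul _ _ y z))
    (z : BalTensor ((s.tensor H t).bimod H) (u.bimod H)) (c : A) :
    φ (((s.tensor H t).tensor H u).act z c) = (s.tensor H (t.tensor H u)).act (φ z) c := by
  refine LinearMap.congr_fun (f := φ ∘ₗ ((s.tensor H t).tensor H u).act.flip c)
    (g := (s.tensor H (t.tensor H u)).act.flip c ∘ₗ φ) (BalTensor.hom_ext₃ fun x y w => ?_) z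
  simp only [LinearMap.comp_apply, LinearMap.flip_apply, hφ]
  let F : U →ₗ[k] BalTensor ((s.tensor H t).bimod H) (u.bimod H) :=
    (BalTensor.tmul _ _).flip w ∘ₗ (BalTensor.tmul (s.bimod H) (t.bimod H)).flip y
  let G : U →ₗ[k] BalTensor (s.bimod H) ((t.tensor H u).bimod H) :=
    (BalTensor.tmul _ _).flip (BalTensor.tmul (t.bimod H) (u.bimod H) y w)
  refine LinearMap.congr_fun (f := φ ∘ₗ ((s.tensor H t).tensor H u).act.flip c ∘ₗ F)
    (g := (s.tensor H (t.tensor H u)).act.flip c ∘ₗ G) (s.ext_span fun x a => ?_) x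
  let F : W →ₗ[k] BalTensor ((s.tensor H t).bimod H) (u.bimod H) :=
    BalTensor.tmul _ _ (BalTensor.tmul (s.bimod H) (t.bimod H) (s.act x a) y)
  let G : W →ₗ[k] BalTensor (s.bimod H) ((t.tensor H u).bimod H) :=
    BalTensor.tmul _ _ (s.act x a) ∘ₗ (BalTensor.tmul (t.bimod H) (u.bimod H) y)
  refine LinearMap.congr_fun (f := φ ∘ₗ ((s.tensor H t).tensor H u).act.flip c ∘ₗ F)
    (g := (s.tensor H (t.tensor H u)).act.flip c ∘ₗ G) (u.ext_span fun w b => ?_) w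
  simp only [LinearMap.comp_apply, LinearMap.flip_apply, F, G]
  rw [tensor_act_tmul_right, tensor_act_tmul_left]
  -- the map `Ψ` sends `(p ⊗ q) ⊗ r` to `x · p ⊗ (y · q ⊗ w · r)`; on elements `x · a ⊗ y ⊗ w · b`
  -- both sides are the value of `Ψ` at `a c₁ ⊗ c₂ ⊗ b c₃`
  let B : A →ₗ[k] A →ₗ[k] A →ₗ[k] BalTensor (s.bimod H) ((t.tensor H u).bimod H) :=
    (((LinearMap.llcomp k A _ _).compl₁₂ (BalTensor.tmul _ _)
      (((BalTensor.tmul (t.bimod H) (u.bimod H) ∘ₗ t.act y)).compl₂ (u.act w))) ∘ₗ s.act x)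
  let Ψ : (A ⊗[k] A) ⊗[k] A →ₗ[k] BalTensor (s.bimod H) ((t.tensor H u).bimod H) :=
    TensorProduct.lift (TensorProduct.lift B)
  have e1 (ζ : A ⊗[k] A) : φ (BalTensor.proj _ _ (TensorProduct.map ((s.tensor H t).act
      (BalTensor.tmul _ _ (s.act x a) y)) (u.act w) ζ)) =
      Ψ ((TensorProduct.curry H.T₂ a).rTensor A ζ) := by
    refine LinearMap.congr_fun (f := φ ∘ₗ BalTensor.proj _ _ ∘ₗ TensorProduct.map
      ((s.tensor H t).act (BalTensor.tmul _ _ (s.act x a) y)) (u.act w))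
      (g := Ψ ∘ₗ (TensorProduct.curry H.T₂ a).rTensor A) (TensorProduct.ext' fun p q => ?_) ζ
    simp only [LinearMap.comp_apply, TensorProduct.map_tmul, LinearMap.rTensor_tmul,
      TensorProduct.curry_apply, BalTensor.proj_tmul, tensor_act_tmul_left]
    refine LinearMap.congr_fun (f := φ ∘ₗ (BalTensor.tmul _ _).flip (u.act w q) ∘ₗ
      BalTensor.proj _ _ ∘ₗ TensorProduct.map (s.act x) (t.act y))
      (g := Ψ ∘ₗ (TensorProduct.mk k _ A).flip q) (TensorProduct.ext' fun p' q' => ?_) _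
    simp [BalTensor.proj_tmul, hφ, Ψ, B]
  have e2 (ζ : A ⊗[k] A) : BalTensor.proj (s.bimod H) ((t.tensor H u).bimod H)
      (TensorProduct.map (s.act x) ((t.tensor H u).act (BalTensor.tmul _ _ y (u.act w b))) ζ) =
      Ψ ((TensorProduct.assoc k A A A).symm
        ((((TensorProduct.curry H.T₃).flip b)).lTensor A ζ)) := by
    refine LinearMap.congr_fun (f := BalTensor.proj _ _ ∘ₗ TensorProduct.map (s.act x)
      ((t.tensor H u).act (BalTensor.tmul _ _ y (u.act w b))))
      (g := Ψ ∘ₗ (TensorProduct.assoc k A A A).symm.toLinearMap ∘ₗ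
        ((TensorProduct.curry H.T₃).flip b).lTensor A) (TensorProduct.ext' fun p q => ?_) ζ
    simp only [LinearMap.comp_apply, TensorProduct.map_tmul, LinearMap.lTensor_tmul,
      TensorProduct.curry_apply, BalTensor.proj_tmul, tensor_act_tmul_right, LinearMap.flip_apply]
    refine LinearMap.congr_fun (f := BalTensor.tmul _ _ (s.act x p) ∘ₗ
      BalTensor.proj _ _ ∘ₗ TensorProduct.map (t.act y) (u.act w))
      (g := Ψ ∘ₗ (TensorProduct.assoc k A A A).symm.toLinearMap ∘ₗ (TensorProduct.mk k A _) p)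
      (TensorProduct.ext' fun p' q' => ?_) _
    simp [BalTensor.proj_tmul, Ψ, B]
  rw [e1, e2, H.T₂_T₃]

/-! ### The unit module -/

/-- `⊓ᴿ(b c)` depends only on `⊓ᴿ(b)`, since it is determined by the functional `ε(b c -)`. -/
theorem exists_unitAct (H : RegWMB k A) :
    ∃ f : H.base →ₗ[k] A →ₗ[k] H.base, ∀ b c, f (H.piR' b) c = H.piR' (b * c) := by
  obtain ⟨g, hg⟩ := H.piR'.exists_rightInverse_of_surjective
    (LinearMap.range_eq_top.2 H.piR'_surjective)
  refine ⟨(LinearMap.mul k A ∘ₗ g).compr₂ H.piR', fun b c => Subtype.ext (H.piR_eq_of fun y => ?_)⟩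
  simp only [LinearMap.comp_apply, LinearMap.mul_apply', mul_assoc]
  exact H.ε_mul_eq_of_piR (congrArg Subtype.val (LinearMap.congr_fun hg (H.piR' b))) _

/-- The base algebra as an `A`-module, via `⊓ᴿ(b) · c = ⊓ᴿ(b c)`. -/
def unit (H : RegWMB k A) : ModStr k A H.base where
  act := (exists_unitAct H).choose
  act_mul r a b := by
    obtain ⟨c, rfl⟩ := H.piR'_surjective r
    simp only [(exists_unitAct H).choose_spec, mul_assoc]
  idempotent := by
    rw [← Submodule.ker_mkQ (Submodule.span k _), LinearMap.ker_eq_top]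
    ext r
    obtain ⟨c, rfl⟩ := H.piR'_surjective r
    refine LinearMap.congr_fun (f := Submodule.mkQ _ ∘ₗ H.piR') (g := 0)
      (H.ext_mul fun a b => ?_) c
    refine (Submodule.Quotient.mk_eq_zero _).2 (Submodule.subset_span ⟨H.piR' a, b, ?_⟩)
    rw [(exists_unitAct H).choose_spec]
  nondeg r h := by
    obtain ⟨c, rfl⟩ := H.piR'_surjective r
    rw [← map_zero H.piR']
    refine Subtype.ext (H.piR_eq_of fun y => ?_)
    refine LinearMap.congr_fun (f := H.ε ∘ₗ lm k c) (g := H.ε ∘ₗ lm k 0)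
      (H.ext_mul fun a b => ?_) y
    have := h a
    rw [(exists_unitAct H).choose_spec, ← map_zero H.piR'] at this
    have := H.ε_mul_eq_of_piR (congrArg Subtype.val this) b
    simpa [mul_assoc] using this

theorem unit_act (H : RegWMB k A) (b c : A) : (unit H).act (H.piR' b) c = H.piR' (b * c) :=
  (exists_unitAct H).choose_spec b c

theorem unit_bimod (H : RegWMB k A) : (unit H).bimod H = BimodStr.regular k H.base := by
  refine BimodStr.ext_maps (fun r => LinearMap.congr_fun ((unit H).ext_span fun z c => ?_))
    (fun r => LinearMap.congr_fun ((unit H).ext_span fun z c => ?_))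
  · obtain ⟨b, rfl⟩ := H.piR'_surjective z
    obtain ⟨d, rfl⟩ := H.piR'_surjective r
    rw [bimod_l, mact_act, unit_act, unit_act, BimodStr.regular_l, H.tau_piR',
      ← H.right_mul_apply]
    exact Subtype.ext (H.piR_piBarL d (b * c))
  · obtain ⟨b, rfl⟩ := H.piR'_surjective z
    rw [bimod_r, mact_act, unit_act, unit_act, BimodStr.regular_r, ← H.piR'_mul,
      H.right_mul_apply]

/-- The left unit constraint is a module map. -/
theorem actL_act (H : RegWMB k A) {s : ModStr k A V}
    {φ : BalTensor ((unit H).bimod H) (s.bimod H) →ₗ[k] V}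
    (hφ : ∀ r v, φ (BalTensor.tmul _ _ r v) = (s.bimod H).l r v)
    (z : BalTensor ((unit H).bimod H) (s.bimod H)) (c : A) :
    φ (((unit H).tensor H s).act z c) = s.act (φ z) c := by
  refine LinearMap.congr_fun (f := φ ∘ₗ ((unit H).tensor H s).act.flip c)
    (g := s.act.flip c ∘ₗ φ) (BalTensor.hom_ext fun r v => ?_) z
  simp only [LinearMap.comp_apply, LinearMap.flip_apply, hφ]
  obtain ⟨b, rfl⟩ := H.piR'_surjective r
  refine LinearMap.congr_fun (f := φ ∘ₗ ((unit H).tensor H s).act.flip c ∘ₗ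
    BalTensor.tmul ((unit H).bimod H) (s.bimod H) (H.piR' b))
    (g := s.act.flip c ∘ₗ (s.bimod H).l (H.piR' b)) (s.ext_span fun v a => ?_) v
  simp only [LinearMap.comp_apply, LinearMap.flip_apply, tensor_act_tmul_right]
  rw [bimod_l, mact_act, ← s.act_mul, H.tau_piR', ← mul_left, H.piBarL_left,
    ← LinearMap.mul_apply' (R := k) a, ← sliceL_lTensor, ← H.rm_T₃]
  have e := H.E₂_lm_left b (H.T₃ (c ⊗ₜ a))
  rw [H.E₂_T₃] at e
  rw [← e, sliceL]
  refine LinearMap.congr_fun (f := φ ∘ₗ BalTensor.proj _ _ ∘ₗ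
    TensorProduct.map ((unit H).act (H.piR' b)) (s.act v))
    (g := s.act v ∘ₗ sliceL A H.ε ∘ₗ H.E₂ ∘ₗ (lm k b).rTensor A)
    (TensorProduct.ext' fun p q => ?_) _
  simp only [LinearMap.comp_apply, TensorProduct.map_tmul, BalTensor.proj_tmul, hφ, unit_act,
    bimod_l, mact_act, H.tau_piR', H.piBarL_right, LinearMap.rTensor_tmul, LinearMap.mul_apply']

/-- The right unit constraint is a module map. -/
theorem actR_act (H : RegWMB k A) {s : ModStr k A V}
    {φ : BalTensor (s.bimod H) ((unit H).bimod H) →ₗ[k] V}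
    (hφ : ∀ v r, φ (BalTensor.tmul _ _ v r) = (s.bimod H).r r v)
    (z : BalTensor (s.bimod H) ((unit H).bimod H)) (c : A) :
    φ ((s.tensor H (unit H)).act z c) = s.act (φ z) c := by
  refine LinearMap.congr_fun (f := φ ∘ₗ (s.tensor H (unit H)).act.flip c)
    (g := s.act.flip c ∘ₗ φ) (BalTensor.hom_ext fun v r => ?_) z
  simp only [LinearMap.comp_apply, LinearMap.flip_apply, hφ]
  obtain ⟨b, rfl⟩ := H.piR'_surjective r
  refine LinearMap.congr_fun (f := φ ∘ₗ (s.tensor H (unit H)).act.flip c ∘ₗ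
    (BalTensor.tmul (s.bimod H) ((unit H).bimod H)).flip (H.piR' b))
    (g := s.act.flip c ∘ₗ (s.bimod H).r (H.piR' b)) (s.ext_span fun v a => ?_) v
  simp only [LinearMap.comp_apply, LinearMap.flip_apply, tensor_act_tmul_left]
  rw [bimod_r, mact_act, ← s.act_mul, ← mul_left, RegWMB.piR'_coe, H.piR_left,
    ← LinearMap.mul_apply' (R := k) a, ← sliceR_rTensor', H.rm_T₃]
  have e := H.E₂_lm_right b (H.T₂ (a ⊗ₜ c))
  rw [H.E₂_T₂] at e
  rw [← e, sliceR]
  refine LinearMap.congr_fun (f := φ ∘ₗ BalTensor.proj _ _ ∘ₗ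
    TensorProduct.map (s.act v) ((unit H).act (H.piR' b)))
    (g := s.act v ∘ₗ sliceR A H.ε ∘ₗ H.E₂ ∘ₗ (lm k b).lTensor A)
    (TensorProduct.ext' fun p q => ?_) _
  simp only [LinearMap.comp_apply, TensorProduct.map_tmul, BalTensor.proj_tmul, hφ, unit_act,
    bimod_r, mact_act, RegWMB.piR'_coe, H.piR_right, LinearMap.lTensor_tmul, LinearMap.mul_apply']

end ModStr

namespace ComodStr

variable {k : Type u} {A M N X : Type v} {_ : Field k} {iA : NonUnitalRing A} {_ : Module k A}
  {i1 : IsScalarTower k A A} {i2 : SMulCommClass k A A} {H : RegWMB k A}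
  [AddCommGroup M] [Module k M] [AddCommGroup N] [Module k N] [AddCommGroup X] [Module k X]

/-! ### The opposite comodule -/

/-- `λ(m ⊗ b c) = λ(m ⊗ b) (1 ⊗ c)` for a multiplier `c`. -/
theorem lam_right (s : ComodStr H M) (w : Multiplier k A) (m : M) (b : A) :
    s.lam (m ⊗ₜ right w b) = (right w).lTensor M (s.lam (m ⊗ₜ b)) := by
  refine H.eq_of_lTensor_lm fun a => ?_
  have e : rm k (right w b) = right w ∘ₗ rm k b := by ext; simp [H.right_mul_apply]
  rw [s.compat, ← LinearMap.lTensor_comp_apply]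
  have e' : lm k a ∘ₗ right w = right w ∘ₗ lm k a := by ext; simp [H.right_mul_apply]
  rw [e', LinearMap.lTensor_comp_apply, s.compat, ← LinearMap.lTensor_comp_apply, ← e]

theorem lam_rm (s : ComodStr H M) (m : M) (b c : A) :
    s.lam (m ⊗ₜ (b * c)) = (rm k c).lTensor M (s.lam (m ⊗ₜ b)) := by
  refine H.eq_of_lTensor_lm fun a => ?_
  rw [s.compat, RegWMB.lm_rm_lTensor, s.compat, ← LinearMap.lTensor_comp_apply, ← RegWMB.rm_mul]

/-- `z ↦ λ₁₂ λ₁₃ (m ⊗ z)` -/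
def lam₂ (s : ComodStr H M) (m : M) : A ⊗[k] A →ₗ[k] (M ⊗[k] A) ⊗[k] A :=
  s.lam.rTensor A ∘ₗ leg13 A s.lam ∘ₗ (TensorProduct.mk k M A m).rTensor A

/-- `z ↦ ρ₁₂ ρ₁₃ (m ⊗ z)` -/
def rho₂ (s : ComodStr H M) (m : M) : A ⊗[k] A →ₗ[k] (M ⊗[k] A) ⊗[k] A :=
  s.rho.rTensor A ∘ₗ leg13 A s.rho ∘ₗ (TensorProduct.mk k M A m).rTensor A

theorem lam₂_tmul (s : ComodStr H M) (m : M) (a b : A) :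
    s.lam₂ m (a ⊗ₜ b) = (s.lam ∘ₗ (TensorProduct.mk k M A).flip a).rTensor A (s.lam (m ⊗ₜ b)) := by
  simp [lam₂, leg13_tmul, LinearMap.rTensor_comp_apply]

theorem rho₂_tmul (s : ComodStr H M) (m : M) (a b : A) :
    s.rho₂ m (a ⊗ₜ b) = (s.rho ∘ₗ (TensorProduct.mk k M A).flip a).rTensor A (s.rho (m ⊗ₜ b)) := by
  simp [rho₂, leg13_tmul, LinearMap.rTensor_comp_apply]

theorem lam₂_T₁ (s : ComodStr H M) (m : M) (a b : A) :
    s.lam₂ m (H.T₁ (a ⊗ₜ b)) = leg23 M H.T₁ (s.lam (m ⊗ₜ a) ⊗ₜ b) := by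
  have h := LinearMap.congr_fun s.coassoc ((m ⊗ₜ a) ⊗ₜ b)
  simpa [leg23_tmul, lam₂] using h

theorem lam₂_E₁ (s : ComodStr H M) (m : M) (z : A ⊗[k] A) :
    s.lam₂ m (H.E₁ z) = s.lam₂ m z := by
  refine LinearMap.congr_fun (f := s.lam₂ m ∘ₗ H.E₁) (TensorProduct.ext' fun a b => ?_) z
  have h := LinearMap.congr_fun s.normal ((m ⊗ₜ a) ⊗ₜ b)
  simpa [leg23_tmul, lam₂] using h

theorem lam₂_rm (s : ComodStr H M) (m : M) (c : A) (z : A ⊗[k] A) :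
    s.lam₂ m ((rm k c).rTensor A z) = ((rm k c).lTensor M).rTensor A (s.lam₂ m z) := by
  refine LinearMap.congr_fun (f := s.lam₂ m ∘ₗ (rm k c).rTensor A)
    (g := ((rm k c).lTensor M).rTensor A ∘ₗ s.lam₂ m) (TensorProduct.ext' fun a b => ?_) z
  simp only [LinearMap.comp_apply, LinearMap.rTensor_tmul, lam₂_tmul]
  rw [← LinearMap.rTensor_comp_apply]
  congr 2
  ext m
  simp [lam_rm]

/-- The product of `A ⊗ A`. -/
abbrev mul₂ (k : Type u) (A : Type v) [Field k] [NonUnitalRing A] [Module k A]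
    [IsScalarTower k A A] [SMulCommClass k A A] : A ⊗[k] A →ₗ[k] A ⊗[k] A →ₗ[k] A ⊗[k] A :=
  TensorProduct.map₂ (LinearMap.mul k A) (LinearMap.mul k A)

theorem leg23_mul₂_left (x y : A) (z : (M ⊗[k] A) ⊗[k] A) :
    leg23 M (mul₂ k A (x ⊗ₜ y)) z =
      ((lm k x).lTensor M).rTensor A ((lm k y).lTensor (M ⊗[k] A) z) :=
  LinearMap.congr_fun (g := ((lm k x).lTensor M).rTensor A ∘ₗ (lm k y).lTensor (M ⊗[k] A))
    (TensorProduct.ext_threefold fun _ _ _ => by simp [leg23_tmul]) z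

theorem leg23_mul₂_right (x y : A) (z : (M ⊗[k] A) ⊗[k] A) :
    leg23 M ((mul₂ k A).flip (x ⊗ₜ y)) z =
      ((rm k x).lTensor M).rTensor A ((rm k y).lTensor (M ⊗[k] A) z) :=
  LinearMap.congr_fun (g := ((rm k x).lTensor M).rTensor A ∘ₗ (rm k y).lTensor (M ⊗[k] A))
    (TensorProduct.ext_threefold fun _ _ _ => by simp [leg23_tmul]) z

/-- Linear dependence of `leg23` on the map. -/
def leg23Hom (M : Type v) [AddCommGroup M] [Module k M] :
    (A ⊗[k] A →ₗ[k] A ⊗[k] A) →ₗ[k] (M ⊗[k] A) ⊗[k] A →ₗ[k] (M ⊗[k] A) ⊗[k] A :=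
  (LinearMap.llcomp k _ _ _ (TensorProduct.assoc k M A A).symm.toLinearMap) ∘ₗ
    (LinearMap.lcomp k _ (TensorProduct.assoc k M A A).toLinearMap) ∘ₗ LinearMap.lTensorHom M

theorem leg23Hom_apply (f : A ⊗[k] A →ₗ[k] A ⊗[k] A) : leg23Hom M f = leg23 M f := rfl

/-- `(1 ⊗ w) λ₁₂ λ₁₃ (m ⊗ z) = (ρ₁₂ ρ₁₃ (m ⊗ w)) (1 ⊗ z)` -/
theorem compat₂ (s : ComodStr H M) (m : M) (w z : A ⊗[k] A) :
    leg23 M (mul₂ k A w) (s.lam₂ m z) = leg23 M ((mul₂ k A).flip z) (s.rho₂ m w) := by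
  simp only [← leg23Hom_apply]
  refine LinearMap.congr_fun₂ (f := (leg23Hom M ∘ₗ mul₂ k A).compl₂ (s.lam₂ m))
    (g := ((leg23Hom M ∘ₗ (mul₂ k A).flip).compl₂ (s.rho₂ m)).flip)
    (TensorProduct.ext' fun x y => TensorProduct.ext' fun a b => ?_) w z
  simp only [LinearMap.compl₂_apply, LinearMap.comp_apply, LinearMap.flip_apply, leg23Hom_apply]
  rw [leg23_mul₂_left, leg23_mul₂_right, lam₂_tmul, rho₂_tmul, ← rTensor_lTensor, s.compat,
    ← rTensor_lTensor, ← LinearMap.rTensor_comp_apply, ← LinearMap.rTensor_comp_apply]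
  congr 2
  ext n
  simp [s.compat]

/-- The right multiplications by elements of `A ⊗ A` separate the elements of `M ⊗ A ⊗ A`. -/
theorem leg23_mul₂_separates {z z' : (M ⊗[k] A) ⊗[k] A} (H : RegWMB k A)
    (h : ∀ w, leg23 M ((mul₂ k A).flip w) z = leg23 M ((mul₂ k A).flip w) z') : z = z' := by
  refine H.eq_of_lTensor_rm fun y => ?_
  refine eq_of_rTensor (fun x => (rm k x).lTensor M) (fun v hv => ?_) fun x => ?_
  · exact H.eq_of_lTensor_rm fun x => by rw [hv, map_zero]
  · rw [← leg23_mul₂_right, ← leg23_mul₂_right, h]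

theorem leg23_comp (f g : A ⊗[k] A →ₗ[k] A ⊗[k] A) (z : (M ⊗[k] A) ⊗[k] A) :
    leg23 M f (leg23 M g z) = leg23 M (f ∘ₗ g) z := by
  simp [leg23, LinearMap.lTensor_comp_apply]

theorem mul₂_lm (a : A) (z w : A ⊗[k] A) :
    mul₂ k A ((lm k a).rTensor A z) w = (lm k a).rTensor A (mul₂ k A z w) :=
  LinearMap.congr_fun₂ (f := mul₂ k A ∘ₗ (lm k a).rTensor A)
    (g := (mul₂ k A).compr₂ ((lm k a).rTensor A))
    (TensorProduct.ext' fun _ _ => TensorProduct.ext' fun _ _ => by simp [mul_assoc]) z w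

theorem mul₂_rm (a : A) (z w : A ⊗[k] A) :
    mul₂ k A z ((rm k a).rTensor A w) = (rm k a).rTensor A (mul₂ k A z w) :=
  LinearMap.congr_fun₂ (f := (mul₂ k A).compl₂ ((rm k a).rTensor A))
    (g := (mul₂ k A).compr₂ ((rm k a).rTensor A))
    (TensorProduct.ext' fun _ _ => TensorProduct.ext' fun _ _ => by simp [mul_assoc]) z w

/-- `((1 ⊗ y) Δ(x)) (Δ(p) (1 ⊗ v)) = (1 ⊗ y) Δ(x p) (1 ⊗ v)` -/
theorem T₃_mul_T₁ (H : RegWMB k A) (x y p v : A) :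
    mul₂ k A (H.T₃ (x ⊗ₜ y)) (H.T₁ (p ⊗ₜ v)) = (lm k y).lTensor A (H.T₁ ((x * p) ⊗ₜ v)) := by
  refine H.eq_of_rTensor_lm fun a => H.eq_of_rTensor_rm fun q => ?_
  have h := LinearMap.congr_fun (H.wmb.Δ_mul x p) (q ⊗ₜ v)
  rw [← mul₂_lm, ← mul₂_rm, ← H.ΔR_tmul', ← H.ΔL_tmul]
  refine (H.Δ_compat x _ _).symm.trans ?_
  refine (congrArg _ h).symm.trans ?_
  rw [RegWMB.map₂_tmul_left]
  refine (congrArg (fun t => (lm k a).rTensor A ((lm k y).lTensor A t))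
    (H.ΔL_tmul (x * p) q v)).trans ?_
  rw [← rTensor_lTensor, RegWMB.lm_rm_rTensor]

theorem leg23_E₁_lam₂ (s : ComodStr H M) (m : M) (z : A ⊗[k] A) :
    leg23 M H.E₁ (s.lam₂ m z) = s.lam₂ m z := by
  rw [← lam₂_E₁]
  refine H.E₁_induction (f := leg23 M H.E₁ ∘ₗ s.lam₂ m) (fun p x => ?_) z
  refine LinearMap.congr_fun (f := (leg23 M H.E₁ ∘ₗ s.lam₂ m) ∘ₗ H.ΔL p)
    (g := s.lam₂ m ∘ₗ H.ΔL p) (TensorProduct.ext' fun u v => ?_) x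
  have e (t : (M ⊗[k] A) ⊗[k] A) : leg23 M H.E₁ (((rm k u).lTensor M).rTensor A t) =
      ((rm k u).lTensor M).rTensor A (leg23 M H.E₁ t) := by
    have h : ((rm k u).lTensor M).rTensor A = leg23 M ((rm k u).rTensor A) := by
      refine TensorProduct.ext_threefold fun _ _ _ => ?_
      simp [leg23_tmul]
    rw [h, leg23_comp, leg23_comp]
    congr 2
    ext a b
    simp [← H.E₁_rm_left]
  rw [LinearMap.comp_apply, LinearMap.comp_apply, LinearMap.comp_apply, H.ΔL_tmul, lam₂_rm,
    lam₂_T₁, e, leg23_comp]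
  congr 3
  exact LinearMap.ext H.E₁_T₁

/-- The normality axiom for `ρ`. It follows from that for `λ` by the compatibility of the two
maps. -/
theorem rho₂_E₂ (s : ComodStr H M) (m : M) (z : A ⊗[k] A) :
    s.rho₂ m (H.E₂ z) = s.rho₂ m z := by
  refine leg23_mul₂_separates H fun w => ?_
  rw [← compat₂, ← compat₂]
  have h : mul₂ k A (H.E₂ z) = mul₂ k A z ∘ₗ H.E₁ := LinearMap.ext fun y => (H.wmb.E_mult z y).symm
  rw [h, ← leg23_comp, leg23_E₁_lam₂]

/-- The coassociativity axiom for `ρ`. Multiplied on the right by the values of `Δ`, which span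
`E (A ⊗ A)`, it becomes the coassociativity of `λ`. -/
theorem rho₂_T₃ (s : ComodStr H M) (m : M) (x y : A) :
    s.rho₂ m (H.T₃ (x ⊗ₜ y)) = leg23 M H.T₃ (s.rho (m ⊗ₜ x) ⊗ₜ y) := by
  refine leg23_mul₂_separates H fun z => ?_
  have h1 : (mul₂ k A).flip z ∘ₗ H.T₃ = (mul₂ k A).flip (H.E₁ z) ∘ₗ H.T₃ := LinearMap.ext fun t => by
    have h := H.wmb.E_mult (H.T₃ t) z
    rw [H.E₂_T₃] at h
    exact h.symm
  rw [← compat₂, ← lam₂_E₁, leg23_comp, h1, ← leg23Hom_apply, ← leg23Hom_apply]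
  refine H.E₁_induction (f := leg23Hom M (mul₂ k A (H.T₃ (x ⊗ₜ y))) ∘ₗ s.lam₂ m)
    (g := (leg23Hom M).flip (s.rho (m ⊗ₜ x) ⊗ₜ y) ∘ₗ
      (LinearMap.lcomp k (A ⊗[k] A) H.T₃ ∘ₗ (mul₂ k A).flip)) (fun p w => ?_) z
  refine LinearMap.congr_fun (f := (leg23Hom M (mul₂ k A (H.T₃ (x ⊗ₜ y))) ∘ₗ s.lam₂ m) ∘ₗ H.ΔL p)
    (g := ((leg23Hom M).flip (s.rho (m ⊗ₜ x) ⊗ₜ y) ∘ₗ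
      (LinearMap.lcomp k (A ⊗[k] A) H.T₃ ∘ₗ (mul₂ k A).flip)) ∘ₗ H.ΔL p)
    (TensorProduct.ext' fun u v => ?_) w
  simp only [LinearMap.comp_apply, LinearMap.flip_apply, LinearMap.lcomp_apply', leg23Hom_apply]
  have hu : ((rm k u).lTensor M).rTensor A = leg23 M ((rm k u).rTensor A) :=
    TensorProduct.ext_threefold fun _ _ _ => by simp [leg23_tmul]
  have hu1 : mul₂ k A (H.T₃ (x ⊗ₜ y)) ∘ₗ (rm k u).rTensor A =
      (rm k u).rTensor A ∘ₗ mul₂ k A (H.T₃ (x ⊗ₜ y)) := LinearMap.ext fun t => mul₂_rm u _ t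
  have hu2 (t : A ⊗[k] A) : (mul₂ k A).flip ((rm k u).rTensor A t) ∘ₗ H.T₃ =
      (rm k u).rTensor A ∘ₗ (mul₂ k A).flip t ∘ₗ H.T₃ := LinearMap.ext fun t' => mul₂_rm u _ t
  rw [H.ΔL_tmul, lam₂_rm, lam₂_T₁, hu, leg23_comp, hu1, hu2, ← leg23_comp, ← leg23_comp]
  congr 1
  have e1 (t : M ⊗[k] A) : leg23 M (mul₂ k A (H.T₃ (x ⊗ₜ y)) ∘ₗ H.T₁) (t ⊗ₜ v) =
      leg23 M ((lm k y).lTensor A ∘ₗ H.T₁) ((lm k x).lTensor M t ⊗ₜ v) :=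
    LinearMap.congr_fun (f := leg23 M (mul₂ k A (H.T₃ (x ⊗ₜ y)) ∘ₗ H.T₁) ∘ₗ
      (TensorProduct.mk k _ A).flip v) (g := leg23 M ((lm k y).lTensor A ∘ₗ H.T₁) ∘ₗ
      (TensorProduct.mk k _ A).flip v ∘ₗ (lm k x).lTensor M)
      (TensorProduct.ext' fun n q => by simp [leg23_tmul, T₃_mul_T₁]) t
  have e2 (t : M ⊗[k] A) : leg23 M ((mul₂ k A).flip (H.T₁ (p ⊗ₜ v)) ∘ₗ H.T₃) (t ⊗ₜ y) =
      leg23 M ((lm k y).lTensor A ∘ₗ H.T₁) ((rm k p).lTensor M t ⊗ₜ v) :=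
    LinearMap.congr_fun (f := leg23 M ((mul₂ k A).flip (H.T₁ (p ⊗ₜ v)) ∘ₗ H.T₃) ∘ₗ
      (TensorProduct.mk k _ A).flip y) (g := leg23 M ((lm k y).lTensor A ∘ₗ H.T₁) ∘ₗ
      (TensorProduct.mk k _ A).flip v ∘ₗ (rm k p).lTensor M)
      (TensorProduct.ext' fun n q => by simp [leg23_tmul, T₃_mul_T₁]) t
  rw [leg23_comp, e1, e2, s.compat]

/-- Fullness of the comodule, as a cancellation rule. -/
theorem lam_ext (s : ComodStr H M) {f g : M →ₗ[k] X}
    (h : ∀ m a, f.rTensor A (s.lam (m ⊗ₜ a)) = g.rTensor A (s.lam (m ⊗ₜ a))) : f = g := by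
  refine LinearMap.ext_on s.full ?_
  rintro _ ⟨m, a, ω, rfl⟩
  rw [← sliceR_rTensor', h, sliceR_rTensor']

/-- Fullness in terms of `ρ`: the slices of `λ` and `ρ` span the same space by compatibility. -/
theorem rho_full (s : ComodStr H M) :
    Submodule.span k {x | ∃ m a, ∃ ω : A →ₗ[k] k, x = sliceR M ω (s.rho (m ⊗ₜ a))} = ⊤ := by
  set S := Submodule.span k {x | ∃ m a, ∃ ω : A →ₗ[k] k, x = sliceR M ω (s.rho (m ⊗ₜ a))}
  rw [← Submodule.ker_mkQ S, LinearMap.ker_eq_top]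
  refine s.lam_ext fun m a => H.eq_of_lTensor_lm fun c => ?_
  rw [← rTensor_lTensor, s.compat, rTensor_lTensor, (RegWMB.mkQ_rTensor_eq_zero_iff S _).2]
  · simp
  · exact fun ω => Submodule.subset_span ⟨m, c, ω, rfl⟩

/-- The opposite comodule: the maps `λ` and `ρ` exchange their roles. -/
abbrev opp (s : ComodStr H M) : @ComodStr k A _ (opRing A) _ opTower opComm H.opp M _ _ :=
  @ComodStr.mk k A _ (opRing A) _ opTower opComm H.opp M _ _ s.rho s.lam
    (fun m a b => (s.compat m b a).symm)
    (TensorProduct.ext_threefold fun m a b => by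
      have h := s.rho₂_T₃ m a b
      simpa [leg23_tmul, rho₂] using h)
    (TensorProduct.ext_threefold fun m a b => by
      have h := s.rho₂_E₂ m (a ⊗ₜ b)
      simpa [leg23_tmul, rho₂] using h)
    s.rho_full

/-! ### The actions of the base algebra -/

/-- `λ(m ◃ r ⊗ x) = λ(m ⊗ r x)` for `r = ⊓̄ᴿ(a)` -/
theorem lam_slice (s : ComodStr H M) (m : M) (a x : A) :
    s.lam (sliceR M H.ε (s.lam (m ⊗ₜ a)) ⊗ₜ x) =
      s.lam (m ⊗ₜ sliceR A H.ε (H.E₁ (x ⊗ₜ a))) := by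
  have h1 (z : A ⊗[k] A) : sliceR (M ⊗[k] A) H.ε (s.lam₂ m (H.E₁ z)) =
      s.lam (m ⊗ₜ sliceR A H.ε (H.E₁ z)) := by
    refine H.E₁_induction (f := sliceR (M ⊗[k] A) H.ε ∘ₗ s.lam₂ m)
      (g := s.lam ∘ₗ TensorProduct.mk k M A m ∘ₗ sliceR A H.ε) (fun p w => ?_) z
    refine LinearMap.congr_fun (f := (sliceR (M ⊗[k] A) H.ε ∘ₗ s.lam₂ m) ∘ₗ H.ΔL p)
      (g := (s.lam ∘ₗ TensorProduct.mk k M A m ∘ₗ sliceR A H.ε) ∘ₗ H.ΔL p)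
      (TensorProduct.ext' fun u v => ?_) w
    simp only [LinearMap.comp_apply, TensorProduct.mk_apply]
    rw [H.ΔL_tmul, lam₂_rm, lam₂_T₁, sliceR_rTensor', sliceR_rTensor', LinearMap.flip_apply,
      LinearMap.mul_apply', lam_rm, ← H.piBarR_right, lam_right, sliceR_leg23]
    rfl
  have h2 : sliceR (M ⊗[k] A) H.ε (s.lam₂ m (x ⊗ₜ a)) =
      s.lam (sliceR M H.ε (s.lam (m ⊗ₜ a)) ⊗ₜ x) := by
    rw [lam₂_tmul, sliceR_rTensor']; rfl
  rw [← h2, ← lam₂_E₁, h1]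

theorem rho_slice (s : ComodStr H M) (m : M) (a x : A) :
    s.rho (sliceR M H.ε (s.rho (m ⊗ₜ a)) ⊗ₜ x) =
      s.rho (m ⊗ₜ sliceR A H.ε (H.E₂ (x ⊗ₜ a))) := lam_slice s.opp m a x

/-- `λ(r ▹ m ⊗ x) = (1 ⊗ r) λ(m ⊗ x)` for `r = ⊓ᴿ(c)` -/
theorem lam_slice_rho (s : ComodStr H M) (m : M) (c x : A) :
    s.lam (sliceR M H.ε (s.rho (m ⊗ₜ c)) ⊗ₜ x) =
      (left (H.piR c)).lTensor M (s.lam (m ⊗ₜ x)) := by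
  refine H.eq_of_lTensor_lm fun y => ?_
  rw [s.compat, rho_slice, ← s.compat, ← H.piR_right,
    show LinearMap.mul k A (right (H.piR c) y) = lm k y ∘ₗ left (H.piR c) from RegWMB.lm_right _ _,
    LinearMap.lTensor_comp_apply]

/-- `ρ(m ◃ r ⊗ x) = ρ(m ⊗ x) (1 ⊗ r)` for `r = ⊓̄ᴿ(c)` -/
theorem rho_slice_lam (s : ComodStr H M) (m : M) (c x : A) :
    s.rho (sliceR M H.ε (s.lam (m ⊗ₜ c)) ⊗ₜ x) =
      (right (H.piBarR c)).lTensor M (s.rho (m ⊗ₜ x)) := by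
  refine H.eq_of_lTensor_rm fun y => ?_
  rw [← s.compat, lam_slice, s.compat, ← H.piBarR_left,
    show (LinearMap.mul k A).flip (left (H.piBarR c) y) = rm k y ∘ₗ right (H.piBarR c) from
      RegWMB.rm_left _ _, LinearMap.lTensor_comp_apply]

/-- `m ◃ x₁ ⊗ x₂ a`, formed with `λ`, is `λ(m ⊗ x a)` -/
theorem lam_T₁ (s : ComodStr H M) (m : M) (x a : A) :
    (sliceR M H.ε).rTensor A (s.lam₂ m (H.T₁ (x ⊗ₜ a))) = s.lam (m ⊗ₜ (x * a)) := by
  rw [lam₂_T₁, sliceM_leg23, lam_rm]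
  congr 2
  ext y
  simp [H.counit_T₁]

/-- The right action of `⊓̄ᴿ(a)` on a comodule is well defined. For every functional `ω` on `M`
and every `x`, compatibility of `λ` and `ρ` expresses `ε(x (ω ⊗ A)λ(m ⊗ a))` by the functional
`ε(- a)`, which is determined by `⊓̄ᴿ(a)`; then `ε_eq_zero_of_mul` removes `x`. -/
theorem slice_lam_eq (s : ComodStr H M) (hf : H.RightFull) {a a' : A}
    (h : H.piBarR a = H.piBarR a') (m : M) :
    sliceR M H.ε (s.lam (m ⊗ₜ a)) = sliceR M H.ε (s.lam (m ⊗ₜ a')) := by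
  rw [← sub_eq_zero]
  refine dual_separates (k := k) _ fun ω => ?_
  rw [← map_sub, ← map_sub, ← TensorProduct.tmul_sub, ← slice_slice]
  refine H.ε_eq_zero_of_mul hf fun x => ?_
  have h0 (y : A) : H.ε (y * (a - a')) = 0 := by
    rw [← H.ε_piBarR, map_sub, sub_eq_zero.2 h, map_zero]; simp
  have h1 : H.ε ∘ₗ rm k (a - a') = 0 := by ext y; exact h0 y
  have h2 := slice_slice ω (H.ε ∘ₗ lm k x) (s.lam (m ⊗ₜ (a - a')))
  rw [← sliceR_lTensor, s.compat, sliceR_lTensor, h1] at h2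
  refine h2.trans ?_
  simp [sliceR]

end ComodStr

namespace RegWMB

variable {k : Type u} {A V W : Type v} {_ : Field k} {iA : NonUnitalRing A} {_ : Module k A}
  {i1 : IsScalarTower k A A} {i2 : SMulCommClass k A A}

theorem Om_left (H : RegWMB k A) (hf : H.RightFull) (r : H.base) (a : A) :
    H.Om hf (left r.1 a) = (left r.1).lTensor _ (H.Om hf a) := by
  refine H.base_tensor_ext_left fun p => ?_
  rw [evL_Om, rTensor_lTensor, evL_Om, ← (H.base_isBase r).E₁_left]; rfl

theorem Om'_right (H : RegWMB k A) (r : H.base) (a : A) :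
    H.Om' (right r.1 a) = (right r.1).lTensor _ (H.Om' a) := by
  refine H.base_tensor_ext_right fun p => ?_
  rw [evR_Om', rTensor_lTensor, evR_Om']
  exact (H.base_isBase r).opp.E₁_left (p ⊗ₜ a)

theorem sliceR_ε_Om (H : RegWMB k A) (hf : H.RightFull) (a : A) :
    sliceR H.base H.ε (H.Om hf a) = H.piBarR' hf a := by
  refine Subtype.ext (H.multiplier_ext_left fun p => ?_)
  rw [← evL_apply, ← sliceR_rTensor', evL_Om]; rfl

theorem sliceR_ε_Om' (H : RegWMB k A) (a : A) : sliceR H.base H.ε (H.Om' a) = H.piR' a := by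
  refine Subtype.ext (H.multiplier_ext_right fun p => ?_)
  rw [← evR_apply, ← sliceR_rTensor', evR_Om']; rfl

end RegWMB

namespace ComodStr

variable {k : Type u} {A M N X : Type v} {_ : Field k} {iA : NonUnitalRing A} {_ : Module k A}
  {i1 : IsScalarTower k A A} {i2 : SMulCommClass k A A} {H : RegWMB k A}
  [AddCommGroup M] [Module k M] [AddCommGroup N] [Module k N] [AddCommGroup X] [Module k X]

/-! ### The bimodule structure of a comodule -/

theorem slice_rho_eq (s : ComodStr H M) (hf : H.RightFull) {a a' : A}
    (h : H.piR a = H.piR a') (m : M) :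
    sliceR M H.ε (s.rho (m ⊗ₜ a)) = sliceR M H.ε (s.rho (m ⊗ₜ a')) :=
  slice_lam_eq s.opp hf.opp
    (RegWMB.multiplier_ext_left H.opp fun x => congrArg (fun w => right w x) h) m

theorem rho_T₃ (s : ComodStr H M) (m : M) (x a : A) :
    (sliceR M H.ε).rTensor A (s.rho₂ m (H.T₃ (x ⊗ₜ a))) = s.rho (m ⊗ₜ (a * x)) :=
  lam_T₁ s.opp m x a

theorem rho_ext (s : ComodStr H M) {f g : M →ₗ[k] X}
    (h : ∀ m a, f.rTensor A (s.rho (m ⊗ₜ a)) = g.rTensor A (s.rho (m ⊗ₜ a))) : f = g :=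
  lam_ext s.opp h

theorem exists_rAct (s : ComodStr H M) (hf : H.RightFull) : ∃ f : H.base →ₗ[k] M →ₗ[k] M,
    ∀ a m, f (H.piBarR' hf a) m = sliceR M H.ε (s.lam (m ⊗ₜ a)) := by
  obtain ⟨g, hg⟩ := (H.piBarR' hf).exists_rightInverse_of_surjective
    (LinearMap.range_eq_top.2 (H.piBarR'_surjective hf))
  refine ⟨(TensorProduct.curry (sliceR M H.ε ∘ₗ s.lam)).flip ∘ₗ g, fun a m => ?_⟩
  exact s.slice_lam_eq hf (congrArg Subtype.val (LinearMap.congr_fun hg (H.piBarR' hf a))) m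

theorem exists_lAct (s : ComodStr H M) (hf : H.RightFull) : ∃ f : H.base →ₗ[k] M →ₗ[k] M,
    ∀ a m, f (H.piR' a) m = sliceR M H.ε (s.rho (m ⊗ₜ a)) := by
  obtain ⟨g, hg⟩ := H.piR'.exists_rightInverse_of_surjective
    (LinearMap.range_eq_top.2 H.piR'_surjective)
  refine ⟨(TensorProduct.curry (sliceR M H.ε ∘ₗ s.rho)).flip ∘ₗ g, fun a m => ?_⟩
  exact s.slice_rho_eq hf (congrArg Subtype.val (LinearMap.congr_fun hg (H.piR' a))) m

/-- The right action `m ◃ ⊓̄ᴿ(a) = (M ⊗ ε) λ(m ⊗ a)`. -/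
def rAct (s : ComodStr H M) (hf : H.RightFull) : H.base →ₗ[k] M →ₗ[k] M :=
  (s.exists_rAct hf).choose

/-- The left action `⊓ᴿ(a) ▹ m = (M ⊗ ε) ρ(m ⊗ a)`. -/
def lAct (s : ComodStr H M) (hf : H.RightFull) : H.base →ₗ[k] M →ₗ[k] M :=
  (s.exists_lAct hf).choose

theorem rAct_piBarR' (s : ComodStr H M) (hf : H.RightFull) (a : A) (m : M) :
    s.rAct hf (H.piBarR' hf a) m = sliceR M H.ε (s.lam (m ⊗ₜ a)) :=
  (s.exists_rAct hf).choose_spec a m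

theorem lAct_piR' (s : ComodStr H M) (hf : H.RightFull) (a : A) (m : M) :
    s.lAct hf (H.piR' a) m = sliceR M H.ε (s.rho (m ⊗ₜ a)) :=
  (s.exists_lAct hf).choose_spec a m

theorem lam_rAct (s : ComodStr H M) (hf : H.RightFull) (r : H.base) (m : M) (x : A) :
    s.lam (s.rAct hf r m ⊗ₜ x) = s.lam (m ⊗ₜ left r.1 x) := by
  obtain ⟨a, rfl⟩ := H.piBarR'_surjective hf r
  rw [rAct_piBarR', lam_slice]; rfl

theorem rho_lAct (s : ComodStr H M) (hf : H.RightFull) (r : H.base) (m : M) (x : A) :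
    s.rho (s.lAct hf r m ⊗ₜ x) = s.rho (m ⊗ₜ right r.1 x) := by
  obtain ⟨a, rfl⟩ := H.piR'_surjective r
  rw [lAct_piR', rho_slice]; rfl

theorem lam_lAct (s : ComodStr H M) (hf : H.RightFull) (r : H.base) (m : M) (x : A) :
    s.lam (s.lAct hf r m ⊗ₜ x) = (left r.1).lTensor M (s.lam (m ⊗ₜ x)) := by
  obtain ⟨a, rfl⟩ := H.piR'_surjective r
  rw [lAct_piR', lam_slice_rho]; rfl

theorem rho_rAct (s : ComodStr H M) (hf : H.RightFull) (r : H.base) (m : M) (x : A) :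
    s.rho (s.rAct hf r m ⊗ₜ x) = (right r.1).lTensor M (s.rho (m ⊗ₜ x)) := by
  obtain ⟨a, rfl⟩ := H.piBarR'_surjective hf r
  rw [rAct_piBarR', rho_slice_lam]; rfl

/-- The bimodule structure over the base algebra of a comodule. -/
def bimod (s : ComodStr H M) (hf : H.RightFull) : BimodStr k H.base M where
  l := s.lAct hf
  r := s.rAct hf
  l_mul a b m := by
    obtain ⟨c, rfl⟩ := H.piR'_surjective a
    rw [← H.piR'_mul, lAct_piR', lAct_piR', rho_lAct]
  r_mul a b m := by
    obtain ⟨c, rfl⟩ := H.piBarR'_surjective hf b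
    rw [← H.piBarR'_mul, rAct_piBarR', rAct_piBarR', lam_rAct]
  l_r a b m := by
    obtain ⟨c, rfl⟩ := H.piR'_surjective a
    obtain ⟨d, rfl⟩ := H.piBarR'_surjective hf b
    rw [rAct_piBarR', lam_lAct, lAct_piR' s hf c (s.rAct hf _ m), rho_rAct]
    have e1 : H.ε ∘ₗ left (H.piR' c).1 = H.ε ∘ₗ lm k c := by ext; simp [H.ε_piR]
    have e2 : H.ε ∘ₗ right (H.piBarR' hf d).1 = H.ε ∘ₗ rm k d := by ext; simp [H.ε_piBarR]
    rw [sliceR_lTensor, sliceR_lTensor, e1, e2, ← sliceR_lTensor, s.compat, sliceR_lTensor]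

theorem bimod_l (s : ComodStr H M) (hf : H.RightFull) : (s.bimod hf).l = s.lAct hf := rfl
theorem bimod_r (s : ComodStr H M) (hf : H.RightFull) : (s.bimod hf).r = s.rAct hf := rfl

/-- `λ(m ⊗ x)` is the sum of the `(◃ r) λ(m ⊗ x')` if `E (1 ⊗ x)` is the sum of the
`r ⊗ x' ∈ R ⊗ A`. -/
theorem lam_Om (s : ComodStr H M) (hf : H.RightFull) (m : M) (x : A) :
    TensorProduct.lift ((LinearMap.rTensorHom A ∘ₗ s.rAct hf).compl₂
      (s.lam ∘ₗ TensorProduct.mk k M A m)) (H.Om hf x) = s.lam (m ⊗ₜ x) := by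
  refine LinearMap.congr_fun (f := TensorProduct.lift ((LinearMap.rTensorHom A ∘ₗ
    s.rAct hf).compl₂ (s.lam ∘ₗ TensorProduct.mk k M A m)) ∘ₗ H.Om hf)
    (g := s.lam ∘ₗ TensorProduct.mk k M A m) (H.ext_mul fun q z => ?_) x
  simp only [LinearMap.comp_apply, TensorProduct.mk_apply]
  rw [H.Om_mul, ← lam_T₁]
  refine LinearMap.congr_fun (f := TensorProduct.lift ((LinearMap.rTensorHom A ∘ₗ
    s.rAct hf).compl₂ (s.lam ∘ₗ TensorProduct.mk k M A m)) ∘ₗ (H.piBarR' hf).rTensor A)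
    (g := (sliceR M H.ε).rTensor A ∘ₗ s.lam₂ m) (TensorProduct.ext' fun u v => ?_) _
  simp only [LinearMap.comp_apply, lam₂_tmul, LinearMap.rTensor_tmul, TensorProduct.lift.tmul,
    LinearMap.compl₂_apply, TensorProduct.mk_apply, LinearMap.coe_rTensorHom]
  rw [← LinearMap.rTensor_comp_apply]
  congr 2
  ext m
  simp [rAct_piBarR']

/-- `ρ(m ⊗ x)` is the sum of the `(r ▹) ρ(m ⊗ x')` if `(1 ⊗ x) E` is the sum of the
`r ⊗ x' ∈ R ⊗ A`. -/
theorem rho_Om' (s : ComodStr H M) (hf : H.RightFull) (m : M) (x : A) :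
    TensorProduct.lift ((LinearMap.rTensorHom A ∘ₗ s.lAct hf).compl₂
      (s.rho ∘ₗ TensorProduct.mk k M A m)) (H.Om' x) = s.rho (m ⊗ₜ x) := by
  refine LinearMap.congr_fun (f := TensorProduct.lift ((LinearMap.rTensorHom A ∘ₗ
    s.lAct hf).compl₂ (s.rho ∘ₗ TensorProduct.mk k M A m)) ∘ₗ H.Om')
    (g := s.rho ∘ₗ TensorProduct.mk k M A m) (H.ext_mul fun z q => ?_) x
  simp only [LinearMap.comp_apply, TensorProduct.mk_apply]
  rw [H.Om'_mul, ← rho_T₃]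
  refine LinearMap.congr_fun (f := TensorProduct.lift ((LinearMap.rTensorHom A ∘ₗ
    s.lAct hf).compl₂ (s.rho ∘ₗ TensorProduct.mk k M A m)) ∘ₗ H.piR'.rTensor A)
    (g := (sliceR M H.ε).rTensor A ∘ₗ s.rho₂ m) (TensorProduct.ext' fun u v => ?_) _
  simp only [LinearMap.comp_apply, rho₂_tmul, LinearMap.rTensor_tmul, TensorProduct.lift.tmul,
    LinearMap.compl₂_apply, TensorProduct.mk_apply, LinearMap.coe_rTensorHom]
  rw [← LinearMap.rTensor_comp_apply]
  congr 2
  ext m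
  simp [lAct_piR']

theorem ext_rAct (s : ComodStr H M) (hf : H.RightFull) {f : M →ₗ[k] X}
    (h : ∀ r m, f (s.rAct hf r m) = 0) : f = 0 := by
  refine s.lam_ext fun m a => ?_
  rw [← s.lam_Om hf]
  refine LinearMap.congr_fun (f := f.rTensor A ∘ₗ TensorProduct.lift ((LinearMap.rTensorHom A ∘ₗ
    s.rAct hf).compl₂ (s.lam ∘ₗ TensorProduct.mk k M A m)))
    (g := (0 : M →ₗ[k] X).rTensor A ∘ₗ TensorProduct.lift ((LinearMap.rTensorHom A ∘ₗ
    s.rAct hf).compl₂ (s.lam ∘ₗ TensorProduct.mk k M A m))) (TensorProduct.ext' fun u v => ?_) _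
  have e : f ∘ₗ s.rAct hf u = 0 := LinearMap.ext (h u)
  simp only [LinearMap.comp_apply, TensorProduct.lift.tmul, LinearMap.compl₂_apply,
    TensorProduct.mk_apply, LinearMap.coe_rTensorHom]
  rw [← LinearMap.rTensor_comp_apply, e]
  simp

theorem ext_lAct (s : ComodStr H M) (hf : H.RightFull) {f : M →ₗ[k] X}
    (h : ∀ r m, f (s.lAct hf r m) = 0) : f = 0 := by
  refine s.rho_ext fun m a => ?_
  rw [← s.rho_Om' hf]
  refine LinearMap.congr_fun (f := f.rTensor A ∘ₗ TensorProduct.lift ((LinearMap.rTensorHom A ∘ₗ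
    s.lAct hf).compl₂ (s.rho ∘ₗ TensorProduct.mk k M A m)))
    (g := (0 : M →ₗ[k] X).rTensor A ∘ₗ TensorProduct.lift ((LinearMap.rTensorHom A ∘ₗ
    s.lAct hf).compl₂ (s.rho ∘ₗ TensorProduct.mk k M A m))) (TensorProduct.ext' fun u v => ?_) _
  have e : f ∘ₗ s.lAct hf u = 0 := LinearMap.ext (h u)
  simp only [LinearMap.comp_apply, TensorProduct.lift.tmul, LinearMap.compl₂_apply,
    TensorProduct.mk_apply, LinearMap.coe_rTensorHom]
  rw [← LinearMap.rTensor_comp_apply, e]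
  simp

theorem bimod_firm (s : ComodStr H M) (hf : H.RightFull) : (s.bimod hf).IsFirm :=
  BimodStr.isFirm_of_local_units _ H.exists_left_unit (H.exists_right_unit hf)
    (fun _ h => s.ext_lAct hf h) (fun _ h => s.ext_rAct hf h)

/-- The firm bimodule structure of a comodule. -/
def comodBimod (s : ComodStr H M) (hf : H.RightFull) : ComodBimod H H.base s where
  str := s.bimod hf
  firm := s.bimod_firm hf
  r_eq r a hr m := by
    have : r = H.piBarR' hf a := Subtype.ext ((H.isPiBarR_iff _ _).1 hr)
    rw [this, bimod_r, rAct_piBarR']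
  l_eq r a hr m := by
    have : r = H.piR' a := Subtype.ext ((H.isPiR_iff _ _).1 hr)
    rw [this, bimod_l, lAct_piR']

/-- The map sending `m ⊗ a` to the sum of the `r ▹ m ⊗ a'` if `E (1 ⊗ a)` is the sum of the
`r ⊗ a' ∈ R ⊗ A`. -/
def omL (s : ComodStr H M) (hf : H.RightFull) : M ⊗[k] A →ₗ[k] M ⊗[k] A :=
  TensorProduct.lift ((LinearMap.rTensorHom A ∘ₗ (s.lAct hf).flip).compl₂ (H.Om hf))

theorem omL_tmul (s : ComodStr H M) (hf : H.RightFull) (m : M) (a : A) :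
    s.omL hf (m ⊗ₜ a) = ((s.lAct hf).flip m).rTensor A (H.Om hf a) := rfl

/-- The analogue for `λ` of `E Δ(a) = Δ(a)`: the image of `λ` is fixed by the action of `E` on
`M ⊗ A` through the left action of `R` on `M`. -/
theorem omL_lam (s : ComodStr H M) (hf : H.RightFull) (m : M) (a : A) :
    s.omL hf (s.lam (m ⊗ₜ a)) = s.lam (m ⊗ₜ a) := by
  refine H.eq_of_lTensor_lm fun x => ?_
  let G : H.base ⊗[k] A →ₗ[k] M ⊗[k] A →ₗ[k] M ⊗[k] A := TensorProduct.lift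
    ((TensorProduct.mapBilinear (RingHom.id k) M A M A).compl₁₂ (s.lAct hf) (LinearMap.mul k A))
  have e1 (z : M ⊗[k] A) : (lm k x).lTensor M (s.omL hf z) = G (H.Om' x) z := by
    refine LinearMap.congr_fun (f := (lm k x).lTensor M ∘ₗ s.omL hf)
      (TensorProduct.ext' fun n b => ?_) z
    rw [LinearMap.comp_apply, omL_tmul, ← rTensor_lTensor, H.lm_Om]
    refine LinearMap.congr_fun (f := ((s.lAct hf).flip n).rTensor A ∘ₗ (rm k b).lTensor _)
      (g := G.flip (n ⊗ₜ b)) (TensorProduct.ext' fun r y => ?_) _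
    simp [G]
  have e2 (w : H.base ⊗[k] A) : G w (s.lam (m ⊗ₜ a)) = (rm k a).lTensor M (TensorProduct.lift
      ((LinearMap.rTensorHom A ∘ₗ s.lAct hf).compl₂ (s.rho ∘ₗ TensorProduct.mk k M A m)) w) := by
    refine LinearMap.congr_fun (f := G.flip (s.lam (m ⊗ₜ a)))
      (g := (rm k a).lTensor M ∘ₗ TensorProduct.lift
      ((LinearMap.rTensorHom A ∘ₗ s.lAct hf).compl₂ (s.rho ∘ₗ TensorProduct.mk k M A m)))
      (TensorProduct.ext' fun r y => ?_) _
    have e : G (r ⊗ₜ y) = (s.lAct hf r).rTensor A ∘ₗ (lm k y).lTensor M :=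
      TensorProduct.ext' fun _ _ => by simp [G]
    rw [LinearMap.flip_apply, e, LinearMap.comp_apply, s.compat, rTensor_lTensor]
    rfl
  rw [e1, e2, rho_Om', s.compat]

/-- The analogue for `ρ` of `Δ(a) E = Δ(a)`: the image of `ρ` is fixed by the action of `E` on
`M ⊗ A` through the right action of `R` on `M`. -/
theorem omR_rho (s : ComodStr H M) (hf : H.RightFull) (m : M) (a : A) :
    TensorProduct.lift ((LinearMap.rTensorHom A ∘ₗ (s.rAct hf).flip).compl₂ H.Om')
      (s.rho (m ⊗ₜ a)) = s.rho (m ⊗ₜ a) := by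
  refine H.eq_of_lTensor_rm fun x => ?_
  let G : H.base ⊗[k] A →ₗ[k] M ⊗[k] A →ₗ[k] M ⊗[k] A := TensorProduct.lift
    ((TensorProduct.mapBilinear (RingHom.id k) M A M A).compl₁₂ (s.rAct hf) (LinearMap.mul k A).flip)
  have e1 (z : M ⊗[k] A) : (rm k x).lTensor M (TensorProduct.lift ((LinearMap.rTensorHom A ∘ₗ
      (s.rAct hf).flip).compl₂ H.Om') z) = G (H.Om hf x) z := by
    refine LinearMap.congr_fun (f := (rm k x).lTensor M ∘ₗ TensorProduct.lift
      ((LinearMap.rTensorHom A ∘ₗ (s.rAct hf).flip).compl₂ H.Om'))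
      (TensorProduct.ext' fun n b => ?_) z
    rw [LinearMap.comp_apply, TensorProduct.lift.tmul, LinearMap.compl₂_apply,
      LinearMap.comp_apply, LinearMap.coe_rTensorHom, ← rTensor_lTensor, ← H.lm_Om hf]
    refine LinearMap.congr_fun (f := ((s.rAct hf).flip n).rTensor A ∘ₗ (lm k b).lTensor _)
      (g := G.flip (n ⊗ₜ b)) (TensorProduct.ext' fun r y => ?_) _
    simp [G]
  have e2 (w : H.base ⊗[k] A) : G w (s.rho (m ⊗ₜ a)) = (lm k a).lTensor M (TensorProduct.lift
      ((LinearMap.rTensorHom A ∘ₗ s.rAct hf).compl₂ (s.lam ∘ₗ TensorProduct.mk k M A m)) w) := by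
    refine LinearMap.congr_fun (f := G.flip (s.rho (m ⊗ₜ a)))
      (g := (lm k a).lTensor M ∘ₗ TensorProduct.lift
      ((LinearMap.rTensorHom A ∘ₗ s.rAct hf).compl₂ (s.lam ∘ₗ TensorProduct.mk k M A m)))
      (TensorProduct.ext' fun r y => ?_) _
    have e : G (r ⊗ₜ y) = (s.rAct hf r).rTensor A ∘ₗ (rm k y).lTensor M :=
      TensorProduct.ext' fun _ _ => by simp [G]
    rw [LinearMap.flip_apply, e, LinearMap.comp_apply, ← s.compat, rTensor_lTensor]
    rfl
  rw [e1, e2, lam_Om, s.compat]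

/-- `⊓̄ᴿ(a') ▹ m' = m ◃ ⊓̄ᴿ(a)` for `λ(m ⊗ a) = m' ⊗ a'` -/
theorem lift_lAct_lam (s : ComodStr H M) (hf : H.RightFull) (m : M) (a : A) :
    TensorProduct.lift ((s.lAct hf).flip.compl₂ (H.piBarR' hf)) (s.lam (m ⊗ₜ a)) =
      s.rAct hf (H.piBarR' hf a) m := by
  rw [rAct_piBarR', ← s.omL_lam hf m a]
  conv_lhs => rw [s.omL_lam hf m a]
  refine LinearMap.congr_fun (g := sliceR M H.ε ∘ₗ s.omL hf)
    (TensorProduct.ext' fun n b => ?_) (s.lam (m ⊗ₜ a))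
  rw [LinearMap.comp_apply, omL_tmul, sliceR_rTensor', H.sliceR_ε_Om]
  rfl

/-- `m' ◃ ⊓ᴿ(a') = ⊓ᴿ(a) ▹ m` for `ρ(m ⊗ a) = m' ⊗ a'` -/
theorem lift_rAct_rho (s : ComodStr H M) (hf : H.RightFull) (m : M) (a : A) :
    TensorProduct.lift ((s.rAct hf).flip.compl₂ H.piR') (s.rho (m ⊗ₜ a)) =
      s.lAct hf (H.piR' a) m := by
  rw [lAct_piR', ← s.omR_rho hf m a]
  conv_lhs => rw [s.omR_rho hf m a]
  refine LinearMap.congr_fun (g := sliceR M H.ε ∘ₗ TensorProduct.lift ((LinearMap.rTensorHom A ∘ₗ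
    (s.rAct hf).flip).compl₂ H.Om')) (TensorProduct.ext' fun n b => ?_) (s.rho (m ⊗ₜ a))
  rw [LinearMap.comp_apply, TensorProduct.lift.tmul, TensorProduct.lift.tmul,
    LinearMap.compl₂_apply, LinearMap.compl₂_apply, LinearMap.comp_apply,
    LinearMap.coe_rTensorHom, sliceR_rTensor', H.sliceR_ε_Om']

end ComodStr

namespace ComodStr

variable {k : Type u} {A M N X M' N' : Type v} {_ : Field k} {iA : NonUnitalRing A} {_ : Module k A}
  {i1 : IsScalarTower k A A} {i2 : SMulCommClass k A A} {H : RegWMB k A}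
  [AddCommGroup M] [Module k M] [AddCommGroup N] [Module k N] [AddCommGroup X] [Module k X]
  [AddCommGroup M'] [Module k M'] [AddCommGroup N'] [Module k N']

/-! ### The tensor product of comodules -/

/-- The map `n ⊗ a ↦ b(m', n) ⊗ a'` where `λ(m ⊗ a) = m' ⊗ a'`. -/
def lamPair (s : ComodStr H M) (b : M →ₗ[k] N →ₗ[k] X) (m : M) : N ⊗[k] A →ₗ[k] X ⊗[k] A :=
  TensorProduct.lift ((LinearMap.rTensorHom A ∘ₗ b.flip).compl₂ (s.lam ∘ₗ TensorProduct.mk k M A m))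

theorem lamPair_tmul (s : ComodStr H M) (b : M →ₗ[k] N →ₗ[k] X) (m : M) (n : N) (a : A) :
    s.lamPair b m (n ⊗ₜ a) = (b.flip n).rTensor A (s.lam (m ⊗ₜ a)) := rfl

/-- The map `m ⊗ a ↦ b(m, n') ⊗ a'` where `ρ(n ⊗ a) = n' ⊗ a'`. -/
def rhoPair (t : ComodStr H N) (b : M →ₗ[k] N →ₗ[k] X) (n : N) : M ⊗[k] A →ₗ[k] X ⊗[k] A :=
  TensorProduct.lift ((LinearMap.rTensorHom A ∘ₗ b).compl₂ (t.rho ∘ₗ TensorProduct.mk k N A n))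

theorem rhoPair_tmul (t : ComodStr H N) (b : M →ₗ[k] N →ₗ[k] X) (n : N) (m : M) (a : A) :
    t.rhoPair b n (m ⊗ₜ a) = (b m).rTensor A (t.rho (n ⊗ₜ a)) := rfl

/-- `(b ⊗ A) λ₁₃ λ₂₃` in terms of `lamPair`. -/
theorem lamPair_eq (s : ComodStr H M) (t : ComodStr H N) (b : M →ₗ[k] N →ₗ[k] X) (m : M) (n : N)
    (a : A) : (TensorProduct.lift b).rTensor A (leg13 N s.lam (leg23 M t.lam ((m ⊗ₜ n) ⊗ₜ a))) =
      s.lamPair b m (t.lam (n ⊗ₜ a)) := by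
  rw [leg23_tmul]
  refine LinearMap.congr_fun (f := (TensorProduct.lift b).rTensor A ∘ₗ leg13 N s.lam ∘ₗ
    (TensorProduct.mk k M N m).rTensor A) (TensorProduct.ext' fun n a => ?_) _
  simp only [LinearMap.comp_apply, LinearMap.rTensor_tmul, TensorProduct.mk_apply, leg13_tmul,
    lamPair_tmul]
  rw [← LinearMap.rTensor_comp_apply]
  congr 2

/-- `(b ⊗ A) ρ₂₃ ρ₁₃` in terms of `rhoPair`. -/
theorem rhoPair_eq (s : ComodStr H M) (t : ComodStr H N) (b : M →ₗ[k] N →ₗ[k] X) (m : M) (n : N)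
    (a : A) : (TensorProduct.lift b).rTensor A (leg23 M t.rho (leg13 N s.rho ((m ⊗ₜ n) ⊗ₜ a))) =
      t.rhoPair b n (s.rho (m ⊗ₜ a)) := by
  rw [leg13_tmul]
  refine LinearMap.congr_fun (f := (TensorProduct.lift b).rTensor A ∘ₗ leg23 M t.rho ∘ₗ
    ((TensorProduct.mk k M N).flip n).rTensor A) (TensorProduct.ext' fun m a => ?_) _
  simp only [LinearMap.comp_apply, LinearMap.rTensor_tmul, TensorProduct.mk_apply, leg23_tmul,
    rhoPair_tmul, LinearMap.flip_apply]
  rw [← LinearMap.rTensor_comp_apply]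
  congr 2

/-- Compatibility of `λ` and `ρ` on a tensor product: both sides are `b(m', n') ⊗ x' y'` with
`m' ⊗ x' = ρ(m ⊗ x)` and `n' ⊗ y' = λ(n ⊗ y)`. -/
theorem lm_lamPair (s : ComodStr H M) (t : ComodStr H N) (b : M →ₗ[k] N →ₗ[k] X) (m : M) (n : N)
    (x y : A) : (lm k x).lTensor X (s.lamPair b m (t.lam (n ⊗ₜ y))) =
      (rm k y).lTensor X (t.rhoPair b n (s.rho (m ⊗ₜ x))) := by
  refine Eq.trans (b := TensorProduct.map₂ b (LinearMap.mul k A) (s.rho (m ⊗ₜ x)) (t.lam (n ⊗ₜ y)))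
    ?_ ?_
  · refine LinearMap.congr_fun (f := (lm k x).lTensor X ∘ₗ s.lamPair b m)
      (TensorProduct.ext' fun n c => ?_) _
    rw [LinearMap.comp_apply, lamPair_tmul, ← rTensor_lTensor, s.compat]
    exact LinearMap.congr_fun (f := (b.flip n).rTensor A ∘ₗ (rm k c).lTensor M)
      (g := (TensorProduct.map₂ b (LinearMap.mul k A)).flip (n ⊗ₜ c))
      (TensorProduct.ext' fun m d => by simp) _
  · refine LinearMap.congr_fun (f := (TensorProduct.map₂ b (LinearMap.mul k A)).flip _)
      (g := (rm k y).lTensor X ∘ₗ t.rhoPair b n) (TensorProduct.ext' fun m c => ?_) _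
    rw [LinearMap.comp_apply, rhoPair_tmul, ← rTensor_lTensor, ← t.compat]
    exact LinearMap.congr_fun (f := TensorProduct.map₂ b (LinearMap.mul k A) (m ⊗ₜ c))
      (g := (b m).rTensor A ∘ₗ (lm k c).lTensor N)
      (TensorProduct.ext' fun m d => by simp) _

variable (s : ComodStr H M) (t : ComodStr H N) (hf : H.RightFull)

/-- The map `m ⊗ n ⊗ a ↦ b(m', n') ⊗ a''` where `λ(n ⊗ a) = n' ⊗ a'` and
`λ(m ⊗ a') = m' ⊗ a''`. -/
def diagLam (b : M →ₗ[k] N →ₗ[k] X) : (M ⊗[k] N) ⊗[k] A →ₗ[k] X ⊗[k] A :=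
  (TensorProduct.lift b).rTensor A ∘ₗ leg13 N s.lam ∘ₗ leg23 M t.lam

/-- The map `m ⊗ n ⊗ a ↦ b(m', n') ⊗ a''` where `ρ(m ⊗ a) = m' ⊗ a'` and
`ρ(n ⊗ a') = n' ⊗ a''`. -/
def diagRho (b : M →ₗ[k] N →ₗ[k] X) : (M ⊗[k] N) ⊗[k] A →ₗ[k] X ⊗[k] A :=
  (TensorProduct.lift b).rTensor A ∘ₗ leg23 M t.rho ∘ₗ leg13 N s.rho

theorem diagLam_tmul (b : M →ₗ[k] N →ₗ[k] X) (m : M) (n : N) (a : A) :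
    s.diagLam t b ((m ⊗ₜ n) ⊗ₜ a) = s.lamPair b m (t.lam (n ⊗ₜ a)) := s.lamPair_eq t b m n a

theorem diagRho_tmul (b : M →ₗ[k] N →ₗ[k] X) (m : M) (n : N) (a : A) :
    s.diagRho t b ((m ⊗ₜ n) ⊗ₜ a) = t.rhoPair b n (s.rho (m ⊗ₜ a)) := s.rhoPair_eq t b m n a

/-- Both sides are obtained from `λ(n ⊗ a)` by multiplying the second factor on the left by `r`,
before applying `λ` of `M`. -/
theorem diagLam_balanced (b : M →ₗ[k] N →ₗ[k] X) (m : M) (r : H.base) (n : N) (a : A) :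
    s.diagLam t b ((s.rAct hf r m ⊗ₜ n) ⊗ₜ a) = s.diagLam t b ((m ⊗ₜ t.lAct hf r n) ⊗ₜ a) := by
  rw [diagLam_tmul, diagLam_tmul, lam_lAct]
  refine LinearMap.congr_fun (g := s.lamPair b m ∘ₗ (left r.1).lTensor N)
    (TensorProduct.ext' fun n a => ?_) _
  rw [LinearMap.comp_apply, LinearMap.lTensor_tmul, lamPair_tmul, lamPair_tmul, lam_rAct]

/-- Both sides are obtained from `ρ(m ⊗ a)` by multiplying the second factor on the right by `r`,
before applying `ρ` of `N`. -/
theorem diagRho_balanced (b : M →ₗ[k] N →ₗ[k] X) (m : M) (r : H.base) (n : N) (a : A) :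
    s.diagRho t b ((s.rAct hf r m ⊗ₜ n) ⊗ₜ a) = s.diagRho t b ((m ⊗ₜ t.lAct hf r n) ⊗ₜ a) := by
  rw [diagRho_tmul, diagRho_tmul, rho_rAct]
  refine LinearMap.congr_fun (f := t.rhoPair b n ∘ₗ (right r.1).lTensor M)
    (TensorProduct.ext' fun m a => ?_) _
  rw [LinearMap.comp_apply, LinearMap.lTensor_tmul, rhoPair_tmul, rhoPair_tmul, rho_lAct]

/-- The map `(M ⊗_R N) ⊗ A → X ⊗ A` induced by a balanced map. -/
def balMap (f : (M ⊗[k] N) ⊗[k] A →ₗ[k] X ⊗[k] A)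
    (h : ∀ m r n a, f ((s.rAct hf r m ⊗ₜ n) ⊗ₜ a) = f ((m ⊗ₜ t.lAct hf r n) ⊗ₜ a)) :
    BalTensor (s.bimod hf) (t.bimod hf) ⊗[k] A →ₗ[k] X ⊗[k] A :=
  TensorProduct.lift (BalTensor.lift _ _ ((TensorProduct.mk k M N).compr₂ (TensorProduct.curry f))
    fun m r n => LinearMap.ext fun a => h m r n a)

theorem balMap_tmul (f : (M ⊗[k] N) ⊗[k] A →ₗ[k] X ⊗[k] A)
    (h : ∀ m r n a, f ((s.rAct hf r m ⊗ₜ n) ⊗ₜ a) = f ((m ⊗ₜ t.lAct hf r n) ⊗ₜ a)) (m : M) (n : N)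
    (a : A) : s.balMap t hf f h (BalTensor.tmul _ _ m n ⊗ₜ a) = f ((m ⊗ₜ n) ⊗ₜ a) := by
  rw [balMap, TensorProduct.lift.tmul, BalTensor.lift_tmul]
  rfl

/-- The map `λ` of `M ⊗_R N`. -/
def tensorLam : BalTensor (s.bimod hf) (t.bimod hf) ⊗[k] A →ₗ[k]
    BalTensor (s.bimod hf) (t.bimod hf) ⊗[k] A :=
  s.balMap t hf (s.diagLam t (BalTensor.tmul _ _)) (s.diagLam_balanced t hf _)

/-- The map `ρ` of `M ⊗_R N`. -/
def tensorRho : BalTensor (s.bimod hf) (t.bimod hf) ⊗[k] A →ₗ[k]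
    BalTensor (s.bimod hf) (t.bimod hf) ⊗[k] A :=
  s.balMap t hf (s.diagRho t (BalTensor.tmul _ _)) (s.diagRho_balanced t hf _)

theorem lift_tmul_eq_proj (s : ComodStr H M) (t : ComodStr H N) (hf : H.RightFull) :
    TensorProduct.lift (BalTensor.tmul (s.bimod hf) (t.bimod hf)) =
    BalTensor.proj (s.bimod hf) (t.bimod hf) := TensorProduct.ext' fun _ _ => rfl

theorem tensorLam_proj : s.tensorLam t hf ∘ₗ (BalTensor.proj (s.bimod hf) (t.bimod hf)).rTensor A =
    (BalTensor.proj (s.bimod hf) (t.bimod hf)).rTensor A ∘ₗ leg13 N s.lam ∘ₗ leg23 M t.lam :=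
  TensorProduct.ext_threefold fun m n a => by
    rw [← s.lift_tmul_eq_proj t hf]
    exact s.balMap_tmul t hf (s.diagLam t (BalTensor.tmul _ _)) (s.diagLam_balanced t hf _) m n a

theorem tensorRho_proj : s.tensorRho t hf ∘ₗ (BalTensor.proj (s.bimod hf) (t.bimod hf)).rTensor A =
    (BalTensor.proj (s.bimod hf) (t.bimod hf)).rTensor A ∘ₗ leg23 M t.rho ∘ₗ leg13 N s.rho :=
  TensorProduct.ext_threefold fun m n a => by
    rw [← s.lift_tmul_eq_proj t hf]
    exact s.balMap_tmul t hf (s.diagRho t (BalTensor.tmul _ _)) (s.diagRho_balanced t hf _) m n a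

theorem tensorLam_tmul (m : M) (n : N) (a : A) :
    s.tensorLam t hf (BalTensor.tmul _ _ m n ⊗ₜ a) =
      s.lamPair (BalTensor.tmul _ _) m (t.lam (n ⊗ₜ a)) :=
  (s.balMap_tmul t hf _ _ m n a).trans (s.diagLam_tmul t _ m n a)

theorem tensorRho_tmul (m : M) (n : N) (a : A) :
    s.tensorRho t hf (BalTensor.tmul _ _ m n ⊗ₜ a) =
      t.rhoPair (BalTensor.tmul _ _) n (s.rho (m ⊗ₜ a)) :=
  (s.balMap_tmul t hf _ _ m n a).trans (s.diagRho_tmul t _ m n a)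

/-- The right action of the base algebra on `M ⊗_R N` is that on `N`: for `λ(n ⊗ a) = n' ⊗ a'` one
has `m ◃ ⊓̄ᴿ(a') ⊗_R n' = m ⊗_R ⊓̄ᴿ(a') ▹ n'`, and `⊓̄ᴿ(a') ▹ n' = n ◃ ⊓̄ᴿ(a)`. -/
theorem sliceR_tensorLam (m : M) (n : N) (a : A) :
    sliceR _ H.ε (s.tensorLam t hf (BalTensor.tmul _ _ m n ⊗ₜ a)) =
      BalTensor.tmul _ _ m (t.rAct hf (H.piBarR' hf a) n) := by
  rw [tensorLam_tmul, ← lift_lAct_lam]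
  refine LinearMap.congr_fun (f := sliceR _ H.ε ∘ₗ s.lamPair (BalTensor.tmul _ _) m)
    (g := BalTensor.tmul (s.bimod hf) (t.bimod hf) m ∘ₗ
      TensorProduct.lift ((t.lAct hf).flip.compl₂ (H.piBarR' hf)))
    (TensorProduct.ext' fun n b => ?_) _
  rw [LinearMap.comp_apply, lamPair_tmul, sliceR_rTensor', LinearMap.flip_apply, ← rAct_piBarR']
  exact BalTensor.balanced (s.bimod hf) (t.bimod hf) m _ n

/-- The left action of the base algebra on `M ⊗_R N` is that on `M`, as in `sliceR_tensorLam`. -/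
theorem sliceR_tensorRho (m : M) (n : N) (a : A) :
    sliceR _ H.ε (s.tensorRho t hf (BalTensor.tmul _ _ m n ⊗ₜ a)) =
      BalTensor.tmul _ _ (s.lAct hf (H.piR' a) m) n := by
  rw [tensorRho_tmul, ← lift_rAct_rho]
  refine LinearMap.congr_fun (f := sliceR _ H.ε ∘ₗ t.rhoPair (BalTensor.tmul _ _) n)
    (g := (BalTensor.tmul (s.bimod hf) (t.bimod hf)).flip n ∘ₗ
      TensorProduct.lift ((s.rAct hf).flip.compl₂ H.piR'))
    (TensorProduct.ext' fun m b => ?_) _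
  rw [LinearMap.comp_apply, rhoPair_tmul, sliceR_rTensor', ← lAct_piR' t hf]
  exact (BalTensor.balanced (s.bimod hf) (t.bimod hf) m _ n).symm

/-- The map `(n ⊗ a) ⊗ b ↦ b(m', n) ⊗ a' ⊗ b'` where `λ₁₂ λ₁₃ (m ⊗ a ⊗ b) = m' ⊗ a' ⊗ b'`. -/
def lamPair₂ (b : M →ₗ[k] N →ₗ[k] X) (m : M) : (N ⊗[k] A) ⊗[k] A →ₗ[k] (X ⊗[k] A) ⊗[k] A :=
  TensorProduct.lift ((LinearMap.rTensorHom A ∘ₗ LinearMap.rTensorHom A ∘ₗ b.flip).compl₂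
    (s.lam₂ m)) ∘ₗ (TensorProduct.assoc k N A A).toLinearMap

theorem lamPair₂_tmul (b : M →ₗ[k] N →ₗ[k] X) (m : M) (n : N) (z : A ⊗[k] A) :
    s.lamPair₂ b m ((TensorProduct.mk k N A n).rTensor A z) =
      ((b.flip n).rTensor A).rTensor A (s.lam₂ m z) :=
  LinearMap.congr_fun (f := s.lamPair₂ b m ∘ₗ (TensorProduct.mk k N A n).rTensor A)
    (g := ((b.flip n).rTensor A).rTensor A ∘ₗ s.lam₂ m)
    (TensorProduct.ext' fun a c => by simp [lamPair₂]) z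

theorem leg23_naturality {f : M →ₗ[k] X} (g : A ⊗[k] A →ₗ[k] A ⊗[k] A) (z : (M ⊗[k] A) ⊗[k] A) :
    leg23 X g ((f.rTensor A).rTensor A z) = (f.rTensor A).rTensor A (leg23 M g z) := by
  refine LinearMap.congr_fun (f := leg23 X g ∘ₗ (f.rTensor A).rTensor A)
    (g := (f.rTensor A).rTensor A ∘ₗ leg23 M g) (TensorProduct.ext_threefold fun m a c => ?_) z
  simp only [LinearMap.comp_apply, LinearMap.rTensor_tmul, leg23_tmul]
  rw [← LinearMap.rTensor_comp_apply]
  congr 2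

theorem lamPair₂_T₁ (b : M →ₗ[k] N →ₗ[k] X) (m : M) (z : N ⊗[k] A) (c : A) :
    s.lamPair₂ b m (leg23 N H.T₁ (z ⊗ₜ c)) = leg23 X H.T₁ (s.lamPair b m z ⊗ₜ c) := by
  refine LinearMap.congr_fun (f := s.lamPair₂ b m ∘ₗ leg23 N H.T₁ ∘ₗ
    (TensorProduct.mk k _ A).flip c) (g := leg23 X H.T₁ ∘ₗ (TensorProduct.mk k _ A).flip c ∘ₗ
      s.lamPair b m) (TensorProduct.ext' fun n a => ?_) z
  simp only [LinearMap.comp_apply, LinearMap.flip_apply, TensorProduct.mk_apply, leg23_tmul,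
    lamPair₂_tmul, lam₂_T₁, lamPair_tmul, ← leg23_naturality, LinearMap.rTensor_tmul]

theorem exists_lamPairHom (b : M →ₗ[k] N →ₗ[k] X) :
    ∃ f : N ⊗[k] A →ₗ[k] M →ₗ[k] X ⊗[k] A, ∀ y m, f y m = s.lamPair b m y := by
  refine ⟨TensorProduct.lift (LinearMap.mk₂ k (fun n a => (b.flip n).rTensor A ∘ₗ
      s.lam ∘ₗ (TensorProduct.mk k M A).flip a)
      (fun _ _ _ => by rw [map_add, LinearMap.rTensor_add, LinearMap.add_comp])
      (fun _ _ _ => by rw [map_smul, LinearMap.rTensor_smul, LinearMap.smul_comp])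
      (fun _ _ _ => by rw [map_add, LinearMap.comp_add, LinearMap.comp_add])
      (fun _ _ _ => by rw [map_smul, LinearMap.comp_smul, LinearMap.comp_smul])), fun y m => ?_⟩
  exact LinearMap.congr_fun (f := LinearMap.applyₗ m ∘ₗ TensorProduct.lift _)
    (g := s.lamPair b m) (TensorProduct.ext' fun n a => rfl) y

/-- The map `λ₁₂ λ₁₃` of `M ⊗_R N` applies `λ₁₂ λ₁₃` of `N` and then that of `M`, so its
coassociativity and normality reduce to those of `M` and `N`. -/
theorem tensorLam_lam₂ (m : M) (n : N) (z : A ⊗[k] A) :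
    (s.tensorLam t hf).rTensor A (leg13 A (s.tensorLam t hf)
      ((TensorProduct.mk k _ A (BalTensor.tmul _ _ m n)).rTensor A z)) =
      s.lamPair₂ (BalTensor.tmul _ _) m (t.lam₂ n z) := by
  refine LinearMap.congr_fun (f := (s.tensorLam t hf).rTensor A ∘ₗ leg13 A (s.tensorLam t hf) ∘ₗ
    (TensorProduct.mk k _ A (BalTensor.tmul _ _ m n)).rTensor A)
    (g := s.lamPair₂ (BalTensor.tmul _ _) m ∘ₗ t.lam₂ n) (TensorProduct.ext' fun a c => ?_) z
  simp only [LinearMap.comp_apply, LinearMap.rTensor_tmul, TensorProduct.mk_apply, leg13_tmul,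
    tensorLam_tmul, lam₂_tmul, ← LinearMap.rTensor_comp_apply]
  refine LinearMap.congr_fun (f := (s.tensorLam t hf ∘ₗ
    (TensorProduct.mk k _ A).flip a).rTensor A ∘ₗ s.lamPair (BalTensor.tmul _ _) m)
    (g := s.lamPair₂ (BalTensor.tmul _ _) m ∘ₗ
      (t.lam ∘ₗ (TensorProduct.mk k N A).flip a).rTensor A) (TensorProduct.ext' fun n d => ?_) _
  simp only [LinearMap.comp_apply, LinearMap.rTensor_tmul, TensorProduct.mk_apply,
    LinearMap.flip_apply, lamPair_tmul]
  obtain ⟨f, hfy⟩ := s.exists_lamPairHom (BalTensor.tmul (s.bimod hf) (t.bimod hf))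
  have e1 (w : M ⊗[k] A) : (s.tensorLam t hf ∘ₗ (TensorProduct.mk k _ A).flip a).rTensor A
      (((BalTensor.tmul (s.bimod hf) (t.bimod hf)).flip n).rTensor A w) =
      (f (t.lam (n ⊗ₜ a))).rTensor A w := by
    rw [← LinearMap.rTensor_comp_apply]
    congr 2
    ext m
    exact (s.tensorLam_tmul t hf m n a).trans (hfy _ _).symm
  have e2 (y : N ⊗[k] A) : s.lamPair₂ (BalTensor.tmul _ _) m (y ⊗ₜ d) =
      (f y).rTensor A (s.lam (m ⊗ₜ d)) := by
    refine LinearMap.congr_fun (f := s.lamPair₂ (BalTensor.tmul _ _) m ∘ₗ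
      (TensorProduct.mk k _ A).flip d) (g := (LinearMap.rTensorHom A ∘ₗ f).flip (s.lam (m ⊗ₜ d)))
      (TensorProduct.ext' fun n a => ?_) y
    have e : f (n ⊗ₜ a) = ((BalTensor.tmul _ _).flip n).rTensor A ∘ₗ
        s.lam ∘ₗ (TensorProduct.mk k M A).flip a := LinearMap.ext fun m => hfy _ m
    refine (s.lamPair₂_tmul _ m n (a ⊗ₜ d)).trans ?_
    rw [lam₂_tmul, LinearMap.flip_apply, LinearMap.comp_apply, LinearMap.coe_rTensorHom, e]
    simp only [LinearMap.rTensor_comp_apply]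
  exact (e1 _).trans (e2 _).symm

/-- The comodule `M ⊗_R N`. -/
def tensor : ComodStr H (BalTensor (s.bimod hf) (t.bimod hf)) where
  lam := s.tensorLam t hf
  rho := s.tensorRho t hf
  compat p a b := by
    refine BalTensor.hom_ext_apply (f := (lm k a).lTensor _ ∘ₗ s.tensorLam t hf ∘ₗ
      (TensorProduct.mk k _ A).flip b) (g := (rm k b).lTensor _ ∘ₗ s.tensorRho t hf ∘ₗ
      (TensorProduct.mk k _ A).flip a) (fun m n => ?_) p
    simp only [LinearMap.comp_apply, LinearMap.flip_apply, TensorProduct.mk_apply, tensorLam_tmul,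
      tensorRho_tmul]
    exact s.lm_lamPair t _ m n a b
  coassoc := by
    refine TensorProduct.ext_threefold fun p a b => ?_
    simp only [LinearMap.comp_apply, leg23_tmul, LinearMap.rTensor_tmul]
    refine BalTensor.hom_ext_apply (f := ((s.tensorLam t hf).rTensor A ∘ₗ
      leg13 A (s.tensorLam t hf) ∘ₗ leg23 _ H.T₁ ∘ₗ (TensorProduct.mk k _ A).flip b ∘ₗ
      (TensorProduct.mk k _ A).flip a))
      (g := leg23 _ H.T₁ ∘ₗ (TensorProduct.mk k _ A).flip b ∘ₗ s.tensorLam t hf ∘ₗ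
        (TensorProduct.mk k _ A).flip a)
      (fun m n => ?_) p
    simp only [LinearMap.comp_apply, LinearMap.flip_apply, TensorProduct.mk_apply, leg23_tmul,
      tensorLam_tmul]
    rw [tensorLam_lam₂, lam₂_T₁, lamPair₂_T₁]
  normal := by
    refine TensorProduct.ext_threefold fun p a b => ?_
    simp only [LinearMap.comp_apply, leg23_tmul]
    refine BalTensor.hom_ext_apply (f := ((s.tensorLam t hf).rTensor A ∘ₗ
      leg13 A (s.tensorLam t hf) ∘ₗ leg23 _ H.E₁ ∘ₗ (TensorProduct.mk k _ A).flip b ∘ₗ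
      (TensorProduct.mk k _ A).flip a))
      (g := (s.tensorLam t hf).rTensor A ∘ₗ
      leg13 A (s.tensorLam t hf) ∘ₗ (TensorProduct.mk k _ A).flip b ∘ₗ
      (TensorProduct.mk k _ A).flip a)
      (fun m n => ?_) p
    simp only [LinearMap.comp_apply, LinearMap.flip_apply, TensorProduct.mk_apply, leg23_tmul]
    have h := s.tensorLam_lam₂ t hf m n (a ⊗ₜ b)
    rw [LinearMap.rTensor_tmul] at h
    rw [tensorLam_lam₂, lam₂_E₁]
    exact h.symm
  full := by
    rw [← Submodule.ker_mkQ (Submodule.span k _), LinearMap.ker_eq_top]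
    refine BalTensor.hom_ext fun m n => ?_
    refine LinearMap.congr_fun (f := Submodule.mkQ _ ∘ₗ BalTensor.tmul _ _ m) (g := 0)
      (t.ext_rAct hf fun r n => ?_) n
    obtain ⟨a, rfl⟩ := H.piBarR'_surjective hf r
    exact (Submodule.Quotient.mk_eq_zero _).2 (Submodule.subset_span
      ⟨BalTensor.tmul _ _ m n, a, H.ε, (s.sliceR_tensorLam t hf m n a).symm⟩)

/-- The bimodule structure of the comodule `M ⊗_R N` is given by the outer actions. -/
theorem tensor_bimod : (s.tensor t hf).bimod hf = (s.bimod hf).tensor (t.bimod hf) := by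
  refine BimodStr.ext_maps (fun r => BalTensor.hom_ext_apply fun m n => ?_)
    (fun r => BalTensor.hom_ext_apply fun m n => ?_)
  · obtain ⟨a, rfl⟩ := H.piR'_surjective r
    rw [bimod_l, lAct_piR', BimodStr.tensor_l_tmul]
    exact s.sliceR_tensorRho t hf m n a
  · obtain ⟨a, rfl⟩ := H.piBarR'_surjective hf r
    rw [bimod_r, rAct_piBarR', BimodStr.tensor_r_tmul]
    exact s.sliceR_tensorLam t hf m n a

theorem tensor_lam_tmul (m : M) (n : N) (a : A) :
    (s.tensor t hf).lam (BalTensor.tmul _ _ m n ⊗ₜ a) =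
      s.lamPair (BalTensor.tmul _ _) m (t.lam (n ⊗ₜ a)) := s.tensorLam_tmul t hf m n a

theorem tensor_rho_tmul (m : M) (n : N) (a : A) :
    (s.tensor t hf).rho (BalTensor.tmul _ _ m n ⊗ₜ a) =
      t.rhoPair (BalTensor.tmul _ _) n (s.rho (m ⊗ₜ a)) := s.tensorRho_tmul t hf m n a

end ComodStr

namespace ComodStr

variable {k : Type u} {A M N X M' N' : Type v} {_ : Field k} {iA : NonUnitalRing A} {_ : Module k A}
  {i1 : IsScalarTower k A A} {i2 : SMulCommClass k A A} {H : RegWMB k A}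
  [AddCommGroup M] [Module k M] [AddCommGroup N] [Module k N] [AddCommGroup X] [Module k X]
  [AddCommGroup M'] [Module k M'] [AddCommGroup N'] [Module k N']

/-- The tensor product over `R` of comodule maps is a comodule map. -/
theorem map_tensor_lam (hf : H.RightFull) {s : ComodStr H M} {t : ComodStr H N}
    {s' : ComodStr H M'} {t' : ComodStr H N'} {f : M →ₗ[k] M'} {g : N →ₗ[k] N'}
    (h₁ : f.rTensor A ∘ₗ s.lam = s'.lam ∘ₗ f.rTensor A)
    (h₂ : g.rTensor A ∘ₗ t.lam = t'.lam ∘ₗ g.rTensor A)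
    {φ : BalTensor (s.bimod hf) (t.bimod hf) →ₗ[k] BalTensor (s'.bimod hf) (t'.bimod hf)}
    (hφ : ∀ m n, φ (BalTensor.tmul _ _ m n) = BalTensor.tmul _ _ (f m) (g n)) :
    φ.rTensor A ∘ₗ (s.tensor t hf).lam = (s'.tensor t' hf).lam ∘ₗ φ.rTensor A := by
  refine TensorProduct.ext' fun p a => BalTensor.hom_ext_apply
    (f := φ.rTensor A ∘ₗ (s.tensor t hf).lam ∘ₗ (TensorProduct.mk k _ A).flip a)
    (g := (s'.tensor t' hf).lam ∘ₗ (TensorProduct.mk k _ A).flip a ∘ₗ φ) (fun m n => ?_) p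
  simp only [LinearMap.comp_apply, LinearMap.flip_apply, TensorProduct.mk_apply, hφ,
    tensor_lam_tmul]
  rw [← LinearMap.rTensor_tmul, ← LinearMap.comp_apply (f := t'.lam), ← h₂, LinearMap.comp_apply]
  refine LinearMap.congr_fun (f := φ.rTensor A ∘ₗ s.lamPair (BalTensor.tmul _ _) m)
    (g := s'.lamPair (BalTensor.tmul _ _) (f m) ∘ₗ g.rTensor A) (TensorProduct.ext' fun n a => ?_) _
  simp only [LinearMap.comp_apply, LinearMap.rTensor_tmul, lamPair_tmul]
  rw [← LinearMap.rTensor_tmul, ← LinearMap.comp_apply (f := s'.lam), ← h₁, LinearMap.comp_apply,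
    ← LinearMap.rTensor_comp_apply, ← LinearMap.rTensor_comp_apply]
  congr 2
  ext m
  exact hφ m n

/-- The associativity constraint is a comodule map. -/
theorem assoc_lam (hf : H.RightFull) {s : ComodStr H M} {t : ComodStr H N} {u : ComodStr H X}
    {φ : BalTensor ((s.tensor t hf).bimod hf) (u.bimod hf) →ₗ[k]
      BalTensor (s.bimod hf) ((t.tensor u hf).bimod hf)}
    (hφ : ∀ x y z, φ (BalTensor.tmul _ _ (BalTensor.tmul _ _ x y) z) =
      BalTensor.tmul _ _ x (BalTensor.tmul _ _ y z)) :
    φ.rTensor A ∘ₗ ((s.tensor t hf).tensor u hf).lam =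
      (s.tensor (t.tensor u hf) hf).lam ∘ₗ φ.rTensor A := by
  refine TensorProduct.ext' fun p a => LinearMap.congr_fun
    (f := φ.rTensor A ∘ₗ ((s.tensor t hf).tensor u hf).lam ∘ₗ (TensorProduct.mk k _ A).flip a)
    (g := (s.tensor (t.tensor u hf) hf).lam ∘ₗ (TensorProduct.mk k _ A).flip a ∘ₗ φ)
    (BalTensor.hom_ext₃ fun x y z => ?_) p
  simp only [LinearMap.comp_apply, LinearMap.flip_apply, TensorProduct.mk_apply, hφ,
    tensor_lam_tmul]
  refine LinearMap.congr_fun (f := φ.rTensor A ∘ₗ (s.tensor t hf).lamPair (BalTensor.tmul _ _)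
    (BalTensor.tmul _ _ x y)) (g := s.lamPair (BalTensor.tmul _ _) x ∘ₗ
      t.lamPair (BalTensor.tmul _ _) y) (TensorProduct.ext' fun z a => ?_) _
  simp only [LinearMap.comp_apply, lamPair_tmul, tensor_lam_tmul]
  refine LinearMap.congr_fun (f := φ.rTensor A ∘ₗ ((BalTensor.tmul _ _).flip z).rTensor A ∘ₗ
    s.lamPair (BalTensor.tmul _ _) x) (g := s.lamPair (BalTensor.tmul _ _) x ∘ₗ
      ((BalTensor.tmul (t.bimod hf) (u.bimod hf)).flip z).rTensor A)
    (TensorProduct.ext' fun y a => ?_) _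
  simp only [LinearMap.comp_apply, lamPair_tmul, LinearMap.rTensor_tmul,
    ← LinearMap.rTensor_comp_apply]
  congr 2
  ext x
  exact hφ x y z

/-! ### The unit comodule -/

/-- Linear functionals of the form `r ↦ ω(r p)` separate the elements of `R`. -/
theorem sliceL_base_separates (H : RegWMB k A) {V : Type v} [AddCommGroup V] [Module k V]
    (z : H.base ⊗[k] V)
    (h : ∀ x : (A →ₗ[k] k) × A, sliceL V (x.1 ∘ₗ H.evL x.2) z = 0) : z = 0 :=
  H.base_tensor_ext_left fun p => sliceL_injective fun ω => by
    rw [sliceL_rTensor, map_zero, map_zero]; exact h (ω, p)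

/-- The map `λ` of the base algebra. -/
def unitLam (H : RegWMB k A) (hf : H.RightFull) : H.base ⊗[k] A →ₗ[k] H.base ⊗[k] A :=
  TensorProduct.lift ((left.domRestrict H.base.toSubmodule).compr₂ (H.Om hf))

/-- The map `ρ` of the base algebra. -/
def unitRho (H : RegWMB k A) : H.base ⊗[k] A →ₗ[k] H.base ⊗[k] A :=
  TensorProduct.lift ((right.domRestrict H.base.toSubmodule).compr₂ H.Om')

theorem unitLam_tmul (H : RegWMB k A) (hf : H.RightFull) (r : H.base) (a : A) :
    unitLam H hf (r ⊗ₜ a) = H.Om hf (left r.1 a) := rfl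

/-- Slicing `λ₁₂ λ₁₃ (r ⊗ z)` on the factor `R` gives `(l ⊗ 1) E (1 ⊗ r) z` with `l` in the second
leg of `E`. This turns the comodule axioms for `R` into rules for `E`. -/
theorem sliceL_unitLam (H : RegWMB k A) (hf : H.RightFull) (ω : A →ₗ[k] k) (p : A) (r : H.base)
    (z : A ⊗[k] A) : (sliceL A (ω ∘ₗ H.evL p)).rTensor A ((unitLam H hf).rTensor A
      (leg13 A (unitLam H hf) ((TensorProduct.mk k _ A r).rTensor A z))) =
      (H.legL ω p).rTensor A (H.E₁ ((left r.1).lTensor A z)) := by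
  refine LinearMap.congr_fun (f := (sliceL A (ω ∘ₗ H.evL p)).rTensor A ∘ₗ
    (unitLam H hf).rTensor A ∘ₗ leg13 A (unitLam H hf) ∘ₗ (TensorProduct.mk k _ A r).rTensor A)
    (g := (H.legL ω p).rTensor A ∘ₗ H.E₁ ∘ₗ (left r.1).lTensor A)
    (TensorProduct.ext' fun a b => ?_) z
  simp only [LinearMap.comp_apply, LinearMap.rTensor_tmul, TensorProduct.mk_apply, leg13_tmul,
    LinearMap.lTensor_tmul, unitLam_tmul]
  rw [← H.evL_Om hf, ← LinearMap.rTensor_comp_apply, ← LinearMap.rTensor_comp_apply,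
    ← LinearMap.rTensor_comp_apply]
  congr 2
  ext r
  simp only [LinearMap.comp_apply, LinearMap.flip_apply, TensorProduct.mk_apply, unitLam_tmul,
    ← sliceL_rTensor, H.evL_Om]
  rfl

/-- The base algebra as a comodule. -/
def unit (H : RegWMB k A) (hf : H.RightFull) : ComodStr H H.base where
  lam := unitLam H hf
  rho := unitRho H
  compat r a b := by
    have h := H.lm_Om hf a (left r.1 b)
    rw [show rm k (left r.1 b) = rm k b ∘ₗ right r.1 from
      RegWMB.rm_left _ _, LinearMap.lTensor_comp_apply, ← H.Om'_right] at h
    exact h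
  coassoc := by
    refine TensorProduct.ext_threefold fun r a b => ?_
    simp only [LinearMap.comp_apply, leg23_tmul, LinearMap.rTensor_tmul]
    refine eq_of_rTensor (fun x : (A →ₗ[k] k) × A => sliceL A (x.1 ∘ₗ H.evL x.2))
      (sliceL_base_separates H) fun x => ?_
    rw [sliceL_unitLam, ← (H.base_isBase r).T₁_left, H.E₁_T₁, ← H.T₁_legL, sliceL_leg23,
      LinearMap.rTensor_tmul, unitLam_tmul, ← sliceL_rTensor, H.evL_Om]
    rfl
  normal := by
    refine TensorProduct.ext_threefold fun r a b => ?_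
    simp only [LinearMap.comp_apply, leg23_tmul]
    refine eq_of_rTensor (fun x : (A →ₗ[k] k) × A => sliceL A (x.1 ∘ₗ H.evL x.2))
      (sliceL_base_separates H) fun x => ?_
    have h := sliceL_unitLam H hf x.1 x.2 r (a ⊗ₜ b)
    rw [LinearMap.rTensor_tmul] at h
    rw [sliceL_unitLam, ← (H.base_isBase r).E₁_left]
    refine Eq.trans ?_ h.symm
    rw [← LinearMap.comp_apply (f := H.E₁), H.wmb.E₁_idem]
  full := by
    rw [← Submodule.ker_mkQ (Submodule.span k _), LinearMap.ker_eq_top]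
    ext r
    obtain ⟨e, he⟩ := H.exists_right_unit hf r
    obtain ⟨a, rfl⟩ := H.piBarR'_surjective hf e
    refine (Submodule.Quotient.mk_eq_zero _).2 (Submodule.subset_span ⟨r, a, H.ε, ?_⟩)
    rw [unitLam_tmul, H.sliceR_ε_Om, H.piBarR'_mul, he]

theorem unit_lam_tmul (H : RegWMB k A) (hf : H.RightFull) (r : H.base) (a : A) :
    (unit H hf).lam (r ⊗ₜ a) = H.Om hf (left r.1 a) := rfl

theorem unit_rho_tmul (H : RegWMB k A) (hf : H.RightFull) (r : H.base) (a : A) :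
    (unit H hf).rho (r ⊗ₜ a) = H.Om' (right r.1 a) := rfl

theorem unit_bimod (H : RegWMB k A) (hf : H.RightFull) :
    (unit H hf).bimod hf = BimodStr.regular k H.base := by
  refine BimodStr.ext_maps (fun r z => ?_) (fun r z => ?_)
  · obtain ⟨a, rfl⟩ := H.piR'_surjective r
    rw [bimod_l, lAct_piR', unit_rho_tmul, H.sliceR_ε_Om', H.piR'_mul, BimodStr.regular_l]
  · obtain ⟨a, rfl⟩ := H.piBarR'_surjective hf r
    rw [bimod_r, rAct_piBarR', unit_lam_tmul, H.sliceR_ε_Om, H.piBarR'_mul, BimodStr.regular_r]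

/-- The left unit constraint is a comodule map. -/
theorem actL_lam (hf : H.RightFull) {s : ComodStr H M}
    {φ : BalTensor ((unit H hf).bimod hf) (s.bimod hf) →ₗ[k] M}
    (hφ : ∀ r m, φ (BalTensor.tmul _ _ r m) = (s.bimod hf).l r m) :
    φ.rTensor A ∘ₗ ((unit H hf).tensor s hf).lam = s.lam ∘ₗ φ.rTensor A := by
  refine TensorProduct.ext' fun p a => BalTensor.hom_ext_apply
    (f := φ.rTensor A ∘ₗ ((unit H hf).tensor s hf).lam ∘ₗ (TensorProduct.mk k _ A).flip a)
    (g := s.lam ∘ₗ (TensorProduct.mk k _ A).flip a ∘ₗ φ) (fun r m => ?_) p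
  simp only [LinearMap.comp_apply, LinearMap.flip_apply, TensorProduct.mk_apply, hφ,
    tensor_lam_tmul]
  rw [bimod_l, lam_lAct, ← omL_lam s hf]
  conv_lhs => rw [s.omL_lam hf]
  refine LinearMap.congr_fun (f := φ.rTensor A ∘ₗ (unit H hf).lamPair (BalTensor.tmul _ _) r)
    (g := (left r.1).lTensor M ∘ₗ s.omL hf) (TensorProduct.ext' fun m b => ?_) _
  rw [LinearMap.comp_apply, LinearMap.comp_apply, lamPair_tmul, unit_lam_tmul, H.Om_left, omL_tmul,
    ← rTensor_lTensor, ← LinearMap.rTensor_comp_apply]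
  congr 2
  ext r
  exact hφ r m

/-- The right unit constraint is a comodule map. -/
theorem actR_lam (hf : H.RightFull) {s : ComodStr H M}
    {φ : BalTensor (s.bimod hf) ((unit H hf).bimod hf) →ₗ[k] M}
    (hφ : ∀ m r, φ (BalTensor.tmul _ _ m r) = (s.bimod hf).r r m) :
    φ.rTensor A ∘ₗ (s.tensor (unit H hf) hf).lam = s.lam ∘ₗ φ.rTensor A := by
  refine TensorProduct.ext' fun p a => BalTensor.hom_ext_apply
    (f := φ.rTensor A ∘ₗ (s.tensor (unit H hf) hf).lam ∘ₗ (TensorProduct.mk k _ A).flip a)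
    (g := s.lam ∘ₗ (TensorProduct.mk k _ A).flip a ∘ₗ φ) (fun m r => ?_) p
  simp only [LinearMap.comp_apply, LinearMap.flip_apply, TensorProduct.mk_apply, hφ,
    tensor_lam_tmul]
  rw [bimod_r, lam_rAct, ← lam_Om s hf, unit_lam_tmul]
  refine LinearMap.congr_fun (f := φ.rTensor A ∘ₗ s.lamPair (BalTensor.tmul _ _) m)
    (TensorProduct.ext' fun r b => ?_) _
  rw [LinearMap.comp_apply, lamPair_tmul, ← LinearMap.rTensor_comp_apply]
  refine LinearMap.congr_fun (congrArg _ ?_) _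
  ext m
  exact hφ m r

end ComodStr

/-! ### Yetter-Drinfeld modules -/

namespace RegWMB

variable {k : Type u} {A : Type v} {_ : Field k} {iA : NonUnitalRing A} {_ : Module k A}
  {i1 : IsScalarTower k A A} {i2 : SMulCommClass k A A}

/-- `Δ(b) Δ(q) (1 ⊗ z) = Δ(b q) (1 ⊗ z)` -/
theorem ΔL_T₁ (H : RegWMB k A) (b q z : A) : H.ΔL b (H.T₁ (q ⊗ₜ z)) = H.T₁ ((b * q) ⊗ₜ z) := by
  refine H.eq_of_rTensor_rm fun y => ?_
  have e (w : A ⊗[k] A) : (rm k y).rTensor A (H.ΔL b w) = H.ΔL b ((rm k y).rTensor A w) := by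
    refine LinearMap.congr_fun (f := (rm k y).rTensor A ∘ₗ H.ΔL b)
      (g := H.ΔL b ∘ₗ (rm k y).rTensor A) (TensorProduct.ext' fun p c => ?_) w
    simp only [LinearMap.comp_apply, LinearMap.rTensor_tmul, ΔL_tmul, ← LinearMap.rTensor_comp_apply]
    congr 2
    ext x
    simp [mul_assoc]
  have h := LinearMap.congr_fun (H.wmb.Δ_mul b q) (y ⊗ₜ z)
  exact (e _).trans h.symm

theorem ΔR_T₃ (H : RegWMB k A) (b q z : A) : H.ΔR b (H.T₃ (q ⊗ₜ z)) = H.T₃ ((q * b) ⊗ₜ z) := by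
  refine Eq.trans ?_ (ΔL_T₁ H.opp b q z)
  exact LinearMap.congr_fun (f := H.ΔR b) (TensorProduct.ext' fun p c => H.ΔR_tmul' b p c) _

theorem Om'_lm (H : RegWMB k A) (w b : A) : H.Om' (w * b) = (lm k w).lTensor _ (H.Om' b) := by
  refine H.base_tensor_ext_right fun p => ?_
  rw [rTensor_lTensor, evR_Om', evR_Om', ← E₂_lm_right]
  rfl

end RegWMB

namespace ModStr

variable {k : Type u} {A V W U P : Type v} [Field k] [NonUnitalRing A] [Module k A]
  [IsScalarTower k A A] [SMulCommClass k A A]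
  [AddCommGroup V] [Module k V] [AddCommGroup W] [Module k W] [AddCommGroup U] [Module k U]

theorem regular_bimod_r (H : RegWMB k A) (r : H.base) (a : A) :
    ((regular H).bimod H).r r a = right r.1 a := by
  refine LinearMap.congr_fun (g := right r.1) ((regular H).ext_span fun x y => ?_) a
  rw [bimod_r, mact_act]
  exact (H.right_mul_apply _ _ _).symm

/-- `(a ⊗ w) Δ(b) = a b₁ ⊗ w · b₂` -/
theorem diag_regular_left (H : RegWMB k A) (t : ModStr k A W) (b a : A) (w : W) :
    (regular H).diag H t b (a ⊗ₜ w) = (t.act w).lTensor A (H.T₂ (a ⊗ₜ b)) := by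
  refine LinearMap.congr_fun (f := (regular H).diag H t b ∘ₗ (TensorProduct.mk k A W).flip w)
    (g := (t.act w).lTensor A ∘ₗ H.T₂ ∘ₗ (TensorProduct.mk k A A).flip b)
    ((regular H).ext_span fun x y => ?_) a
  simp only [LinearMap.comp_apply, LinearMap.flip_apply, TensorProduct.mk_apply, diag_act_left]
  refine Eq.trans ?_ (congrArg _ (H.T₂_lm x y b).symm)
  exact LinearMap.congr_fun (f := TensorProduct.map (lm k x) (t.act w))
    (g := (t.act w).lTensor A ∘ₗ (lm k x).rTensor A) (TensorProduct.ext' fun _ _ => rfl) _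

/-- `(v ⊗ a) Δ(b) = v · b₁ ⊗ a b₂` -/
theorem diag_regular_right (H : RegWMB k A) (s : ModStr k A V) (b a : A) (v : V) :
    s.diag H (regular H) b (v ⊗ₜ a) = (s.act v).rTensor A (H.T₃ (b ⊗ₜ a)) := by
  refine LinearMap.congr_fun (f := s.diag H (regular H) b ∘ₗ TensorProduct.mk k V A v)
    (g := (s.act v).rTensor A ∘ₗ H.T₃ ∘ₗ TensorProduct.mk k A A b)
    ((regular H).ext_span fun x y => ?_) a
  simp only [LinearMap.comp_apply, TensorProduct.mk_apply, diag_act_right]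
  refine Eq.trans ?_ (congrArg _ (H.T₃_lm b x y).symm)
  exact LinearMap.congr_fun (f := TensorProduct.map (s.act v) (lm k x))
    (g := (s.act v).rTensor A ∘ₗ (lm k x).lTensor A) (TensorProduct.ext' fun _ _ => rfl) _

/-- `E₂^{V,A}` in terms of the elements `(1 ⊗ a) E` of `R ⊗ A`. -/
theorem E₂_regular_right (H : RegWMB k A) (s : ModStr k A V) (v : V) (a : A) :
    s.E₂ H (regular H) (v ⊗ₜ a) = ((s.bimod H).r.flip v).rTensor A (H.Om' a) := by
  refine LinearMap.congr_fun (f := s.E₂ H (regular H) ∘ₗ TensorProduct.mk k V A v)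
    (g := ((s.bimod H).r.flip v).rTensor A ∘ₗ H.Om')
    ((regular H).ext_span fun x y => ?_) a
  simp only [LinearMap.comp_apply, TensorProduct.mk_apply, E₂_act_right]
  refine Eq.trans ?_ (congrArg _ (H.Om'_lm x y).symm)
  exact LinearMap.congr_fun (f := TensorProduct.map ((s.bimod H).r.flip v) (lm k x))
    (g := ((s.bimod H).r.flip v).rTensor A ∘ₗ (lm k x).lTensor _)
    (TensorProduct.ext' fun _ _ => rfl) _

theorem E₂_regular_left (H : RegWMB k A) (t : ModStr k A W) (a : A) (w : W) (b : A) :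
    (regular H).E₂ H t (a ⊗ₜ t.act w b) = TensorProduct.map (H.evR a) (t.act w) (H.Om' b) := by
  rw [E₂_act_right]
  congr 2
  ext r
  exact regular_bimod_r H r a

/-- `E` commutes with `1 ⊗ r`. -/
theorem E₂_right (H : RegWMB k A) (s : ModStr k A V) (t : ModStr k A W) (r : H.base)
    (z : V ⊗[k] W) : s.E₂ H t (((t.bimod H).r r).lTensor V z) =
      ((t.bimod H).r r).lTensor V (s.E₂ H t z) := by
  refine LinearMap.congr_fun (f := s.E₂ H t ∘ₗ ((t.bimod H).r r).lTensor V)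
    (g := ((t.bimod H).r r).lTensor V ∘ₗ s.E₂ H t) (s.tensor_ext_left fun v a w => ?_) z
  refine LinearMap.congr_fun (f := (s.E₂ H t ∘ₗ ((t.bimod H).r r).lTensor V) ∘ₗ
    TensorProduct.mk k V W (s.act v a)) (g := (((t.bimod H).r r).lTensor V ∘ₗ s.E₂ H t) ∘ₗ
    TensorProduct.mk k V W (s.act v a)) (t.ext_span fun w b => ?_) w
  simp only [LinearMap.comp_apply, TensorProduct.mk_apply, LinearMap.lTensor_tmul, E₂_act]
  rw [bimod_r, mact_act, E₂_act]
  have h := (H.base_isBase r).opp.E₁_left (a ⊗ₜ b)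
  refine (congrArg _ h).trans ?_
  exact LinearMap.congr_fun (f := TensorProduct.map (s.act v) (t.act w) ∘ₗ (right r.1).lTensor A)
    (g := (t.mact r.1).lTensor V ∘ₗ TensorProduct.map (s.act v) (t.act w))
    (TensorProduct.ext' fun _ _ => by simp [mact_act]) _

/-- The diagonal action as a linear map. -/
def diagHom (H : RegWMB k A) (s : ModStr k A V) (t : ModStr k A W) :
    A →ₗ[k] V ⊗[k] W →ₗ[k] V ⊗[k] W where
  toFun := s.diag H t
  map_add' a b := LinearMap.ext fun z => diag_add H s t a b z
  map_smul' c a := LinearMap.ext fun z => diag_smul H s t c a z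

end ModStr

namespace ComodStr

variable {k : Type u} {A M N X : Type v} [Field k] [NonUnitalRing A] [Module k A]
  [IsScalarTower k A A] [SMulCommClass k A A] {H : RegWMB k A}
  [AddCommGroup M] [Module k M] [AddCommGroup N] [Module k N] [AddCommGroup X] [Module k X]

/-- The first compatibility condition of a Yetter-Drinfeld module:
`ρ((x ⊗ a) Δᵒᵖ(b)) = ρ(x ⊗ a) Δ(b)`. -/
def IsYD (c : ComodStr H M) (m : ModStr k A M) : Prop := ∀ b x a,
  c.rho (TensorProduct.comm k A M ((ModStr.regular H).diag H m b (a ⊗ₜ x))) =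
    m.diag H (ModStr.regular H) b (c.rho (x ⊗ₜ a))

/-- The condition `E₂^{X,A} ρ = ρ` holds if the two right actions of the base algebra agree. -/
theorem E₂_rho_of_bimod (hf : H.RightFull) {c : ComodStr H M} {m : ModStr k A M}
    (h : m.bimod H = c.bimod hf) : m.E₂ H (ModStr.regular H) ∘ₗ c.rho = c.rho := by
  have e : m.E₂ H (ModStr.regular H) = TensorProduct.lift
      ((LinearMap.rTensorHom A ∘ₗ (c.rAct hf).flip).compl₂ H.Om') := by
    refine TensorProduct.ext' fun x a => ?_
    rw [ModStr.E₂_regular_right, h]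
    rfl
  rw [e]
  exact TensorProduct.ext' fun x a => c.omR_rho hf x a

/-- The condition `ρ (E₂^{A,X})²¹ = ρ` holds if the two left actions of the base algebra agree. -/
theorem rho_E₂_of_bimod (hf : H.RightFull) {c : ComodStr H M} {m : ModStr k A M}
    (h : m.bimod H = c.bimod hf) : c.rho ∘ₗ (TensorProduct.comm k A M).toLinearMap ∘ₗ
    (ModStr.regular H).E₂ H m ∘ₗ (TensorProduct.comm k M A).toLinearMap = c.rho := by
  refine TensorProduct.ext' fun x a => ?_
  refine LinearMap.congr_fun (f := (c.rho ∘ₗ (TensorProduct.comm k A M).toLinearMap ∘ₗ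
    (ModStr.regular H).E₂ H m ∘ₗ (TensorProduct.comm k M A).toLinearMap) ∘ₗ
    (TensorProduct.mk k M A).flip a) (g := c.rho ∘ₗ (TensorProduct.mk k M A).flip a)
    (m.ext_span fun x b => ?_) x
  simp only [LinearMap.comp_apply, LinearMap.flip_apply, TensorProduct.mk_apply,
    LinearEquiv.coe_coe, TensorProduct.comm_tmul, ModStr.E₂_regular_left]
  conv_rhs => rw [← H.lift_tau_Om' b]
  refine LinearMap.congr_fun (f := c.rho ∘ₗ (TensorProduct.comm k A M).toLinearMap ∘ₗ
    TensorProduct.map (H.evR a) (m.act x)) (g := c.rho ∘ₗ (TensorProduct.mk k M A).flip a ∘ₗ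
    m.act x ∘ₗ TensorProduct.lift (right ∘ₗ H.tau)) (TensorProduct.ext' fun r b => ?_) _
  simp only [LinearMap.comp_apply, TensorProduct.map_tmul, LinearEquiv.coe_coe,
    TensorProduct.comm_tmul, LinearMap.flip_apply, TensorProduct.mk_apply,
    TensorProduct.lift.tmul, H.evR_apply]
  rw [← c.rho_lAct hf, ← bimod_l, ← h, ModStr.bimod_l, ModStr.mact_act]

/-- The base algebra is a Yetter-Drinfeld module. -/
theorem unit_isYD (hf : H.RightFull) : (unit H hf).IsYD (ModStr.unit H) := by
  -- `((1 ⊗ x) E) Δ(b) = (1 ⊗ x b) E` in `R ⊗ A`, with the diagonal action on the left-hand side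
  have key (b x : A) : (ModStr.unit H).diag H (ModStr.regular H) b (H.Om' x) = H.Om' (x * b) := by
    refine LinearMap.congr_fun (f := (ModStr.unit H).diag H (ModStr.regular H) b ∘ₗ H.Om')
      (g := H.Om' ∘ₗ rm k b) (H.ext_mul (X := H.base ⊗[k] A) fun z q => ?_) x
    simp only [LinearMap.comp_apply, LinearMap.flip_apply, LinearMap.mul_apply']
    rw [mul_assoc, H.Om'_mul, H.Om'_mul, ← H.ΔR_T₃]
    refine LinearMap.congr_fun (f := (ModStr.unit H).diag H (ModStr.regular H) b ∘ₗ
      H.piR'.rTensor A) (g := H.piR'.rTensor A ∘ₗ H.ΔR b) (TensorProduct.ext' fun p y => ?_) _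
    simp only [LinearMap.comp_apply, LinearMap.rTensor_tmul, ModStr.diag_regular_right]
    rw [H.ΔR_tmul', ← LinearMap.rTensor_comp_apply]
    congr 2
    ext c
    rw [ModStr.unit_act]
    rfl
  intro b r a
  obtain ⟨c, rfl⟩ := H.piR'_surjective r
  rw [unit_rho_tmul, key, ModStr.diag_regular_left, ← mul_left, H.piR'_coe, H.piR_left,
    ← LinearMap.mul_apply' (R := k) a, ← sliceR_rTensor', H.rm_T₃]
  have e := H.E₂_lm_right c (H.T₂ (a ⊗ₜ b))
  rw [H.E₂_T₂] at e
  rw [← e]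
  refine LinearMap.congr_fun (f := (unit H hf).rho ∘ₗ
    (TensorProduct.comm k A H.base).toLinearMap ∘ₗ ((ModStr.unit H).act (H.piR' c)).lTensor A)
    (g := H.Om' ∘ₗ sliceR A H.ε ∘ₗ H.E₂ ∘ₗ (lm k c).lTensor A)
    (TensorProduct.ext' fun u v => ?_) _
  simp only [LinearMap.comp_apply, LinearMap.lTensor_tmul, LinearEquiv.coe_coe,
    TensorProduct.comm_tmul, ModStr.unit_act, unit_rho_tmul, H.piR'_coe, H.piR_right]
  rfl

end ComodStr

namespace YD

variable {k : Type u} {A : Type v} [Field k] [NonUnitalRing A] [Module k A]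
  [IsScalarTower k A A] [SMulCommClass k A A] {H : RegWMB k A}

/-- On a Yetter-Drinfeld module the two bimodule structures over the base algebra coincide. -/
theorem bimod_eq (hf : H.RightFull) (X : YD H) : X.mstr.bimod H = X.cstr.bimod hf := by
  -- a firm bimodule is non-degenerate, so it suffices to compare the images under `ρ`
  have hrho {x y : X.carrier} (h : ∀ a, X.cstr.rho (x ⊗ₜ a) = X.cstr.rho (y ⊗ₜ a)) : x = y := by
    refine (X.cstr.bimod_firm hf).eq_of_l H.exists_left_unit fun r => ?_
    obtain ⟨a, rfl⟩ := H.piR'_surjective r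
    rw [ComodStr.bimod_l, ComodStr.lAct_piR', ComodStr.lAct_piR', h]
  have hE (z : A ⊗[k] X.carrier) : X.cstr.rho (TensorProduct.comm k A X.carrier
      ((ModStr.regular H).E₂ H X.mstr z)) = X.cstr.rho (TensorProduct.comm k A X.carrier z) := by
    have := LinearMap.congr_fun X.rho_E₂ (TensorProduct.comm k A X.carrier z)
    simpa using this
  refine BimodStr.ext_maps (fun r x => hrho fun a => ?_) (fun r x => hrho fun a => ?_)
  -- `a r ⊗ x` and `a ⊗ r ▹ x` have the same image under `E₂`, and `ρ` absorbs `E₂`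
  · rw [ComodStr.bimod_l, ComodStr.rho_lAct, ← TensorProduct.comm_tmul, ← hE,
      ← ModStr.E₂_balanced, hE, ModStr.regular_bimod_r, TensorProduct.comm_tmul]
  -- the values of the diagonal action span the range of `E₂`; on these, both right actions of `r` on
  -- `X` correspond under `ρ` to the right multiplication by `1 ⊗ r`, as follows from the
  -- Yetter-Drinfeld condition for `b r`
  · have key : ((X.cstr.rho ∘ₗ (TensorProduct.comm k A X.carrier).toLinearMap ∘ₗ
        ((X.mstr.bimod H).r r).lTensor A) ∘ₗ (ModStr.regular H).E₂ H X.mstr) =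
        (X.cstr.rho ∘ₗ (TensorProduct.comm k A X.carrier).toLinearMap ∘ₗ
        (X.cstr.rAct hf r).lTensor A) ∘ₗ (ModStr.regular H).E₂ H X.mstr := by
      refine ModStr.E₂_ext_diag H _ _ fun b z => ?_
      simp only [LinearMap.comp_apply, LinearEquiv.coe_coe]
      rw [← ModStr.diag_right]
      refine LinearMap.congr_fun (f := X.cstr.rho ∘ₗ
        (TensorProduct.comm k A X.carrier).toLinearMap ∘ₗ
        (ModStr.regular H).diag H X.mstr (right r.1 b))
        (g := X.cstr.rho ∘ₗ (TensorProduct.comm k A X.carrier).toLinearMap ∘ₗ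
        (X.cstr.rAct hf r).lTensor A ∘ₗ (ModStr.regular H).diag H X.mstr b)
        (TensorProduct.ext' fun a x => ?_) z
      simp only [LinearMap.comp_apply, LinearEquiv.coe_coe, X.rho_Δ]
      rw [ModStr.diag_right, ← X.rho_Δ]
      refine LinearMap.congr_fun (f := (((ModStr.regular H).bimod H).r r).lTensor _ ∘ₗ
        X.cstr.rho ∘ₗ (TensorProduct.comm k A X.carrier).toLinearMap)
        (g := X.cstr.rho ∘ₗ (TensorProduct.comm k A X.carrier).toLinearMap ∘ₗ
        (X.cstr.rAct hf r).lTensor A) (TensorProduct.ext' fun a x => ?_) _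
      simp only [LinearMap.comp_apply, LinearEquiv.coe_coe, LinearMap.lTensor_tmul,
        TensorProduct.comm_tmul, ComodStr.rho_rAct]
      congr 2
      ext a
      exact ModStr.regular_bimod_r H r a
    have key := LinearMap.congr_fun key (a ⊗ₜ x)
    simp only [LinearMap.comp_apply, LinearEquiv.coe_coe, ← ModStr.E₂_right, hE] at key
    have e (z : A ⊗[k] X.carrier) : X.cstr.rho (TensorProduct.comm k A X.carrier
        ((X.cstr.rAct hf r).lTensor A z)) = (right r.1).lTensor _
          (X.cstr.rho (TensorProduct.comm k A X.carrier z)) :=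
      LinearMap.congr_fun (f := X.cstr.rho ∘ₗ (TensorProduct.comm k A X.carrier).toLinearMap ∘ₗ
        (X.cstr.rAct hf r).lTensor A) (g := (right r.1).lTensor _ ∘ₗ X.cstr.rho ∘ₗ
          (TensorProduct.comm k A X.carrier).toLinearMap)
        (TensorProduct.ext' fun a x => by simp [ComodStr.rho_rAct]) z
    rw [e, hE, ← e] at key
    rw [ComodStr.bimod_r]
    simpa using key

end YD

namespace ComodStr

variable {k : Type u} {A M N X : Type v} [Field k] [NonUnitalRing A] [Module k A]
  [IsScalarTower k A A] [SMulCommClass k A A] {H : RegWMB k A}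
  [AddCommGroup M] [Module k M] [AddCommGroup N] [Module k N] [AddCommGroup X] [Module k X]

/-! ### The tensor product of Yetter-Drinfeld modules -/

/-- Linear dependence of `rhoPair` on the element of the comodule. -/
def rhoPairHom (t : ComodStr H N) (b : M →ₗ[k] N →ₗ[k] X) : N →ₗ[k] M ⊗[k] A →ₗ[k] X ⊗[k] A where
  toFun := t.rhoPair b
  map_add' n n' := TensorProduct.ext' fun m a => by
    simp [rhoPair_tmul, TensorProduct.add_tmul]
  map_smul' c n := TensorProduct.ext' fun m a => by
    simp [rhoPair_tmul, ← TensorProduct.smul_tmul']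

/-- `x · e b₁ ⊗ (y ⊗ a) Δ(b₂) = (x · e ⊗ y ⊗ a) (Δ ⊗ A) Δ(b)` -/
theorem lift_diagHom_T₂ (m : ModStr k A M) (n : ModStr k A N) (x : M) (e b : A) :
    TensorProduct.lift ((LinearMap.llcomp k (N ⊗[k] A) (N ⊗[k] A)
      (BalTensor (m.bimod H) (n.bimod H) ⊗[k] A) ∘ₗ LinearMap.rTensorHom A ∘ₗ
      BalTensor.tmul (m.bimod H) (n.bimod H) ∘ₗ m.act x).compl₂
      (n.diagHom H (ModStr.regular H))) (H.T₂ (e ⊗ₜ b)) =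
    (m.tensor H n).diag H (ModStr.regular H) b ∘ₗ
      (BalTensor.tmul (m.bimod H) (n.bimod H) (m.act x e)).rTensor A := by
  refine TensorProduct.ext' fun y a => ?_
  have h1 : (m.tensor H n).act (BalTensor.tmul _ _ (m.act x e) y) =
      (BalTensor.proj (m.bimod H) (n.bimod H) ∘ₗ TensorProduct.map (m.act x) (n.act y)) ∘ₗ
        TensorProduct.curry H.T₂ e := LinearMap.ext fun c => m.tensor_act_tmul_left H n x y e c
  rw [LinearMap.comp_apply, LinearMap.rTensor_tmul, ModStr.diag_regular_right, h1,
    LinearMap.rTensor_comp_apply, H.T₂_T₃]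
  refine LinearMap.congr_fun (f := LinearMap.applyₗ (y ⊗ₜ a) ∘ₗ TensorProduct.lift _)
    (g := (BalTensor.proj (m.bimod H) (n.bimod H) ∘ₗ
      TensorProduct.map (m.act x) (n.act y)).rTensor A ∘ₗ
      (TensorProduct.assoc k A A A).symm.toLinearMap ∘ₗ ((TensorProduct.curry H.T₃).flip a).lTensor A)
    (TensorProduct.ext' fun u w => ?_) (H.T₂ (e ⊗ₜ b))
  have h2 : (TensorProduct.lift ((LinearMap.llcomp k (N ⊗[k] A) (N ⊗[k] A)
      (BalTensor (m.bimod H) (n.bimod H) ⊗[k] A) ∘ₗ LinearMap.rTensorHom A ∘ₗ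
      BalTensor.tmul (m.bimod H) (n.bimod H) ∘ₗ m.act x).compl₂
      (n.diagHom H (ModStr.regular H))) (u ⊗ₜ w)) (y ⊗ₜ a) =
      (BalTensor.tmul (m.bimod H) (n.bimod H) (m.act x u)).rTensor A
        ((n.act y).rTensor A (H.T₃ (w ⊗ₜ a))) :=
    congrArg ((BalTensor.tmul (m.bimod H) (n.bimod H) (m.act x u)).rTensor A)
      (n.diag_regular_right H w a y)
  refine h2.trans ?_
  simp only [LinearMap.comp_apply, LinearMap.lTensor_tmul, LinearEquiv.coe_coe,
    LinearMap.flip_apply, TensorProduct.curry_apply]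
  exact LinearMap.congr_fun (f := (BalTensor.tmul (m.bimod H) (n.bimod H) (m.act x u)).rTensor A ∘ₗ
      (n.act y).rTensor A) (g := (BalTensor.proj (m.bimod H) (n.bimod H) ∘ₗ
      TensorProduct.map (m.act x) (n.act y)).rTensor A ∘ₗ
      (TensorProduct.assoc k A A A).symm.toLinearMap ∘ₗ TensorProduct.mk k A (A ⊗[k] A) u)
      (TensorProduct.ext' fun v q => by simp [BalTensor.proj_tmul]) _

/-- The map `p ⊗ q ↦ (M ⊗ ρ(y · q ⊗ -)) ((-) Δ(p))`. -/
def rhoDiag (c : ComodStr H N) (m : ModStr k A M) (n : ModStr k A N) (y : N) :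
    A ⊗[k] A →ₗ[k] M ⊗[k] A →ₗ[k] BalTensor (m.bimod H) (n.bimod H) ⊗[k] A :=
  TensorProduct.lift ((LinearMap.llcomp k (M ⊗[k] A) (M ⊗[k] A)
    (BalTensor (m.bimod H) (n.bimod H) ⊗[k] A)).flip.compl₁₂ (m.diagHom H (ModStr.regular H))
      (c.rhoPairHom (BalTensor.tmul (m.bimod H) (n.bimod H)) ∘ₗ n.act y))

theorem rhoDiag_tmul (c : ComodStr H N) (m : ModStr k A M) (n : ModStr k A N) (y : N) (p q : A)
    (z : M ⊗[k] A) : c.rhoDiag m n y (p ⊗ₜ q) z =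
      c.rhoPair (BalTensor.tmul (m.bimod H) (n.bimod H)) (n.act y q)
        (m.diag H (ModStr.regular H) p z) := rfl

/-- `x · b₁ ⊗_R ρ(y · d b₃ ⊗ a b₂) = (x ⊗_R ρ(y · d ⊗ a)) Δ(b)`: the Yetter-Drinfeld condition of
the second factor, applied to `b₂`. -/
theorem rhoDiag_T₃ {c : ComodStr H N} (m : ModStr k A M) {n : ModStr k A N} (h : c.IsYD n) (y : N)
    (b d : A) : c.rhoDiag m n y (H.T₃ (b ⊗ₜ d)) =
      (m.tensor H n).diag H (ModStr.regular H) b ∘ₗ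
        c.rhoPair (BalTensor.tmul (m.bimod H) (n.bimod H)) (n.act y d) := by
  refine m.tensor_ext_left fun x e a => ?_
  -- the map `(u ⊗ v) ⊗ q ↦ x · u ⊗ ρ(y · q ⊗ a v)`
  let Φ : (A ⊗[k] A) ⊗[k] A →ₗ[k] BalTensor (m.bimod H) (n.bimod H) ⊗[k] A :=
    TensorProduct.lift ((LinearMap.rTensorHom A ∘ₗ BalTensor.tmul (m.bimod H) (n.bimod H)).compl₁₂
      (m.act x) (c.rho ∘ₗ (TensorProduct.comm k A N).toLinearMap ∘ₗ
        TensorProduct.map (lm k a) (n.act y))) ∘ₗ (TensorProduct.assoc k A A A).toLinearMap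
  have h1 : c.rhoDiag m n y (H.T₃ (b ⊗ₜ d)) (m.act x e ⊗ₜ a) =
      Φ ((TensorProduct.curry H.T₂ e).rTensor A (H.T₃ (b ⊗ₜ d))) := by
    refine LinearMap.congr_fun (f := (c.rhoDiag m n y).flip (m.act x e ⊗ₜ a))
      (g := Φ ∘ₗ (TensorProduct.curry H.T₂ e).rTensor A) (TensorProduct.ext' fun p q => ?_) _
    rw [LinearMap.flip_apply, rhoDiag_tmul, ModStr.diag_act_left]
    refine LinearMap.congr_fun (f := c.rhoPair (BalTensor.tmul _ _) (n.act y q) ∘ₗ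
      TensorProduct.map (m.act x) (lm k a)) (g := Φ ∘ₗ (TensorProduct.mk k _ A).flip q)
      (TensorProduct.ext' fun u v => ?_) _
    simp [Φ, rhoPair_tmul]
  have h2 : Φ ((TensorProduct.assoc k A A A).symm
      ((((TensorProduct.curry H.T₃).flip d)).lTensor A (H.T₂ (e ⊗ₜ b)))) =
      TensorProduct.lift ((LinearMap.llcomp k (N ⊗[k] A) (N ⊗[k] A)
      (BalTensor (m.bimod H) (n.bimod H) ⊗[k] A) ∘ₗ LinearMap.rTensorHom A ∘ₗ
      BalTensor.tmul (m.bimod H) (n.bimod H) ∘ₗ m.act x).compl₂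
      (n.diagHom H (ModStr.regular H))) (H.T₂ (e ⊗ₜ b)) (c.rho (n.act y d ⊗ₜ a)) := by
    refine LinearMap.congr_fun (f := Φ ∘ₗ (TensorProduct.assoc k A A A).symm.toLinearMap ∘ₗ
      ((TensorProduct.curry H.T₃).flip d).lTensor A)
      (g := LinearMap.applyₗ (c.rho (n.act y d ⊗ₜ a)) ∘ₗ TensorProduct.lift _)
      (TensorProduct.ext' fun u w => ?_) _
    have h3 : Φ ((TensorProduct.assoc k A A A).symm (u ⊗ₜ H.T₃ (w ⊗ₜ d))) =
        (BalTensor.tmul (m.bimod H) (n.bimod H) (m.act x u)).rTensor A (c.rho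
          (TensorProduct.comm k A N (TensorProduct.map (lm k a) (n.act y) (H.T₃ (w ⊗ₜ d))))) := by
      simp only [Φ, LinearMap.comp_apply, LinearEquiv.coe_coe, LinearEquiv.apply_symm_apply]
      rfl
    refine h3.trans ?_
    have h4 : TensorProduct.map (lm k a) (n.act y) (H.T₃ (w ⊗ₜ d)) =
      (ModStr.regular H).diag H n w (a ⊗ₜ n.act y d) :=
        ((ModStr.regular H).diag_act_right H n w a y d).symm
    rw [h4, h]
    rfl
  rw [h1, H.T₂_T₃, h2, lift_diagHom_T₂]
  rfl

/-- The first compatibility condition for the tensor product of Yetter-Drinfeld modules: in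
`ρ(x · b₂ ⊗ y · e b₃ ⊗ a b₁)`, the condition of the first factor applies to `b₁` and `b₂`, and then
`rhoDiag_T₃` applies. -/
theorem IsYD.tensor {c : ComodStr H M} {m : ModStr k A M} {d : ComodStr H N} {n : ModStr k A N}
    (h : c.IsYD m) (h' : d.IsYD n) {t : ComodStr H (BalTensor (m.bimod H) (n.bimod H))}
    (ht : ∀ x y a, t.rho (BalTensor.tmul (m.bimod H) (n.bimod H) x y ⊗ₜ a) =
      d.rhoPair (BalTensor.tmul (m.bimod H) (n.bimod H)) y (c.rho (x ⊗ₜ a))) :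
    t.IsYD (m.tensor H n) := by
  intro b p a
  refine BalTensor.hom_ext_apply (f := t.rho ∘ₗ (TensorProduct.comm k A _).toLinearMap ∘ₗ
    (ModStr.regular H).diag H (m.tensor H n) b ∘ₗ TensorProduct.mk k A _ a)
    (g := (m.tensor H n).diag H (ModStr.regular H) b ∘ₗ t.rho ∘ₗ
      (TensorProduct.mk k _ A).flip a) (fun x y => ?_) p
  refine LinearMap.congr_fun (f := (t.rho ∘ₗ (TensorProduct.comm k A _).toLinearMap ∘ₗ
    (ModStr.regular H).diag H (m.tensor H n) b ∘ₗ TensorProduct.mk k A _ a) ∘ₗ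
    BalTensor.tmul (m.bimod H) (n.bimod H) x)
    (g := ((m.tensor H n).diag H (ModStr.regular H) b ∘ₗ t.rho ∘ₗ
      (TensorProduct.mk k _ A).flip a) ∘ₗ BalTensor.tmul (m.bimod H) (n.bimod H) x)
      (n.ext_span fun y e => ?_) y
  simp only [LinearMap.comp_apply, LinearMap.flip_apply, TensorProduct.mk_apply,
    LinearEquiv.coe_coe]
  have h1 : (m.tensor H n).act (BalTensor.tmul _ _ x (n.act y e)) =
      (BalTensor.proj (m.bimod H) (n.bimod H) ∘ₗ TensorProduct.map (m.act x) (n.act y)) ∘ₗ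
        (TensorProduct.curry H.T₃).flip e :=
    LinearMap.ext fun c => m.tensor_act_tmul_right H n x y e c
  have h2 := congrArg (TensorProduct.assoc k A A A) (H.T₂_T₃ a e b)
  rw [LinearEquiv.apply_symm_apply] at h2
  rw [ModStr.diag_regular_left, h1, LinearMap.lTensor_comp_apply, ← h2, ht,
    ← LinearMap.comp_apply (f := (m.tensor H n).diag H (ModStr.regular H) b), ← rhoDiag_T₃ m h']
  refine LinearMap.congr_fun (f := t.rho ∘ₗ (TensorProduct.comm k A _).toLinearMap ∘ₗ
    (BalTensor.proj (m.bimod H) (n.bimod H) ∘ₗ TensorProduct.map (m.act x) (n.act y)).lTensor A ∘ₗ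
    (TensorProduct.assoc k A A A).toLinearMap ∘ₗ (TensorProduct.curry H.T₂ a).rTensor A)
    (g := (d.rhoDiag m n y).flip (c.rho (x ⊗ₜ a))) (TensorProduct.ext' fun p q => ?_) _
  rw [LinearMap.flip_apply, rhoDiag_tmul, ← h, ModStr.diag_regular_left]
  refine LinearMap.congr_fun (f := t.rho ∘ₗ (TensorProduct.comm k A _).toLinearMap ∘ₗ
    (BalTensor.proj (m.bimod H) (n.bimod H) ∘ₗ TensorProduct.map (m.act x) (n.act y)).lTensor A ∘ₗ
    (TensorProduct.assoc k A A A).toLinearMap ∘ₗ (TensorProduct.mk k _ A).flip q)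
    (g := d.rhoPair (BalTensor.tmul _ _) (n.act y q) ∘ₗ c.rho ∘ₗ
      (TensorProduct.comm k A M).toLinearMap ∘ₗ (m.act x).lTensor A)
    (TensorProduct.ext' fun u v => ?_) _
  simp [BalTensor.proj_tmul, ht]

/-- The comodule structure of `M ⊗_R N`, with the bimodule structures of `M` and `N` given up to
equality. -/
def tensorOf (s : ComodStr H M) (t : ComodStr H N) (hf : H.RightFull) {S : BimodStr k H.base M}
    {T : BimodStr k H.base N} (hS : S = s.bimod hf) (hT : T = t.bimod hf) :
    ComodStr H (BalTensor S T) := by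
  subst hS hT
  exact s.tensor t hf

theorem tensorOf_rho_tmul (s : ComodStr H M) (t : ComodStr H N) (hf : H.RightFull)
    {S : BimodStr k H.base M} {T : BimodStr k H.base N} (hS : S = s.bimod hf)
    (hT : T = t.bimod hf) (m : M) (n : N) (a : A) :
    (s.tensorOf t hf hS hT).rho (BalTensor.tmul _ _ m n ⊗ₜ a) =
      t.rhoPair (BalTensor.tmul _ _) n (s.rho (m ⊗ₜ a)) := by
  subst hS hT
  exact s.tensor_rho_tmul t hf m n a

theorem tensorOf_bimod (s : ComodStr H M) (t : ComodStr H N) (hf : H.RightFull)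
    {S : BimodStr k H.base M} {T : BimodStr k H.base N} (hS : S = s.bimod hf)
    (hT : T = t.bimod hf) : (s.tensorOf t hf hS hT).bimod hf = S.tensor T := by
  subst hS hT
  exact s.tensor_bimod t hf

end ComodStr

namespace YD

variable {k : Type u} {A : Type v} [Field k] [NonUnitalRing A] [Module k A]
  [IsScalarTower k A A] [SMulCommClass k A A] {H : RegWMB k A}

/-- The Yetter-Drinfeld module `X ⊗_R Y`. -/
abbrev tensor (hf : H.RightFull) (X Y : YD H) : YD H where
  carrier := BalTensor (X.mstr.bimod H) (Y.mstr.bimod H)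
  mstr := X.mstr.tensor H Y.mstr
  cstr := X.cstr.tensorOf Y.cstr hf (X.bimod_eq hf) (Y.bimod_eq hf)
  rho_Δ := ComodStr.IsYD.tensor X.rho_Δ Y.rho_Δ (ComodStr.tensorOf_rho_tmul _ _ hf _ _)
  E₂_rho := ComodStr.E₂_rho_of_bimod hf
    ((ModStr.tensor_bimod H _ _).trans (ComodStr.tensorOf_bimod _ _ hf _ _).symm)
  rho_E₂ := ComodStr.rho_E₂_of_bimod hf
    ((ModStr.tensor_bimod H _ _).trans (ComodStr.tensorOf_bimod _ _ hf _ _).symm)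

/-- The base algebra as a Yetter-Drinfeld module. -/
abbrev unit (hf : H.RightFull) : YD H where
  carrier := H.base
  mstr := ModStr.unit H
  cstr := ComodStr.unit H hf
  rho_Δ := ComodStr.unit_isYD hf
  E₂_rho := ComodStr.E₂_rho_of_bimod hf
    ((ModStr.unit_bimod H).trans (ComodStr.unit_bimod H hf).symm)
  rho_E₂ := ComodStr.rho_E₂_of_bimod hf
    ((ModStr.unit_bimod H).trans (ComodStr.unit_bimod H hf).symm)

end YD

section StrictLift

/-! ### Lifting monoidal structures strictly along faithful functors -/

variable {C D D' : Type*} [Category* C] [Category* D] [Category* D'] [MonoidalCategory C]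

/-- The data needed to lift the monoidal structure of `C` along `F : D ⥤ C` in such a way that `F`
becomes strict monoidal: objects of `D` on top of the monoidal products and of the unit, such that
the structure morphisms of `C` are values of `F`. -/
structure StrictLift (F : D ⥤ C) where
  tensor : D → D → D
  unit : D
  tensor_eq : ∀ X Y, F.obj X ⊗ F.obj Y = F.obj (tensor X Y)
  unit_eq : 𝟙_ C = F.obj unit
  exists_map : ∀ {X Y X' Y' : D} (f : X ⟶ X') (g : Y ⟶ Y'),
    ∃ h : tensor X Y ⟶ tensor X' Y', F.map h =
      eqToHom (tensor_eq X Y).symm ≫ (F.map f ⊗ₘ F.map g) ≫ eqToHom (tensor_eq X' Y')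
  exists_assoc : ∀ X Y Z : D, ∃ h : tensor (tensor X Y) Z ⟶ tensor X (tensor Y Z), F.map h =
    eqToHom (tensor_eq (tensor X Y) Z).symm ≫ (eqToHom (tensor_eq X Y).symm ▷ F.obj Z) ≫
      (α_ (F.obj X) (F.obj Y) (F.obj Z)).hom ≫ (F.obj X ◁ eqToHom (tensor_eq Y Z)) ≫
      eqToHom (tensor_eq X (tensor Y Z))
  exists_left : ∀ X : D, ∃ h : tensor unit X ⟶ X, F.map h =
    eqToHom (tensor_eq unit X).symm ≫ (eqToHom unit_eq.symm ▷ F.obj X) ≫ (λ_ (F.obj X)).hom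
  exists_right : ∀ X : D, ∃ h : tensor X unit ⟶ X, F.map h =
    eqToHom (tensor_eq X unit).symm ≫ (F.obj X ◁ eqToHom unit_eq.symm) ≫ (ρ_ (F.obj X)).hom

namespace StrictLift

variable {F : D ⥤ C} (L : StrictLift F)

/-- The lift of `F(f) ⊗ F(g)`. -/
def map {X Y X' Y' : D} (f : X ⟶ X') (g : Y ⟶ Y') : L.tensor X Y ⟶ L.tensor X' Y' :=
  (L.exists_map f g).choose

theorem map_spec {X Y X' Y' : D} (f : X ⟶ X') (g : Y ⟶ Y') : F.map (L.map f g) =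
    eqToHom (L.tensor_eq X Y).symm ≫ (F.map f ⊗ₘ F.map g) ≫ eqToHom (L.tensor_eq X' Y') :=
  (L.exists_map f g).choose_spec

omit [MonoidalCategory C] in
theorem exists_iso [F.ReflectsIsomorphisms] {X Y : D} {φ : F.obj X ⟶ F.obj Y} [IsIso φ]
    (h : ∃ f : X ⟶ Y, F.map f = φ) : ∃ f : X ≅ Y, F.map f.hom = φ := by
  obtain ⟨f, rfl⟩ := h
  have := isIso_of_reflects_iso f F
  exact ⟨asIso f, rfl⟩

variable [F.ReflectsIsomorphisms]

/-- The lift of the associativity constraint. -/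
def assoc (X Y Z : D) : L.tensor (L.tensor X Y) Z ≅ L.tensor X (L.tensor Y Z) :=
  (exists_iso (L.exists_assoc X Y Z)).choose

/-- The lift of the left unit constraint. -/
def leftUnitor (X : D) : L.tensor L.unit X ≅ X := (exists_iso (L.exists_left X)).choose

/-- The lift of the right unit constraint. -/
def rightUnitor (X : D) : L.tensor X L.unit ≅ X := (exists_iso (L.exists_right X)).choose

/-- The lifted operations. -/
@[reducible] def monoidalStruct : MonoidalCategoryStruct D where
  tensorObj := L.tensor
  whiskerLeft X _ _ f := L.map (𝟙 X) f
  whiskerRight f Y := L.map f (𝟙 Y)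
  tensorHom f g := L.map f g
  tensorUnit := L.unit
  associator := L.assoc
  leftUnitor := L.leftUnitor
  rightUnitor := L.rightUnitor

/-- The functor `F` is compatible with the lifted operations. -/
def inducingData : letI := L.monoidalStruct; Monoidal.InducingFunctorData F :=
  letI := L.monoidalStruct
  { μIso := fun X Y => eqToIso (L.tensor_eq X Y)
    εIso := eqToIso L.unit_eq
    whiskerLeft_eq := fun X _ _ f => (L.map_spec (𝟙 X) f).trans (by simp)
    whiskerRight_eq := fun f Y => (L.map_spec f (𝟙 Y)).trans (by simp)
    tensorHom_eq := fun f g => L.map_spec f g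
    associator_eq := fun X Y Z =>
      (exists_iso (L.exists_assoc X Y Z)).choose_spec.trans (by simp)
    leftUnitor_eq := fun X => (exists_iso (L.exists_left X)).choose_spec.trans (by simp)
    rightUnitor_eq := fun X => (exists_iso (L.exists_right X)).choose_spec.trans (by simp) }

variable [F.Faithful]

/-- The lifted monoidal structure. -/
@[reducible] def monoidal : MonoidalCategory D :=
  letI := L.monoidalStruct
  Monoidal.induced F L.inducingData

/-- The functor `F` is monoidal with respect to the lifted structure. -/
@[reducible] def functorMonoidal : letI := L.monoidal; F.Monoidal :=
  letI := L.monoidalStruct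
  Monoidal.fromInducedMonoidal F L.inducingData

theorem ε_eq : letI := L.monoidal; letI := L.functorMonoidal
    Functor.LaxMonoidal.ε F = eqToHom L.unit_eq := rfl

theorem μ_eq (X Y : D) : letI := L.monoidal; letI := L.functorMonoidal
    Functor.LaxMonoidal.μ F X Y = eqToHom (L.tensor_eq X Y) := rfl

theorem isStrictMonoidal : letI := L.monoidal; letI := L.functorMonoidal
    IsStrictMonoidal F := ⟨⟨_, L.ε_eq⟩, fun X Y => ⟨_, L.μ_eq X Y⟩⟩

/-- A functor between categories with lifted monoidal structures, which commutes with the functors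
to the base category and preserves the chosen monoidal products and unit, is strict monoidal. -/
theorem exists_isStrictMonoidal {F' : D' ⥤ C} [F'.ReflectsIsomorphisms] [F'.Faithful]
    (L' : StrictLift F') (G : D ⥤ D') (hF : F = G ⋙ F')
    (hT : ∀ X Y, L'.tensor (G.obj X) (G.obj Y) = G.obj (L.tensor X Y))
    (hI : L'.unit = G.obj L.unit) :
    letI := L.monoidal; letI := L'.monoidal
    ∃ _ : G.Monoidal, IsStrictMonoidal G := by
  subst hF
  let _ := L.monoidal
  let _ := L'.monoidal
  have hwr {X Y : D'} (f : X ⟶ Y) (Z : D') : F'.map (f ▷ Z) =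
      eqToHom (L'.tensor_eq X Z).symm ≫ (F'.map f ▷ F'.obj Z) ≫ eqToHom (L'.tensor_eq Y Z) :=
    (L'.map_spec f (𝟙 Z)).trans (by simp)
  have hwl {X Y : D'} (Z : D') (f : X ⟶ Y) : F'.map (Z ◁ f) =
      eqToHom (L'.tensor_eq Z X).symm ≫ (F'.obj Z ◁ F'.map f) ≫ eqToHom (L'.tensor_eq Z Y) :=
    (L'.map_spec (𝟙 Z) f).trans (by simp)
  have hwr' {X Y : D} (f : X ⟶ Y) (Z : D) : F'.map (G.map (f ▷ Z)) =
      eqToHom (L.tensor_eq X Z).symm ≫ (F'.map (G.map f) ▷ F'.obj (G.obj Z)) ≫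
        eqToHom (L.tensor_eq Y Z) :=
    (L.map_spec f (𝟙 Z)).trans (by simp)
  have hwl' {X Y : D} (Z : D) (f : X ⟶ Y) : F'.map (G.map (Z ◁ f)) =
      eqToHom (L.tensor_eq Z X).symm ≫ (F'.obj (G.obj Z) ◁ F'.map (G.map f)) ≫
        eqToHom (L.tensor_eq Z Y) :=
    (L.map_spec (𝟙 Z) f).trans (by simp)
  have ha (X Y Z : D') : F'.map (α_ X Y Z).hom = _ :=
    (exists_iso (L'.exists_assoc X Y Z)).choose_spec
  have ha' (X Y Z : D) : F'.map (G.map (α_ X Y Z).hom) = _ :=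
    (exists_iso (L.exists_assoc X Y Z)).choose_spec
  have hl (X : D') : F'.map (λ_ X).hom = _ := (exists_iso (L'.exists_left X)).choose_spec
  have hl' (X : D) : F'.map (G.map (λ_ X).hom) = _ := (exists_iso (L.exists_left X)).choose_spec
  have hr (X : D') : F'.map (ρ_ X).hom = _ := (exists_iso (L'.exists_right X)).choose_spec
  have hr' (X : D) : F'.map (G.map (ρ_ X).hom) = _ := (exists_iso (L.exists_right X)).choose_spec
  -- every coherence equation in `D'` is checked after applying the faithful functor `F'`
  let core : G.CoreMonoidal :=
    { εIso := eqToIso hI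
      μIso := fun X Y => eqToIso (hT X Y)
      μIso_hom_natural_left := fun {X Y} f X' => F'.map_injective (by
        simp [hwr, hwr', eqToHom_map])
      μIso_hom_natural_right := fun {X Y} X' f => F'.map_injective (by
        simp [hwl, hwl', eqToHom_map])
      associativity := fun X Y Z => F'.map_injective (by
        simp [ha, ha', eqToHom_map, eqToHom_whiskerRight, whiskerLeft_eqToHom])
      left_unitality := fun X => F'.map_injective (by
        rw [hl]
        simp only [Functor.map_comp, hl', eqToIso.hom, hwr, eqToHom_map]
        simp [eqToHom_whiskerRight])
      right_unitality := fun X => F'.map_injective (by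
        rw [hr]
        simp only [Functor.map_comp, hr', eqToIso.hom, hwl, eqToHom_map]
        simp [whiskerLeft_eqToHom]) }
  exact ⟨core.toMonoidal, ⟨hI, rfl⟩, fun X Y => ⟨hT X Y, rfl⟩⟩

end StrictLift

end StrictLift

/-! ### Structure morphisms of firm bimodules up to equality of objects -/

namespace FirmBimod

variable {k : Type u} {R : Type v} [Field k] [NonUnitalRing R] [Module k R]
  [IsScalarTower k R R] [SMulCommClass k R R]

theorem mk_congr {V : Type v} [AddCommGroup V] [Module k V] {s t : BimodStr k R V}
    (h : s = t) {hs : s.IsFirm} {ht : t.IsFirm} : (⟨V, s, hs⟩ : FirmBimod k R) = ⟨V, t, ht⟩ := by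
  subst h; rfl

theorem str_eq {V : Type v} [AddCommGroup V] [Module k V] {s t : BimodStr k R V}
    {hs : s.IsFirm} {ht : t.IsFirm} (h : (⟨V, s, hs⟩ : FirmBimod k R) = ⟨V, t, ht⟩) : s = t := by
  simpa using h

/-- The identification of two bimodules with the same underlying vector space is the identity
map. -/
theorem eqToHom_lin {V : Type v} [AddCommGroup V] [Module k V] {s t : BimodStr k R V}
    {hs : s.IsFirm} {ht : t.IsFirm} (h : (⟨V, s, hs⟩ : FirmBimod k R) = ⟨V, t, ht⟩) :
    Hom.lin (eqToHom h) = LinearMap.id := by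
  obtain rfl := str_eq h
  rfl

/-- Conjugation by identifications of bimodules with the same underlying space does not change the
underlying map of `f ⊗_R g`. -/
theorem conj_tensorHom_tmul {X Y X' Y' : FirmBimod k R} {p : BimodStr k R (BalTensor X.str Y.str)}
    {p' : BimodStr k R (BalTensor X'.str Y'.str)} {hp : p.IsFirm} {hp' : p'.IsFirm}
    (h : tensorObj X Y = ⟨_, p, hp⟩) (h' : tensorObj X' Y' = ⟨_, p', hp'⟩) (f : X ⟶ X')
    (g : Y ⟶ Y') (x : X.carrier) (y : Y.carrier) :
    Hom.lin (eqToHom h.symm ≫ tensorHom f g ≫ eqToHom h') (BalTensor.tmul X.str Y.str x y) =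
      BalTensor.tmul X'.str Y'.str (Hom.lin f x) (Hom.lin g y) := by
  obtain rfl := str_eq h
  obtain rfl := str_eq h'
  simp [tensorHom]

/-- The associativity constraint, up to equality of the bimodule structures involved. -/
theorem conj_associator_tmul {X Y Z : FirmBimod k R} {p : BimodStr k R (BalTensor X.str Y.str)}
    {q : BimodStr k R (BalTensor Y.str Z.str)} {p' : BimodStr k R (BalTensor p Z.str)}
    {q' : BimodStr k R (BalTensor X.str q)} {hp : p.IsFirm} {hq : q.IsFirm}
    {hp' : p'.IsFirm} {hq' : q'.IsFirm} (h₁ : tensorObj X Y = ⟨_, p, hp⟩)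
    (h₂ : tensorObj ⟨_, p, hp⟩ Z = ⟨_, p', hp'⟩) (h₃ : tensorObj Y Z = ⟨_, q, hq⟩)
    (h₄ : tensorObj X ⟨_, q, hq⟩ = ⟨_, q', hq'⟩) (x : X.carrier) (y : Y.carrier)
    (z : Z.carrier) :
    Hom.lin (eqToHom h₂.symm ≫ tensorHom (eqToHom h₁.symm) (𝟙 Z) ≫ (associator X Y Z).hom ≫
      tensorHom (𝟙 X) (eqToHom h₃) ≫ eqToHom h₄)
        (BalTensor.tmul p Z.str (BalTensor.tmul X.str Y.str x y) z) =
      BalTensor.tmul X.str q x (BalTensor.tmul Y.str Z.str y z) := by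
  obtain rfl := str_eq h₁
  obtain rfl := str_eq h₂
  obtain rfl := str_eq h₃
  obtain rfl := str_eq h₄
  simp [tensorHom, associator]

/-- The left unit constraint, up to equality of the bimodule structures involved. -/
theorem conj_leftUnitor_tmul (hR : (BimodStr.regular k R).IsFirm) {X : FirmBimod k R}
    {s : BimodStr k R R} {p : BimodStr k R (BalTensor s X.str)} {hs : s.IsFirm} {hp : p.IsFirm}
    (h₁ : unit hR = ⟨R, s, hs⟩) (h₂ : tensorObj ⟨R, s, hs⟩ X = ⟨_, p, hp⟩) (r : R)
    (x : X.carrier) :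
    Hom.lin (eqToHom h₂.symm ≫ tensorHom (eqToHom h₁.symm) (𝟙 X) ≫ (leftUnitor hR X).hom)
      (BalTensor.tmul s X.str r x) = X.str.l r x := by
  obtain rfl := str_eq h₁
  obtain rfl := str_eq h₂
  simp only [eqToHom_refl, Category.id_comp, comp_lin, tensorHom, id_lin, LinearMap.comp_apply,
    BalTensor.map_tmul, LinearMap.id_apply]
  exact X.str.actL_tmul r x

/-- The right unit constraint, up to equality of the bimodule structures involved. -/
theorem conj_rightUnitor_tmul (hR : (BimodStr.regular k R).IsFirm) {X : FirmBimod k R}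
    {s : BimodStr k R R} {p : BimodStr k R (BalTensor X.str s)} {hs : s.IsFirm} {hp : p.IsFirm}
    (h₁ : unit hR = ⟨R, s, hs⟩) (h₂ : tensorObj X ⟨R, s, hs⟩ = ⟨_, p, hp⟩) (x : X.carrier)
    (r : R) :
    Hom.lin (eqToHom h₂.symm ≫ tensorHom (𝟙 X) (eqToHom h₁.symm) ≫ (rightUnitor hR X).hom)
      (BalTensor.tmul X.str s x r) = X.str.r r x := by
  obtain rfl := str_eq h₁
  obtain rfl := str_eq h₂
  simp only [eqToHom_refl, Category.id_comp, comp_lin, tensorHom, id_lin, LinearMap.comp_apply,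
    BalTensor.map_tmul, LinearMap.id_apply]
  exact X.str.actR_tmul x r

end FirmBimod

/-! ### Comodule maps, with the bimodule structures given up to equality -/

namespace ComodStr

variable {k : Type u} {A M N M' N' X : Type v} [Field k] [NonUnitalRing A] [Module k A]
  [IsScalarTower k A A] [SMulCommClass k A A] {H : RegWMB k A} [AddCommGroup M] [Module k M]
  [AddCommGroup N] [Module k N] [AddCommGroup M'] [Module k M'] [AddCommGroup N'] [Module k N']
  [AddCommGroup X] [Module k X]

theorem map_tensorOf_lam (hf : H.RightFull) {s : ComodStr H M} {t : ComodStr H N}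
    {s' : ComodStr H M'} {t' : ComodStr H N'} {S : BimodStr k H.base M} {T : BimodStr k H.base N}
    {S' : BimodStr k H.base M'} {T' : BimodStr k H.base N'} (hS : S = s.bimod hf)
    (hT : T = t.bimod hf) (hS' : S' = s'.bimod hf) (hT' : T' = t'.bimod hf)
    {f : M →ₗ[k] M'} {g : N →ₗ[k] N'}
    (h₁ : f.rTensor A ∘ₗ s.lam = s'.lam ∘ₗ f.rTensor A)
    (h₂ : g.rTensor A ∘ₗ t.lam = t'.lam ∘ₗ g.rTensor A)
    {φ : BalTensor S T →ₗ[k] BalTensor S' T'}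
    (hφ : ∀ m n, φ (BalTensor.tmul _ _ m n) = BalTensor.tmul _ _ (f m) (g n)) :
    φ.rTensor A ∘ₗ (s.tensorOf t hf hS hT).lam =
      (s'.tensorOf t' hf hS' hT').lam ∘ₗ φ.rTensor A := by
  subst hS hT hS' hT'
  exact map_tensor_lam hf h₁ h₂ hφ

theorem assoc_tensorOf_lam (hf : H.RightFull) {s : ComodStr H M} {t : ComodStr H N}
    {u : ComodStr H X} {S : BimodStr k H.base M} {T : BimodStr k H.base N}
    {U : BimodStr k H.base X} {P : BimodStr k H.base (BalTensor S T)}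
    {Q : BimodStr k H.base (BalTensor T U)} (hS : S = s.bimod hf) (hT : T = t.bimod hf)
    (hU : U = u.bimod hf) (hP : P = (s.tensorOf t hf hS hT).bimod hf)
    (hQ : Q = (t.tensorOf u hf hT hU).bimod hf) {φ : BalTensor P U →ₗ[k] BalTensor S Q}
    (hφ : ∀ x y z, φ (BalTensor.tmul _ _ (BalTensor.tmul _ _ x y) z) =
      BalTensor.tmul _ _ x (BalTensor.tmul _ _ y z)) :
    φ.rTensor A ∘ₗ ((s.tensorOf t hf hS hT).tensorOf u hf hP hU).lam =
      (s.tensorOf (t.tensorOf u hf hT hU) hf hS hQ).lam ∘ₗ φ.rTensor A := by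
  subst hS hT hU hP hQ
  exact assoc_lam hf hφ

theorem actL_tensorOf_lam (hf : H.RightFull) {s : ComodStr H M} {S : BimodStr k H.base M}
    {U : BimodStr k H.base H.base} (hS : S = s.bimod hf) (hU : U = (unit H hf).bimod hf)
    {φ : BalTensor U S →ₗ[k] M} (hφ : ∀ r m, φ (BalTensor.tmul _ _ r m) = S.l r m) :
    φ.rTensor A ∘ₗ ((unit H hf).tensorOf s hf hU hS).lam = s.lam ∘ₗ φ.rTensor A := by
  subst hS hU
  exact actL_lam hf hφ

theorem actR_tensorOf_lam (hf : H.RightFull) {s : ComodStr H M} {S : BimodStr k H.base M}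
    {U : BimodStr k H.base H.base} (hS : S = s.bimod hf) (hU : U = (unit H hf).bimod hf)
    {φ : BalTensor S U →ₗ[k] M} (hφ : ∀ m r, φ (BalTensor.tmul _ _ m r) = S.r r m) :
    φ.rTensor A ∘ₗ (s.tensorOf (unit H hf) hf hS hU).lam = s.lam ∘ₗ φ.rTensor A := by
  subst hS hU
  exact actR_lam hf hφ

end ComodStr

/-! ### The monoidal categories of modules, comodules and Yetter-Drinfeld modules -/

section MonoidalStructures

variable {k : Type u} {A : Type v} [Field k] [NonUnitalRing A] [Module k A]
  [IsScalarTower k A A] [SMulCommClass k A A] (H : RegWMB k A) (hf : H.RightFull)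

namespace RMod

/-- The functor from `A`-modules to firm bimodules over the base algebra. -/
abbrev toBimod : RMod k A ⥤ FirmBimod k H.base :=
  modToBimod (H.isBaseAlgebra hf) fun V => V.str.modBimod H hf

/-- The `A`-module `V ⊗_R W`. -/
abbrev tensor (V W : RMod k A) : RMod k A := ⟨_, V.str.tensor H W.str⟩

/-- The base algebra as an `A`-module. -/
abbrev unit : RMod k A := ⟨_, ModStr.unit H⟩

instance : (toBimod H hf).Faithful where
  map_injective h := Hom.ext (congrArg FirmBimod.Hom.lin h)

instance : (toBimod H hf).ReflectsIsomorphisms where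
  reflects {V W} f hφ := by
    obtain ⟨g, h₁, h₂⟩ := hφ.out
    let l : W.carrier →ₗ[k] V.carrier := FirmBimod.Hom.lin g
    have h₁' : l ∘ₗ f.lin = LinearMap.id := congrArg FirmBimod.Hom.lin h₁
    have h₂' : f.lin ∘ₗ l = LinearMap.id := congrArg FirmBimod.Hom.lin h₂
    refine ⟨⟨l, fun x a => ?_⟩, Hom.ext h₁', Hom.ext h₂'⟩
    have h₃ : l (f.lin (V.str.act (l x) a)) = V.str.act (l x) a := LinearMap.congr_fun h₁' _
    rwa [f.map_act, show f.lin (l x) = x from LinearMap.congr_fun h₂' x] at h₃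

theorem tensor_eq (V W : RMod k A) :
    FirmBimod.tensorObj ((toBimod H hf).obj V) ((toBimod H hf).obj W) =
      (toBimod H hf).obj (tensor H V W) :=
  FirmBimod.mk_congr (V.str.tensor_bimod H W.str).symm

theorem unit_eq : FirmBimod.unit (H.base_firm hf) = (toBimod H hf).obj (unit H) :=
  FirmBimod.mk_congr (ModStr.unit_bimod H).symm

/-- The monoidal structure of firm bimodules lifts to `A`-modules. -/
def strictLift : letI := FirmBimod.monoidal (H.base_firm hf); StrictLift (toBimod H hf) :=
  letI := FirmBimod.monoidal (H.base_firm hf)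
  { tensor := tensor H
    unit := unit H
    tensor_eq := tensor_eq H hf
    unit_eq := unit_eq H hf
    exists_map := fun {V W V' W'} f g => by
      let φ : (toBimod H hf).obj (tensor H V W) ⟶ (toBimod H hf).obj (tensor H V' W') :=
        eqToHom (tensor_eq H hf V W).symm ≫
          FirmBimod.tensorHom ((toBimod H hf).map f) ((toBimod H hf).map g) ≫
          eqToHom (tensor_eq H hf V' W')
      have hφ : ∀ v w, FirmBimod.Hom.lin φ
          (BalTensor.tmul (V.str.bimod H) (W.str.bimod H) v w) =
          BalTensor.tmul (V'.str.bimod H) (W'.str.bimod H) (f.lin v) (g.lin w) :=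
        FirmBimod.conj_tensorHom_tmul (tensor_eq H hf V W) (tensor_eq H hf V' W') _ _
      exact ⟨⟨FirmBimod.Hom.lin φ, ModStr.map_act H f.map_act g.map_act hφ⟩, rfl⟩
    exists_assoc := fun V W U => by
      let φ : (toBimod H hf).obj (tensor H (tensor H V W) U) ⟶
          (toBimod H hf).obj (tensor H V (tensor H W U)) :=
        eqToHom (tensor_eq H hf (tensor H V W) U).symm ≫
          FirmBimod.tensorHom (eqToHom (tensor_eq H hf V W).symm) (𝟙 ((toBimod H hf).obj U)) ≫
          (FirmBimod.associator ((toBimod H hf).obj V) ((toBimod H hf).obj W)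
            ((toBimod H hf).obj U)).hom ≫
          FirmBimod.tensorHom (𝟙 ((toBimod H hf).obj V)) (eqToHom (tensor_eq H hf W U)) ≫
          eqToHom (tensor_eq H hf V (tensor H W U))
      have hφ := FirmBimod.conj_associator_tmul (tensor_eq H hf V W)
        (tensor_eq H hf (tensor H V W) U) (tensor_eq H hf W U)
        (tensor_eq H hf V (tensor H W U))
      exact ⟨⟨FirmBimod.Hom.lin φ, ModStr.assoc_act H hφ⟩, rfl⟩
    exists_left := fun V => by
      let φ : (toBimod H hf).obj (tensor H (unit H) V) ⟶ (toBimod H hf).obj V :=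
        eqToHom (tensor_eq H hf (unit H) V).symm ≫
          FirmBimod.tensorHom (eqToHom (unit_eq H hf).symm) (𝟙 ((toBimod H hf).obj V)) ≫
          (FirmBimod.leftUnitor (H.base_firm hf) ((toBimod H hf).obj V)).hom
      have hφ := FirmBimod.conj_leftUnitor_tmul (H.base_firm hf) (unit_eq H hf)
        (tensor_eq H hf (unit H) V)
      exact ⟨⟨FirmBimod.Hom.lin φ, ModStr.actL_act H hφ⟩, rfl⟩
    exists_right := fun V => by
      let φ : (toBimod H hf).obj (tensor H V (unit H)) ⟶ (toBimod H hf).obj V :=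
        eqToHom (tensor_eq H hf V (unit H)).symm ≫
          FirmBimod.tensorHom (𝟙 ((toBimod H hf).obj V)) (eqToHom (unit_eq H hf).symm) ≫
          (FirmBimod.rightUnitor (H.base_firm hf) ((toBimod H hf).obj V)).hom
      have hφ := FirmBimod.conj_rightUnitor_tmul (H.base_firm hf) (unit_eq H hf)
        (tensor_eq H hf V (unit H))
      exact ⟨⟨FirmBimod.Hom.lin φ, ModStr.actR_act H hφ⟩, rfl⟩ }

end RMod

end MonoidalStructures

section MonoidalStructures

variable {k : Type u} {A : Type v} [Field k] [NonUnitalRing A] [Module k A]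
  [IsScalarTower k A A] [SMulCommClass k A A] {H : RegWMB k A} (hf : H.RightFull)

namespace FullComod

/-- The functor from `A`-comodules to firm bimodules over the base algebra. -/
abbrev toBimod : FullComod H ⥤ FirmBimod k H.base :=
  comodToBimod (H.isBaseAlgebra hf) fun M => M.str.comodBimod hf

/-- The `A`-comodule `M ⊗_R N`. -/
abbrev tensor (M N : FullComod H) : FullComod H := ⟨_, M.str.tensor N.str hf⟩

/-- The base algebra as an `A`-comodule. -/
abbrev unit : FullComod H := ⟨_, ComodStr.unit H hf⟩

instance : (toBimod hf).Faithful where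
  map_injective h := Hom.ext (congrArg FirmBimod.Hom.lin h)

/-- The inverse of a bijective comodule map is a comodule map. -/
theorem Hom.inv_map_lam {M N : FullComod H} (f : Hom M N) {l : N.carrier →ₗ[k] M.carrier}
    (h₁ : l ∘ₗ f.lin = LinearMap.id) (h₂ : f.lin ∘ₗ l = LinearMap.id) :
    l.rTensor A ∘ₗ N.str.lam = M.str.lam ∘ₗ l.rTensor A := by
  have h := congrArg (fun g => l.rTensor A ∘ₗ g ∘ₗ l.rTensor A) f.map_lam
  simp only [LinearMap.comp_assoc, ← LinearMap.rTensor_comp, h₂, LinearMap.rTensor_id,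
    LinearMap.comp_id] at h
  rw [← h, ← LinearMap.comp_assoc, ← LinearMap.rTensor_comp, h₁, LinearMap.rTensor_id,
    LinearMap.id_comp]

instance : (toBimod hf).ReflectsIsomorphisms where
  reflects {V W} f hφ := by
    obtain ⟨g, h₁, h₂⟩ := hφ.out
    let l : W.carrier →ₗ[k] V.carrier := FirmBimod.Hom.lin g
    have h₁' : l ∘ₗ f.lin = LinearMap.id := congrArg FirmBimod.Hom.lin h₁
    have h₂' : f.lin ∘ₗ l = LinearMap.id := congrArg FirmBimod.Hom.lin h₂
    exact ⟨⟨l, Hom.inv_map_lam f h₁' h₂'⟩, Hom.ext h₁', Hom.ext h₂'⟩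

theorem tensor_eq (V W : FullComod H) :
    FirmBimod.tensorObj ((toBimod hf).obj V) ((toBimod hf).obj W) =
      (toBimod hf).obj (tensor hf V W) :=
  FirmBimod.mk_congr (V.str.tensor_bimod W.str hf).symm

theorem unit_eq : FirmBimod.unit (H.base_firm hf) = (toBimod hf).obj (unit hf) :=
  FirmBimod.mk_congr (ComodStr.unit_bimod H hf).symm

/-- The monoidal structure of firm bimodules lifts to `A`-comodules. -/
def strictLift : letI := FirmBimod.monoidal (H.base_firm hf); StrictLift (toBimod hf) :=
  letI := FirmBimod.monoidal (H.base_firm hf)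
  { tensor := tensor hf
    unit := unit hf
    tensor_eq := tensor_eq hf
    unit_eq := unit_eq hf
    exists_map := fun {V W V' W'} f g => by
      let φ : (toBimod hf).obj (tensor hf V W) ⟶ (toBimod hf).obj (tensor hf V' W') :=
        eqToHom (tensor_eq hf V W).symm ≫
          FirmBimod.tensorHom ((toBimod hf).map f) ((toBimod hf).map g) ≫
          eqToHom (tensor_eq hf V' W')
      have hφ : ∀ v w, FirmBimod.Hom.lin φ
          (BalTensor.tmul (V.str.bimod hf) (W.str.bimod hf) v w) =
          BalTensor.tmul (V'.str.bimod hf) (W'.str.bimod hf) (f.lin v) (g.lin w) :=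
        FirmBimod.conj_tensorHom_tmul (tensor_eq hf V W) (tensor_eq hf V' W') _ _
      exact ⟨⟨FirmBimod.Hom.lin φ, ComodStr.map_tensor_lam hf f.map_lam g.map_lam hφ⟩, rfl⟩
    exists_assoc := fun V W U => by
      let φ : (toBimod hf).obj (tensor hf (tensor hf V W) U) ⟶
          (toBimod hf).obj (tensor hf V (tensor hf W U)) :=
        eqToHom (tensor_eq hf (tensor hf V W) U).symm ≫
          FirmBimod.tensorHom (eqToHom (tensor_eq hf V W).symm) (𝟙 ((toBimod hf).obj U)) ≫
          (FirmBimod.associator ((toBimod hf).obj V) ((toBimod hf).obj W)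
            ((toBimod hf).obj U)).hom ≫
          FirmBimod.tensorHom (𝟙 ((toBimod hf).obj V)) (eqToHom (tensor_eq hf W U)) ≫
          eqToHom (tensor_eq hf V (tensor hf W U))
      have hφ := FirmBimod.conj_associator_tmul (tensor_eq hf V W)
        (tensor_eq hf (tensor hf V W) U) (tensor_eq hf W U)
        (tensor_eq hf V (tensor hf W U))
      exact ⟨⟨FirmBimod.Hom.lin φ, ComodStr.assoc_lam hf hφ⟩, rfl⟩
    exists_left := fun V => by
      let φ : (toBimod hf).obj (tensor hf (unit hf) V) ⟶ (toBimod hf).obj V :=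
        eqToHom (tensor_eq hf (unit hf) V).symm ≫
          FirmBimod.tensorHom (eqToHom (unit_eq hf).symm) (𝟙 ((toBimod hf).obj V)) ≫
          (FirmBimod.leftUnitor (H.base_firm hf) ((toBimod hf).obj V)).hom
      have hφ := FirmBimod.conj_leftUnitor_tmul (H.base_firm hf) (unit_eq hf)
        (tensor_eq hf (unit hf) V)
      exact ⟨⟨FirmBimod.Hom.lin φ, ComodStr.actL_lam hf hφ⟩, rfl⟩
    exists_right := fun V => by
      let φ : (toBimod hf).obj (tensor hf V (unit hf)) ⟶ (toBimod hf).obj V :=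
        eqToHom (tensor_eq hf V (unit hf)).symm ≫
          FirmBimod.tensorHom (𝟙 ((toBimod hf).obj V)) (eqToHom (unit_eq hf).symm) ≫
          (FirmBimod.rightUnitor (H.base_firm hf) ((toBimod hf).obj V)).hom
      have hφ := FirmBimod.conj_rightUnitor_tmul (H.base_firm hf) (unit_eq hf)
        (tensor_eq hf V (unit hf))
      exact ⟨⟨FirmBimod.Hom.lin φ, ComodStr.actR_lam hf hφ⟩, rfl⟩ }

end FullComod

end MonoidalStructures

section MonoidalStructures

variable {k : Type u} {A : Type v} [Field k] [NonUnitalRing A] [Module k A]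
  [IsScalarTower k A A] [SMulCommClass k A A] {H : RegWMB k A} (hf : H.RightFull)

namespace YD

/-- The functor from Yetter-Drinfeld modules to firm bimodules over the base algebra. -/
abbrev toBimod : YD H ⥤ FirmBimod k H.base := toMod H ⋙ RMod.toBimod H hf

instance : (toBimod hf).Faithful where
  map_injective h := Hom.ext (congrArg FirmBimod.Hom.lin h)

instance : (toBimod hf).ReflectsIsomorphisms where
  reflects {V W} f hφ := by
    have : IsIso ((RMod.toBimod H hf).map ((toMod H).map f)) := hφ
    have hm : IsIso ((toMod H).map f) := isIso_of_reflects_iso _ (RMod.toBimod H hf)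
    obtain ⟨g, h₁, h₂⟩ := hm.out
    have h₁' : RMod.Hom.lin g ∘ₗ f.lin = LinearMap.id := congrArg RMod.Hom.lin h₁
    have h₂' : f.lin ∘ₗ RMod.Hom.lin g = LinearMap.id := congrArg RMod.Hom.lin h₂
    exact ⟨⟨RMod.Hom.lin g, g.map_act, FullComod.Hom.inv_map_lam ((toComod H).map f) h₁' h₂'⟩,
      Hom.ext h₁', Hom.ext h₂'⟩

theorem tensor_eq (V W : YD H) :
    FirmBimod.tensorObj ((toBimod hf).obj V) ((toBimod hf).obj W) =
      (toBimod hf).obj (tensor hf V W) :=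
  RMod.tensor_eq H hf _ _

theorem unit_eq : FirmBimod.unit (H.base_firm hf) = (toBimod hf).obj (unit hf) :=
  RMod.unit_eq H hf

set_option maxHeartbeats 400000 in
/-- The monoidal structure of firm bimodules lifts to Yetter-Drinfeld modules. -/
def strictLift : letI := FirmBimod.monoidal (H.base_firm hf); StrictLift (toBimod hf) :=
  letI := FirmBimod.monoidal (H.base_firm hf)
  { tensor := tensor hf
    unit := unit hf
    tensor_eq := tensor_eq hf
    unit_eq := unit_eq hf
    exists_map := fun {V W V' W'} f g => by
      let φ : (toBimod hf).obj (tensor hf V W) ⟶ (toBimod hf).obj (tensor hf V' W') :=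
        eqToHom (tensor_eq hf V W).symm ≫
          FirmBimod.tensorHom ((toBimod hf).map f) ((toBimod hf).map g) ≫
          eqToHom (tensor_eq hf V' W')
      have hφ : ∀ v w, FirmBimod.Hom.lin φ
          (BalTensor.tmul (V.mstr.bimod H) (W.mstr.bimod H) v w) =
          BalTensor.tmul (V'.mstr.bimod H) (W'.mstr.bimod H) (f.lin v) (g.lin w) :=
        FirmBimod.conj_tensorHom_tmul (tensor_eq hf V W) (tensor_eq hf V' W') _ _
      exact ⟨⟨FirmBimod.Hom.lin φ, ModStr.map_act H f.map_act g.map_act hφ,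
        ComodStr.map_tensorOf_lam hf (V.bimod_eq hf) (W.bimod_eq hf) (V'.bimod_eq hf)
          (W'.bimod_eq hf) f.map_lam g.map_lam hφ⟩, rfl⟩
    exists_assoc := fun V W U => by
      let φ : (toBimod hf).obj (tensor hf (tensor hf V W) U) ⟶
          (toBimod hf).obj (tensor hf V (tensor hf W U)) :=
        eqToHom (tensor_eq hf (tensor hf V W) U).symm ≫
          FirmBimod.tensorHom (eqToHom (tensor_eq hf V W).symm) (𝟙 ((toBimod hf).obj U)) ≫
          (FirmBimod.associator ((toBimod hf).obj V) ((toBimod hf).obj W)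
            ((toBimod hf).obj U)).hom ≫
          FirmBimod.tensorHom (𝟙 ((toBimod hf).obj V)) (eqToHom (tensor_eq hf W U)) ≫
          eqToHom (tensor_eq hf V (tensor hf W U))
      have hφ := FirmBimod.conj_associator_tmul (tensor_eq hf V W)
        (tensor_eq hf (tensor hf V W) U) (tensor_eq hf W U)
        (tensor_eq hf V (tensor hf W U))
      exact ⟨⟨FirmBimod.Hom.lin φ, ModStr.assoc_act H hφ,
        ComodStr.assoc_tensorOf_lam hf (V.bimod_eq hf) (W.bimod_eq hf) (U.bimod_eq hf)
          ((tensor hf V W).bimod_eq hf) ((tensor hf W U).bimod_eq hf) hφ⟩, rfl⟩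
    exists_left := fun V => by
      let φ : (toBimod hf).obj (tensor hf (unit hf) V) ⟶ (toBimod hf).obj V :=
        eqToHom (tensor_eq hf (unit hf) V).symm ≫
          FirmBimod.tensorHom (eqToHom (unit_eq hf).symm) (𝟙 ((toBimod hf).obj V)) ≫
          (FirmBimod.leftUnitor (H.base_firm hf) ((toBimod hf).obj V)).hom
      let l : BalTensor ((ModStr.unit H).bimod H) (V.mstr.bimod H) →ₗ[k] V.carrier :=
        FirmBimod.Hom.lin φ
      have hl : ∀ r v, l (BalTensor.tmul _ _ r v) = (V.mstr.bimod H).l r v :=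
        FirmBimod.conj_leftUnitor_tmul (H.base_firm hf) (unit_eq hf) (tensor_eq hf (unit hf) V)
      exact ⟨⟨l, ModStr.actL_act H hl, ComodStr.actL_tensorOf_lam hf (V.bimod_eq hf)
        ((unit hf).bimod_eq hf) hl⟩, rfl⟩
    exists_right := fun V => by
      let φ : (toBimod hf).obj (tensor hf V (unit hf)) ⟶ (toBimod hf).obj V :=
        eqToHom (tensor_eq hf V (unit hf)).symm ≫
          FirmBimod.tensorHom (𝟙 ((toBimod hf).obj V)) (eqToHom (unit_eq hf).symm) ≫
          (FirmBimod.rightUnitor (H.base_firm hf) ((toBimod hf).obj V)).hom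
      let l : BalTensor (V.mstr.bimod H) ((ModStr.unit H).bimod H) →ₗ[k] V.carrier :=
        FirmBimod.Hom.lin φ
      have hl : ∀ v r, l (BalTensor.tmul _ _ v r) = (V.mstr.bimod H).r r v :=
        FirmBimod.conj_rightUnitor_tmul (H.base_firm hf) (unit_eq hf) (tensor_eq hf V (unit hf))
      exact ⟨⟨l, ModStr.actR_act H hl, ComodStr.actR_tensorOf_lam hf (V.bimod_eq hf)
        ((unit hf).bimod_eq hf) hl⟩, rfl⟩ }

end YD

end MonoidalStructures

section MonoidalStructures

variable {k : Type u} {A : Type v} [Field k] [NonUnitalRing A] [Module k A]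
  [IsScalarTower k A A] [SMulCommClass k A A] {H : RegWMB k A} (hf : H.RightFull)

/-- Equality of the bimodule structures gives equality of the comodules built on the two tensor
products. -/
theorem ComodStr.tensor_eq_tensorOf {M N : Type v} [AddCommGroup M] [Module k M]
    [AddCommGroup N] [Module k N] (s : ComodStr H M) (t : ComodStr H N)
    {S : BimodStr k H.base M} {T : BimodStr k H.base N} (hS : S = s.bimod hf)
    (hT : T = t.bimod hf) :
    (⟨_, s.tensor t hf⟩ : FullComod H) = ⟨_, s.tensorOf t hf hS hT⟩ := by
  subst hS hT
  rfl

/-- The two ways to regard a Yetter-Drinfeld module as a firm bimodule agree. -/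
theorem YD.toMod_toBimod : toMod H ⋙ RMod.toBimod H hf = toComod H ⋙ FullComod.toBimod hf := by
  refine CategoryTheory.Functor.ext (fun X => FirmBimod.mk_congr (X.bimod_eq hf)) fun X Y f =>
    FirmBimod.hom_ext' ?_
  rw [FirmBimod.comp_lin, FirmBimod.comp_lin]
  have h₁ := FirmBimod.eqToHom_lin (FirmBimod.mk_congr (X.bimod_eq hf)
    (hs := X.mstr.bimod_firm H hf) (ht := X.cstr.bimod_firm hf))
  have h₂ := FirmBimod.eqToHom_lin (FirmBimod.mk_congr (Y.bimod_eq hf)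
    (hs := Y.mstr.bimod_firm H hf) (ht := Y.cstr.bimod_firm hf)).symm
  exact (congrArg₂ (fun (a : Y.carrier →ₗ[k] Y.carrier) (b : X.carrier →ₗ[k] X.carrier) =>
    (a ∘ₗ f.lin) ∘ₗ b) h₂ h₁).symm

theorem RMod.isDiagonalMod (V W : RMod k A) : IsDiagonalMod H V.str W.str (tensor H V W).str
    (FirmBimod.Hom.lin (eqToHom (tensor_eq H hf V W)) ∘ₗ
      BalTensor.proj (V.str.bimod H) (W.str.bimod H)) := by
  have h : FirmBimod.Hom.lin (eqToHom (tensor_eq H hf V W)) = LinearMap.id :=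
    FirmBimod.eqToHom_lin _
  intro z c
  rw [h]
  exact ModStr.tensor_act_proj H V.str W.str z c

theorem RMod.isUnitMod : IsUnitMod H (R := H.base) (unit H).str
    (FirmBimod.Hom.lin (eqToHom (unit_eq H hf))) := by
  have h : FirmBimod.Hom.lin (eqToHom (unit_eq H hf)) = LinearMap.id := FirmBimod.eqToHom_lin _
  intro r r' b c hb hc
  rw [h, show r = H.piR' b from Subtype.ext ((H.isPiR_iff _ _).1 hb),
    show r' = H.piR' (b * c) from Subtype.ext ((H.isPiR_iff _ _).1 hc)]
  exact ModStr.unit_act H b c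

theorem FullComod.isDiagonalComod (M N : FullComod H) :
    IsDiagonalComod H M.str N.str (tensor hf M N).str
      (FirmBimod.Hom.lin (eqToHom (tensor_eq hf M N)) ∘ₗ
        BalTensor.proj (M.str.bimod hf) (N.str.bimod hf)) := by
  have h : FirmBimod.Hom.lin (eqToHom (tensor_eq hf M N)) = LinearMap.id :=
    FirmBimod.eqToHom_lin _
  rw [h]
  exact ⟨M.str.tensorLam_proj N.str hf, M.str.tensorRho_proj N.str hf⟩

theorem FullComod.isUnitComod : IsUnitComod H (R := H.base) (unit hf).str
    (FirmBimod.Hom.lin (eqToHom (unit_eq hf))) := by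
  have h : FirmBimod.Hom.lin (eqToHom (unit_eq hf)) = LinearMap.id := FirmBimod.eqToHom_lin _
  rw [h]
  refine fun r a => ⟨⟨H.Om hf (left r.1 a), fun b => H.evL_Om hf b _, ?_⟩,
    ⟨H.Om' (right r.1 a), fun b => H.evR_Om' b _, ?_⟩⟩
  · exact (ComodStr.unit_lam_tmul H hf r a).trans (LinearMap.rTensor_id_apply ..).symm
  · exact (ComodStr.unit_rho_tmul H hf r a).trans (LinearMap.rTensor_id_apply ..).symm

end MonoidalStructures

theorem mainTheorem2 {k : Type u} {A : Type v} [Field k] [NonUnitalRing A] [Module k A]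
    [IsScalarTower k A A] [SMulCommClass k A A] (H : RegWMB k A) (hfull : H.RightFull) :
    ∃ (R : NonUnitalSubalgebra k (Multiplier k A)) (hR : H.IsBaseAlgebra R)
      (hfirm : (BimodStr.regular k R).IsFirm)
      (bM : ∀ V : RMod k A, ModBimod H R V.str)
      (bC : ∀ M : FullComod H, ComodBimod H R M.str)
      (_ : MonoidalCategory (RMod k A)) (_ : MonoidalCategory (FullComod H))
      (_ : MonoidalCategory (YD H)),
      letI := FirmBimod.monoidal hfirm
      ∃ (_ : (modToBimod hR bM).Monoidal) (_ : (comodToBimod hR bC).Monoidal)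
        (_ : (YD.toMod H).Monoidal) (_ : (YD.toComod H).Monoidal),
        IsStrictMonoidal (modToBimod hR bM) ∧ IsStrictMonoidal (comodToBimod hR bC) ∧
        IsStrictMonoidal (YD.toMod H) ∧ IsStrictMonoidal (YD.toComod H) ∧
        YD.toMod H ⋙ modToBimod hR bM = YD.toComod H ⋙ comodToBimod hR bC ∧
        (∀ V W : RMod k A, IsDiagonalMod H V.str W.str (V ⊗ W).str
          ((Functor.LaxMonoidal.μ (modToBimod hR bM) V W).lin ∘ₗ
            BalTensor.proj (bM V).str (bM W).str)) ∧
        IsUnitMod H (𝟙_ (RMod k A)).str (Functor.LaxMonoidal.ε (modToBimod hR bM)).lin ∧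
        (∀ M N : FullComod H, IsDiagonalComod H M.str N.str (M ⊗ N).str
          ((Functor.LaxMonoidal.μ (comodToBimod hR bC) M N).lin ∘ₗ
            BalTensor.proj (bC M).str (bC N).str)) ∧
        IsUnitComod H (𝟙_ (FullComod H)).str
          (Functor.LaxMonoidal.ε (comodToBimod hR bC)).lin := by
  let _ := FirmBimod.monoidal (H.base_firm hfull)
  obtain ⟨hm, hm'⟩ := (YD.strictLift hfull).exists_isStrictMonoidal (RMod.strictLift H hfull)
    (YD.toMod H) rfl (fun _ _ => rfl) rfl
  obtain ⟨hc, hc'⟩ := (YD.strictLift hfull).exists_isStrictMonoidal (FullComod.strictLift hfull)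
    (YD.toComod H) (YD.toMod_toBimod hfull)
    (fun X Y => ComodStr.tensor_eq_tensorOf hfull _ _ (X.bimod_eq hfull) (Y.bimod_eq hfull))
    rfl
  exact ⟨H.base, H.isBaseAlgebra hfull, H.base_firm hfull, fun V => V.str.modBimod H hfull,
    fun M => M.str.comodBimod hfull, (RMod.strictLift H hfull).monoidal,
    (FullComod.strictLift hfull).monoidal, (YD.strictLift hfull).monoidal,
    (RMod.strictLift H hfull).functorMonoidal, (FullComod.strictLift hfull).functorMonoidal,
    hm, hc, (RMod.strictLift H hfull).isStrictMonoidal,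
    (FullComod.strictLift hfull).isStrictMonoidal, hm', hc', YD.toMod_toBimod hfull,
    RMod.isDiagonalMod hfull, RMod.isUnitMod hfull, FullComod.isDiagonalComod hfull,
    FullComod.isUnitComod hfull⟩
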